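/- All vector spaces are over $\mathbb{Q}$, gradings are cohomological, differentials have degree $+1$, and $V[j]^k=V^{k+j}$. Symmetric sequences $\mathsf P((n))$, $n\ge 2$, are also regarded as functors $A\mapsto \mathsf P((A))$ on finite sets $A$, $|A|\ge 2$, and bijections. **1-shifted cyclic homotopy operads.** A 1-shifted cyclic homotopy operad is a graded symmetric sequence $\mathsf S$ with, for every finite (unrooted) tree $T$ all of whose vertices have valence $\ge 2$, a multilinear operation $\mu_T:\bigotimes_{i}\mathsf S((A_i))\to \mathsf S((L))$ of degree $+1$, where $A_i$ is the set of half-edges at the vertex $i$ and $L$ is the set of legs of $T$. The $\mu_T$ are graded symmetric in the vertices and compatible with bijections of the half-edges, and for every tree $T$ and homogeneous decorations $x_i$ they satisfy the $\infty$-relation $$\sum_{V}\pm\,\mu_{T/V}\bigl(\mu_{T|_V}((x_i)_{i\in V}),(x_i)_{i\notin V}\bigr)=0 ,$$ where the sum is over the nonempty sets $V$ of vertices that span a subtree $T|_V$, $T/V$ is obtained by contracting this subtree, and $\pm$ is the Koszul sign for moving $(x_i)_{i\in V}$ to the front. The operation of the one-vertex tree is the differential; "arity" of a relation is the number of vertices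 of $T$. **The $Q$-construction.** Let $\mathsf P$ be a (unital) cyclic dg operad with $\mathsf P((2))\cong H_\bullet(S^1)=\mathrm{span}(1,\Delta)$, where $1$ is the operadic unit, $\Delta$ has degree $-1$, the differential is zero and the action of $S_2$ is trivial. Let $Q\mathsf P((r))=\mathsf P((r))[6-2r]\otimes\mathbb{Q}[v_1,\dots,v_r]$ for $r\ge 3$, with $v_j$ of degree $-2$, with the differential $$d(x\otimes p)=dx\otimes p+\sum_{j=1}^r(-1)^{|x|}(x\circ_j\Delta)\otimes\frac{\partial p}{\partial v_j},$$ and with $S_r$ also permuting the variables; and let $Q\mathsf P((2))=\mathbb{Q}[u][1]$, with $u$ of degree $+2$, zero differential, and the transposition $\tau\in S_2$ acting by $\tau u^n=(-1)^{n+1}u^n$ for all $n\ge 0$. Binary compositions of degree $+1$ (gluing $a\in A$ to $b\in B$): for $|A|,|B|\ge 3$ $$\mu_{a,b}(x\otimes p,y\otimes q)=(-1)^{|x|}(x\circ_{a,1}\Delta\circ_{2,b}y)\otimes pq|_{v_a=v_b=0};$$ for $|A|\ge3$ $$\mu_{a,1}(x\otimes p,u^n)=(-1)^{|x|}x\otimes\partial_{v_a}^np,\qquad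 \mu_{2,a}(u^n,x\otimes p)=(-1)^{n+1}x\otimes\partial_{v_a}^np$$ (the free leg of $u^n$ takes the place of $a$); and $\mu_{2,1}(p(u),q(u))=-p(u)q(u)$. Ternary compositions of degree $+1$: $\mu_{a,b_1,b_2,c}$ on $Q\mathsf P((A))\otimes Q\mathsf P((B))\otimes Q\mathsf P((C))$ is zero unless $|A|,|C|\ge 3$ and $|B|=2$, and then $$\mu_{a,1,2,c}(x\otimes p,u^n,y\otimes r)=(x\circ_{a,c}y)\otimes\sum_{j=0}^{n-1}(-1)^{|x|+n-1-j}\,\partial_{v_a}^jp|_{v_a=0}\;\partial_{v_c}^{n-1-j}r|_{v_c=0}.$$ **Proposition.** With the differential, these binary and ternary compositions, and all operations of trees with at least four vertices equal to zero, $Q\mathsf P$ is a well-defined 1-shifted cyclic homotopy operad. In particular $Q\mathsf P$ is a graded symmetric sequence, all operations have degree $+1$, are graded symmetric and compatible with the bijections, and the $\infty$-relations hold for all trees (those with one to five vertices are the only nontrivial ones). Moreover $1=u^0\in Q\mathsf P((2))$ is a strict unit of degree $-1$: $\mu_{a,1}(X,1)=(-1)^{|X|}X$ for homogeneous $X$ (with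 the free leg of $1$ in the place of $a$), and $d1=0$ and the ternary operations vanish when one argument is $1$. The augmentation ideal $\overline{Q\mathsf P}$, which is $u\mathbb{Q}[u][1]$ in arity two and $Q\mathsf P((r))$ in arities $r\ge3$, is closed under the bijections and under all operations and is a complement of the span of $1$; hence the operations restrict to a 1-shifted cyclic homotopy operad structure on $\overline{Q\mathsf P}$. -/

import Mathlib

/-!
Cyclic dg operads over `ℚ`, 1-shifted cyclic homotopy operads, and the `Q`-construction.

Symmetric sequences are written as functors on finite sets and bijections. The finite sets of labels
are the finite subsets of `ℕ` (every finite set is in bijection with one of these).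
Gradings are cohomological, all differentials have degree `+1`.
-/

universe u

open scoped TensorProduct

noncomputable section

namespace CycOp

/-! ### Graded symmetric sequences -/

/-- The data of a graded symmetric sequence: a vector space `obj A` for every finite set `A` of
labels, its homogeneous parts, and the action of the bijections. -/
structure SymSeq where
  obj : Finset ℕ → Type u
  [acg : ∀ A, AddCommGroup (obj A)]
  [mod : ∀ A, Module ℚ (obj A)]
  gr : ∀ A, ℤ → Submodule ℚ (obj A)
  map : ∀ {A B : Finset ℕ}, (A ≃ B) → (obj A →ₗ[ℚ] obj B)

attribute [instance] SymSeq.acg SymSeq.mod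

namespace SymSeq

variable (S : SymSeq.{u})

/-- The laws of a graded symmetric sequence. -/
structure IsLawful : Prop where
  isInternal : ∀ A, DirectSum.IsInternal (S.gr A)
  map_refl : ∀ (A : Finset ℕ) (x : S.obj A), S.map (Equiv.refl A) x = x
  map_trans : ∀ {A B C : Finset ℕ} (e : A ≃ B) (f : B ≃ C) (x : S.obj A),
    S.map (e.trans f) x = S.map f (S.map e x)
  map_gr : ∀ {A B : Finset ℕ} (e : A ≃ B) (k : ℤ) (x : S.obj A),
    x ∈ S.gr A k → S.map e x ∈ S.gr B k

/-- The identification of `obj A` with `obj C` for equal sets `A = C` of labels. -/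
def castMap (A C : Finset ℕ) : S.obj A →ₗ[ℚ] S.obj C :=
  open Classical in if h : A = C then h ▸ LinearMap.id else 0

variable {S} in
/-- The linear map `x ↦ (-1)^{|x|} x`. -/
def IsLawful.sgn (h : S.IsLawful) (A : Finset ℕ) : S.obj A →ₗ[ℚ] S.obj A :=
  (DirectSum.toModule ℚ ℤ (S.obj A) fun k => ((-1 : ℚ) ^ k) • (S.gr A k).subtype) ∘ₗ
    (LinearEquiv.ofBijective (DirectSum.coeLinearMap (S.gr A)) (h.isInternal A)).symm.toLinearMap

end SymSeq

/-! ### Cyclic dg operads -/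

/-- `C` is the set of legs obtained from the sets of legs `A` and `B` (of at least two elements)
by gluing the leg `a ∈ A` to the leg `b ∈ B`. The glued legs disappear, so that their names do not
matter: only the remaining legs are required to have different names. -/
structure Glue (a b : ℕ) (A B C : Finset ℕ) : Prop where
  two_le_left : 2 ≤ A.card
  two_le_right : 2 ≤ B.card
  mem_left : a ∈ A
  mem_right : b ∈ B
  disjoint : Disjoint (A.erase a) (B.erase b)
  eq : C = A.erase a ∪ B.erase b

/-- (Unital) cyclic dg operads over `ℚ`. The composition `x ∘_{a,b} y`, for `x` with legs `A`
and `y` with legs `B`, is `comp a b A B C x y`; it carries meaning only if `Glue a b A B C` holds,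
and there are no axioms on its other values. The spaces `obj A` with `A.card < 2` play no role.
`one B`, for `B` of two elements, is the unit with legs `B`. -/
structure CyclicOperad extends SymSeq.{u} where
  lawful : toSymSeq.IsLawful
  d : ∀ A, obj A →ₗ[ℚ] obj A
  d_gr : ∀ A k x, x ∈ gr A k → d A x ∈ gr A (k + 1)
  d_d : ∀ A x, d A (d A x) = 0
  d_map : ∀ {A B : Finset ℕ} (e : A ≃ B) (x : obj A), map e (d A x) = d B (map e x)
  comp : ∀ (_a _b : ℕ) (A B C : Finset ℕ), obj A →ₗ[ℚ] obj B →ₗ[ℚ] obj C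
  comp_gr : ∀ {a b A B C}, Glue a b A B C → ∀ k l x y, x ∈ gr A k → y ∈ gr B l →
    comp a b A B C x y ∈ gr C (k + l)
  comp_d : ∀ {a b A B C}, Glue a b A B C → ∀ k x y, x ∈ gr A k →
    d C (comp a b A B C x y) = comp a b A B C (d A x) y + (-1 : ℚ) ^ k • comp a b A B C x (d B y)
  comp_symm : ∀ {a b A B C}, Glue a b A B C → ∀ k l x y, x ∈ gr A k → y ∈ gr B l →
    comp a b A B C x y = (-1 : ℚ) ^ (k * l) • comp b a B A C y x
  comp_assoc : ∀ {a b c e A B D AB BD C}, Glue a b A B AB → Glue c e AB D C → Glue c e B D BD →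
    Glue a b A BD C → c ≠ b → ∀ x y z,
    comp c e AB D C (comp a b A B AB x y) z = comp a b A BD C x (comp c e B D BD y z)
  comp_map : ∀ {a b A B C a' b' A' B' C'}, Glue a b A B C → Glue a' b' A' B' C' →
    ∀ (e : A ≃ A') (f : B ≃ B') (g : C ≃ C'),
    (∀ z : A, (z : ℕ) = a → (e z : ℕ) = a') → (∀ z : B, (z : ℕ) = b → (f z : ℕ) = b') →
    (∀ (z : A) (w : C), (z : ℕ) ≠ a → (z : ℕ) = w → (g w : ℕ) = e z) →
    (∀ (z : B) (w : C), (z : ℕ) ≠ b → (z : ℕ) = w → (g w : ℕ) = f z) →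
    ∀ x y, map g (comp a b A B C x y) = comp a' b' A' B' C' (map e x) (map f y)
  one : ∀ B, obj B
  one_gr : ∀ B, B.card = 2 → one B ∈ gr B 0
  one_map : ∀ {B B' : Finset ℕ} (e : B ≃ B'), B.card = 2 → map e (one B) = one B'
  comp_one : ∀ {a b A B}, Glue a b A B A → B.card = 2 → ∀ x, comp a b A B A x (one B) = x

/-- `Δ B`, for `B` of two elements, is the element `Δ` of degree `-1` of an identification of
`P((2))` with `H_•(S¹) = span (1, Δ)` (zero differential, trivial action of the transposition).
The relation `Δ ∘ Δ = 0` holds for degree reasons. -/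
structure IsCircle (P : CyclicOperad.{u}) (Δ : ∀ B, P.obj B) : Prop where
  gr : ∀ B, B.card = 2 → Δ B ∈ P.gr B (-1)
  map : ∀ {B B' : Finset ℕ} (e : B ≃ B'), B.card = 2 → P.map e (Δ B) = Δ B'
  d : ∀ B, B.card = 2 → P.d B (Δ B) = 0
  basis : ∀ B, B.card = 2 → ∀ x : P.obj B, ∃! c : ℚ × ℚ, x = c.1 • P.one B + c.2 • Δ B

/-! ### Trees -/

/-- The data of a tree with set of vertices `ι`: the flags (half-edges) at every vertex, the
relation that two flags form an edge, and the set of legs. -/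
structure Tree (ι : Type) where
  flags : ι → Finset ℕ
  glued : ℕ → ℕ → Prop
  legs : Finset ℕ

namespace Tree

variable {ι : Type} (T : Tree ι)

/-- The graph on the set of vertices. -/
def graph : SimpleGraph ι :=
  SimpleGraph.fromRel fun i j => ∃ a ∈ T.flags i, ∃ b ∈ T.flags j, T.glued a b

/-- `T` is a tree with all vertices of valence at least two. -/
structure IsTree : Prop where
  two_le : ∀ i, 2 ≤ (T.flags i).card
  disjoint : ∀ i j, i ≠ j → Disjoint (T.flags i) (T.flags j)
  symm : ∀ a b, T.glued a b → T.glued b a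
  ends : ∀ a b, T.glued a b → ∃ i j, i ≠ j ∧ a ∈ T.flags i ∧ b ∈ T.flags j
  unique : ∀ a b c, T.glued a b → T.glued a c → b = c
  simple : ∀ i j, ∀ a ∈ T.flags i, ∀ a' ∈ T.flags i, ∀ b ∈ T.flags j, ∀ b' ∈ T.flags j,
    T.glued a b → T.glued a' b' → a = a'
  isTree : T.graph.IsTree
  mem_legs : ∀ a, a ∈ T.legs ↔ (∃ i, a ∈ T.flags i) ∧ ∀ b, ¬ T.glued a b

/-- `a` is a flag at a vertex of `V`. -/
def FlagOf (V : Finset ι) (a : ℕ) : Prop := ∃ i ∈ V, a ∈ T.flags i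

/-- The part of `T` spanned by the vertices in `V`; the edges to other vertices become legs. -/
def restrict (V : Finset ι) : Tree {i // i ∈ V} where
  flags i := T.flags i
  glued a b := T.glued a b ∧ T.FlagOf V a ∧ T.FlagOf V b
  legs := open Classical in
    (V.biUnion T.flags).filter fun a => ∀ b, ¬ (T.glued a b ∧ T.FlagOf V b)

/-- The flags at the vertices of `T / V`; the new vertex is `⊥`. -/
def contractFlags (V : Finset ι) : WithBot {i // i ∉ V} → Finset ℕ :=
  WithBot.recBotCoe (T.restrict V).legs fun i => T.flags i

/-- `T / V`: the subtree spanned by `V` is contracted to one new vertex, named `⊥`, which comes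
first in the order of the vertices. -/
def contract (V : Finset ι) : Tree (WithBot {i // i ∉ V}) where
  flags := T.contractFlags V
  glued a b := T.glued a b ∧ ¬ (T.FlagOf V a ∧ T.FlagOf V b)
  legs := T.legs

/-- Renaming of the vertices. -/
def reindex {κ : Type} (T : Tree κ) (e : ι ≃ κ) : Tree ι where
  flags i := T.flags (e i)
  glued := T.glued
  legs := T.legs

/-- The decoration of `T / V` by `y` at the new vertex and by `x` at the others. -/
def contractDec {S : SymSeq.{u}} (V : Finset ι) (y : S.obj (T.restrict V).legs)
    (x : ∀ i, S.obj (T.flags i)) (w : WithBot {i // i ∉ V}) :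
    S.obj ((T.contract V).flags w) :=
  WithBot.recBotCoe (C := fun w => S.obj (T.contractFlags V w)) y (fun i => x i) w

end Tree

/-! ### 1-shifted cyclic homotopy operads -/

/-- Operations `μ_T : ⊗_T S → S` for all trees `T`. The decorations of a tree are multiplied in a
chosen linear order of the vertices. -/
abbrev TreeOps (S : SymSeq.{u}) : Type (max 1 u) :=
  ∀ {ι : Type} [Fintype ι] [LinearOrder ι] (T : Tree ι), (∀ i, S.obj (T.flags i)) → S.obj T.legs

/-- `μ_{T / V}(μ_{T | V}(x_V), x_{ι ∖ V})`. -/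
def TreeOps.nested {S : SymSeq.{u}} (μ : TreeOps S) {ι : Type} [Fintype ι] [LinearOrder ι]
    (T : Tree ι) (V : Finset ι) (x : ∀ i, S.obj (T.flags i)) : S.obj T.legs :=
  μ (T.contract V) (T.contractDec V (μ (T.restrict V) fun i => x i) x)

/-- The Koszul sign of a renaming of the vertices. -/
def permSign {ι κ : Type} [Fintype ι] [LinearOrder ι] [LinearOrder κ] (e : ι ≃ κ)
    (deg : κ → ℤ) : ℚ :=
  ∏ i, ∏ j, if i < j ∧ e j < e i then (-1 : ℚ) ^ (deg (e i) * deg (e j)) else 1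

/-- The Koszul sign of moving the factors at the vertices of `V` to the front. -/
def frontSign {ι : Type} [LinearOrder ι] [Fintype ι] (V : Finset ι) (deg : ι → ℤ) : ℚ :=
  ∏ i ∈ Vᶜ, ∏ j ∈ V, if i < j then (-1 : ℚ) ^ (deg i * deg j) else 1

/-- `S` with the operations `μ_T` of degree `+1` is a 1-shifted cyclic homotopy operad, that is,
the coderivation of degree `1` of the cofree cyclic cooperad with components `μ_T` squares to zero.
The operation of the tree with one vertex is the differential. -/
structure IsHomotopyOperad (S : SymSeq.{u}) (μ : TreeOps S) : Prop where
  lawful : S.IsLawful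
  multilinear : ∀ {ι : Type} [Fintype ι] [LinearOrder ι] (T : Tree ι), T.IsTree →
    ∃ f : MultilinearMap ℚ (fun i => S.obj (T.flags i)) (S.obj T.legs), ∀ x, μ T x = f x
  degree : ∀ {ι : Type} [Fintype ι] [LinearOrder ι] (T : Tree ι), T.IsTree →
    ∀ (deg : ι → ℤ) (x : ∀ i, S.obj (T.flags i)), (∀ i, x i ∈ S.gr (T.flags i) (deg i)) →
    μ T x ∈ S.gr T.legs (∑ i, deg i + 1)
  /-- `μ_T` is graded symmetric in the vertices. -/
  vertex_equivariant : ∀ {ι κ : Type} [Fintype ι] [LinearOrder ι] [Fintype κ] [LinearOrder κ]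
    (T : Tree κ) (e : ι ≃ κ), T.IsTree →
    ∀ (deg : κ → ℤ) (x : ∀ i, S.obj (T.flags i)), (∀ i, x i ∈ S.gr (T.flags i) (deg i)) →
    μ (T.reindex e) (fun i => x (e i)) = permSign e deg • μ T x
  /-- `μ_T` is compatible with bijections of the flags. -/
  flag_equivariant : ∀ {ι : Type} [Fintype ι] [LinearOrder ι] (T T' : Tree ι),
    T.IsTree → T'.IsTree → ∀ (f : ∀ i, T.flags i ≃ T'.flags i) (g : T.legs ≃ T'.legs),
    (∀ i j (a : T.flags i) (b : T.flags j), T.glued a b ↔ T'.glued (f i a) (f j b)) →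
    (∀ i (a : T.flags i) (c : T.legs), (a : ℕ) = c → (g c : ℕ) = f i a) →
    ∀ x, S.map g (μ T x) = μ T' fun i => S.map (f i) (x i)
  /-- The `∞`-relation of the tree `T`: the sum runs over all subtrees of `T`. -/
  relation : ∀ {ι : Type} [Fintype ι] [LinearOrder ι] (T : Tree ι), T.IsTree →
    ∀ (deg : ι → ℤ) (x : ∀ i, S.obj (T.flags i)), (∀ i, x i ∈ S.gr (T.flags i) (deg i)) →
    open Classical in
    ∑ V ∈ (Finset.univ : Finset (Finset ι)).filter (fun V => (T.restrict V).IsTree),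
      frontSign V deg • TreeOps.nested μ T V x = 0

/-- `e B b`, for `b ∈ B` and `B` of two elements, is a strict unit of degree `-1`; it is read with
`b` as its first leg. -/
structure IsStrictUnit (S : SymSeq.{u}) (μ : TreeOps S) (e : ∀ B : Finset ℕ, ℕ → S.obj B) :
    Prop where
  degree : ∀ B, B.card = 2 → ∀ b ∈ B, e B b ∈ S.gr B (-1)
  map : ∀ {B B' : Finset ℕ} (f : B ≃ B'), B.card = 2 → ∀ b : B, S.map f (e B b) = e B' (f b)
  binary : ∀ {ι : Type} [Fintype ι] [LinearOrder ι] (T : Tree ι), T.IsTree →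
    ∀ i j : ι, i < j → (∀ k, k = i ∨ k = j) → ∀ a ∈ T.flags i, ∀ b ∈ T.flags j, T.glued a b →
    (T.flags j).card = 2 → ∀ (x : ∀ i, S.obj (T.flags i)) (n : ℤ), x i ∈ S.gr (T.flags i) n →
    x j = e (T.flags j) b → ∀ f : T.flags i ≃ T.legs,
    (∀ z : T.flags i, (z : ℕ) ≠ a → (f z : ℕ) = z) →
    μ T x = (-1 : ℚ) ^ n • S.map f (x i)
  other : ∀ {ι : Type} [Fintype ι] [LinearOrder ι] (T : Tree ι), T.IsTree →
    Fintype.card ι ≠ 2 → ∀ i, (T.flags i).card = 2 → ∀ b ∈ T.flags i,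
    ∀ x : ∀ i, S.obj (T.flags i), x i = e (T.flags i) b → μ T x = 0

/-- `I` is an augmentation ideal: a complement of the span of the unit that is closed under the
bijections and under all operations. -/
structure IsAugmentationIdeal (S : SymSeq.{u}) (μ : TreeOps S) (e : ∀ B : Finset ℕ, ℕ → S.obj B)
    (I : ∀ A, Submodule ℚ (S.obj A)) : Prop where
  eq_top : ∀ A, 3 ≤ A.card → I A = ⊤
  isCompl : ∀ B, B.card = 2 → ∀ b ∈ B, IsCompl (I B) (Submodule.span ℚ {e B b})
  map : ∀ {A B : Finset ℕ} (f : A ≃ B), ∀ x ∈ I A, S.map f x ∈ I B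
  closed : ∀ {ι : Type} [Fintype ι] [LinearOrder ι] (T : Tree ι), T.IsTree →
    ∀ x : ∀ i, S.obj (T.flags i), (∀ i, x i ∈ I (T.flags i)) → μ T x ∈ I T.legs

/-! ### The symmetric sequence `Q P` -/

/-- `ℚ[v_a | a ∈ A]`. -/
abbrev Poly (A : Finset ℕ) : Type := MvPolynomial A ℚ

/-- `∂/∂v_a`. -/
def pd (a : ℕ) (A : Finset ℕ) : Module.End ℚ (Poly A) :=
  if h : a ∈ A then (MvPolynomial.pderiv (R := ℚ) (⟨a, h⟩ : A)).toLinearMap else 0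

/-- The substitution `v_a = 0`, for `A.erase a ⊆ C`. -/
def setZero (a : ℕ) (A C : Finset ℕ) : Poly A →ₗ[ℚ] Poly C :=
  (MvPolynomial.aeval fun v : A =>
    if h : (v : ℕ) ≠ a ∧ (v : ℕ) ∈ C then (MvPolynomial.X ⟨v, h.2⟩ : Poly C) else 0).toLinearMap

/-- The substitution `v_a = v_c`, for `C = A.erase a ∪ {c}`. -/
def subst (a c : ℕ) (A C : Finset ℕ) : Poly A →ₗ[ℚ] Poly C :=
  (MvPolynomial.aeval fun v : A =>
    if h : (if (v : ℕ) = a then c else (v : ℕ)) ∈ C then (MvPolynomial.X ⟨_, h⟩ : Poly C)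
    else 0).toLinearMap

/-- `q(∂/∂v_a)`, for `q ∈ ℚ[u]`. -/
def opd (a : ℕ) (A : Finset ℕ) (q : Polynomial ℚ) : Module.End ℚ (Poly A) :=
  Polynomial.aeval (pd a A) q

/-- The action of the transposition on `ℚ[u][1]`: `τ uⁿ = (-1)^{n+1} uⁿ`. -/
def tau : Polynomial ℚ →ₗ[ℚ] Polynomial ℚ :=
  -(Polynomial.aeval (-Polynomial.X : Polynomial ℚ)).toLinearMap

/-- For a set `A` of two elements, elements of `Q P(A)` are stored as elements of `ℚ[u]`, with the
smaller element of `A` as the first leg. If `a ∈ A`, then `readAt A a` changes between this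
convention and the one where `a` is the first leg. -/
def readAt (A : Finset ℕ) (a : ℕ) : Polynomial ℚ →ₗ[ℚ] Polynomial ℚ :=
  open Classical in if ∀ x ∈ A, a ≤ x then LinearMap.id else tau

/-- The other element of a set `A ∋ a` of two elements. -/
def other (A : Finset ℕ) (a : ℕ) : ℕ := (A.erase a).sup id

section Construction

variable (P : CyclicOperad.{u})

/-- `P(A) ⊗ ℚ[v_a | a ∈ A]`. -/
abbrev PV (A : Finset ℕ) : Type u := P.obj A ⊗[ℚ] Poly A

/-- `Q P(A)`: this is `P(A) ⊗ ℚ[v_a | a ∈ A]` if `A` has at least three elements, `ℚ[u]` if `A`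
has two elements, and zero otherwise. -/
def QSub (A : Finset ℕ) : Submodule ℚ (PV P A × Polynomial ℚ) where
  carrier := {X | (¬ 3 ≤ A.card → X.1 = 0) ∧ (A.card ≠ 2 → X.2 = 0)}
  add_mem' := fun {X Y} hX hY =>
    ⟨fun h => by simp [hX.1 h, hY.1 h], fun h => by simp [hX.2 h, hY.2 h]⟩
  zero_mem' := ⟨fun _ => rfl, fun _ => rfl⟩
  smul_mem' := fun c X hX => ⟨fun h => by simp [hX.1 h], fun h => by simp [hX.2 h]⟩

abbrev QObj (A : Finset ℕ) : Type u := QSub P A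

variable {P} in
/-- The component in `P(A) ⊗ ℚ[v_a | a ∈ A]`; it is zero if `A.card < 3`. -/
def QObj.hi {A : Finset ℕ} (X : QObj P A) : PV P A := X.1.1

variable {P} in
/-- The component in `ℚ[u]`; it is zero if `A.card ≠ 2`. -/
def QObj.lo {A : Finset ℕ} (X : QObj P A) : Polynomial ℚ := X.1.2

/-- The element with given components. -/
def mkQ (A : Finset ℕ) (v : PV P A) (q : Polynomial ℚ) : QObj P A :=
  open Classical in
  ⟨(if 3 ≤ A.card then v else 0, if A.card = 2 then q else 0),
    fun h => if_neg h, fun h => if_neg h⟩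

/-- The part of degree `k` of `P(A)[6 - 2r] ⊗ ℚ[v_a | a ∈ A]`, with `r = A.card` and the `v_a` of
degree `-2`. -/
def grV (A : Finset ℕ) (k : ℤ) : Submodule ℚ (PV P A) :=
  Submodule.span ℚ {w | ∃ (i : ℤ) (n : ℕ) (x : P.obj A) (p : Poly A), x ∈ P.gr A i ∧
    p.IsHomogeneous n ∧ k = i - (6 - 2 * (A.card : ℤ)) - 2 * n ∧ w = x ⊗ₜ[ℚ] p}

/-- The part of degree `k` of `ℚ[u][1]`, with `u` of degree `2`. -/
def grU (k : ℤ) : Submodule ℚ (Polynomial ℚ) :=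
  Submodule.span ℚ {w | ∃ n : ℕ, k = 2 * n - 1 ∧ w = Polynomial.X ^ n}

/-- The graded symmetric sequence `Q P`. -/
def Q : SymSeq.{u} where
  obj A := QObj P A
  gr A k :=
    (grV P A k).comap (LinearMap.fst ℚ (PV P A) (Polynomial ℚ) ∘ₗ (QSub P A).subtype) ⊓
    (grU k).comap (LinearMap.snd ℚ (PV P A) (Polynomial ℚ) ∘ₗ (QSub P A).subtype)
  map {A B} e :=
    { toFun := fun X =>
        mkQ P B (TensorProduct.map (P.map e) (MvPolynomial.rename (R := ℚ) e).toLinearMap X.hi)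
          ((open Classical in if Monotone e then LinearMap.id else tau) X.lo)
      map_add' := fun X Y => by
        apply Subtype.ext
        simp only [mkQ, QObj.hi, QObj.lo, Submodule.coe_add, Prod.fst_add, Prod.snd_add, map_add]
        ext1 <;> dsimp only [Prod.fst_add, Prod.snd_add] <;> split_ifs <;> simp
      map_smul' := fun c X => by
        apply Subtype.ext
        simp only [mkQ, QObj.hi, QObj.lo, Submodule.coe_smul, Prod.smul_fst, Prod.smul_snd,
          map_smul, RingHom.id_apply]
        ext1 <;> dsimp only [Prod.smul_fst, Prod.smul_snd] <;> split_ifs <;> simp }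

/-! ### The operations of `Q P` -/

variable (Δ : ∀ B, P.obj B)

/-- `x ↦ (-1)^{|x|} x` on `P`. -/
abbrev sg (A : Finset ℕ) : P.obj A →ₗ[ℚ] P.obj A := P.lawful.sgn A

/-- `x ↦ (-1)^{|x|} x` on `P(A) ⊗ ℚ[v_a | a ∈ A]` (polynomials and shifts have even degree). -/
def sgV (A : Finset ℕ) : PV P A →ₗ[ℚ] PV P A := TensorProduct.map (sg P A) LinearMap.id

/-- `x ↦ x ∘_j Δ`: here `Δ` has the legs `j + 1`, which is glued to `j`, and `j`. -/
def act (j : ℕ) (A : Finset ℕ) : P.obj A →ₗ[ℚ] P.obj A :=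
  (P.comp j (j + 1) A {j, j + 1} A).flip (Δ {j, j + 1})

/-- `x ↦ x ∘_{a,b} 1`, that is, `x` with the leg `a` renamed; the unit has the legs `B`. -/
def ren (a b : ℕ) (A B C : Finset ℕ) : P.obj A →ₗ[ℚ] P.obj C :=
  (P.comp a b A B C).flip (P.one B)

/-- The differential: `d_P + d_v` in arities at least three, zero in arity two. Here
`d_v (x ⊗ p) = ∑_j (-1)^{|x|} (x ∘_j Δ) ⊗ ∂p/∂v_j`. -/
def dQ (A : Finset ℕ) (X : QObj P A) : QObj P A :=
  mkQ P A
    (TensorProduct.map (P.d A) LinearMap.id X.hi +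
      ∑ j ∈ A, TensorProduct.map (act P Δ j A ∘ₗ sg P A) (pd j A) X.hi)
    0

/-- The binary composition `μ_{a,b} : Q P(A) ⊗ Q P(B) → Q P(C)`, with `C = A ⊔ B ∖ {a, b}`. The
first three summands are the cases of arities `(≥ 3, ≥ 3)`, `(≥ 3, 2)` and `(2, ≥ 3)`:
* `μ_{a,b}(x ⊗ p, y ⊗ q) = (-1)^{|x|} (x ∘_{a,1} Δ ∘_{2,b} y) ⊗ p q |_{v_a = v_b = 0}`;
* `μ_{a,1}(x ⊗ p, uⁿ) = (-1)^{|x|} x ⊗ ∂ⁿp/∂v_aⁿ`, with leg `2` of `uⁿ` renamed to `a`;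
* `μ_{2,b}(uⁿ, y ⊗ q) = (-1)^{n+1} y ⊗ ∂ⁿq/∂v_bⁿ`, with leg `1` of `uⁿ` renamed to `b`.
If both arities are two, `μ_{2,1}(p, q) = - p q`. -/
def mu2 (a b : ℕ) (A B C : Finset ℕ) (X : QObj P A) (Y : QObj P B) : QObj P C :=
  mkQ P C
    (TensorProduct.map₂ ((P.comp a b A B C) ∘ₗ act P Δ a A ∘ₗ sg P A)
        ((LinearMap.mul ℚ (Poly C)).compl₁₂ (setZero a A C) (setZero b B C)) X.hi Y.hi +
      TensorProduct.map (ren P a b A B C ∘ₗ sg P A)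
        (subst a (other B b) A C ∘ₗ opd a A (readAt B b Y.lo)) X.hi +
      TensorProduct.map (ren P b a B A C)
        (subst b (other A a) B C ∘ₗ opd b B (tau (readAt A (other A a) X.lo))) Y.hi)
    (readAt C (other A a) (-(readAt A (other A a) X.lo * readAt B b Y.lo)))

/-- For `q = uⁿ`, this is
`(p, r) ↦ ∑_{j < n} (-1)^{n-1-j} (∂ʲp/∂v_aʲ) |_{v_a = 0} (∂^{n-1-j}r/∂v_c^{n-1-j}) |_{v_c = 0}`. -/
def kernel3 (a c : ℕ) (A C D : Finset ℕ) (q : Polynomial ℚ) : Poly A →ₗ[ℚ] Poly C →ₗ[ℚ] Poly D :=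
  q.sum fun n t => t • ∑ j ∈ Finset.range n, (-1 : ℚ) ^ (n - 1 - j) •
    (LinearMap.mul ℚ (Poly D)).compl₁₂ (setZero a A D ∘ₗ (pd a A) ^ j)
      (setZero c C D ∘ₗ (pd c C) ^ (n - 1 - j))

/-- The ternary composition
`μ_{a,b₁,b₂,c} : Q P(A) ⊗ Q P(B) ⊗ Q P(C) → Q P(D)`, with `D = A ⊔ B ⊔ C ∖ {a, b₁, b₂, c}`:
if `A` and `C` have at least three elements and `B = {b₁, b₂}`, then `(x ⊗ p, uⁿ, y ⊗ r)` is sent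
to `(-1)^{|x|} (x ∘_{a,c} y) ⊗ kernel3(p, r)`, and otherwise the composition is zero. -/
def mu3 (a b₁ c : ℕ) (A B C D : Finset ℕ) (X : QObj P A) (Y : QObj P B) (Z : QObj P C) :
    QObj P D :=
  mkQ P D
    (TensorProduct.map₂ (P.comp a c A C D ∘ₗ sg P A) (kernel3 a c A C D (readAt B b₁ Y.lo))
      X.hi Z.hi)
    0

/-- The sum of the `μ_{a,b}(x i, x j)` over the edges `{a, b}` of `T` between the vertices `i`, `j`
(there is only one if `T` is a tree with vertices `i` and `j`). -/
def edgeOp {ι : Type} (T : Tree ι) (i j : ι) (X : QObj P (T.flags i)) (Y : QObj P (T.flags j)) :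
    QObj P T.legs :=
  open Classical in
  ∑ a ∈ T.flags i, ∑ b ∈ T.flags j, if T.glued a b then mu2 P Δ a b _ _ _ X Y else 0

/-- The sum of the `μ_{a,b₁,b₂,c}(x i, x j, x k)` over the paths of `T` that consist of an edge
`{a, b₁}` between the vertices `i`, `j` and an edge `{b₂, c}` between the vertices `j`, `k` (there
is at most one if `T` is a tree with vertices `i`, `j` and `k`). -/
def pathOp {ι : Type} (T : Tree ι) (i j k : ι) (X : QObj P (T.flags i)) (Y : QObj P (T.flags j))
    (Z : QObj P (T.flags k)) : QObj P T.legs :=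
  open Classical in
  ∑ a ∈ T.flags i, ∑ b₁ ∈ T.flags j, ∑ b₂ ∈ T.flags j, ∑ c ∈ T.flags k,
    if T.glued a b₁ ∧ T.glued b₂ c then mu3 P a b₁ c _ _ _ _ X Y Z else 0

/-- `x ↦ (-1)^{|x|} x` on `Q P` (the degrees in arity two are odd). -/
def sgQ (A : Finset ℕ) (X : QObj P A) : QObj P A := mkQ P A (sgV P A X.hi) (-X.lo)

/-- The operations of `Q P`: the differential, the binary and the ternary compositions; the other
operations are zero. For three vertices `i < j < k`, the middle vertex of the tree can be `j`, `i`
or `k`. In the last two cases the factors are permuted; the sign is the Koszul sign, since the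
composition vanishes unless the factor at the middle vertex has arity two, hence odd degree, and
the others have arity at least three. -/
def Qop : TreeOps (Q P) := fun {ι} _ _ T x =>
  if h₁ : Fintype.card ι = 1 then
    let i := Fintype.orderIsoFinOfCardEq ι h₁ 0
    (Q P).castMap (T.flags i) T.legs (dQ P Δ (T.flags i) (x i))
  else if h₂ : Fintype.card ι = 2 then
    let i := Fintype.orderIsoFinOfCardEq ι h₂ 0
    let j := Fintype.orderIsoFinOfCardEq ι h₂ 1
    edgeOp P Δ T i j (x i) (x j)
  else if h₃ : Fintype.card ι = 3 then
    let i := Fintype.orderIsoFinOfCardEq ι h₃ 0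
    let j := Fintype.orderIsoFinOfCardEq ι h₃ 1
    let k := Fintype.orderIsoFinOfCardEq ι h₃ 2
    pathOp P T i j k (x i) (x j) (x k) +
      pathOp P T j i k (sgQ P _ (x j)) (x i) (x k) +
      pathOp P T i k j (x i) (x k) (sgQ P _ (x j))
  else 0

/-- The element `1 ∈ ℚ[u][1] = Q P(B)`, for `B` of two elements, with `b` as the first leg. -/
def Qunit (B : Finset ℕ) (b : ℕ) : (Q P).obj B := mkQ P B 0 (readAt B b 1)

/-- The augmentation ideal of `Q P`: in arity two it is `u ℚ[u][1]`. -/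
def Qideal (A : Finset ℕ) : Submodule ℚ ((Q P).obj A) :=
  LinearMap.ker (Polynomial.lcoeff ℚ 0 ∘ₗ LinearMap.snd ℚ (PV P A) (Polynomial ℚ) ∘ₗ
    (QSub P A).subtype)

end Construction

end CycOp

end

noncomputable section

namespace CycOp

/-! ### Relabelling of finite sets -/

/-- The bijection of finite sets given by a function on labels. -/
def relabel (φ : ℕ → ℕ) (A C : Finset ℕ) (h : Set.BijOn φ A C) : A ≃ C :=
  (Set.BijOn.equiv φ h : (A : Set ℕ) ≃ (C : Set ℕ))

@[simp] lemma coe_relabel (φ : ℕ → ℕ) (A C : Finset ℕ) (h : Set.BijOn φ A C) (z : A) :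
    (relabel φ A C h z : ℕ) = φ z := rfl

/-- The function that sends `a` to `c` and fixes the other labels. -/
def move (a c : ℕ) (n : ℕ) : ℕ := if n = a then c else n

lemma move_self (a c : ℕ) : move a c a = c := if_pos rfl

lemma move_of_ne {a c n : ℕ} (h : n ≠ a) : move a c n = n := if_neg h

/-- `C` arises from `A` by renaming `a ∈ A` to `c`. -/
structure Renames (a c : ℕ) (A C : Finset ℕ) : Prop where
  mem : a ∈ A
  notMem : c ∉ A.erase a
  eq : C = insert c (A.erase a)

namespace Renames

variable {a c : ℕ} {A C : Finset ℕ}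

lemma bijOn (h : Renames a c A C) : Set.BijOn (move a c) A C := by
  obtain ⟨h1, h2, rfl⟩ := h
  refine ⟨?_, ?_, ?_⟩
  · intro n hn
    by_cases hna : n = a <;> simp_all [move]
  · intro m hm n hn hmn
    simp only [Finset.mem_coe, Finset.mem_erase, not_and, move] at *
    split_ifs at hmn <;> grind
  · intro n hn
    simp only [Finset.coe_insert, Finset.coe_erase, Set.mem_insert_iff, Set.mem_sdiff,
      Finset.mem_coe, Set.mem_singleton_iff] at hn
    rcases hn with rfl | hn
    · exact ⟨a, h1, move_self _ _⟩
    · exact ⟨n, hn.1, move_of_ne hn.2⟩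

/-- The bijection that renames `a` to `c`. -/
def equiv (h : Renames a c A C) : A ≃ C := relabel _ _ _ h.bijOn

lemma equiv_self (h : Renames a c A C) (z : A) (hz : (z : ℕ) = a) : (h.equiv z : ℕ) = c := by
  simp [equiv, hz, move]

lemma equiv_of_ne (h : Renames a c A C) (z : A) (hz : (z : ℕ) ≠ a) : (h.equiv z : ℕ) = z := by
  simp [equiv, hz, move]

end Renames

lemma exists_equiv_pair {a b c e : ℕ} (hab : a ≠ b) (hce : c ≠ e) :
    ∃ f : ({a, b} : Finset ℕ) ≃ ({c, e} : Finset ℕ),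
      (∀ z : ({a, b} : Finset ℕ), (z : ℕ) = a → (f z : ℕ) = c) ∧
      ∀ z : ({a, b} : Finset ℕ), (z : ℕ) = b → (f z : ℕ) = e := by
  have h : Set.BijOn (fun n => if n = a then c else e) ({a, b} : Finset ℕ) ({c, e} : Finset ℕ) := by
    refine ⟨?_, ?_, ?_⟩
    · intro n hn; simp; grind
    · intro m hm n hn h; simp at *; grind
    · intro n hn
      simp at hn
      rcases hn with rfl | rfl
      · exact ⟨a, by simp⟩
      · exact ⟨b, by simp [hab.symm]⟩
  exact ⟨relabel _ _ _ h, fun z hz => by simp [hz], fun z hz => by simp [hz, hab.symm]⟩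

namespace Glue

variable {a b : ℕ} {A B C : Finset ℕ}

lemma swap (h : Glue a b A B C) : Glue b a B A C :=
  ⟨h.two_le_right, h.two_le_left, h.mem_right, h.mem_left, h.disjoint.symm,
    by rw [h.eq, Finset.union_comm]⟩

lemma card (h : Glue a b A B C) : C.card + 2 = A.card + B.card := by
  rw [h.eq, Finset.card_union_of_disjoint h.disjoint, Finset.card_erase_of_mem h.mem_left,
    Finset.card_erase_of_mem h.mem_right]
  have := h.two_le_left; have := h.two_le_right
  omega

lemma two_le (h : Glue a b A B C) : 2 ≤ C.card := by
  have := h.card; have := h.two_le_left; have := h.two_le_right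
  omega

lemma mem_iff (h : Glue a b A B C) {z : ℕ} : z ∈ C ↔ (z ∈ A ∧ z ≠ a) ∨ (z ∈ B ∧ z ≠ b) := by
  rw [h.eq]; simp [and_comm]

lemma disj (h : Glue a b A B C) {z : ℕ} (h1 : z ∈ A) (h2 : z ≠ a) (h3 : z ∈ B) : z = b := by
  by_contra h4
  exact (Finset.disjoint_left.1 h.disjoint (Finset.mem_erase.2 ⟨h2, h1⟩))
    (Finset.mem_erase.2 ⟨h4, h3⟩)

lemma of_mem_iff (h1 : 2 ≤ A.card) (h2 : 2 ≤ B.card) (h3 : a ∈ A) (h4 : b ∈ B)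
    (h5 : ∀ z, z ∈ A → z ≠ a → z ∈ B → z = b)
    (h6 : ∀ z, z ∈ C ↔ (z ∈ A ∧ z ≠ a) ∨ (z ∈ B ∧ z ≠ b)) : Glue a b A B C :=
  ⟨h1, h2, h3, h4, Finset.disjoint_left.2 fun z hz hz' => by
    simp only [Finset.mem_erase] at hz hz'; exact hz'.1 (h5 z hz.2 hz.1 hz'.2),
    by ext z; rw [h6]; simp [and_comm]⟩

lemma pair {j z : ℕ} (hA : 2 ≤ A.card) (hj : j ∈ A) (hz : z ≠ j) : Glue j z A {j, z} A := by
  refine of_mem_iff hA (by rw [Finset.card_pair hz.symm]) hj (by simp) ?_ ?_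
  · intro w _ h h'; simp at h'; tauto
  · intro w; simp; grind

end Glue

lemma exists_notMem_finset (S : Finset ℕ) : ∃ z, z ∉ S := Infinite.exists_notMem_finset S

/-! ### Graded symmetric sequences -/

namespace SymSeq.IsLawful

variable {S : SymSeq.{u}} (h : S.IsLawful)
include h

lemma sgn_of_mem {A : Finset ℕ} {k : ℤ} {x : S.obj A} (hx : x ∈ S.gr A k) :
    h.sgn A x = (-1 : ℚ) ^ k • x := by
  have : (LinearEquiv.ofBijective (DirectSum.coeLinearMap (S.gr A)) (h.isInternal A)).symm x =
      DirectSum.lof ℚ ℤ (fun k => S.gr A k) k ⟨x, hx⟩ := by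
    rw [LinearEquiv.symm_apply_eq]
    exact (DirectSum.coeLinearMap_lof (S.gr A) k ⟨x, hx⟩).symm
  rw [sgn, LinearMap.comp_apply, LinearEquiv.coe_coe, this, DirectSum.toModule_lof]
  simp

@[elab_as_elim]
lemma induction {A : Finset ℕ} {p : S.obj A → Prop} (x : S.obj A)
    (mem : ∀ k, ∀ x ∈ S.gr A k, p x) (add : ∀ x y, p x → p y → p (x + y)) : p x := by
  have hx : x ∈ ⨆ k, S.gr A k := by rw [(h.isInternal A).submodule_iSup_eq_top]; trivial
  exact Submodule.iSup_induction _ (motive := p) hx mem (mem 0 0 (zero_mem _)) add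

lemma hom_ext {A : Finset ℕ} {M : Type*} [AddCommGroup M] [Module ℚ M] {f g : S.obj A →ₗ[ℚ] M}
    (hfg : ∀ k, ∀ x ∈ S.gr A k, f x = g x) (x : S.obj A) : f x = g x :=
  h.induction x hfg fun x y hx hy => by rw [map_add, map_add, hx, hy]

lemma sgn_gr {A : Finset ℕ} {k : ℤ} {x : S.obj A} (hx : x ∈ S.gr A k) :
    h.sgn A x ∈ S.gr A k := by
  rw [h.sgn_of_mem hx]; exact Submodule.smul_mem _ _ hx

lemma sgn_sgn {A : Finset ℕ} (x : S.obj A) : h.sgn A (h.sgn A x) = x :=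
  h.hom_ext (f := h.sgn A ∘ₗ h.sgn A) (g := LinearMap.id) (fun k x hx => by
    simp [h.sgn_of_mem hx, smul_smul, ← mul_zpow]) x

lemma map_sgn {A B : Finset ℕ} (e : A ≃ B) (x : S.obj A) :
    S.map e (h.sgn A x) = h.sgn B (S.map e x) :=
  h.hom_ext (f := S.map e ∘ₗ h.sgn A) (g := h.sgn B ∘ₗ S.map e) (fun k x hx => by
    simp [h.sgn_of_mem hx, h.sgn_of_mem (h.map_gr e k x hx)]) x

/-- The operator `x ↦ k x`, for `x` of degree `k`. -/
def weight (A : Finset ℕ) : Module.End ℚ (S.obj A) :=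
  (DirectSum.toModule ℚ ℤ (S.obj A) fun k => (k : ℚ) • (S.gr A k).subtype) ∘ₗ
    (LinearEquiv.ofBijective (DirectSum.coeLinearMap (S.gr A)) (h.isInternal A)).symm.toLinearMap

lemma weight_of_mem {A : Finset ℕ} {k : ℤ} {x : S.obj A} (hx : x ∈ S.gr A k) :
    h.weight A x = (k : ℚ) • x := by
  have : (LinearEquiv.ofBijective (DirectSum.coeLinearMap (S.gr A)) (h.isInternal A)).symm x =
      DirectSum.lof ℚ ℤ (fun k => S.gr A k) k ⟨x, hx⟩ := by
    rw [LinearEquiv.symm_apply_eq]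
    exact (DirectSum.coeLinearMap_lof (S.gr A) k ⟨x, hx⟩).symm
  rw [weight, LinearMap.comp_apply, LinearEquiv.coe_coe, this, DirectSum.toModule_lof]
  simp

end SymSeq.IsLawful

lemma neg_one_zpow_congr {m n : ℤ} (h : Even (m - n)) : (-1 : ℚ) ^ m = (-1 : ℚ) ^ n := by
  rw [show m = n + (m - n) by ring, zpow_add₀ (by norm_num), h.neg_one_zpow, mul_one]

lemma neg_one_zpow_mul_self (n : ℤ) : (-1 : ℚ) ^ n * (-1 : ℚ) ^ n = 1 := by
  rw [← mul_zpow]; simp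

/-! ### The operators `x ↦ (-1)^{|x|} x ∘_j Δ` -/

section

variable (P : CyclicOperad.{u})

/-- `x ↦ (-1)^{|x|} x ∘_j Δ`. -/
def circ (Δ : ∀ B, P.obj B) (j : ℕ) (A : Finset ℕ) : P.obj A →ₗ[ℚ] P.obj A := act P Δ j A ∘ₗ sg P A

variable {P} {Δ : ∀ B, P.obj B} {a b j k : ℕ} {A B C : Finset ℕ}

lemma d_sgn (x : P.obj A) : P.d A (sg P A x) = - sg P A (P.d A x) :=
  P.lawful.hom_ext (f := P.d A ∘ₗ sg P A) (g := - (sg P A ∘ₗ P.d A)) (fun k x hx => by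
    simp [P.lawful.sgn_of_mem hx, P.lawful.sgn_of_mem (P.d_gr _ _ _ hx),
      zpow_add₀ (show (-1 : ℚ) ≠ 0 by norm_num)]) x

lemma comp_sgn (h : Glue a b A B C) (x : P.obj A) (y : P.obj B) :
    sg P C (P.comp a b A B C x y) = P.comp a b A B C (sg P A x) (sg P B y) := by
  refine P.lawful.induction x (fun k x hx => ?_) fun x x' hx hx' => by simp [hx, hx']
  refine P.lawful.induction y (fun l y hy => ?_) fun x x' hx hx' => by simp [hx, hx']
  simp [P.lawful.sgn_of_mem hx, P.lawful.sgn_of_mem hy,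
    P.lawful.sgn_of_mem (P.comp_gr h _ _ _ _ hx hy), zpow_add₀ (show (-1 : ℚ) ≠ 0 by norm_num),
    smul_smul, mul_comm]

lemma d_comp (h : Glue a b A B C) (x : P.obj A) (y : P.obj B) :
    P.d C (P.comp a b A B C x y) =
      P.comp a b A B C (P.d A x) y + P.comp a b A B C (sg P A x) (P.d B y) := by
  refine P.lawful.induction x (fun k x hx => ?_) fun x x' hx hx' => by simp [hx, hx']; abel
  rw [P.comp_d h k _ _ hx, P.lawful.sgn_of_mem hx]; simp

lemma act_comp_right (h : Glue a b A B C) (hj : j ∈ B) (hjb : j ≠ b) (x : P.obj A) (y : P.obj B) :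
    act P Δ j C (P.comp a b A B C x y) = P.comp a b A B C x (act P Δ j B y) :=
  P.comp_assoc h (Glue.pair h.two_le (h.mem_iff.2 (.inr ⟨hj, hjb⟩)) (by omega))
    (Glue.pair h.two_le_right hj (by omega)) h hjb _ _ _

lemma circ_comp_right (h : Glue a b A B C) (hj : j ∈ B) (hjb : j ≠ b) (x : P.obj A)
    (y : P.obj B) :
    circ P Δ j C (P.comp a b A B C x y) = P.comp a b A B C (sg P A x) (circ P Δ j B y) := by
  rw [circ, LinearMap.comp_apply, comp_sgn h, act_comp_right h hj hjb]
  rfl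

section

variable (hΔ : IsCircle P Δ)
include hΔ

lemma act_eq (hA : 2 ≤ A.card) (hj : j ∈ A) {z : ℕ} (hz : z ≠ j) (x : P.obj A) :
    act P Δ j A x = P.comp j z A {j, z} A x (Δ {j, z}) := by
  obtain ⟨f, hf, hf'⟩ := exists_equiv_pair (show j ≠ j + 1 by omega) hz.symm
  have := P.comp_map (Glue.pair hA hj (show j + 1 ≠ j by omega)) (Glue.pair hA hj hz)
    (Equiv.refl A) f (Equiv.refl A) (by simp) hf' (by simp)
    (by
      intro w w' h1 h2
      have : (w : ℕ) = j := by have := Finset.mem_insert.1 w.2; simp at this; tauto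
      rw [hf _ this]; simp [← h2, this]) x (Δ {j, j + 1})
  rw [P.lawful.map_refl, P.lawful.map_refl, hΔ.map _ (Finset.card_pair (by omega))] at this
  exact this

lemma act_gr (hA : 2 ≤ A.card) (hj : j ∈ A) {n : ℤ} {x : P.obj A} (hx : x ∈ P.gr A n) :
    act P Δ j A x ∈ P.gr A (n - 1) :=
  P.comp_gr (Glue.pair hA hj (show j + 1 ≠ j by omega)) n (-1) _ _ hx
    (hΔ.gr _ (Finset.card_pair (by omega)))

lemma circ_gr (hA : 2 ≤ A.card) (hj : j ∈ A) {n : ℤ} {x : P.obj A} (hx : x ∈ P.gr A n) :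
    circ P Δ j A x ∈ P.gr A (n - 1) :=
  act_gr hΔ hA hj (P.lawful.sgn_gr hx)

lemma act_comp_left (h : Glue a b A B C) (hj : j ∈ A) (hja : j ≠ a) (x : P.obj A) (y : P.obj B) :
    act P Δ j C (P.comp a b A B C x y) = P.comp a b A B C (act P Δ j A x) (sg P B y) := by
  refine P.lawful.induction x (fun k x hx => ?_) fun x x' hx hx' => by simp [hx, hx']
  refine P.lawful.induction y (fun l y hy => ?_) fun x x' hx hx' => by simp [hx, hx']
  rw [P.comp_symm h k l _ _ hx hy, map_smul, act_comp_right h.swap hj hja,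
    P.comp_symm h.swap l (k - 1) _ _ hy (act_gr hΔ h.two_le_left hj hx), P.lawful.sgn_of_mem hy,
    map_smul, smul_smul, ← zpow_add₀ (by norm_num)]
  congr 1
  exact neg_one_zpow_congr ⟨k * l - l, by ring⟩

lemma circ_sgn (hA : 2 ≤ A.card) (hj : j ∈ A) (x : P.obj A) :
    circ P Δ j A (sg P A x) = - sg P A (circ P Δ j A x) :=
  P.lawful.hom_ext (f := circ P Δ j A ∘ₗ sg P A) (g := - (sg P A ∘ₗ circ P Δ j A))
    (fun k x hx => by
      simp only [LinearMap.comp_apply, LinearMap.neg_apply, P.lawful.sgn_of_mem hx,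
        P.lawful.sgn_of_mem (circ_gr hΔ hA hj hx), map_smul, ← neg_smul]
      congr 1
      rw [zpow_sub₀ (by norm_num)]; ring) x

lemma circ_comp_left (h : Glue a b A B C) (hj : j ∈ A) (hja : j ≠ a) (x : P.obj A) (y : P.obj B) :
    circ P Δ j C (P.comp a b A B C x y) = P.comp a b A B C (circ P Δ j A x) y := by
  rw [circ, LinearMap.comp_apply, comp_sgn h, act_comp_left hΔ h hj hja, P.lawful.sgn_sgn]
  rfl

lemma act_comp_glue (h : Glue a b A B C) (x : P.obj A) (y : P.obj B) :
    P.comp a b A B C (act P Δ a A x) (sg P B y) = P.comp a b A B C x (act P Δ b B y) := by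
  refine P.lawful.induction y (fun l y hy => ?_) fun x x' hx hx' => by simp [hx, hx']
  obtain ⟨z, hz⟩ := exists_notMem_finset (A ∪ B ∪ {a, b})
  simp only [Finset.mem_union, not_or, Finset.mem_insert, Finset.mem_singleton] at hz
  obtain ⟨⟨hzA, hzB⟩, hza, hzb⟩ := hz
  have g1 : Glue a b {a, z} B (insert z (B.erase b)) := by
    refine Glue.of_mem_iff (by rw [Finset.card_pair (Ne.symm hza)]) h.two_le_right (by simp)
      h.mem_right ?_ ?_
    · intro w hw hw' hwB; simp at hw; grind
    · intro w; simp; grind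
  have g2 : Glue a z A (insert z (B.erase b)) C := by
    refine Glue.of_mem_iff h.two_le_left g1.two_le h.mem_left (by simp) ?_ ?_
    · intro w hw hw' hwB
      simp at hwB
      rcases hwB with hwB | hwB
      · exact hwB
      · exact absurd (h.disj hw hw' hwB.2) hwB.1
    · intro w; rw [h.mem_iff]; simp; grind
  have hr : Renames z b (insert z (B.erase b)) B :=
    ⟨by simp, by simp [hzB], by rw [Finset.erase_insert (by simp [hzB]),
      Finset.insert_erase h.mem_right]⟩
  rw [act_eq hΔ h.two_le_left h.mem_left hza,
    P.comp_assoc (Glue.pair h.two_le_left h.mem_left hza) h g1 g2 (Ne.symm hza),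
    P.comp_symm g1 (-1) l _ _ (hΔ.gr _ (Finset.card_pair (Ne.symm hza)))
      (P.lawful.sgn_gr hy)]
  have e1 := P.comp_map g2 h (Equiv.refl A) hr.equiv (Equiv.refl C) (by simp) hr.equiv_self
    (by simp; tauto) (by intro w w' h1 h2; simp [hr.equiv_of_ne w h1, h2]) x
    (P.comp b a B {a, z} (insert z (B.erase b)) y (Δ {a, z}))
  obtain ⟨f, hf, hf'⟩ := exists_equiv_pair (Ne.symm hza) (show b + 1 ≠ b by omega)
  have hp : ({b + 1, b} : Finset ℕ) = {b, b + 1} := Finset.pair_comm _ _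
  have e2 := P.comp_map g1.swap (hp ▸ Glue.pair h.two_le_right h.mem_right (by omega))
    (Equiv.refl B) f hr.equiv (by simp) hf
    (by
      intro w w' h1 h2
      have : (w' : ℕ) ≠ z := by rintro h3; rw [h3] at h2; exact hzB (h2 ▸ w.2)
      simp [hr.equiv_of_ne w' this, h2])
    (by
      intro w w' h1 h2
      have h3 : (w : ℕ) = z := by have := Finset.mem_insert.1 w.2; simp at this; tauto
      rw [hf' _ h3, hr.equiv_self _ (h2 ▸ h3)]) y (Δ {a, z})
  rw [P.lawful.map_refl, hΔ.map _ (Finset.card_pair (Ne.symm hza)), hp] at e2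
  rw [P.lawful.map_refl, P.lawful.map_refl, e2] at e1
  rw [P.lawful.sgn_of_mem hy, map_smul, map_smul, LinearMap.smul_apply, map_smul,
    smul_smul, e1,
    ← zpow_add₀ (by norm_num), neg_one_zpow_congr (n := 0) ⟨0, by ring⟩, zpow_zero, one_smul]
  rfl

lemma circ_comp_glue (h : Glue a b A B C) (x : P.obj A) (y : P.obj B) :
    P.comp a b A B C (circ P Δ a A x) y = P.comp a b A B C (sg P A x) (circ P Δ b B y) := by
  have := act_comp_glue hΔ h (sg P A x) (sg P B y)
  rwa [P.lawful.sgn_sgn] at this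

lemma d_act (hA : 2 ≤ A.card) (hj : j ∈ A) (x : P.obj A) :
    P.d A (act P Δ j A x) = act P Δ j A (P.d A x) := by
  have := d_comp (Glue.pair hA hj (show j + 1 ≠ j by omega)) x (Δ _)
  rw [hΔ.d _ (Finset.card_pair (by omega)), map_zero, add_zero] at this
  exact this

lemma d_circ (hA : 2 ≤ A.card) (hj : j ∈ A) (x : P.obj A) :
    P.d A (circ P Δ j A x) = - circ P Δ j A (P.d A x) := by
  rw [circ, LinearMap.comp_apply, d_act hΔ hA hj, d_sgn, map_neg]
  rfl

lemma act_act (hA : 2 ≤ A.card) (hj : j ∈ A) (hk : k ∈ A) (hjk : j ≠ k) (x : P.obj A) :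
    act P Δ j A (act P Δ k A x) = - act P Δ k A (act P Δ j A x) := by
  have := act_comp_left hΔ (Glue.pair hA hk (show k + 1 ≠ k by omega)) hj hjk x (Δ _)
  rw [P.lawful.sgn_of_mem (hΔ.gr _ (Finset.card_pair (by omega)))] at this
  rw [show act P Δ k A x = P.comp k (k + 1) A {k, k + 1} A x (Δ _) from rfl, this]
  simp [act]

lemma eq_zero_of_mem_gr (hB : B.card = 2) {x : P.obj B} (hx : x ∈ P.gr B (-2)) : x = 0 := by
  obtain ⟨⟨c, e⟩, hc, -⟩ := hΔ.basis B hB x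
  obtain ⟨z, hz, hz'⟩ := hΔ.basis B hB 0
  have h1 := P.lawful.weight_of_mem hx
  have h2 := P.lawful.weight_of_mem (hΔ.gr B hB)
  have h3 := P.lawful.weight_of_mem (P.one_gr B hB)
  have h4 : (0 : P.obj B) = (2 * c) • P.one B + e • Δ B := by
    have : P.lawful.weight B x = P.lawful.weight B (c • P.one B + e • Δ B) := by rw [← hc]
    rw [h1, map_add, map_smul, map_smul, h2, h3, hc] at this
    push_cast at this
    linear_combination (norm := module) this
  have e1 := hz' (2 * c, e) h4
  have e2 := hz' (0, 0) (by simp)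
  rw [← e2] at e1
  simp only [Prod.mk.injEq, mul_eq_zero, OfNat.ofNat_ne_zero, false_or] at e1
  rw [hc, e1.1, e1.2]; simp

lemma act_act_self (hA : 2 ≤ A.card) (hj : j ∈ A) (x : P.obj A) :
    act P Δ j A (act P Δ j A x) = 0 := by
  obtain ⟨w, hw⟩ := exists_notMem_finset (insert j A)
  obtain ⟨z, hz⟩ := exists_notMem_finset (insert w (insert j A))
  simp only [Finset.mem_insert, not_or] at hw hz
  have g1 : Glue j z {j, w} {j, z} {j, w} := Glue.pair (by rw [Finset.card_pair (Ne.symm hw.1)])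
    (by simp) hz.2.1
  have h0 := eq_zero_of_mem_gr hΔ (Finset.card_pair (Ne.symm hw.1))
    (P.comp_gr g1 (-1) (-1) _ _ (hΔ.gr _ (Finset.card_pair (Ne.symm hw.1)))
      (hΔ.gr _ (Finset.card_pair (Ne.symm hz.2.1))))
  rw [act_eq hΔ hA hj hz.2.1, act_eq hΔ hA hj hw.1,
    P.comp_assoc (Glue.pair hA hj hw.1) (Glue.pair hA hj hz.2.1) g1 (Glue.pair hA hj hw.1)
      (Ne.symm hw.1), h0, map_zero]

lemma circ_eq (hA : 2 ≤ A.card) (hj : j ∈ A) (x : P.obj A) :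
    circ P Δ j A x = - sg P A (act P Δ j A x) := by
  have h := circ_sgn hΔ hA hj (sg P A x)
  simp only [circ, LinearMap.comp_apply, P.lawful.sgn_sgn] at h ⊢
  exact h

lemma circ_circ_eq (hA : 2 ≤ A.card) (hk : k ∈ A) (x : P.obj A) :
    circ P Δ j A (circ P Δ k A x) = - act P Δ j A (act P Δ k A x) := by
  rw [circ_eq hΔ hA hk, circ, LinearMap.comp_apply, map_neg, P.lawful.sgn_sgn, map_neg]

lemma circ_circ (hA : 2 ≤ A.card) (hj : j ∈ A) (hk : k ∈ A) (hjk : j ≠ k) (x : P.obj A) :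
    circ P Δ j A (circ P Δ k A x) = - circ P Δ k A (circ P Δ j A x) := by
  rw [circ_circ_eq hΔ hA hk, circ_circ_eq hΔ hA hj, act_act hΔ hA hj hk hjk]

lemma circ_circ_self (hA : 2 ≤ A.card) (hj : j ∈ A) (x : P.obj A) :
    circ P Δ j A (circ P Δ j A x) = 0 := by
  rw [circ_circ_eq hΔ hA hj, act_act_self hΔ hA hj, neg_zero]

lemma map_act (hA : 2 ≤ A.card) (e : A ≃ B) (z : A) (x : P.obj A) :
    P.map e (act P Δ z A x) = act P Δ (e z) B (P.map e x) := by
  have hB : 2 ≤ B.card := by have := Fintype.card_congr e; simp at this; omega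
  obtain ⟨f, hf, hf'⟩ := exists_equiv_pair (show (z : ℕ) ≠ z + 1 by omega)
    (show (e z : ℕ) ≠ e z + 1 by omega)
  have := P.comp_map (Glue.pair hA z.2 (show (z : ℕ) + 1 ≠ z by omega))
    (Glue.pair hB (e z).2 (show (e z : ℕ) + 1 ≠ e z by omega)) e f e
    (by intro w hw; rw [Subtype.ext hw]) hf' (by intro w w' _ h; rw [Subtype.ext h])
    (by
      intro w w' h h2
      have h3 : (w : ℕ) = z := by have := Finset.mem_insert.1 w.2; simp at this; tauto
      rw [hf _ h3, show w' = z from Subtype.ext (by rw [← h2, h3])]) x (Δ _)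
  rw [hΔ.map _ (Finset.card_pair (by omega))] at this
  exact this

lemma map_circ (hA : 2 ≤ A.card) (e : A ≃ B) (z : A) (x : P.obj A) :
    P.map e (circ P Δ z A x) = circ P Δ (e z) B (P.map e x) := by
  rw [circ, LinearMap.comp_apply, map_act hΔ hA, P.lawful.map_sgn]; rfl

end

/-- Composition with the unit is a renaming. -/
lemma ren_eq (hA : 2 ≤ A.card) {c : ℕ} (h : Glue a b A B C) (hB : B = {b, c}) (hbc : b ≠ c)
    (hr : Renames a c A C) (x : P.obj A) : ren P a b A B C x = P.map hr.equiv x := by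
  subst hB
  obtain ⟨f, hf, hf'⟩ := exists_equiv_pair hbc (show a + 1 ≠ a by omega)
  have hp : ({a + 1, a} : Finset ℕ) = {a, a + 1} := Finset.pair_comm _ _
  have g := Glue.pair hA h.mem_left (show a + 1 ≠ a by omega)
  have := P.comp_map h (hp ▸ g)
    (Equiv.refl A) f hr.equiv.symm (by simp) hf
    (by
      intro z w hz hw
      rw [show w = hr.equiv z from Subtype.ext (by rw [hr.equiv_of_ne z hz, hw])]; simp)
    (by
      intro z w hz hw
      have h3 : (z : ℕ) = c := by have := Finset.mem_insert.1 z.2; simp at this; tauto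
      rw [hf' _ h3, show w = hr.equiv ⟨a, hr.mem⟩ from Subtype.ext (by
        rw [hr.equiv_self _ rfl, ← hw, h3])]; simp) x (P.one _)
  rw [P.lawful.map_refl, P.one_map _ (Finset.card_pair hbc), hp,
    P.comp_one g (Finset.card_pair (by omega))] at this
  conv_rhs => rw [← this, ← P.lawful.map_trans]
  simp [P.lawful.map_refl, ren]

end

/-! ### Polynomials in linear operators -/

section Operators

variable {M N K M' N' K' : Type*} [AddCommGroup M] [AddCommGroup N] [AddCommGroup K]
  [AddCommGroup M'] [AddCommGroup N'] [AddCommGroup K'] [Module ℚ M] [Module ℚ N] [Module ℚ K]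
  [Module ℚ M'] [Module ℚ N'] [Module ℚ K']

lemma pow_intertwine {S : Module.End ℚ M} {S' : Module.End ℚ M'} {f : M →ₗ[ℚ] M'}
    (hf : ∀ x, f (S x) = S' (f x)) (n : ℕ) (x : M) : f ((S ^ n) x) = (S' ^ n) (f x) := by
  induction n generalizing x with
  | zero => simp
  | succ n ih => rw [pow_succ, pow_succ, Module.End.mul_apply, Module.End.mul_apply, ih, hf]

lemma aeval_intertwine {S : Module.End ℚ M} {S' : Module.End ℚ M'} {f : M →ₗ[ℚ] M'}
    (hf : ∀ x, f (S x) = S' (f x)) (q : Polynomial ℚ) (x : M) :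
    f (Polynomial.aeval S q x) = Polynomial.aeval S' q (f x) := by
  induction q using Polynomial.induction_on' with
  | add p q hp hq => simp [hp, hq]
  | monomial n t => simp [Polynomial.aeval_monomial, pow_intertwine hf,
      Algebra.algebraMap_eq_smul_one]

/-- For `q = uⁿ`, this is `(x, y) ↦ ∑_{j < n} (-1)^{n-1-j} B (Sʲ x) (T^{n-1-j} y)`. -/
def altSum (B : M →ₗ[ℚ] N →ₗ[ℚ] K) (S : Module.End ℚ M) (T : Module.End ℚ N)
    (q : Polynomial ℚ) : M →ₗ[ℚ] N →ₗ[ℚ] K :=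
  q.sum fun n t => t • ∑ j ∈ Finset.range n, (-1 : ℚ) ^ (n - 1 - j) •
    B.compl₁₂ (S ^ j) (T ^ (n - 1 - j))

variable (B : M →ₗ[ℚ] N →ₗ[ℚ] K) (S : Module.End ℚ M) (T : Module.End ℚ N)

lemma altSum_add (p q : Polynomial ℚ) :
    altSum B S T (p + q) = altSum B S T p + altSum B S T q := by
  rw [altSum, Polynomial.sum_add_index _ _ _ (by simp) (by intros; rw [add_smul])]; rfl

lemma altSum_monomial (n : ℕ) (t : ℚ) (x : M) (y : N) :
    altSum B S T (Polynomial.monomial n t) x y =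
      t • ∑ j ∈ Finset.range n, (-1 : ℚ) ^ (n - 1 - j) • B ((S ^ j) x) ((T ^ (n - 1 - j)) y) := by
  rw [altSum, Polynomial.sum_monomial_index _ _ (by simp)]
  simp [LinearMap.sum_apply]

@[simp] lemma altSum_zero : altSum B S T 0 = 0 := by
  rw [altSum, Polynomial.sum_zero_index]

lemma altSum_C (t : ℚ) : altSum B S T (Polynomial.C t) = 0 := by
  ext x y
  rw [← Polynomial.monomial_zero_left, altSum_monomial]; simp

@[simp] lemma altSum_one : altSum B S T 1 = 0 := altSum_C B S T 1

lemma altSum_smul (c : ℚ) (q : Polynomial ℚ) (x : M) (y : N) :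
    altSum B S T (c • q) x y = c • altSum B S T q x y := by
  induction q using Polynomial.induction_on' with
  | add p q hp hq => simp only [smul_add, altSum_add, LinearMap.add_apply, hp, hq]
  | monomial n t => rw [Polynomial.smul_monomial, altSum_monomial, altSum_monomial, smul_smul,
      smul_eq_mul]

lemma altSum_neg (q : Polynomial ℚ) (x : M) (y : N) :
    altSum B S T (-q) x y = - altSum B S T q x y := by
  simpa using altSum_smul B S T (-1) q x y

lemma altSum_monomial_succ (n : ℕ) (x : M) (y : N) :
    altSum B S T (Polynomial.monomial (n + 1) 1) x y =
      altSum B S T (Polynomial.monomial n 1) (S x) y + (-1 : ℚ) ^ n • B x ((T ^ n) y) := by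
  rw [altSum_monomial, altSum_monomial, Finset.sum_range_succ', one_smul, one_smul]
  congr 1
  refine Finset.sum_congr rfl fun j _ => ?_
  rw [show n + 1 - 1 - (j + 1) = n - 1 - j by omega, pow_succ, Module.End.mul_apply]

variable {B S T}

lemma altSum_intertwine {B' : M' →ₗ[ℚ] N' →ₗ[ℚ] K'} {S' : Module.End ℚ M'}
    {T' : Module.End ℚ N'} (φ : K →ₗ[ℚ] K') (f : M →ₗ[ℚ] M') (g : N →ₗ[ℚ] N')
    (hf : ∀ x, f (S x) = S' (f x)) (hg : ∀ x, g (T x) = T' (g x))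
    (h : ∀ x y, φ (B x y) = B' (f x) (g y)) (q : Polynomial ℚ) (x : M) (y : N) :
    φ (altSum B S T q x y) = altSum B' S' T' q (f x) (g y) := by
  induction q using Polynomial.induction_on' with
  | add p q hp hq => simp only [altSum_add, LinearMap.add_apply, map_add, hp, hq]
  | monomial n t =>
    simp only [altSum_monomial, map_smul, map_sum, h, pow_intertwine hf, pow_intertwine hg]

lemma altSum_leibniz {φ : K →ₗ[ℚ] K} {f s : M →ₗ[ℚ] M} {g : N →ₗ[ℚ] N}
    (hf : ∀ x, f (S x) = S (f x)) (hs : ∀ x, s (S x) = S (s x)) (hg : ∀ x, g (T x) = T (g x))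
    (h : ∀ x y, φ (B x y) = B (f x) y + B (s x) (g y)) (q : Polynomial ℚ) (x : M) (y : N) :
    φ (altSum B S T q x y) = altSum B S T q (f x) y + altSum B S T q (s x) (g y) := by
  induction q using Polynomial.induction_on' with
  | add p q hp hq =>
    simp only [altSum_add, LinearMap.add_apply, map_add, hp, hq]; abel
  | monomial n t =>
    simp only [altSum_monomial, map_smul, map_sum, h, pow_intertwine hf, pow_intertwine hg,
      pow_intertwine hs, ← smul_add, ← Finset.sum_add_distrib]

lemma altSum_balance {f s : M →ₗ[ℚ] M} {g : N →ₗ[ℚ] N}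
    (hf : ∀ x, f (S x) = S (f x)) (hs : ∀ x, s (S x) = S (s x)) (hg : ∀ x, g (T x) = T (g x))
    (h : ∀ x y, B (f x) y = B (s x) (g y)) (q : Polynomial ℚ) (x : M) (y : N) :
    altSum B S T q (f x) y = altSum B S T q (s x) (g y) := by
  induction q using Polynomial.induction_on' with
  | add p q hp hq => simp only [altSum_add, LinearMap.add_apply, hp, hq]
  | monomial n t =>
    simp only [altSum_monomial, ← pow_intertwine hf, ← pow_intertwine hg, ← pow_intertwine hs, h]

lemma tau_monomial (n : ℕ) (t : ℚ) :
    tau (Polynomial.monomial n t) = - ((-1 : ℚ) ^ n • Polynomial.monomial n t) := by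
  rw [tau, LinearMap.neg_apply, AlgHom.toLinearMap_apply, Polynomial.aeval_monomial, neg_pow,
    ← Polynomial.C_mul_X_pow_eq_monomial]
  simp [Polynomial.smul_eq_C_mul]
  ring

@[simp] lemma tau_tau (q : Polynomial ℚ) : tau (tau q) = q := by
  induction q using Polynomial.induction_on' with
  | add p q hp hq => simp [hp, hq]
  | monomial n t => simp [tau_monomial, smul_smul, ← mul_pow]

lemma tau_mul (p q : Polynomial ℚ) : tau (p * q) = - (tau p * tau q) := by
  simp [tau]

/-- The homotopy formula. -/
lemma altSum_homotopy (q : Polynomial ℚ) (x : M) (y : N) :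
    altSum B S T q (S x) y + altSum B S T q x (T y) =
      B (Polynomial.aeval S q x) y + B x (Polynomial.aeval T (tau q) y) := by
  induction q using Polynomial.induction_on' with
  | add p q hp hq =>
    simp only [altSum_add, LinearMap.add_apply, map_add]
    linear_combination (norm := module) hp + hq
  | monomial n t =>
    have key : ∀ x, altSum B S T (Polynomial.monomial n 1) (S x) y +
        altSum B S T (Polynomial.monomial n 1) x (T y) =
        B ((S ^ n) x) y - (-1 : ℚ) ^ n • B x ((T ^ n) y) := by
      induction n with
      | zero => intro x; simp
      | succ n ih =>
        intro x
        rw [altSum_monomial_succ, altSum_monomial_succ, pow_succ S, Module.End.mul_apply,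
          pow_succ T, Module.End.mul_apply, pow_succ]
        linear_combination (norm := module) ih (S x)
    have h1 : Polynomial.monomial n t = t • Polynomial.monomial n (1 : ℚ) := by
      rw [Polynomial.smul_monomial, smul_eq_mul, mul_one]
    rw [h1, map_smul tau, tau_monomial]
    simp only [altSum_smul, map_neg, map_smul, LinearMap.smul_apply, LinearMap.neg_apply,
      Polynomial.aeval_monomial, map_one, one_mul]
    linear_combination (norm := module) t • key x

lemma altSum_mul (p q : Polynomial ℚ) (x : M) (y : N) :
    altSum B S T (p * q) x y =
      altSum B S T q (Polynomial.aeval S p x) y -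
        altSum B S T p x (Polynomial.aeval T (tau q) y) := by
  induction q using Polynomial.induction_on' with
  | add q q' hq hq' =>
    simp only [mul_add, altSum_add, LinearMap.add_apply, map_add]
    linear_combination (norm := module) hq + hq'
  | monomial n t =>
  induction p using Polynomial.induction_on' with
  | add p p' hp hp' =>
    simp only [add_mul, altSum_add, LinearMap.add_apply, map_add]
    linear_combination (norm := module) hp + hp'
  | monomial m s =>
    have key : ∀ x, altSum B S T (Polynomial.monomial (m + n) 1) x y =
        altSum B S T (Polynomial.monomial n 1) ((S ^ m) x) y +
        (-1 : ℚ) ^ n • altSum B S T (Polynomial.monomial m 1) x ((T ^ n) y) := by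
      induction m with
      | zero => intro x; simp
      | succ m ih =>
        intro x
        rw [show m + 1 + n = m + n + 1 by ring, altSum_monomial_succ, altSum_monomial_succ, ih,
          pow_succ S, Module.End.mul_apply, pow_add T, Module.End.mul_apply, pow_add]
        module
    have h1 : ∀ (n : ℕ) (t : ℚ), Polynomial.monomial n t = t • Polynomial.monomial n (1 : ℚ) := by
      intro n t
      rw [Polynomial.smul_monomial, smul_eq_mul, mul_one]
    rw [Polynomial.monomial_mul_monomial, h1 (m + n), h1 m, h1 n, map_smul tau, tau_monomial]
    simp only [altSum_smul, map_neg, map_smul, LinearMap.smul_apply, LinearMap.neg_apply,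
      Polynomial.aeval_monomial, map_one, one_mul]
    linear_combination (norm := module) (s * t) • key x

lemma altSum_tau {B' : N →ₗ[ℚ] M →ₗ[ℚ] K} {x : M} {y : N} {c : ℚ}
    (h : ∀ m n, B' ((T ^ m) y) ((S ^ n) x) = c • B ((S ^ n) x) ((T ^ m) y)) (q : Polynomial ℚ) :
    altSum B' T S (tau q) y x = c • altSum B S T q x y := by
  induction q using Polynomial.induction_on' with
  | add q q' hq hq' => simp only [altSum_add, LinearMap.add_apply, map_add, hq, hq', smul_add]
  | monomial n t =>
    rw [tau_monomial, altSum_neg, altSum_smul, altSum_monomial, altSum_monomial]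
    rw [← Finset.sum_range_reflect]
    simp only [h, Finset.smul_sum, ← Finset.sum_neg_distrib, smul_smul, ← neg_smul]
    refine Finset.sum_congr rfl fun j hj => ?_
    have := Finset.mem_range.1 hj
    rw [show n - 1 - (n - 1 - j) = j by omega]
    congr 1
    obtain ⟨k, rfl⟩ : ∃ k, n = j + k + 1 := ⟨n - 1 - j, by omega⟩
    rw [show j + k + 1 - 1 - j = k by omega]
    have : (-1 : ℚ) ^ j * (-1) ^ j = 1 := by rw [← mul_pow]; simp
    linear_combination (t * (-1) ^ k * c) * this

end Operators

/-! ### Substitutions in polynomials -/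

section Polynomials

variable {A B C A' B' C' : Finset ℕ} {a b c j k : ℕ}

lemma pd_of_mem (h : a ∈ A) (p : Poly A) : pd a A p = MvPolynomial.pderiv ⟨a, h⟩ p := by
  simp [pd, h]

lemma pd_comm (p : Poly A) : pd j A (pd k A p) = pd k A (pd j A p) := by
  by_cases hj : j ∈ A
  swap
  · simp [pd, hj]
  by_cases hk : k ∈ A
  swap
  · simp [pd, hk]
  simp only [pd_of_mem hj, pd_of_mem hk]
  induction p using MvPolynomial.induction_on with
  | C c => simp
  | add p q hp hq => simp [hp, hq]
  | mul_X p i hp =>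
    simp only [Derivation.leibniz, map_add, smul_eq_mul, hp, MvPolynomial.pderiv_X, Pi.single_apply]
    split_ifs <;> simp <;> ring

/-- `setZero` as a homomorphism of algebras. -/
def setZeroHom (a : ℕ) (A C : Finset ℕ) : Poly A →ₐ[ℚ] Poly C :=
  MvPolynomial.aeval fun v : A =>
    if h : (v : ℕ) ≠ a ∧ (v : ℕ) ∈ C then (MvPolynomial.X ⟨v, h.2⟩ : Poly C) else 0

lemma setZero_apply (p : Poly A) : setZero a A C p = setZeroHom a A C p := rfl

lemma setZeroHom_X (v : A) : setZeroHom a A C (MvPolynomial.X v) =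
    if h : (v : ℕ) ≠ a ∧ (v : ℕ) ∈ C then (MvPolynomial.X ⟨v, h.2⟩ : Poly C) else 0 := by
  simp [setZeroHom]

lemma pd_setZero (hA : j ∈ A) (hja : j ≠ a) (hC : j ∈ C) (p : Poly A) :
    pd j C (setZero a A C p) = setZero a A C (pd j A p) := by
  simp only [pd_of_mem hA, pd_of_mem hC, setZero_apply]
  induction p using MvPolynomial.induction_on with
  | C c => simp [setZeroHom]
  | add p q hp hq => simp [hp, hq]
  | mul_X p i hp =>
    simp only [Derivation.leibniz, map_add, map_mul, smul_eq_mul, hp, setZeroHom_X]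
    congr 2
    by_cases hi : i = ⟨j, hA⟩
    · subst hi; simp [hja, hC]
    · have hij : (i : ℕ) ≠ j := fun h => hi (Subtype.ext h)
      split_ifs with h
      · rw [MvPolynomial.pderiv_X_of_ne, MvPolynomial.pderiv_X_of_ne hi, map_zero]
        simpa [Subtype.ext_iff] using hij
      · rw [MvPolynomial.pderiv_X_of_ne hi, map_zero, map_zero]

lemma pd_setZero_eq_zero (h : j ∈ A → j = a) (p : Poly A) : pd j C (setZero a A C p) = 0 := by
  by_cases hC : j ∈ C
  swap
  · simp [pd, hC]
  simp only [pd_of_mem hC, setZero_apply]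
  induction p using MvPolynomial.induction_on with
  | C c => simp [setZeroHom]
  | add p q hp hq => simp [hp, hq]
  | mul_X p i hp =>
    simp only [Derivation.leibniz, map_mul, smul_eq_mul, hp, setZeroHom_X]
    split_ifs with hi
    · rw [MvPolynomial.pderiv_X_of_ne]
      · simp
      · rintro h'
        have h1 : (i : ℕ) = j := by simpa using congrArg Subtype.val h'
        exact hi.1 (h1.trans (h (h1 ▸ i.2)))
    · simp

lemma pd_mul (h : j ∈ A) (p q : Poly A) : pd j A (p * q) = pd j A p * q + p * pd j A q := by
  simp only [pd_of_mem h, Derivation.leibniz, smul_eq_mul]; ring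

lemma setZero_setZero {AB : Finset ℕ}
    (h : ∀ v ∈ A, v ≠ a → v ∈ AB ∧ v ≠ c ∧ v ∈ C) (p : Poly A) :
    setZero c AB C (setZero a A AB p) = setZero a A C p := by
  simp only [setZero_apply]
  rw [← AlgHom.comp_apply]
  congr 1
  ext1 v
  simp only [AlgHom.comp_apply, setZeroHom_X]
  by_cases hv : (v : ℕ) = a
  · simp [hv]
  · have := h v v.2 hv
    simp [hv, this, setZeroHom_X]

lemma setZero_comm {AB BD : Finset ℕ}
    (h : ∀ v ∈ B, v ≠ b → v ≠ c → v ∈ AB ∧ v ∈ BD ∧ v ∈ C) (p : Poly B) :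
    setZero c AB C (setZero b B AB p) = setZero b BD C (setZero c B BD p) := by
  simp only [setZero_apply]
  rw [← AlgHom.comp_apply, ← AlgHom.comp_apply]
  congr 1
  ext1 v
  simp only [AlgHom.comp_apply, setZeroHom_X]
  by_cases hv : (v : ℕ) = b
  · by_cases hc : b = c
    · simp [hv, hc]
    · simp only [hv, ne_eq, not_true_eq_false, false_and, dite_false, map_zero, hc,
        not_false_eq_true, true_and]
      split_ifs <;> simp [setZeroHom_X]
  · by_cases hc : (v : ℕ) = c
    · simp only [hc, ne_eq, not_true_eq_false, false_and, dite_false, map_zero]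
      split_ifs <;> simp [setZeroHom_X]
    · have := h v v.2 hv hc
      simp [hv, hc, this, setZeroHom_X]

lemma rename_setZero (e : A ≃ A') (g : C ≃ C') {a' : ℕ} (ha : ∀ z : A, (z : ℕ) = a ↔ (e z : ℕ) = a')
    (hC : ∀ z ∈ A, z ≠ a → z ∈ C)
    (hg : ∀ (z : A) (w : C), (z : ℕ) ≠ a → (z : ℕ) = w → (g w : ℕ) = e z) (p : Poly A) :
    MvPolynomial.rename g (setZero a A C p) = setZero a' A' C' (MvPolynomial.rename e p) := by
  simp only [setZero_apply]
  rw [← AlgHom.comp_apply, ← AlgHom.comp_apply]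
  congr 1
  ext1 v
  simp only [AlgHom.comp_apply, setZeroHom_X, MvPolynomial.rename_X]
  by_cases hv : (v : ℕ) = a
  · simp [hv, (ha v).1 hv]
  · have h1 := hC v v.2 hv
    have h2 := hg v ⟨v, h1⟩ hv rfl
    have h3 : (e v : ℕ) ∈ C' := h2 ▸ (g _).2
    have h4 : (e v : ℕ) ≠ a' := fun h => hv ((ha v).2 h)
    simp only [ne_eq, hv, not_false_eq_true, h1, and_self, dite_true, MvPolynomial.rename_X, h3, h4]
    congr 1
    exact Subtype.ext h2

lemma rename_pd (e : A ≃ A') (z : A) (p : Poly A) :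
    MvPolynomial.rename e (pd z A p) = pd (e z) A' (MvPolynomial.rename e p) := by
  rw [pd_of_mem z.2, pd_of_mem (e z).2]
  exact (MvPolynomial.pderiv_rename e.injective z p).symm

lemma subst_eq_rename (h : Renames a c A C) (p : Poly A) :
    subst a c A C p = MvPolynomial.rename h.equiv p := by
  rw [subst, AlgHom.toLinearMap_apply]
  congr 1
  ext1 v
  have h1 : (if (v : ℕ) = a then c else (v : ℕ)) = h.equiv v := rfl
  simp only [MvPolynomial.aeval_X, MvPolynomial.rename_X, h1, (h.equiv v).2, dite_true]

lemma isHomogeneous_setZero {p : Poly A} {n : ℕ} (hp : p.IsHomogeneous n) :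
    (setZero a A C p).IsHomogeneous n := by
  have := hp.aeval (fun v : A =>
    if h : (v : ℕ) ≠ a ∧ (v : ℕ) ∈ C then (MvPolynomial.X ⟨v, h.2⟩ : Poly C) else 0) (n := 1)
    (fun v => by
      split_ifs
      · exact MvPolynomial.isHomogeneous_X _ _
      · exact MvPolynomial.isHomogeneous_zero _ _ _)
  rwa [one_mul] at this

end Polynomials

/-! ### Operators on `P(A) ⊗ ℚ[v_a | a ∈ A]` -/

section

variable (P : CyclicOperad.{u})

/-- The differential of `P`. -/
def dV (A : Finset ℕ) : Module.End ℚ (PV P A) := TensorProduct.map (P.d A) LinearMap.id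

/-- The derivative `∂/∂v_j`. -/
def pV (j : ℕ) (A : Finset ℕ) : Module.End ℚ (PV P A) :=
  TensorProduct.map LinearMap.id (pd j A)

/-- The operator `x ⊗ p ↦ (-1)^{|x|} (x ∘_j Δ) ⊗ p`. -/
def cV (Δ : ∀ B, P.obj B) (j : ℕ) (A : Finset ℕ) : Module.End ℚ (PV P A) :=
  TensorProduct.map (circ P Δ j A) LinearMap.id

/-- The action of the bijections. -/
def mV {A B : Finset ℕ} (e : A ≃ B) : PV P A →ₗ[ℚ] PV P B :=
  TensorProduct.map (P.map e) (MvPolynomial.rename (R := ℚ) e).toLinearMap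

/-- The composition `(x ⊗ p, y ⊗ q) ↦ (x ∘_{a,b} y) ⊗ pq |_{v_a = v_b = 0}`. -/
def cmp (a b : ℕ) (A B C : Finset ℕ) : PV P A →ₗ[ℚ] PV P B →ₗ[ℚ] PV P C :=
  TensorProduct.map₂ (P.comp a b A B C)
    ((LinearMap.mul ℚ (Poly C)).compl₁₂ (setZero a A C) (setZero b B C))

/-- `q(∂/∂v_a)`. -/
def opV (a : ℕ) (A : Finset ℕ) (q : Polynomial ℚ) : Module.End ℚ (PV P A) :=
  Polynomial.aeval (pV P a A) q

variable {P} {Δ : ∀ B, P.obj B} {a b c e j k : ℕ} {A B C : Finset ℕ}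

@[elab_as_elim]
lemma PV.induction {p : PV P A → Prop} (X : PV P A) (tmul : ∀ x f, p (x ⊗ₜ f))
    (add : ∀ X Y, p X → p Y → p (X + Y)) : p X :=
  X.induction_on (by simpa using tmul 0 0) tmul add

@[simp] lemma dV_tmul (x : P.obj A) (p : Poly A) : dV P A (x ⊗ₜ p) = P.d A x ⊗ₜ p := rfl

@[simp] lemma pV_tmul (x : P.obj A) (p : Poly A) : pV P j A (x ⊗ₜ p) = x ⊗ₜ pd j A p := rfl

@[simp] lemma cV_tmul (x : P.obj A) (p : Poly A) :
    cV P Δ j A (x ⊗ₜ p) = circ P Δ j A x ⊗ₜ p := rfl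

@[simp] lemma sgV_tmul (x : P.obj A) (p : Poly A) : sgV P A (x ⊗ₜ p) = sg P A x ⊗ₜ p := rfl

@[simp] lemma mV_tmul (e : A ≃ B) (x : P.obj A) (p : Poly A) :
    mV P e (x ⊗ₜ p) = P.map e x ⊗ₜ MvPolynomial.rename e p := rfl

@[simp] lemma cmp_tmul (x : P.obj A) (p : Poly A) (y : P.obj B) (q : Poly B) :
    cmp P a b A B C (x ⊗ₜ p) (y ⊗ₜ q) =
      P.comp a b A B C x y ⊗ₜ (setZero a A C p * setZero b B C q) := rfl

/-! Relations between the operators on one factor. -/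

lemma sgV_sgV (X : PV P A) : sgV P A (sgV P A X) = X := by
  induction X using PV.induction with
  | tmul x p => simp [P.lawful.sgn_sgn]
  | add X Y hX hY => simp [hX, hY]

lemma dV_dV (X : PV P A) : dV P A (dV P A X) = 0 := by
  induction X using PV.induction with
  | tmul x p => simp [P.d_d]
  | add X Y hX hY => simp [hX, hY]

lemma dV_sgV (X : PV P A) : dV P A (sgV P A X) = - sgV P A (dV P A X) := by
  induction X using PV.induction with
  | tmul x p => simp [d_sgn, TensorProduct.neg_tmul]
  | add X Y hX hY => simp [hX, hY, add_comm]

lemma dV_pV (X : PV P A) : dV P A (pV P j A X) = pV P j A (dV P A X) := by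
  induction X using PV.induction with
  | tmul x p => simp
  | add X Y hX hY => simp [hX, hY]

lemma pV_sgV (X : PV P A) : pV P j A (sgV P A X) = sgV P A (pV P j A X) := by
  induction X using PV.induction with
  | tmul x p => simp
  | add X Y hX hY => simp [hX, hY]

lemma pV_cV (X : PV P A) : pV P j A (cV P Δ k A X) = cV P Δ k A (pV P j A X) := by
  induction X using PV.induction with
  | tmul x p => simp
  | add X Y hX hY => simp [hX, hY]

lemma pV_comm (X : PV P A) : pV P j A (pV P k A X) = pV P k A (pV P j A X) := by
  induction X using PV.induction with
  | tmul x p => simp [pd_comm (j := j)]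
  | add X Y hX hY => simp [hX, hY]

lemma opV_comm (p q : Polynomial ℚ) (X : PV P A) :
    opV P j A p (opV P k A q X) = opV P k A q (opV P j A p X) :=
  aeval_intertwine (fun X => (aeval_intertwine (fun _ => pV_comm _) p X).symm) q X

lemma opV_sgV (q : Polynomial ℚ) (X : PV P A) :
    opV P j A q (sgV P A X) = sgV P A (opV P j A q X) :=
  (aeval_intertwine (fun _ => pV_sgV _ |>.symm) q X).symm

lemma opV_dV (q : Polynomial ℚ) (X : PV P A) :
    opV P j A q (dV P A X) = dV P A (opV P j A q X) :=
  (aeval_intertwine (fun _ => dV_pV _) q X).symm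

lemma opV_pV (q : Polynomial ℚ) (X : PV P A) :
    opV P j A q (pV P k A X) = pV P k A (opV P j A q X) :=
  (aeval_intertwine (fun _ => pV_comm _) q X).symm

lemma opV_cV (q : Polynomial ℚ) (X : PV P A) :
    opV P j A q (cV P Δ k A X) = cV P Δ k A (opV P j A q X) :=
  (aeval_intertwine (fun _ => (pV_cV _).symm) q X).symm

lemma opV_mul (p q : Polynomial ℚ) (X : PV P A) :
    opV P j A (p * q) X = opV P j A p (opV P j A q X) := by
  rw [opV, map_mul]; rfl

lemma mV_refl (X : PV P A) : mV P (Equiv.refl A) X = X := by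
  induction X using PV.induction with
  | tmul x p => simp [P.lawful.map_refl]
  | add X Y hX hY => simp [hX, hY]

lemma mV_trans (f : A ≃ B) (g : B ≃ C) (X : PV P A) : mV P (f.trans g) X = mV P g (mV P f X) := by
  induction X using PV.induction with
  | tmul x p => simp [P.lawful.map_trans, MvPolynomial.rename_rename]
  | add X Y hX hY => simp [hX, hY]

lemma mV_sgV (f : A ≃ B) (X : PV P A) : mV P f (sgV P A X) = sgV P B (mV P f X) := by
  induction X using PV.induction with
  | tmul x p => simp [P.lawful.map_sgn]
  | add X Y hX hY => simp [hX, hY]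

lemma mV_dV (f : A ≃ B) (X : PV P A) : mV P f (dV P A X) = dV P B (mV P f X) := by
  induction X using PV.induction with
  | tmul x p => simp [P.d_map]
  | add X Y hX hY => simp [hX, hY]

lemma mV_pV (f : A ≃ B) (z : A) (X : PV P A) : mV P f (pV P z A X) = pV P (f z) B (mV P f X) := by
  induction X using PV.induction with
  | tmul x p => simp [rename_pd]
  | add X Y hX hY => simp [hX, hY]

lemma mV_opV (f : A ≃ B) (z : A) (q : Polynomial ℚ) (X : PV P A) :
    mV P f (opV P z A q X) = opV P (f z) B q (mV P f X) :=
  aeval_intertwine (fun _ => mV_pV _ _ _) q X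

lemma opV_tmul (q : Polynomial ℚ) (x : P.obj A) (p : Poly A) :
    opV P a A q (x ⊗ₜ p) = x ⊗ₜ opd a A q p :=
  (aeval_intertwine (f := TensorProduct.mk ℚ (P.obj A) (Poly A) x) (S := pd a A)
    (S' := pV P a A) (fun _ => rfl) q p).symm

/-! Relations with the composition. -/

lemma cmp_sgV (h : Glue a b A B C) (X : PV P A) (Y : PV P B) :
    sgV P C (cmp P a b A B C X Y) = cmp P a b A B C (sgV P A X) (sgV P B Y) := by
  induction X using PV.induction with
  | add X Y hX hY => simp [hX, hY]
  | tmul x p =>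
  induction Y using PV.induction with
  | add X Y hX hY => simp [hX, hY]
  | tmul y q => simp [comp_sgn h]

lemma cmp_dV (h : Glue a b A B C) (X : PV P A) (Y : PV P B) :
    dV P C (cmp P a b A B C X Y) =
      cmp P a b A B C (dV P A X) Y + cmp P a b A B C (sgV P A X) (dV P B Y) := by
  induction X using PV.induction with
  | add X Y hX hY => simp [hX, hY]; abel
  | tmul x p =>
  induction Y using PV.induction with
  | add X Y hX hY => simp [hX, hY]; abel
  | tmul y q => simp [d_comp h, TensorProduct.add_tmul]

lemma cmp_pV_left (h : Glue a b A B C) (hj : j ∈ A) (hja : j ≠ a) (X : PV P A) (Y : PV P B) :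
    pV P j C (cmp P a b A B C X Y) = cmp P a b A B C (pV P j A X) Y := by
  have hC := h.mem_iff.2 (.inl ⟨hj, hja⟩)
  induction X using PV.induction with
  | add X Y hX hY => simp [hX, hY]
  | tmul x p =>
  induction Y using PV.induction with
  | add X Y hX hY => simp [hX, hY]
  | tmul y q =>
    simp [pd_mul hC, pd_setZero hj hja hC, pd_setZero_eq_zero (fun hB => h.disj hj hja hB)]

lemma cmp_pV_right (h : Glue a b A B C) (hj : j ∈ B) (hjb : j ≠ b) (X : PV P A) (Y : PV P B) :
    pV P j C (cmp P a b A B C X Y) = cmp P a b A B C X (pV P j B Y) := by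
  have hC := h.mem_iff.2 (.inr ⟨hj, hjb⟩)
  induction X using PV.induction with
  | add X Y hX hY => simp [hX, hY]
  | tmul x p =>
  induction Y using PV.induction with
  | add X Y hX hY => simp [hX, hY]
  | tmul y q =>
    simp [pd_mul hC, pd_setZero hj hjb hC, pd_setZero_eq_zero (fun hA => h.swap.disj hj hjb hA)]

lemma cmp_opV_left (h : Glue a b A B C) (hj : j ∈ A) (hja : j ≠ a) (f : Polynomial ℚ) (X : PV P A)
    (Y : PV P B) :
    opV P j C f (cmp P a b A B C X Y) = cmp P a b A B C (opV P j A f X) Y :=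
  (aeval_intertwine (f := (cmp P a b A B C).flip Y)
    (fun X => (cmp_pV_left h hj hja X Y).symm) f X).symm

lemma cmp_opV_right (h : Glue a b A B C) (hj : j ∈ B) (hjb : j ≠ b) (f : Polynomial ℚ)
    (X : PV P A) (Y : PV P B) :
    opV P j C f (cmp P a b A B C X Y) = cmp P a b A B C X (opV P j B f Y) :=
  (aeval_intertwine (f := cmp P a b A B C X)
    (fun Y => (cmp_pV_right h hj hjb X Y).symm) f Y).symm

lemma cmp_assoc {AB BD D : Finset ℕ} (h1 : Glue a b A B AB) (h2 : Glue c e AB D C)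
    (h3 : Glue c e B D BD) (h4 : Glue a b A BD C) (hcb : c ≠ b) (X : PV P A) (Y : PV P B)
    (Z : PV P D) :
    cmp P c e AB D C (cmp P a b A B AB X Y) Z = cmp P a b A BD C X (cmp P c e B D BD Y Z) := by
  have hcB : c ∈ B := h3.mem_left
  have hbB : b ∈ B := h1.mem_right
  induction X using PV.induction with
  | add X Y hX hY => simp [hX, hY]
  | tmul x p =>
  induction Y using PV.induction with
  | add X Y hX hY => simp [hX, hY]
  | tmul y q =>
  induction Z using PV.induction with
  | add X Y hX hY => simp only [map_add, hX, hY]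
  | tmul z r =>
    simp only [cmp_tmul, P.comp_assoc h1 h2 h3 h4 hcb]
    congr 1
    have e1 : setZero c AB C (setZero a A AB p) = setZero a A C p := by
      refine setZero_setZero (fun v hv hva => ⟨h1.mem_iff.2 (.inl ⟨hv, hva⟩), ?_,
        h4.mem_iff.2 (.inl ⟨hv, hva⟩)⟩) p
      rintro rfl
      exact hcb (h1.disj hv hva hcB)
    have e2 : setZero b BD C (setZero e D BD r) = setZero e D C r := by
      refine setZero_setZero (fun v hv hva => ⟨h3.mem_iff.2 (.inr ⟨hv, hva⟩), ?_,
        h2.mem_iff.2 (.inr ⟨hv, hva⟩)⟩) r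
      rintro rfl
      exact hcb (h3.swap.disj hv hva hbB).symm
    have e3 : setZero c AB C (setZero b B AB q) = setZero b BD C (setZero c B BD q) :=
      setZero_comm (fun v hv hvb hvc => ⟨h1.mem_iff.2 (.inr ⟨hv, hvb⟩),
        h3.mem_iff.2 (.inl ⟨hv, hvc⟩), h4.mem_iff.2 (.inr ⟨h3.mem_iff.2 (.inl ⟨hv, hvc⟩), hvb⟩)⟩) q
    simp only [setZero_apply, map_mul] at e1 e2 e3 ⊢
    rw [e1, e2, e3, mul_assoc]

/-- The compatibility of bijections `A ≃ A'`, `B ≃ B'` and `C ≃ C'` with gluings. -/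
structure GlueMap (a b : ℕ) {A B C : Finset ℕ} (a' b' : ℕ) {A' B' C' : Finset ℕ}
    (e : A ≃ A') (f : B ≃ B') (g : C ≃ C') : Prop where
  left : Glue a b A B C
  right : Glue a' b' A' B' C'
  fst : ∀ z : A, (z : ℕ) = a → (e z : ℕ) = a'
  snd : ∀ z : B, (z : ℕ) = b → (f z : ℕ) = b'
  map_fst : ∀ (z : A) (w : C), (z : ℕ) ≠ a → (z : ℕ) = w → (g w : ℕ) = e z
  map_snd : ∀ (z : B) (w : C), (z : ℕ) ≠ b → (z : ℕ) = w → (g w : ℕ) = f z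

namespace GlueMap

variable {a' b' : ℕ} {A' B' C' : Finset ℕ} {e : A ≃ A'} {f : B ≃ B'} {g : C ≃ C'}

lemma fst_iff (h : GlueMap a b a' b' e f g) (z : A) : (z : ℕ) = a ↔ (e z : ℕ) = a' := by
  refine ⟨h.fst z, fun hz => ?_⟩
  have h1 := h.fst ⟨a, h.left.mem_left⟩ rfl
  have h2 : e z = e ⟨a, h.left.mem_left⟩ := Subtype.ext (hz.trans h1.symm)
  exact congrArg Subtype.val (e.injective h2)

lemma swap (h : GlueMap a b a' b' e f g) : GlueMap b a b' a' f e g :=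
  ⟨h.left.swap, h.right.swap, h.snd, h.fst, h.map_snd, h.map_fst⟩

end GlueMap

lemma cmp_mV {a' b' : ℕ} {A' B' C' : Finset ℕ} {e : A ≃ A'} {f : B ≃ B'} {g : C ≃ C'}
    (h : GlueMap a b a' b' e f g) (X : PV P A) (Y : PV P B) :
    mV P g (cmp P a b A B C X Y) = cmp P a' b' A' B' C' (mV P e X) (mV P f Y) := by
  induction X using PV.induction with
  | add X Y hX hY => simp [hX, hY]
  | tmul x p =>
  induction Y using PV.induction with
  | add X Y hX hY => simp [hX, hY]
  | tmul y q =>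
    simp only [cmp_tmul, mV_tmul,
      P.comp_map h.left h.right e f g h.fst h.snd h.map_fst h.map_snd, map_mul]
    rw [rename_setZero e g h.fst_iff (fun z hz hza => h.left.mem_iff.2 (.inl ⟨hz, hza⟩)) h.map_fst,
      rename_setZero f g h.swap.fst_iff (fun z hz hza => h.left.mem_iff.2 (.inr ⟨hz, hza⟩))
        h.map_snd]

section

variable (hΔ : IsCircle P Δ)
include hΔ

lemma cV_sgV (hA : 2 ≤ A.card) (hj : j ∈ A) (X : PV P A) :
    cV P Δ j A (sgV P A X) = - sgV P A (cV P Δ j A X) := by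
  induction X using PV.induction with
  | tmul x p => simp [circ_sgn hΔ hA hj, TensorProduct.neg_tmul]
  | add X Y hX hY => simp [hX, hY, add_comm]

lemma dV_cV (hA : 2 ≤ A.card) (hj : j ∈ A) (X : PV P A) :
    dV P A (cV P Δ j A X) = - cV P Δ j A (dV P A X) := by
  induction X using PV.induction with
  | tmul x p => simp [d_circ hΔ hA hj, TensorProduct.neg_tmul]
  | add X Y hX hY => simp [hX, hY, add_comm]

lemma cV_cV (hA : 2 ≤ A.card) (hj : j ∈ A) (hk : k ∈ A) (hjk : j ≠ k) (X : PV P A) :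
    cV P Δ j A (cV P Δ k A X) = - cV P Δ k A (cV P Δ j A X) := by
  induction X using PV.induction with
  | tmul x p =>
    rw [cV_tmul, cV_tmul, circ_circ hΔ hA hj hk hjk, TensorProduct.neg_tmul]; rfl
  | add X Y hX hY => simp [hX, hY, add_comm]

lemma cV_cV_self (hA : 2 ≤ A.card) (hj : j ∈ A) (X : PV P A) :
    cV P Δ j A (cV P Δ j A X) = 0 := by
  induction X using PV.induction with
  | tmul x p => simp [circ_circ_self hΔ hA hj]
  | add X Y hX hY => simp [hX, hY]

lemma mV_cV (hA : 2 ≤ A.card) (f : A ≃ B) (z : A) (X : PV P A) :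
    mV P f (cV P Δ z A X) = cV P Δ (f z) B (mV P f X) := by
  induction X using PV.induction with
  | tmul x p => simp [map_circ hΔ hA]
  | add X Y hX hY => simp [hX, hY]

lemma cmp_cV_left (h : Glue a b A B C) (hj : j ∈ A) (hja : j ≠ a) (X : PV P A) (Y : PV P B) :
    cV P Δ j C (cmp P a b A B C X Y) = cmp P a b A B C (cV P Δ j A X) Y := by
  induction X using PV.induction with
  | add X Y hX hY => simp [hX, hY]
  | tmul x p =>
  induction Y using PV.induction with
  | add X Y hX hY => simp [hX, hY]
  | tmul y q => simp [circ_comp_left hΔ h hj hja]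

lemma cmp_cV_glue (h : Glue a b A B C) (X : PV P A) (Y : PV P B) :
    cmp P a b A B C (cV P Δ a A X) Y = cmp P a b A B C (sgV P A X) (cV P Δ b B Y) := by
  induction X using PV.induction with
  | add X Y hX hY => simp [hX, hY]
  | tmul x p =>
  induction Y using PV.induction with
  | add X Y hX hY => simp only [map_add, hX, hY]
  | tmul y q => simp [circ_comp_glue hΔ h]

end

lemma cmp_cV_right (h : Glue a b A B C) (hj : j ∈ B) (hjb : j ≠ b) (X : PV P A) (Y : PV P B) :
    cV P Δ j C (cmp P a b A B C X Y) = cmp P a b A B C (sgV P A X) (cV P Δ j B Y) := by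
  induction X using PV.induction with
  | add X Y hX hY => simp [hX, hY]
  | tmul x p =>
  induction Y using PV.induction with
  | add X Y hX hY => simp [hX, hY]
  | tmul y q => simp [circ_comp_right h hj hjb]

/-! The grading. -/

@[elab_as_elim]
lemma grV_induction {k : ℤ} {p : PV P A → Prop} {X : PV P A} (hX : X ∈ grV P A k)
    (tmul : ∀ (i : ℤ) (n : ℕ) (x : P.obj A) (f : Poly A), x ∈ P.gr A i → f.IsHomogeneous n →
      k = i - (6 - 2 * (A.card : ℤ)) - 2 * n → p (x ⊗ₜ f))
    (zero : p 0) (add : ∀ X Y, p X → p Y → p (X + Y)) (smul : ∀ (t : ℚ) X, p X → p (t • X)) :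
    p X := by
  refine Submodule.span_induction ?_ zero (fun X Y _ _ => add X Y) (fun t X _ => smul t X) hX
  rintro _ ⟨i, n, x, f, hx, hf, hk, rfl⟩
  exact tmul i n x f hx hf hk

lemma tmul_mem_grV {k i : ℤ} {n : ℕ} {x : P.obj A} {f : Poly A} (hx : x ∈ P.gr A i)
    (hf : f.IsHomogeneous n) (hk : k = i - (6 - 2 * (A.card : ℤ)) - 2 * n) :
    x ⊗ₜ f ∈ grV P A k :=
  Submodule.subset_span ⟨i, n, x, f, hx, hf, hk, rfl⟩

lemma grV_map {k : ℤ} {f : PV P A →ₗ[ℚ] PV P B} {l : ℤ}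
    (tmul : ∀ (i : ℤ) (n : ℕ) (x : P.obj A) (p : Poly A), x ∈ P.gr A i → p.IsHomogeneous n →
      k = i - (6 - 2 * (A.card : ℤ)) - 2 * n → f (x ⊗ₜ p) ∈ grV P B l)
    {X : PV P A} (hX : X ∈ grV P A k) : f X ∈ grV P B l :=
  grV_induction hX tmul (by simp) (fun X Y hX hY => by rw [map_add]; exact add_mem hX hY)
    (fun t X hX => by rw [map_smul]; exact Submodule.smul_mem _ _ hX)

lemma sgV_of_mem {k : ℤ} {X : PV P A} (hX : X ∈ grV P A k) : sgV P A X = (-1 : ℚ) ^ k • X := by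
  refine grV_induction hX (fun i n x f hx hf hk => ?_) (by simp)
    (fun X Y hX hY => by rw [map_add, hX, hY, smul_add])
    (fun t X hX => by rw [map_smul, hX, smul_comm])
  rw [sgV_tmul, P.lawful.sgn_of_mem hx, TensorProduct.smul_tmul',
    neg_one_zpow_congr (m := k) (n := i)]
  exact ⟨-(3 - A.card) - n, by rw [hk]; ring⟩

lemma sgV_mem {k : ℤ} {X : PV P A} (hX : X ∈ grV P A k) : sgV P A X ∈ grV P A k := by
  rw [sgV_of_mem hX]; exact Submodule.smul_mem _ _ hX

lemma dV_mem {k : ℤ} {X : PV P A} (hX : X ∈ grV P A k) : dV P A X ∈ grV P A (k + 1) :=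
  grV_map (fun i n x p hx hp hk => tmul_mem_grV (P.d_gr _ _ _ hx) hp (by rw [hk]; ring)) hX

lemma cV_mem (hΔ : IsCircle P Δ) (hA : 2 ≤ A.card) (hj : j ∈ A) {k : ℤ} {X : PV P A}
    (hX : X ∈ grV P A k) : cV P Δ j A X ∈ grV P A (k - 1) :=
  grV_map (fun i n x p hx hp hk => tmul_mem_grV (circ_gr hΔ hA hj hx) hp (by rw [hk]; ring)) hX

lemma pV_mem {k : ℤ} {X : PV P A} (hX : X ∈ grV P A k) : pV P j A X ∈ grV P A (k + 2) := by
  refine grV_map (fun i n x p hx hp hk => ?_) hX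
  by_cases hj : j ∈ A
  swap
  · simp [pd, hj]
  rw [pV_tmul, pd_of_mem hj]
  obtain _ | n := n
  · rw [← MvPolynomial.totalDegree_zero_iff_isHomogeneous,
      MvPolynomial.totalDegree_eq_zero_iff_eq_C] at hp
    rw [hp]; simp
  · exact tmul_mem_grV hx hp.pderiv (by rw [hk]; rw [Nat.add_sub_cancel]; push_cast; ring)

lemma pV_pow_mem {k : ℤ} {X : PV P A} (hX : X ∈ grV P A k) (n : ℕ) :
    (pV P j A ^ n) X ∈ grV P A (k + 2 * n) := by
  induction n with
  | zero => simpa using hX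
  | succ n ih =>
    rw [pow_succ', Module.End.mul_apply]
    convert pV_mem ih using 2
    push_cast; ring

lemma mV_mem (f : A ≃ B) {k : ℤ} {X : PV P A} (hX : X ∈ grV P A k) : mV P f X ∈ grV P B k := by
  have hc : A.card = B.card := by simpa using Fintype.card_congr f
  exact grV_map (fun i n x p hx hp hk => tmul_mem_grV (P.lawful.map_gr _ _ _ hx)
    hp.rename_isHomogeneous (by rw [hk, hc])) hX

lemma cmp_mem (h : Glue a b A B C) {k l : ℤ} {X : PV P A} {Y : PV P B} (hX : X ∈ grV P A k)
    (hY : Y ∈ grV P B l) : cmp P a b A B C X Y ∈ grV P C (k + l + 2) := by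
  refine grV_map (f := (cmp P a b A B C).flip Y) (fun i n x p hx hp hk => ?_) hX
  refine grV_map (f := cmp P a b A B C (x ⊗ₜ p)) (fun i' n' y q hy hq hl => ?_) hY
  rw [cmp_tmul]
  refine tmul_mem_grV (P.comp_gr h _ _ _ _ hx hy)
    ((isHomogeneous_setZero hp).mul (isHomogeneous_setZero hq)) ?_
  have := h.card
  rw [hk, hl]
  push_cast
  zify at this
  linarith

lemma cmp_symm (h : Glue a b A B C) {k l : ℤ} {X : PV P A} {Y : PV P B} (hX : X ∈ grV P A k)
    (hY : Y ∈ grV P B l) :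
    cmp P a b A B C X Y = (-1 : ℚ) ^ (k * l) • cmp P b a B A C Y X := by
  refine grV_induction hX (fun i n x f hx hf hk => ?_) (by simp)
    (fun X Y hX hY => by simp only [map_add, LinearMap.add_apply, hX, hY, smul_add])
    (fun t X hX => by simp only [map_smul, LinearMap.smul_apply, hX, smul_comm t])
  refine grV_induction hY (fun i' n' y q hy hq hl => ?_) (by simp)
    (fun X Y hX hY => by simp only [map_add, LinearMap.add_apply, hX, hY, smul_add])
    (fun t X hX => by simp only [map_smul, LinearMap.smul_apply, hX, smul_comm t])
  rw [cmp_tmul, cmp_tmul, P.comp_symm h _ _ _ _ hx hy, mul_comm (setZero a A C f),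
    TensorProduct.smul_tmul', neg_one_zpow_congr (m := i * i') (n := k * l)]
  obtain ⟨u, hu⟩ : ∃ u, i = k + 2 * u := ⟨3 - A.card + n, by rw [hk]; ring⟩
  obtain ⟨v, hv⟩ : ∃ v, i' = l + 2 * v := ⟨3 - B.card + n', by rw [hl]; ring⟩
  exact ⟨u * l + k * v + 2 * u * v, by rw [hu, hv]; ring⟩

/-! The ternary composition. -/

variable (P) in
/-- For `q = uⁿ`, this is `(X, Z) ↦ ∑_{j < n} (-1)^{n-1-j} (∂_aʲ X) ∘_{a,c} (∂_c^{n-1-j} Z)`. -/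
def tern (a c : ℕ) (A C D : Finset ℕ) (q : Polynomial ℚ) : PV P A →ₗ[ℚ] PV P C →ₗ[ℚ] PV P D :=
  altSum (cmp P a c A C D) (pV P a A) (pV P c C) q

lemma map₂_kernel3 (q : Polynomial ℚ) {D : Finset ℕ} (X : PV P A) (Z : PV P C) :
    TensorProduct.map₂ (P.comp a c A C D ∘ₗ sg P A) (kernel3 a c A C D q) X Z =
      tern P a c A C D q (sgV P A X) Z := by
  induction X using PV.induction with
  | add X Y hX hY => simp only [map_add, LinearMap.add_apply, hX, hY]
  | tmul x p =>
  induction Z using PV.induction with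
  | add X Y hX hY => simp only [map_add, hX, hY]
  | tmul z r =>
    rw [TensorProduct.map₂_apply_tmul, sgV_tmul]
    exact altSum_intertwine (B := (LinearMap.mul ℚ (Poly D)).compl₁₂ (setZero a A D)
      (setZero c C D)) (S := pd a A) (T := pd c C)
      (TensorProduct.mk ℚ (P.obj D) (Poly D) (P.comp a c A C D (sg P A x) z))
      (TensorProduct.mk ℚ (P.obj A) (Poly A) (sg P A x)) (TensorProduct.mk ℚ (P.obj C) (Poly C) z)
      (fun _ => rfl) (fun _ => rfl) (fun _ _ => rfl) q p r

end

/-! ### Elements of arity two -/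

section Arity2

variable {A B : Finset ℕ} {a b c : ℕ}

lemma other_pair (h : a ≠ b) : other {a, b} a = b := by
  rw [other, Finset.erase_insert (by simpa using h)]; simp

lemma exists_eq_pair (h : A.card = 2) (ha : a ∈ A) : ∃ b, b ≠ a ∧ A = {a, b} ∧ other A a = b := by
  obtain ⟨x, y, hxy, rfl⟩ := Finset.card_eq_two.1 h
  simp only [Finset.mem_insert, Finset.mem_singleton] at ha
  rcases ha with rfl | rfl
  · exact ⟨y, hxy.symm, rfl, other_pair hxy⟩
  · exact ⟨x, hxy, Finset.pair_comm _ _, by rw [Finset.pair_comm, other_pair hxy.symm]⟩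

lemma other_mem (h : A.card = 2) (ha : a ∈ A) : other A a ∈ A := by
  obtain ⟨b, -, hA, hb⟩ := exists_eq_pair h ha
  rw [hb, hA]; simp

lemma other_ne (h : A.card = 2) (ha : a ∈ A) : other A a ≠ a := by
  obtain ⟨b, hba, hA, hb⟩ := exists_eq_pair h ha
  rwa [hb]

lemma eq_other (h : A.card = 2) (ha : a ∈ A) (hb : b ∈ A) (hba : b ≠ a) : b = other A a := by
  obtain ⟨c, hca, hA, hc⟩ := exists_eq_pair h ha
  rw [hA] at hb
  simp only [Finset.mem_insert, Finset.mem_singleton] at hb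
  rw [hc]
  tauto

lemma other_other (h : A.card = 2) (ha : a ∈ A) : other A (other A a) = a :=
  (eq_other h (other_mem h ha) ha (other_ne h ha).symm).symm

@[simp] lemma readAt_readAt (q : Polynomial ℚ) : readAt A a (readAt A a q) = q := by
  rw [readAt]; split_ifs <;> simp

lemma le_all_iff (h : A.card = 2) (ha : a ∈ A) : (∀ x ∈ A, a ≤ x) ↔ a < other A a := by
  obtain ⟨b, hba, hA, hb⟩ := exists_eq_pair h ha
  rw [hb, hA]
  simp [lt_iff_le_and_ne, hba.symm]

lemma readAt_other (h : A.card = 2) (ha : a ∈ A) (q : Polynomial ℚ) :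
    readAt A (other A a) q = tau (readAt A a q) := by
  simp only [readAt, le_all_iff h ha, le_all_iff h (other_mem h ha), other_other h ha]
  have := other_ne h ha
  by_cases h1 : a < other A a
  · simp [h1, h1.not_gt]
  · simp [h1, show other A a < a by omega]

lemma readAt_of_ne (h : A.card = 2) (ha : a ∈ A) (hb : b ∈ A) (hba : b ≠ a) (q : Polynomial ℚ) :
    readAt A b q = tau (readAt A a q) := by
  rw [eq_other h ha hb hba, readAt_other h ha]

lemma readAt_equiv (h : A.card = 2) (e : A ≃ B) (z : A) (q : Polynomial ℚ) :
    readAt B (e z) ((open Classical in if Monotone e then LinearMap.id else tau) q) =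
      readAt A z q := by
  have hB : B.card = 2 := by have := Fintype.card_congr e; simp at this; omega
  obtain ⟨w, hw⟩ : ∃ w : A, (w : ℕ) = other A z := ⟨⟨_, other_mem h z.2⟩, rfl⟩
  have hwz : w ≠ z := fun hwz => other_ne h z.2 (by rw [← hw, hwz])
  have hew : (e w : ℕ) = other B (e z) :=
    eq_other hB (e z).2 (e w).2 fun h' => hwz (e.injective (Subtype.ext h'))
  have hne : (e w : ℕ) ≠ e z := hew ▸ other_ne hB (e z).2
  have hne' : (w : ℕ) ≠ z := hw ▸ other_ne h z.2
  have hA : ∀ x : A, x = z ∨ x = w := fun x => by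
    by_cases hx : x = z
    · exact .inl hx
    · exact .inr (Subtype.ext (hw ▸ eq_other h z.2 x.2 fun h' => hx (Subtype.ext h')))
  have hm : Monotone e ↔ ((z : ℕ) < w ↔ (e z : ℕ) < e w) := by
    constructor
    · intro hm
      constructor
      · intro hzw
        exact lt_of_le_of_ne (hm (show z ≤ w from hzw.le)) hne.symm
      · intro hezw
        by_contra hzw
        have : e w ≤ e z := hm (show (w : ℕ) ≤ z by omega)
        have : (e w : ℕ) ≤ e z := this
        omega
    · intro hm x y hxy
      have hxy' : (x : ℕ) ≤ y := hxy
      change (e x : ℕ) ≤ e y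
      rcases hA x with rfl | rfl <;> rcases hA y with rfl | rfl <;> omega
  simp only [readAt, le_all_iff h z.2, le_all_iff hB (e z).2, ← hw, ← hew, hm]
  by_cases h1 : (z : ℕ) < w <;> by_cases h2 : (e z : ℕ) < e w <;> simp [h1, h2]

lemma readAt_injective {p q : Polynomial ℚ} (h : readAt A a p = readAt A a q) : p = q := by
  rw [← readAt_readAt (A := A) (a := a) p, h, readAt_readAt]

end Arity2

namespace Glue

variable {a b : ℕ} {A B C : Finset ℕ}

lemma renames (h : Glue a b A B C) (hB : B.card = 2) : Renames a (other B b) A C := by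
  have h1 := other_mem hB h.mem_right
  have h2 := other_ne hB h.mem_right
  refine ⟨h.mem_left, fun h3 => ?_, ?_⟩
  · rw [Finset.mem_erase] at h3
    exact h2 (h.disj h3.2 h3.1 h1)
  · ext z
    rw [h.mem_iff]
    simp only [Finset.mem_insert, Finset.mem_erase]
    constructor
    · rintro (h3 | h3)
      · exact .inr ⟨h3.2, h3.1⟩
      · exact .inl (eq_other hB h.mem_right h3.1 h3.2)
    · rintro (h3 | h3)
      · exact .inr (h3 ▸ ⟨h1, h2⟩)
      · exact .inl ⟨h3.2, h3.1⟩

/-- The renaming of the glued leg of `A`, if `B` has two elements. -/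
def ren (h : Glue a b A B C) (hB : B.card = 2) : A ≃ C := (h.renames hB).equiv

lemma ren_self (h : Glue a b A B C) (hB : B.card = 2) (z : A) (hz : (z : ℕ) = a) :
    (h.ren hB z : ℕ) = other B b := (h.renames hB).equiv_self z hz

lemma ren_of_ne (h : Glue a b A B C) (hB : B.card = 2) (z : A) (hz : (z : ℕ) ≠ a) :
    (h.ren hB z : ℕ) = z := (h.renames hB).equiv_of_ne z hz

end Glue

/-! ### Components of elements of `Q P` -/

section

variable {P : CyclicOperad.{u}} {A B C : Finset ℕ}

namespace QObj

lemma ext {X Y : QObj P A} (h : X.hi = Y.hi) (h' : X.lo = Y.lo) : X = Y :=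
  Subtype.ext (Prod.ext h h')

lemma hi_eq_zero (h : ¬ 3 ≤ A.card) (X : QObj P A) : X.hi = 0 := X.2.1 h

lemma lo_eq_zero (h : A.card ≠ 2) (X : QObj P A) : X.lo = 0 := X.2.2 h

@[simp] lemma hi_zero : (0 : QObj P A).hi = 0 := rfl
@[simp] lemma lo_zero : (0 : QObj P A).lo = 0 := rfl
@[simp] lemma hi_add (X Y : QObj P A) : (X + Y).hi = X.hi + Y.hi := rfl
@[simp] lemma lo_add (X Y : QObj P A) : (X + Y).lo = X.lo + Y.lo := rfl
@[simp] lemma hi_neg (X : QObj P A) : (-X).hi = -X.hi := rfl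
@[simp] lemma lo_neg (X : QObj P A) : (-X).lo = -X.lo := rfl
@[simp] lemma hi_smul (c : ℚ) (X : QObj P A) : (c • X).hi = c • X.hi := rfl
@[simp] lemma lo_smul (c : ℚ) (X : QObj P A) : (c • X).lo = c • X.lo := rfl

end QObj

lemma mkQ_hi (h : 3 ≤ A.card) (v : PV P A) (q : Polynomial ℚ) : (mkQ P A v q).hi = v := if_pos h

lemma mkQ_lo (h : A.card = 2) (v : PV P A) (q : Polynomial ℚ) : (mkQ P A v q).lo = q := if_pos h

@[simp] lemma mkQ_zero_hi (q : Polynomial ℚ) : (mkQ P A 0 q).hi = 0 := by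
  change (if 3 ≤ A.card then (0 : PV P A) else 0) = 0
  simp

@[simp] lemma mkQ_zero_lo (v : PV P A) : (mkQ P A v 0).lo = 0 := by
  change (if A.card = 2 then (0 : Polynomial ℚ) else 0) = 0
  simp

lemma mkQ_hi_lo (X : QObj P A) : mkQ P A X.hi X.lo = X := by
  refine QObj.ext ?_ ?_
  · by_cases h : 3 ≤ A.card
    · rw [mkQ_hi h]
    · rw [X.hi_eq_zero h, mkQ_zero_hi]
  · by_cases h : A.card = 2
    · rw [mkQ_lo h]
    · rw [X.lo_eq_zero h, mkQ_zero_lo]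

lemma mkQ_add (v w : PV P A) (p q : Polynomial ℚ) :
    mkQ P A (v + w) (p + q) = mkQ P A v p + mkQ P A w q := by
  refine QObj.ext ?_ ?_
  · by_cases h : 3 ≤ A.card
    · simp only [QObj.hi_add, mkQ_hi h]
    · simp only [QObj.hi_eq_zero h]
  · by_cases h : A.card = 2
    · simp only [QObj.lo_add, mkQ_lo h]
    · simp only [QObj.lo_eq_zero h]

lemma mkQ_smul (c : ℚ) (v : PV P A) (p : Polynomial ℚ) :
    mkQ P A (c • v) (c • p) = c • mkQ P A v p := by
  refine QObj.ext ?_ ?_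
  · by_cases h : 3 ≤ A.card
    · simp only [QObj.hi_smul, mkQ_hi h]
    · simp only [QObj.hi_eq_zero h]
  · by_cases h : A.card = 2
    · simp only [QObj.lo_smul, mkQ_lo h]
    · simp only [QObj.lo_eq_zero h]

/-- Equality of elements of arity at least three. -/
lemma QObj.ext_hi (h : 3 ≤ A.card) {X Y : QObj P A} (hXY : X.hi = Y.hi) : X = Y :=
  QObj.ext hXY (by rw [X.lo_eq_zero (by omega), Y.lo_eq_zero (by omega)])

/-- Equality of elements of arity two. -/
lemma QObj.ext_lo (h : A.card = 2) {X Y : QObj P A} (hXY : X.lo = Y.lo) : X = Y :=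
  QObj.ext (by rw [X.hi_eq_zero (by omega), Y.hi_eq_zero (by omega)]) hXY

lemma QObj.ext_readAt (h : A.card = 2) (a : ℕ) {X Y : QObj P A}
    (hXY : readAt A a X.lo = readAt A a Y.lo) : X = Y :=
  QObj.ext_lo h (readAt_injective hXY)

/-! ### The action of the bijections -/

variable (P) in
/-- The action of the bijections on `Q P`. -/
def qmap (e : A ≃ B) : QObj P A →ₗ[ℚ] QObj P B := (Q P).map e

lemma card_eq_of_equiv (e : A ≃ B) : B.card = A.card := by
  have := Fintype.card_congr e; simp at this; omega

@[simp] lemma qmap_hi (e : A ≃ B) (X : QObj P A) : (qmap P e X).hi = mV P e X.hi := by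
  by_cases h : 3 ≤ B.card
  · exact mkQ_hi h _ _
  · rw [QObj.hi_eq_zero h, QObj.hi_eq_zero (card_eq_of_equiv e ▸ h), map_zero]

lemma readAt_qmap_lo (hA : A.card = 2) (e : A ≃ B) (z : A) (X : QObj P A) :
    readAt B (e z) (qmap P e X).lo = readAt A z X.lo := by
  rw [← readAt_equiv hA e z]
  congr 1
  exact mkQ_lo ((card_eq_of_equiv e).trans hA) _ _

lemma readAt_qmap_lo' (hA : A.card = 2) (e : A ≃ B) {z w : ℕ} (hz : z ∈ A)
    (hw : ∀ y : A, (y : ℕ) = z → (e y : ℕ) = w) (X : QObj P A) :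
    readAt B w (qmap P e X).lo = readAt A z X.lo := by
  rw [← hw ⟨z, hz⟩ rfl]
  exact readAt_qmap_lo hA e ⟨z, hz⟩ X

lemma qmap_refl (X : QObj P A) : qmap P (Equiv.refl A) X = X := by
  by_cases h : A.card = 2
  · obtain ⟨a, ha⟩ := Finset.card_pos.1 (show 0 < A.card by omega)
    exact QObj.ext_readAt h a (readAt_qmap_lo' h _ ha (by simp) X)
  · exact QObj.ext (by rw [qmap_hi, mV_refl]) (by rw [QObj.lo_eq_zero h, QObj.lo_eq_zero h])

lemma qmap_trans (e : A ≃ B) (f : B ≃ C) (X : QObj P A) :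
    qmap P (e.trans f) X = qmap P f (qmap P e X) := by
  by_cases h : A.card = 2
  · obtain ⟨a, ha⟩ := Finset.card_pos.1 (show 0 < A.card by omega)
    have hB := card_eq_of_equiv e
    have hC := card_eq_of_equiv f
    refine QObj.ext_readAt (by omega) (f (e ⟨a, ha⟩)) ?_
    rw [readAt_qmap_lo (by omega), readAt_qmap_lo h e ⟨a, ha⟩]
    exact readAt_qmap_lo h (e.trans f) ⟨a, ha⟩ X
  · have hB := card_eq_of_equiv e
    have hC := card_eq_of_equiv f
    exact QObj.ext (by rw [qmap_hi, qmap_hi, qmap_hi, mV_trans])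
      (by rw [QObj.lo_eq_zero (by omega), QObj.lo_eq_zero (by omega)])

/-! ### Components of the operations -/

variable {Δ : ∀ B, P.obj B} {D : Finset ℕ} {a b c j k : ℕ}

lemma dQ_hi (X : QObj P A) :
    (dQ P Δ A X).hi = dV P A X.hi + ∑ j ∈ A, cV P Δ j A (pV P j A X.hi) := by
  by_cases h : 3 ≤ A.card
  · rw [dQ, mkQ_hi h]
    congr 1
    refine Finset.sum_congr rfl fun j _ => ?_
    induction X.hi using PV.induction with
    | tmul x p => rfl
    | add X Y hX hY => simp only [map_add, hX, hY]
  · rw [QObj.hi_eq_zero h, QObj.hi_eq_zero h]; simp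

@[simp] lemma dQ_lo (X : QObj P A) : (dQ P Δ A X).lo = 0 := mkQ_zero_lo _

lemma dQ_of_card (h : A.card = 2) (X : QObj P A) : dQ P Δ A X = 0 :=
  QObj.ext_lo h (by simp)

lemma sgQ_hi (X : QObj P A) : (sgQ P A X).hi = sgV P A X.hi := by
  by_cases h : 3 ≤ A.card
  · rw [sgQ, mkQ_hi h]
  · rw [QObj.hi_eq_zero h, QObj.hi_eq_zero h, map_zero]

lemma sgQ_lo (X : QObj P A) : (sgQ P A X).lo = - X.lo := by
  by_cases h : A.card = 2
  · rw [sgQ, mkQ_lo h]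
  · rw [QObj.lo_eq_zero h, QObj.lo_eq_zero h, neg_zero]

lemma mu3_hi {B : Finset ℕ} (h : Glue a c A C D) (X : QObj P A) (Y : QObj P B) (Z : QObj P C) :
    (mu3 P a b c A B C D X Y Z).hi = tern P a c A C D (readAt B b Y.lo) (sgV P A X.hi) Z.hi := by
  by_cases hD : 3 ≤ D.card
  · rw [mu3, mkQ_hi hD, map₂_kernel3]
  · have := h.card
    have := h.two_le_right
    rw [QObj.hi_eq_zero hD, X.hi_eq_zero (by omega)]
    simp

@[simp] lemma mu3_lo (X : QObj P A) (Y : QObj P B) (Z : QObj P C) :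
    (mu3 P a b c A B C D X Y Z).lo = 0 := mkQ_zero_lo _

lemma mkQ_zero_zero : mkQ P A 0 0 = 0 := QObj.ext (by simp) (by simp)

lemma mu3_of_hi_left {X : QObj P A} (hX : X.hi = 0) (Y : QObj P B) (Z : QObj P C) :
    mu3 P a b c A B C D X Y Z = 0 := by
  rw [mu3, hX, map_zero, LinearMap.zero_apply, mkQ_zero_zero]

lemma mu3_of_lo (X : QObj P A) {Y : QObj P B} (hY : Y.lo = 0) (Z : QObj P C) :
    mu3 P a b c A B C D X Y Z = 0 := by
  rw [mu3, map₂_kernel3, hY, map_zero, tern, altSum_zero, LinearMap.zero_apply,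
    LinearMap.zero_apply, mkQ_zero_zero]

lemma mu3_of_hi_right (X : QObj P A) (Y : QObj P B) {Z : QObj P C} (hZ : Z.hi = 0) :
    mu3 P a b c A B C D X Y Z = 0 := by
  rw [mu3, hZ, map_zero, mkQ_zero_zero]

lemma mu2_hi_hh (h : Glue a b A B C) (hA : 3 ≤ A.card) (hB : 3 ≤ B.card) (X : QObj P A)
    (Y : QObj P B) :
    (mu2 P Δ a b A B C X Y).hi = cmp P a b A B C (cV P Δ a A X.hi) Y.hi := by
  have := h.card
  rw [mu2, mkQ_hi (by omega), X.lo_eq_zero (by omega), Y.lo_eq_zero (by omega)]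
  simp only [map_zero, opd, LinearMap.comp_zero, TensorProduct.map_zero_right,
    LinearMap.zero_apply, add_zero]
  induction X.hi using PV.induction with
  | tmul x p =>
    induction Y.hi using PV.induction with
    | tmul y q => rfl
    | add X Y hX hY => simp only [map_add, hX, hY]
  | add X Y hX hY => simp only [map_add, LinearMap.add_apply, hX, hY]

lemma mu2_lo_of_card (hC : C.card ≠ 2) (X : QObj P A) (Y : QObj P B) :
    (mu2 P Δ a b A B C X Y).lo = 0 := QObj.lo_eq_zero hC _

lemma map_ren_subst (h : Glue a b A B C) (hB : B.card = 2) (q : Polynomial ℚ) (X : PV P A) :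
    TensorProduct.map (ren P a b A B C) (subst a (other B b) A C ∘ₗ opd a A q) X =
      mV P (h.ren hB) (opV P a A q X) := by
  induction X using PV.induction with
  | add X Y hX hY => simp only [map_add, hX, hY]
  | tmul x p =>
    obtain ⟨c, hcb, hBc, hc⟩ := exists_eq_pair hB h.mem_right
    rw [opV_tmul, mV_tmul, TensorProduct.map_tmul, LinearMap.comp_apply,
      subst_eq_rename (h.renames hB), ren_eq h.two_le_left h (hc ▸ hBc) (hc ▸ hcb.symm)
      (h.renames hB)]
    rfl

lemma mu2_hi_hl (h : Glue a b A B C) (hA : 3 ≤ A.card) (hB : B.card = 2) (X : QObj P A)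
    (Y : QObj P B) :
    (mu2 P Δ a b A B C X Y).hi =
      mV P (h.ren hB) (opV P a A (readAt B b Y.lo) (sgV P A X.hi)) := by
  have := h.card
  rw [mu2, mkQ_hi (by omega), Y.hi_eq_zero (by omega), map_zero, map_zero, zero_add, add_zero,
    ← map_ren_subst]
  induction X.hi using PV.induction with
  | tmul x p => rfl
  | add X Y hX hY => simp only [map_add, hX, hY]

lemma mu2_hi_lh (h : Glue a b A B C) (hA : A.card = 2) (hB : 3 ≤ B.card) (X : QObj P A)
    (Y : QObj P B) :
    (mu2 P Δ a b A B C X Y).hi =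
      mV P (h.swap.ren hA) (opV P b B (readAt A a X.lo) Y.hi) := by
  have := h.card
  rw [mu2, mkQ_hi (by omega), X.hi_eq_zero (by omega), map_zero, map_zero, LinearMap.zero_apply,
    zero_add, zero_add, map_ren_subst h.swap hA, readAt_other hA h.mem_left, tau_tau]

lemma mu2_lo_ll (h : Glue a b A B C) (hA : A.card = 2) (hB : B.card = 2) (X : QObj P A)
    (Y : QObj P B) :
    readAt C (other A a) (mu2 P Δ a b A B C X Y).lo =
      tau (readAt A a X.lo) * readAt B b Y.lo * -1 := by
  have := h.card
  rw [mu2, mkQ_lo (by omega), readAt_readAt, readAt_other hA h.mem_left]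
  ring

/-! ### Equivariance of the operations -/

lemma dQ_qmap (hΔ : IsCircle P Δ) (e : A ≃ B) (X : QObj P A) :
    qmap P e (dQ P Δ A X) = dQ P Δ B (qmap P e X) := by
  have hc := card_eq_of_equiv e
  by_cases h : 3 ≤ A.card
  · refine QObj.ext_hi (by omega) ?_
    rw [qmap_hi, dQ_hi, dQ_hi, map_add, map_sum, qmap_hi, mV_dV]
    congr 1
    rw [← Finset.sum_coe_sort A, ← Finset.sum_coe_sort B]
    refine Fintype.sum_equiv e _ _ fun z => ?_
    rw [mV_cV hΔ (by omega), mV_pV]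
  · have h0 : dQ P Δ A X = 0 := QObj.ext (QObj.hi_eq_zero h _) (by simp)
    have h1 : dQ P Δ B (qmap P e X) = 0 := QObj.ext (QObj.hi_eq_zero (by omega) _) (by simp)
    rw [h0, h1, map_zero]

lemma sgQ_qmap (e : A ≃ B) (X : QObj P A) : qmap P e (sgQ P A X) = sgQ P B (qmap P e X) := by
  by_cases h : A.card = 2
  · have hc := card_eq_of_equiv e
    obtain ⟨a, ha⟩ := Finset.card_pos.1 (show 0 < A.card by omega)
    refine QObj.ext_readAt (by omega) (e ⟨a, ha⟩) ?_
    rw [readAt_qmap_lo h, sgQ_lo, sgQ_lo, map_neg, map_neg, readAt_qmap_lo h]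
  · have hc := card_eq_of_equiv e
    refine QObj.ext ?_ (by rw [QObj.lo_eq_zero (by omega), QObj.lo_eq_zero (by omega)])
    rw [qmap_hi, sgQ_hi, sgQ_hi, qmap_hi, mV_sgV]

lemma mV_congr {e f : A ≃ B} (h : ∀ z, (e z : ℕ) = f z) (X : PV P A) : mV P e X = mV P f X := by
  rw [show e = f from Equiv.ext fun z => Subtype.ext (h z)]

lemma qmap_congr {e f : A ≃ B} (h : ∀ z, (e z : ℕ) = f z) (X : QObj P A) :
    qmap P e X = qmap P f X := by
  rw [show e = f from Equiv.ext fun z => Subtype.ext (h z)]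

section

variable {a' b' : ℕ} {A' B' C' : Finset ℕ} {e : A ≃ A'} {f : B ≃ B'} {g : C ≃ C'}

lemma GlueMap.other_snd (h : GlueMap a b a' b' e f g) (hB : B.card = 2) (z : B)
    (hz : (z : ℕ) = other B b) : (f z : ℕ) = other B' b' := by
  refine eq_other ((card_eq_of_equiv f).trans hB) h.right.mem_right (f z).2 fun h' => ?_
  exact other_ne hB h.left.mem_right (hz ▸ (h.swap.fst_iff z).2 h')

lemma GlueMap.ren (h : GlueMap a b a' b' e f g) (hB : B.card = 2) (hB' : B'.card = 2) (z : A) :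
    ((h.left.ren hB).trans g z : ℕ) = e.trans (h.right.ren hB') z := by
  have h1 := other_mem hB h.left.mem_right
  have h2 := other_ne hB h.left.mem_right
  by_cases hz : (z : ℕ) = a
  · rw [Equiv.trans_apply, Equiv.trans_apply, h.right.ren_self hB' _ (h.fst z hz),
      h.map_snd ⟨_, h1⟩ _ h2 (h.left.ren_self hB z hz).symm]
    exact h.other_snd hB _ rfl
  · have h4 : (e z : ℕ) ≠ a' := fun h' => hz ((h.fst_iff z).2 h')
    rw [Equiv.trans_apply, Equiv.trans_apply, h.right.ren_of_ne hB' _ h4,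
      h.map_fst z _ hz (h.left.ren_of_ne hB z hz).symm]

lemma mV_opV' (f : A ≃ B) {z w : ℕ} (hz : z ∈ A) (hw : ∀ y : A, (y : ℕ) = z → (f y : ℕ) = w)
    (q : Polynomial ℚ) (X : PV P A) :
    mV P f (opV P z A q X) = opV P w B q (mV P f X) := by
  rw [← hw ⟨z, hz⟩ rfl]; exact mV_opV f ⟨z, hz⟩ q X

lemma mV_cV' (hΔ : IsCircle P Δ) (hA : 2 ≤ A.card) (f : A ≃ B) {z w : ℕ} (hz : z ∈ A)
    (hw : ∀ y : A, (y : ℕ) = z → (f y : ℕ) = w) (X : PV P A) :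
    mV P f (cV P Δ z A X) = cV P Δ w B (mV P f X) := by
  rw [← hw ⟨z, hz⟩ rfl]; exact mV_cV hΔ hA f ⟨z, hz⟩ X

lemma mV_pV' (f : A ≃ B) {z w : ℕ} (hz : z ∈ A) (hw : ∀ y : A, (y : ℕ) = z → (f y : ℕ) = w)
    (X : PV P A) :
    mV P f (pV P z A X) = pV P w B (mV P f X) := by
  rw [← hw ⟨z, hz⟩ rfl]; exact mV_pV f ⟨z, hz⟩ X

lemma mu2_qmap (hΔ : IsCircle P Δ) (h : GlueMap a b a' b' e f g) (X : QObj P A) (Y : QObj P B) :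
    qmap P g (mu2 P Δ a b A B C X Y) = mu2 P Δ a' b' A' B' C' (qmap P e X) (qmap P f Y) := by
  have hA := card_eq_of_equiv e
  have hB := card_eq_of_equiv f
  have hC := card_eq_of_equiv g
  have h1 := h.left.card
  have h2 := h.left.two_le_left
  have h3 := h.left.two_le_right
  rcases eq_or_lt_of_le h2 with hA2 | hA3 <;> rcases eq_or_lt_of_le h3 with hB2 | hB3
  · have hC2 : C.card = 2 := by omega
    refine QObj.ext_readAt (by omega) (other A' a') ?_
    have h4 := other_mem hA2.symm h.left.mem_left
    rw [mu2_lo_ll h.right (by omega) (by omega),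
      readAt_qmap_lo' hA2.symm e h.left.mem_left h.fst,
      readAt_qmap_lo' hB2.symm f h.left.mem_right h.snd,
      readAt_qmap_lo' hC2 g (z := other A a) (h.left.mem_iff.2
        (.inl ⟨h4, other_ne hA2.symm h.left.mem_left⟩))
        (fun y hy => by
          rw [h.map_fst ⟨_, h4⟩ y (other_ne hA2.symm h.left.mem_left) hy.symm]
          exact h.swap.other_snd hA2.symm _ rfl), mu2_lo_ll h.left hA2.symm hB2.symm]
  · refine QObj.ext_hi (by omega) ?_
    rw [qmap_hi, mu2_hi_lh h.left hA2.symm hB3, mu2_hi_lh h.right (by omega) (by omega),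
      qmap_hi, readAt_qmap_lo' hA2.symm e h.left.mem_left h.fst,
      ← mV_opV' f h.left.mem_right h.snd, ← mV_trans, ← mV_trans]
    exact mV_congr (h.swap.ren hA2.symm (by omega)) _
  · refine QObj.ext_hi (by omega) ?_
    rw [qmap_hi, mu2_hi_hl h.left hA3 hB2.symm, mu2_hi_hl h.right (by omega) (by omega),
      qmap_hi, readAt_qmap_lo' hB2.symm f h.left.mem_right h.snd, ← mV_sgV,
      ← mV_opV' e h.left.mem_left h.fst, ← mV_trans, ← mV_trans]
    exact mV_congr (h.ren hB2.symm (by omega)) _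
  · refine QObj.ext_hi (by omega) ?_
    rw [qmap_hi, mu2_hi_hh h.left hA3 hB3, mu2_hi_hh h.right (by omega) (by omega), cmp_mV h,
      mV_cV' hΔ h2 e h.left.mem_left h.fst, qmap_hi, qmap_hi]

lemma tern_mV (h : GlueMap a b a' b' e f g) (q : Polynomial ℚ) (X : PV P A) (Y : PV P B) :
    mV P g (tern P a b A B C q X Y) = tern P a' b' A' B' C' q (mV P e X) (mV P f Y) :=
  altSum_intertwine _ _ _ (mV_pV' e h.left.mem_left h.fst) (mV_pV' f h.left.mem_right h.snd)
    (cmp_mV h) q X Y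

lemma mu3_qmap {D D' : Finset ℕ} {d d' : ℕ} {i : D ≃ D'} (h : GlueMap a b a' b' e f g)
    (hD : D.card = 2) (hd : d ∈ D) (hi : ∀ z : D, (z : ℕ) = d → (i z : ℕ) = d')
    (X : QObj P A) (Y : QObj P D) (Z : QObj P B) :
    qmap P g (mu3 P a d b A D B C X Y Z) =
      mu3 P a' d' b' A' D' B' C' (qmap P e X) (qmap P i Y) (qmap P f Z) := by
  refine QObj.ext ?_ ?_
  · rw [qmap_hi, mu3_hi h.left, mu3_hi h.right, tern_mV h, readAt_qmap_lo' hD i hd hi, qmap_hi,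
      qmap_hi, mV_sgV]
  · by_cases hC : C.card = 2
    · obtain ⟨z, hz⟩ := Finset.card_pos.1 (show 0 < C.card by omega)
      apply readAt_injective (A := C') (a := g ⟨z, hz⟩)
      rw [readAt_qmap_lo hC]
      simp
    · rw [mu3_lo, QObj.lo_eq_zero (by rwa [card_eq_of_equiv g])]

end

end

/-! ### The grading of `Q P` -/

section

variable {A B C D : Finset ℕ} {a b c : ℕ}

lemma mem_grU_monomial (n : ℕ) (t : ℚ) : Polynomial.monomial n t ∈ grU (2 * n - 1) := by
  rw [← Polynomial.C_mul_X_pow_eq_monomial, ← Polynomial.smul_eq_C_mul]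
  exact Submodule.smul_mem _ _ (Submodule.subset_span ⟨n, rfl, rfl⟩)

lemma exists_of_mem_grU {k : ℤ} {q : Polynomial ℚ} (hq : q ∈ grU k) :
    q = 0 ∨ ∃ (n : ℕ) (t : ℚ), k = 2 * n - 1 ∧ q = Polynomial.monomial n t := by
  refine Submodule.span_induction
    (p := fun q _ => q = 0 ∨ ∃ (n : ℕ) (t : ℚ), k = 2 * n - 1 ∧ q = Polynomial.monomial n t)
    ?_ (.inl rfl) ?_ ?_ hq
  · rintro _ ⟨n, hk, rfl⟩
    exact .inr ⟨n, 1, hk, (Polynomial.monomial_one_right_eq_X_pow n).symm⟩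
  · rintro _ _ - - (rfl | ⟨n, t, hk, rfl⟩) (rfl | ⟨m, s, hk', rfl⟩)
    · simp
    · exact .inr ⟨m, s, hk', by simp⟩
    · exact .inr ⟨n, t, hk, by simp⟩
    · obtain rfl : n = m := by omega
      exact .inr ⟨n, t + s, hk, by simp⟩
  · rintro s _ - (rfl | ⟨n, t, hk, rfl⟩)
    · simp
    · exact .inr ⟨n, s * t, hk, by simp [Polynomial.smul_monomial]⟩

lemma tau_mem {k : ℤ} {q : Polynomial ℚ} (hq : q ∈ grU k) : tau q ∈ grU k := by
  rcases exists_of_mem_grU hq with rfl | ⟨n, t, rfl, rfl⟩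
  · simp
  · rw [tau_monomial]
    exact neg_mem (Submodule.smul_mem _ _ (mem_grU_monomial n t))

lemma readAt_mem {k : ℤ} {q : Polynomial ℚ} (hq : q ∈ grU k) : readAt A a q ∈ grU k := by
  rw [readAt]
  split_ifs
  · exact hq
  · exact tau_mem hq

lemma mul_mem_grU {k l : ℤ} {p q : Polynomial ℚ} (hp : p ∈ grU k) (hq : q ∈ grU l) :
    p * q ∈ grU (k + l + 1) := by
  rcases exists_of_mem_grU hp with rfl | ⟨n, t, rfl, rfl⟩
  · simp
  rcases exists_of_mem_grU hq with rfl | ⟨m, s, rfl, rfl⟩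
  · simp
  rw [Polynomial.monomial_mul_monomial]
  convert mem_grU_monomial (n + m) (t * s) using 2
  push_cast; ring

variable {P : CyclicOperad.{u}} {Δ : ∀ B, P.obj B}

lemma mem_gr_iff {k : ℤ} {X : QObj P A} : X ∈ (Q P).gr A k ↔ X.hi ∈ grV P A k ∧ X.lo ∈ grU k :=
  Iff.rfl

lemma hi_mem {k : ℤ} {X : QObj P A} (hX : X ∈ (Q P).gr A k) : X.hi ∈ grV P A k := hX.1

lemma lo_mem {k : ℤ} {X : QObj P A} (hX : X ∈ (Q P).gr A k) : X.lo ∈ grU k := hX.2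

lemma mkQ_hi_mem {k : ℤ} {v : PV P A} (hv : v ∈ grV P A k) : mkQ P A v 0 ∈ (Q P).gr A k := by
  rw [mem_gr_iff, mkQ_zero_lo]
  refine ⟨?_, zero_mem _⟩
  by_cases h : 3 ≤ A.card
  · rwa [mkQ_hi h]
  · rw [QObj.hi_eq_zero h]; exact zero_mem _

lemma mkQ_lo_mem {k : ℤ} {q : Polynomial ℚ} (hq : q ∈ grU k) : mkQ P A 0 q ∈ (Q P).gr A k := by
  rw [mem_gr_iff, mkQ_zero_hi]
  refine ⟨zero_mem _, ?_⟩
  by_cases h : A.card = 2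
  · rwa [mkQ_lo h]
  · rw [QObj.lo_eq_zero h]; exact zero_mem _

/-- The Euler operator. -/
def euler (A : Finset ℕ) : Module.End ℚ (Poly A) :=
  ∑ i : A, LinearMap.mulLeft ℚ (MvPolynomial.X i) ∘ₗ (MvPolynomial.pderiv (R := ℚ) i).toLinearMap

lemma euler_of_isHomogeneous {p : Poly A} {n : ℕ} (hp : p.IsHomogeneous n) :
    euler A p = (n : ℚ) • p := by
  rw [euler, LinearMap.sum_apply, Nat.cast_smul_eq_nsmul]
  exact hp.sum_X_mul_pderiv

variable (P) in
/-- The operator `X ↦ k X`, for `X` of degree `k`. -/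
def weightV (A : Finset ℕ) : Module.End ℚ (PV P A) :=
  TensorProduct.map (P.lawful.weight A) LinearMap.id -
    (6 - 2 * (A.card : ℚ)) • LinearMap.id - (2 : ℚ) • TensorProduct.map LinearMap.id (euler A)

lemma weightV_of_mem {k : ℤ} {X : PV P A} (hX : X ∈ grV P A k) :
    weightV P A X = (k : ℚ) • X := by
  refine grV_induction hX (fun i n x f hx hf hk => ?_) (by simp)
    (fun X Y hX hY => by rw [map_add, hX, hY, smul_add])
    (fun t X hX => by rw [map_smul, hX, smul_comm])
  simp only [weightV, LinearMap.sub_apply, LinearMap.smul_apply, TensorProduct.map_tmul,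
    LinearMap.id_apply, P.lawful.weight_of_mem hx, euler_of_isHomogeneous hf, hk,
    ← TensorProduct.smul_tmul', TensorProduct.tmul_smul]
  push_cast
  module

/-- The operator `q ↦ k q`, for `q` of degree `k`. -/
def weightU : Module.End ℚ (Polynomial ℚ) :=
  (2 : ℚ) • (LinearMap.mulLeft ℚ Polynomial.X ∘ₗ Polynomial.derivative) - LinearMap.id

lemma weightU_of_mem {k : ℤ} {q : Polynomial ℚ} (hq : q ∈ grU k) : weightU q = (k : ℚ) • q := by
  rcases exists_of_mem_grU hq with rfl | ⟨n, t, rfl, rfl⟩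
  · simp
  · have h : Polynomial.X * Polynomial.derivative (Polynomial.monomial n t) =
        (n : ℚ) • Polynomial.monomial n t := by
      obtain _ | n := n
      · simp
      · rw [Polynomial.derivative_monomial, Nat.add_sub_cancel, Polynomial.X_mul_monomial,
          Polynomial.smul_monomial, smul_eq_mul, mul_comm]
    simp only [weightU, LinearMap.sub_apply, LinearMap.smul_apply, LinearMap.comp_apply,
      LinearMap.mulLeft_apply, LinearMap.id_apply, h]
    push_cast
    module

variable (P) in
/-- The operator `X ↦ k X`, for `X` of degree `k`. -/
def weightQ (A : Finset ℕ) : Module.End ℚ (QObj P A) where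
  toFun X := mkQ P A (weightV P A X.hi) (weightU X.lo)
  map_add' X Y := by simp [mkQ_add]
  map_smul' c X := by simp [mkQ_smul]

lemma weightQ_of_mem {k : ℤ} {X : QObj P A} (hX : X ∈ (Q P).gr A k) :
    weightQ P A X = (k : ℚ) • X := by
  change mkQ P A (weightV P A X.hi) (weightU X.lo) = _
  rw [weightV_of_mem (hi_mem hX), weightU_of_mem (lo_mem hX), mkQ_smul, mkQ_hi_lo]

lemma iSup_gr (A : Finset ℕ) : ⨆ k, (Q P).gr A k = ⊤ := by
  have key : ∀ (k : ℤ) (X : QObj P A), X ∈ (Q P).gr A k →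
      X ∈ ⨆ k, (Q P).gr A k :=
    fun k X hX => Submodule.mem_iSup_of_mem (p := (Q P).gr A) k hX
  rw [eq_top_iff]
  intro X _
  change QObj P A at X
  have hX : X = mkQ P A X.hi 0 + mkQ P A 0 X.lo := by
    rw [← mkQ_add, add_zero, zero_add, mkQ_hi_lo]
  rw [hX]
  refine add_mem ?_ ?_
  · induction X.hi using PV.induction with
    | add v w hv hw =>
      rw [← add_zero (0 : Polynomial ℚ), mkQ_add]
      exact add_mem hv hw
    | tmul x p =>
    induction x using P.lawful.induction with
    | add x y hx hy =>
      rw [TensorProduct.add_tmul, ← add_zero (0 : Polynomial ℚ), mkQ_add]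
      exact add_mem hx hy
    | mem i x hx =>
      rw [← MvPolynomial.sum_homogeneousComponent p]
      induction Finset.range (p.totalDegree + 1) using Finset.induction_on with
      | empty =>
        rw [Finset.sum_empty, TensorProduct.tmul_zero, mkQ_zero_zero]
        exact zero_mem _
      | insert n s hn ih =>
        rw [Finset.sum_insert hn, TensorProduct.tmul_add, ← add_zero (0 : Polynomial ℚ), mkQ_add]
        exact add_mem (key _ _ (mkQ_hi_mem (tmul_mem_grV hx
          (MvPolynomial.homogeneousComponent_isHomogeneous n p) rfl))) ih
  · induction X.lo using Polynomial.induction_on' with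
    | add p q hp hq =>
      rw [← add_zero (0 : PV P A), mkQ_add]
      exact add_mem hp hq
    | monomial n t => exact key _ _ (mkQ_lo_mem (mem_grU_monomial n t))

lemma qmap_lo_mem (e : A ≃ B) {k : ℤ} {X : QObj P A} (hX : X.lo ∈ grU k) :
    (qmap P e X).lo ∈ grU k := by
  by_cases h : A.card = 2
  · obtain ⟨a, ha⟩ := Finset.card_pos.1 (show 0 < A.card by omega)
    have := readAt_qmap_lo h e ⟨a, ha⟩ X
    rw [← readAt_readAt (A := B) (a := e ⟨a, ha⟩) (qmap P e X).lo, this]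
    exact readAt_mem (readAt_mem hX)
  · rw [QObj.lo_eq_zero (by rwa [card_eq_of_equiv e])]; exact zero_mem _

lemma Q_isLawful : (Q P).IsLawful where
  isInternal A := by
    refine DirectSum.isInternal_submodule_of_iSupIndep_of_iSup_eq_top ?_ (iSup_gr A)
    have h := (Module.End.eigenspaces_iSupIndep (weightQ P A)).comp
      (Int.cast_injective (α := ℚ))
    exact h.mono fun k X hX => Module.End.mem_eigenspace_iff.2 (weightQ_of_mem hX)
  map_refl A X := qmap_refl X
  map_trans e f X := qmap_trans e f X
  map_gr e k X hX := mem_gr_iff.2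
    ⟨(qmap_hi e X).symm ▸ mV_mem e (hi_mem hX), qmap_lo_mem e (lo_mem hX)⟩

/-! ### Degrees of the operations -/

lemma odd_or_lo_eq_zero {k : ℤ} {X : QObj P A} (hX : X ∈ (Q P).gr A k) : Odd k ∨ X.lo = 0 := by
  rcases exists_of_mem_grU (lo_mem hX) with h | ⟨n, t, hk, -⟩
  · exact .inr h
  · exact .inl ⟨n - 1, by rw [hk]; ring⟩

lemma opV_mem {k l : ℤ} {X : PV P A} {q : Polynomial ℚ} (hX : X ∈ grV P A k) (hq : q ∈ grU l) :
    opV P a A q X ∈ grV P A (k + l + 1) := by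
  rcases exists_of_mem_grU hq with rfl | ⟨n, t, rfl, rfl⟩
  · simp [opV]
  · rw [opV, Polynomial.aeval_monomial, Module.End.mul_apply, Module.algebraMap_end_apply]
    refine Submodule.smul_mem _ _ ?_
    convert pV_pow_mem hX n using 2
    ring

lemma tern_mem (h : Glue a c A C D) {k l m : ℤ} {X : PV P A} {Z : PV P C} {q : Polynomial ℚ}
    (hX : X ∈ grV P A k) (hq : q ∈ grU m) (hZ : Z ∈ grV P C l) :
    tern P a c A C D q X Z ∈ grV P D (k + m + l + 1) := by
  rcases exists_of_mem_grU hq with rfl | ⟨n, t, rfl, rfl⟩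
  · simp [tern]
  · rw [tern, altSum_monomial]
    refine Submodule.smul_mem _ _ (Submodule.sum_mem _ fun j hj => Submodule.smul_mem _ _ ?_)
    have := Finset.mem_range.1 hj
    convert cmp_mem h (pV_pow_mem hX j) (pV_pow_mem hZ (n - 1 - j)) using 2
    rw [Nat.cast_sub (by omega), Nat.cast_sub (by omega)]
    push_cast; ring

lemma dQ_mem (hΔ : IsCircle P Δ) {k : ℤ} {X : QObj P A} (hX : X ∈ (Q P).gr A k) :
    dQ P Δ A X ∈ (Q P).gr A (k + 1) := by
  rw [mem_gr_iff, dQ_lo]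
  refine ⟨?_, zero_mem _⟩
  by_cases h : 3 ≤ A.card
  · rw [dQ_hi]
    refine add_mem (dV_mem (hi_mem hX)) (Submodule.sum_mem _ fun j hj => ?_)
    convert cV_mem hΔ (by omega) hj (pV_mem (j := j) (hi_mem hX)) using 2
    ring
  · rw [QObj.hi_eq_zero h]; exact zero_mem _

lemma sgQ_of_mem {k : ℤ} {X : QObj P A} (hX : X ∈ (Q P).gr A k) :
    sgQ P A X = (-1 : ℚ) ^ k • X := by
  refine QObj.ext ?_ ?_
  · rw [sgQ_hi, sgV_of_mem (hi_mem hX)]; rfl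
  · rw [sgQ_lo, QObj.lo_smul]
    rcases odd_or_lo_eq_zero hX with h | h
    · rw [h.neg_one_zpow]; simp
    · simp [h]

lemma mu3_mem (h : Glue a c A C D) {k l m : ℤ} {X : QObj P A} {Y : QObj P B} {Z : QObj P C}
    (hX : X ∈ (Q P).gr A k) (hY : Y ∈ (Q P).gr B m) (hZ : Z ∈ (Q P).gr C l) :
    mu3 P a b c A B C D X Y Z ∈ (Q P).gr D (k + m + l + 1) := by
  rw [mem_gr_iff, mu3_lo, mu3_hi h]
  exact ⟨tern_mem h (sgV_mem (hi_mem hX)) (readAt_mem (lo_mem hY)) (hi_mem hZ), zero_mem _⟩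

lemma mu2_mem (hΔ : IsCircle P Δ) (h : Glue a b A B C) {k l : ℤ} {X : QObj P A} {Y : QObj P B}
    (hX : X ∈ (Q P).gr A k) (hY : Y ∈ (Q P).gr B l) :
    mu2 P Δ a b A B C X Y ∈ (Q P).gr C (k + l + 1) := by
  have h1 := h.card
  rw [mem_gr_iff]
  rcases eq_or_lt_of_le h.two_le_left with hA | hA <;>
    rcases eq_or_lt_of_le h.two_le_right with hB | hB
  · refine ⟨by rw [QObj.hi_eq_zero (by omega)]; exact zero_mem _, ?_⟩
    rw [← readAt_readAt (A := C) (a := other A a) (mu2 P Δ a b A B C X Y).lo,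
      mu2_lo_ll h hA.symm hB.symm, mul_neg_one]
    exact readAt_mem (neg_mem (mul_mem_grU (tau_mem (readAt_mem (lo_mem hX))) (readAt_mem (lo_mem hY))))
  · rw [mu2_lo_of_card (by omega), mu2_hi_lh h hA.symm hB, add_comm k]
    exact ⟨mV_mem _ (opV_mem (hi_mem hY) (readAt_mem (lo_mem hX))), zero_mem _⟩
  · rw [mu2_lo_of_card (by omega), mu2_hi_hl h hA hB.symm]
    exact ⟨mV_mem _ (opV_mem (sgV_mem (hi_mem hX)) (readAt_mem (lo_mem hY))), zero_mem _⟩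
  · rw [mu2_lo_of_card (by omega), mu2_hi_hh h hA hB]
    refine ⟨?_, zero_mem _⟩
    convert cmp_mem h (cV_mem hΔ h.two_le_left h.mem_left (hi_mem hX)) (hi_mem hY) using 2
    ring

/-! ### Symmetry of the operations -/

lemma mu2_symm (hΔ : IsCircle P Δ) (h : Glue a b A B C) {k l : ℤ} {X : QObj P A} {Y : QObj P B}
    (hX : X ∈ (Q P).gr A k) (hY : Y ∈ (Q P).gr B l) :
    mu2 P Δ a b A B C X Y = (-1 : ℚ) ^ (k * l) • mu2 P Δ b a B A C Y X := by
  have h1 := h.card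
  rcases eq_or_lt_of_le h.two_le_left with hA | hA <;>
    rcases eq_or_lt_of_le h.two_le_right with hB | hB
  · refine QObj.ext_readAt (by omega) (other A a) ?_
    have e1 := other_mem hA.symm h.mem_left
    have e2 := other_ne hA.symm h.mem_left
    have e3 := other_mem hB.symm h.mem_right
    have e4 := other_ne hB.symm h.mem_right
    rw [mu2_lo_ll h hA.symm hB.symm, QObj.lo_smul, map_smul,
      readAt_of_ne (a := other B b) (b := other A a) (by omega) (h.mem_iff.2 (.inr ⟨e3, e4⟩))
        (h.mem_iff.2 (.inl ⟨e1, e2⟩)) (fun h' => e4 (h.disj (h' ▸ e1) (h' ▸ e2) e3)),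
      mu2_lo_ll h.swap hB.symm hA.symm, mul_neg_one, mul_neg_one, map_neg, tau_mul, tau_tau]
    rcases odd_or_lo_eq_zero hX with hk | hk
    · rcases odd_or_lo_eq_zero hY with hl | hl
      · rw [(hk.mul hl).neg_one_zpow]
        simp [mul_comm]
      · simp [hl]
    · simp [hk]
  · refine QObj.ext_hi (by omega) ?_
    rw [mu2_hi_lh h hA.symm hB, QObj.hi_smul, mu2_hi_hl h.swap hB hA.symm, sgV_of_mem (hi_mem hY),
      map_smul, map_smul, smul_smul, ← zpow_add₀ (by norm_num)]
    rcases odd_or_lo_eq_zero hX with ⟨n, hn⟩ | hk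
    · rw [neg_one_zpow_congr (n := 0) ⟨(n + 1) * l, by rw [hn]; ring⟩, zpow_zero, one_smul]
    · simp [hk, opV]
  · refine QObj.ext_hi (by omega) ?_
    rw [mu2_hi_hl h hA hB.symm, QObj.hi_smul, mu2_hi_lh h.swap hB.symm hA, sgV_of_mem (hi_mem hX),
      map_smul, map_smul]
    rcases odd_or_lo_eq_zero hY with ⟨n, hn⟩ | hk
    · rw [neg_one_zpow_congr (n := k * l) ⟨- n * k, by rw [hn]; ring⟩]
    · simp [hk, opV]
  · refine QObj.ext_hi (by omega) ?_
    rw [mu2_hi_hh h hA hB, QObj.hi_smul, mu2_hi_hh h.swap hB hA,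
      cmp_symm h (cV_mem hΔ h.two_le_left h.mem_left (hi_mem hX)) (hi_mem hY), cmp_cV_glue hΔ h.swap,
      sgV_of_mem (hi_mem hY), map_smul, LinearMap.smul_apply, smul_smul, ← zpow_add₀ (by norm_num),
      neg_one_zpow_congr]
    exact ⟨-l, by ring⟩

lemma tern_symm (h : Glue a c A C D) {k l : ℤ} {X : PV P A} {Z : PV P C}
    (hX : X ∈ grV P A k) (hZ : Z ∈ grV P C l) (q : Polynomial ℚ) :
    tern P c a C A D (tau q) Z X = (-1 : ℚ) ^ (k * l) • tern P a c A C D q X Z := by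
  refine altSum_tau (fun m n => ?_) q
  rw [cmp_symm h.swap (pV_pow_mem hZ m) (pV_pow_mem hX n), neg_one_zpow_congr]
  exact ⟨l * n + m * k + 2 * m * n, by ring⟩

lemma mu3_symm (h : Glue a c A C D) (hb : b ∈ B) {b' : ℕ} (hb' : b' ∈ B) (hbb : b' ≠ b)
    {k l m : ℤ} {X : QObj P A} {Y : QObj P B} {Z : QObj P C}
    (hX : X ∈ (Q P).gr A k) (hY : Y ∈ (Q P).gr B m) (hZ : Z ∈ (Q P).gr C l) :
    mu3 P a b c A B C D X Y Z =
      (-1 : ℚ) ^ (k * m + k * l + m * l) • mu3 P c b' a C B A D Z Y X := by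
  by_cases hB : B.card = 2
  swap
  · rw [mu3_of_lo X (Y.lo_eq_zero hB), mu3_of_lo Z (Y.lo_eq_zero hB), smul_zero]
  refine QObj.ext ?_ (by simp)
  rw [QObj.hi_smul, mu3_hi h, mu3_hi h.swap, readAt_of_ne hB hb hb' hbb, sgV_of_mem (hi_mem hX),
    sgV_of_mem (hi_mem hZ), map_smul, map_smul, LinearMap.smul_apply, LinearMap.smul_apply,
    tern_symm h (hi_mem hX) (hi_mem hZ), smul_smul, smul_smul, ← zpow_add₀ (by norm_num),
    ← zpow_add₀ (by norm_num)]
  rcases odd_or_lo_eq_zero hY with ⟨n, hn⟩ | hk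
  · rw [neg_one_zpow_congr]
    exact ⟨- k * n - k * l - n * l - l, by rw [hn]; ring⟩
  · simp [hk, tern]

end

section

variable {P : CyclicOperad.{u}} {Δ : ∀ B, P.obj B} {A B C D E : Finset ℕ} {a b c d e j : ℕ}

/-! ### Linearity of the operations -/

@[simp] lemma mu2_zero_left (Y : QObj P B) : mu2 P Δ a b A B C 0 Y = 0 := by
  simp [mu2, mkQ_zero_zero, opd]

@[simp] lemma mu2_zero_right (X : QObj P A) : mu2 P Δ a b A B C X 0 = 0 := by
  simp [mu2, mkQ_zero_zero, opd]

@[simp] lemma dQ_zero : dQ P Δ A 0 = 0 := by simp [dQ, mkQ_zero_zero]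

/-! ### The action of polynomials on the legs -/

variable (P) in
/-- The action of `q ∈ ℚ[u]` on the leg `a`. -/
def legQ (a : ℕ) (A : Finset ℕ) (q : Polynomial ℚ) (X : QObj P A) : QObj P A :=
  mkQ P A (opV P a A q X.hi) 0

@[simp] lemma legQ_hi (q : Polynomial ℚ) (X : QObj P A) :
    (legQ P a A q X).hi = opV P a A q X.hi := by
  by_cases h : 3 ≤ A.card
  · rw [legQ, mkQ_hi h]
  · rw [QObj.hi_eq_zero h, QObj.hi_eq_zero h, map_zero]

@[simp] lemma legQ_lo (q : Polynomial ℚ) (X : QObj P A) : (legQ P a A q X).lo = 0 := mkQ_zero_lo _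

lemma mu2_hl (h : Glue a b A B C) (hA : 3 ≤ A.card) (hB : B.card = 2) (X : QObj P A)
    (Y : QObj P B) :
    mu2 P Δ a b A B C X Y = qmap P (h.ren hB) (legQ P a A (readAt B b Y.lo) (sgQ P A X)) := by
  have := h.card
  refine QObj.ext_hi (by omega) ?_
  rw [mu2_hi_hl h hA hB, qmap_hi, legQ_hi, sgQ_hi]

lemma mu2_lh (h : Glue a b A B C) (hA : A.card = 2) (hB : 3 ≤ B.card) (X : QObj P A)
    (Y : QObj P B) :
    mu2 P Δ a b A B C X Y = qmap P (h.swap.ren hA) (legQ P b B (readAt A a X.lo) Y) := by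
  have := h.card
  refine QObj.ext_hi (by omega) ?_
  rw [mu2_hi_lh h hA hB, qmap_hi, legQ_hi]

lemma sgQ_sgQ (X : QObj P A) : sgQ P A (sgQ P A X) = X :=
  QObj.ext (by rw [sgQ_hi, sgQ_hi, sgV_sgV]) (by rw [sgQ_lo, sgQ_lo, neg_neg])

lemma sgQ_legQ (q : Polynomial ℚ) (X : QObj P A) :
    sgQ P A (legQ P a A q X) = legQ P a A q (sgQ P A X) :=
  QObj.ext (by rw [sgQ_hi, legQ_hi, legQ_hi, sgQ_hi, opV_sgV]) (by rw [sgQ_lo]; simp)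

lemma dQ_legQ (q : Polynomial ℚ) (X : QObj P A) :
    dQ P Δ A (legQ P a A q X) = legQ P a A q (dQ P Δ A X) := by
  refine QObj.ext ?_ (by simp)
  simp only [dQ_hi, legQ_hi, map_add, map_sum, opV_dV, opV_cV, opV_pV]

lemma dQ_sgQ (hΔ : IsCircle P Δ) (X : QObj P A) : dQ P Δ A (sgQ P A X) = - sgQ P A (dQ P Δ A X) := by
  by_cases hA : 3 ≤ A.card
  · refine QObj.ext_hi hA ?_
    rw [QObj.hi_neg, dQ_hi, sgQ_hi, sgQ_hi, dQ_hi, map_add, dV_sgV, neg_add, map_sum,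
      ← Finset.sum_neg_distrib]
    congr 1
    refine Finset.sum_congr rfl fun j hj => ?_
    rw [pV_sgV, cV_sgV hΔ (by omega) hj]
  · refine QObj.ext ?_ ?_
    · rw [QObj.hi_eq_zero hA, QObj.hi_eq_zero hA]
    · rw [QObj.lo_neg, sgQ_lo]; simp

lemma legQ_mul (p q : Polynomial ℚ) (X : QObj P A) :
    legQ P a A (p * q) X = legQ P a A p (legQ P a A q X) :=
  QObj.ext (by simp [opV_mul]) (by simp)

lemma legQ_neg (q : Polynomial ℚ) (X : QObj P A) :
    legQ P a A (-q) X = - legQ P a A q X :=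
  QObj.ext (by simp [opV]) (by simp)

lemma mu2_legQ_left (h : Glue a b A B C) (hA : 3 ≤ A.card) (he : e ∈ A) (hea : e ≠ a)
    (q : Polynomial ℚ) (X : QObj P A) (Y : QObj P B) :
    mu2 P Δ a b A B C (legQ P e A q X) Y = legQ P e C q (mu2 P Δ a b A B C X Y) := by
  have := h.card
  rcases eq_or_lt_of_le h.two_le_right with hB | hB
  · refine QObj.ext_hi (by omega) ?_
    rw [legQ_hi, mu2_hi_hl h hA hB.symm, mu2_hi_hl h hA hB.symm, legQ_hi, ← opV_sgV, opV_comm]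
    exact mV_opV' _ he (fun y hy => by rw [h.ren_of_ne _ _ (by rwa [hy]), hy]) _ _
  · refine QObj.ext_hi (by omega) ?_
    rw [legQ_hi, mu2_hi_hh h hA hB, mu2_hi_hh h hA hB, legQ_hi, ← opV_cV, cmp_opV_left h he hea]

lemma mu2_legQ_right (h : Glue a b A B C) (hB : 3 ≤ B.card) (he : e ∈ B) (heb : e ≠ b)
    (q : Polynomial ℚ) (X : QObj P A) (Y : QObj P B) :
    mu2 P Δ a b A B C X (legQ P e B q Y) = legQ P e C q (mu2 P Δ a b A B C X Y) := by
  have := h.card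
  rcases eq_or_lt_of_le h.two_le_left with hA | hA
  · refine QObj.ext_hi (by omega) ?_
    rw [legQ_hi, mu2_hi_lh h hA.symm hB, mu2_hi_lh h hA.symm hB, legQ_hi, opV_comm]
    exact mV_opV' _ he (fun y hy => by rw [h.swap.ren_of_ne _ _ (by rwa [hy]), hy]) _ _
  · refine QObj.ext_hi (by omega) ?_
    rw [legQ_hi, mu2_hi_hh h hA hB, mu2_hi_hh h hA hB, legQ_hi, cmp_opV_right h he heb]

lemma sgQ_mu2 (hΔ : IsCircle P Δ) (h : Glue a b A B C) (X : QObj P A) (Y : QObj P B) :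
    sgQ P C (mu2 P Δ a b A B C X Y) = - mu2 P Δ a b A B C (sgQ P A X) (sgQ P B Y) := by
  have h1 := h.card
  rcases eq_or_lt_of_le h.two_le_left with hA | hA <;>
    rcases eq_or_lt_of_le h.two_le_right with hB | hB
  · refine QObj.ext_readAt (by omega) (other A a) ?_
    rw [sgQ_lo, QObj.lo_neg, map_neg, map_neg, mu2_lo_ll h hA.symm hB.symm,
      mu2_lo_ll h hA.symm hB.symm, sgQ_lo, sgQ_lo]
    simp
  · refine QObj.ext_hi (by omega) ?_
    rw [sgQ_hi, QObj.hi_neg, mu2_hi_lh h hA.symm hB, mu2_hi_lh h hA.symm hB, sgQ_lo, sgQ_hi,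
      opV_sgV, mV_sgV]
    simp [opV]
  · refine QObj.ext_hi (by omega) ?_
    rw [sgQ_hi, QObj.hi_neg, mu2_hi_hl h hA hB.symm, mu2_hi_hl h hA hB.symm, sgQ_lo, sgQ_hi,
      opV_sgV, opV_sgV, mV_sgV, map_neg, opV, opV, map_neg, LinearMap.neg_apply, map_neg, map_neg,
      neg_neg, sgV_sgV]
    change _ = mV P _ (sgV P A (opV P a A _ (sgV P A X.hi)))
    rw [opV_sgV, sgV_sgV]
    rfl
  · refine QObj.ext_hi (by omega) ?_
    rw [sgQ_hi, QObj.hi_neg, mu2_hi_hh h hA hB, mu2_hi_hh h hA hB, cmp_sgV h, sgQ_hi, sgQ_hi,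
      cV_sgV hΔ h.two_le_left h.mem_left]
    simp

/-! ### Relations of the ternary composition -/

lemma tern_intertwine {a' c' : ℕ} {A' C' D' : Finset ℕ} (φ : PV P D →ₗ[ℚ] PV P D')
    (f : PV P A →ₗ[ℚ] PV P A') (g : PV P C →ₗ[ℚ] PV P C')
    (hf : ∀ X, f (pV P a A X) = pV P a' A' (f X)) (hg : ∀ Z, g (pV P c C Z) = pV P c' C' (g Z))
    (h : ∀ X Z, φ (cmp P a c A C D X Z) = cmp P a' c' A' C' D' (f X) (g Z)) (q : Polynomial ℚ)
    (X : PV P A) (Z : PV P C) :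
    φ (tern P a c A C D q X Z) = tern P a' c' A' C' D' q (f X) (g Z) :=
  altSum_intertwine φ f g hf hg h q X Z

lemma tern_pV_left (h : Glue a c A C D) (hj : j ∈ A) (hja : j ≠ a) (q : Polynomial ℚ)
    (X : PV P A) (Z : PV P C) :
    tern P a c A C D q (pV P j A X) Z = pV P j D (tern P a c A C D q X Z) :=
  (tern_intertwine (pV P j D) (pV P j A) LinearMap.id (fun _ => pV_comm _) (fun _ => rfl)
    (fun X Z => (cmp_pV_left h hj hja X Z)) q X Z).symm

lemma tern_pV_right (h : Glue a c A C D) (hj : j ∈ C) (hjc : j ≠ c) (q : Polynomial ℚ)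
    (X : PV P A) (Z : PV P C) :
    tern P a c A C D q X (pV P j C Z) = pV P j D (tern P a c A C D q X Z) :=
  (tern_intertwine (pV P j D) LinearMap.id (pV P j C) (fun _ => rfl) (fun _ => pV_comm _)
    (fun X Z => (cmp_pV_right h hj hjc X Z)) q X Z).symm

lemma tern_opV_left (h : Glue a c A C D) (hj : j ∈ A) (hja : j ≠ a) (q f : Polynomial ℚ)
    (X : PV P A) (Z : PV P C) :
    tern P a c A C D q (opV P j A f X) Z = opV P j D f (tern P a c A C D q X Z) :=
  aeval_intertwine (f := (tern P a c A C D q).flip Z)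
    (fun X => tern_pV_left h hj hja q X Z) f X

lemma tern_opV_right (h : Glue a c A C D) (hj : j ∈ C) (hjc : j ≠ c) (q f : Polynomial ℚ)
    (X : PV P A) (Z : PV P C) :
    tern P a c A C D q X (opV P j C f Z) = opV P j D f (tern P a c A C D q X Z) :=
  aeval_intertwine (f := tern P a c A C D q X) (fun Z => tern_pV_right h hj hjc q X Z) f Z

lemma tern_sgV (h : Glue a c A C D) (q : Polynomial ℚ) (X : PV P A) (Z : PV P C) :
    sgV P D (tern P a c A C D q X Z) = tern P a c A C D q (sgV P A X) (sgV P C Z) :=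
  tern_intertwine _ _ _ (fun _ => (pV_sgV _).symm) (fun _ => (pV_sgV _).symm)
    (cmp_sgV h) q X Z

lemma tern_dV (h : Glue a c A C D) (q : Polynomial ℚ) (X : PV P A) (Z : PV P C) :
    dV P D (tern P a c A C D q X Z) =
      tern P a c A C D q (dV P A X) Z + tern P a c A C D q (sgV P A X) (dV P C Z) :=
  altSum_leibniz (fun _ => dV_pV _) (fun _ => (pV_sgV _).symm) (fun _ => dV_pV _)
    (cmp_dV h) q X Z

lemma tern_cV_left (hΔ : IsCircle P Δ) (h : Glue a c A C D) (hj : j ∈ A) (hja : j ≠ a)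
    (q : Polynomial ℚ) (X : PV P A) (Z : PV P C) :
    cV P Δ j D (tern P a c A C D q X Z) = tern P a c A C D q (cV P Δ j A X) Z :=
  tern_intertwine (cV P Δ j D) (cV P Δ j A) LinearMap.id (fun _ => (pV_cV _).symm) (fun _ => rfl)
    (fun _ _ => cmp_cV_left hΔ h hj hja _ _) q X Z

lemma tern_cV_right (h : Glue a c A C D) (hj : j ∈ C) (hjc : j ≠ c)
    (q : Polynomial ℚ) (X : PV P A) (Z : PV P C) :
    cV P Δ j D (tern P a c A C D q X Z) = tern P a c A C D q (sgV P A X) (cV P Δ j C Z) :=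
  tern_intertwine (cV P Δ j D) (sgV P A) (cV P Δ j C) (fun _ => (pV_sgV _).symm)
    (fun _ => (pV_cV _).symm) (fun _ _ => cmp_cV_right h hj hjc _ _) q X Z

lemma tern_cV_glue (hΔ : IsCircle P Δ) (h : Glue a c A C D) (q : Polynomial ℚ) (X : PV P A)
    (Z : PV P C) :
    tern P a c A C D q (cV P Δ a A X) Z = tern P a c A C D q (sgV P A X) (cV P Δ c C Z) :=
  altSum_balance (fun _ => (pV_cV _).symm) (fun _ => (pV_sgV _).symm) (fun _ => (pV_cV _).symm)
    (cmp_cV_glue hΔ h) q X Z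

lemma tern_homotopy (q : Polynomial ℚ) (X : PV P A) (Z : PV P C) :
    tern P a c A C D q (pV P a A X) Z + tern P a c A C D q X (pV P c C Z) =
      cmp P a c A C D (opV P a A q X) Z + cmp P a c A C D X (opV P c C (tau q) Z) :=
  altSum_homotopy q X Z

lemma tern_mul (p q : Polynomial ℚ) (X : PV P A) (Z : PV P C) :
    tern P a c A C D (p * q) X Z =
      tern P a c A C D q (opV P a A p X) Z - tern P a c A C D p X (opV P c C (tau q) Z) :=
  altSum_mul p q X Z

lemma tern_neg (q : Polynomial ℚ) (X : PV P A) (Z : PV P C) :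
    tern P a c A C D (-q) X Z = - tern P a c A C D q X Z :=
  altSum_neg _ _ _ q X Z

section

variable {AB BD : Finset ℕ} (h1 : Glue a b A B AB) (h2 : Glue c e AB D C) (h3 : Glue c e B D BD)
  (h4 : Glue a b A BD C) (hcb : c ≠ b)
include h1 h2 h3 h4 hcb

lemma cmp_tern (q : Polynomial ℚ) (X : PV P A) (Y : PV P B) (Z : PV P D) :
    cmp P c e AB D C (tern P a b A B AB q X Y) Z = tern P a b A BD C q X (cmp P c e B D BD Y Z) :=
  tern_intertwine ((cmp P c e AB D C).flip Z) LinearMap.id ((cmp P c e B D BD).flip Z)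
    (fun _ => rfl) (fun Y => (cmp_pV_left h3 h1.mem_right hcb.symm Y Z).symm)
    (fun X Y => cmp_assoc h1 h2 h3 h4 hcb X Y Z) q X Y

lemma tern_cmp (q : Polynomial ℚ) (X : PV P A) (Y : PV P B) (Z : PV P D) :
    tern P c e AB D C q (cmp P a b A B AB X Y) Z = cmp P a b A BD C X (tern P c e B D BD q Y Z) :=
  (tern_intertwine (cmp P a b A BD C X) (cmp P a b A B AB X) LinearMap.id
    (fun Y => (cmp_pV_right h1 h3.mem_left hcb X Y).symm) (fun _ => rfl)
    (fun Y Z => (cmp_assoc h1 h2 h3 h4 hcb X Y Z).symm) q Y Z).symm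

lemma tern_tern (p q : Polynomial ℚ) (X : PV P A) (Y : PV P B) (Z : PV P D) :
    tern P c e AB D C q (tern P a b A B AB p X Y) Z =
      tern P a b A BD C p X (tern P c e B D BD q Y Z) :=
  tern_intertwine ((tern P c e AB D C q).flip Z) LinearMap.id ((tern P c e B D BD q).flip Z)
    (fun _ => rfl) (fun Y => tern_pV_left h3 h1.mem_right hcb.symm q Y Z)
    (fun X Y => tern_cmp h1 h2 h3 h4 hcb q X Y Z) p X Y

end

/-! ### The relation with one vertex -/

lemma eq_zero_of_eq_neg {M : Type*} [AddCommGroup M] [Module ℚ M] {x : M} (h : x = -x) : x = 0 := by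
  have h2 : (2 : ℚ) • x = 0 := by rw [two_smul]; nth_rw 1 [h]; exact neg_add_cancel x
  exact (smul_eq_zero.1 h2).resolve_left two_ne_zero

lemma dQ_dQ (hΔ : IsCircle P Δ) (X : QObj P A) : dQ P Δ A (dQ P Δ A X) = 0 := by
  by_cases hA : 3 ≤ A.card
  swap
  · exact QObj.ext (QObj.hi_eq_zero hA _) (by simp)
  refine QObj.ext_hi hA ?_
  rw [dQ_hi, dQ_hi, map_add, dV_dV, zero_add, map_sum, QObj.hi_zero]
  have h1 : ∀ j ∈ A, dV P A (cV P Δ j A (pV P j A X.hi)) = - cV P Δ j A (pV P j A (dV P A X.hi)) :=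
    fun j hj => by rw [dV_cV hΔ (by omega) hj, dV_pV]
  have h2 : ∑ j ∈ A, ∑ k ∈ A, cV P Δ j A (cV P Δ k A (pV P j A (pV P k A X.hi))) = 0 := by
    refine eq_zero_of_eq_neg ?_
    conv_lhs => rw [Finset.sum_comm]
    rw [← Finset.sum_neg_distrib]
    refine Finset.sum_congr rfl fun j hj => ?_
    rw [← Finset.sum_neg_distrib]
    refine Finset.sum_congr rfl fun k hk => ?_
    rw [pV_comm]
    by_cases hjk : j = k
    · subst hjk
      rw [cV_cV_self hΔ (by omega) hj, neg_zero]
    · exact cV_cV hΔ (by omega) hk hj (Ne.symm hjk) _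
  rw [Finset.sum_congr rfl h1]
  simp only [map_add, map_sum, Finset.sum_add_distrib, pV_cV, Finset.sum_neg_distrib]
  rw [h2]
  abel

/-! ### The relation with two vertices -/

lemma Glue.sum_eq (h : Glue a b A B C) {M : Type*} [AddCommGroup M] {f g k : ℕ → M}
    (hf : ∀ j ∈ A, j ≠ a → k j = f j) (hg : ∀ j ∈ B, j ≠ b → k j = g j) :
    ∑ j ∈ C, k j = (∑ j ∈ A, f j - f a) + (∑ j ∈ B, g j - g b) := by
  rw [h.eq, Finset.sum_union h.disjoint, ← Finset.sum_erase_eq_sub h.mem_left,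
    ← Finset.sum_erase_eq_sub h.mem_right]
  congr 1
  · exact Finset.sum_congr rfl fun j hj => hf j (Finset.mem_of_mem_erase hj)
      (Finset.ne_of_mem_erase hj)
  · exact Finset.sum_congr rfl fun j hj => hg j (Finset.mem_of_mem_erase hj)
      (Finset.ne_of_mem_erase hj)

lemma relation_two (hΔ : IsCircle P Δ) (h : Glue a b A B C) (X : QObj P A) (Y : QObj P B) :
    dQ P Δ C (mu2 P Δ a b A B C X Y) + mu2 P Δ a b A B C (dQ P Δ A X) Y +
      mu2 P Δ a b A B C (sgQ P A X) (dQ P Δ B Y) = 0 := by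
  have h1 := h.card
  rcases eq_or_lt_of_le h.two_le_left with hA | hA <;>
    rcases eq_or_lt_of_le h.two_le_right with hB | hB
  · rw [dQ_of_card (by omega), dQ_of_card (by omega), dQ_of_card (by omega)]
    simp
  · rw [dQ_of_card (A := A) (by omega), mu2_zero_left, mu2_lh h hA.symm hB, mu2_lh h hA.symm hB,
      ← dQ_qmap hΔ, dQ_legQ, sgQ_lo, map_neg, legQ_neg, map_neg]
    simp
  · rw [dQ_of_card (A := B) (by omega), mu2_zero_right, mu2_hl h hA hB.symm, mu2_hl h hA hB.symm,
      ← dQ_qmap hΔ, dQ_legQ, dQ_sgQ hΔ]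
    have : ∀ q (X : QObj P A), legQ P a A q (-X) = - legQ P a A q X := fun q X =>
      QObj.ext (by simp) (by simp)
    rw [this, map_neg]
    simp
  · have hA2 := h.two_le_left
    have hB2 := h.two_le_right
    have hC2 := h.two_le
    have ha := h.mem_left
    have hb := h.mem_right
    refine QObj.ext_hi (by omega) ?_
    simp only [QObj.hi_add, QObj.hi_zero, mu2_hi_hh h hA hB, dQ_hi, map_add, map_sum,
      LinearMap.add_apply, LinearMap.sum_apply, sgQ_hi]
    rw [h.sum_eq (f := fun j => cmp P a b A B C (cV P Δ j A (pV P j A (cV P Δ a A X.hi))) Y.hi)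
      (g := fun j => cmp P a b A B C (sgV P A (cV P Δ a A X.hi)) (cV P Δ j B (pV P j B Y.hi)))]
    rotate_left
    · intro j hj hja
      rw [cmp_pV_left h hj hja, cmp_cV_left hΔ h hj hja]
    · intro j hj hjb
      rw [cmp_pV_right h hj hjb, cmp_cV_right h hj hjb]
    have e1 : ∑ j ∈ A, cmp P a b A B C (cV P Δ a A (cV P Δ j A (pV P j A X.hi))) Y.hi =
        - ∑ j ∈ A, cmp P a b A B C (cV P Δ j A (pV P j A (cV P Δ a A X.hi))) Y.hi := by
      rw [← Finset.sum_neg_distrib]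
      refine Finset.sum_congr rfl fun j hj => ?_
      rw [pV_cV]
      by_cases hja : j = a
      · subst hja
        rw [cV_cV_self hΔ hA2 ha]; simp
      · rw [cV_cV hΔ hA2 ha hj (Ne.symm hja)]; simp
    have e2 : ∑ j ∈ B, cmp P a b A B C (cV P Δ a A (sgV P A X.hi)) (cV P Δ j B (pV P j B Y.hi)) =
        - ∑ j ∈ B, cmp P a b A B C (sgV P A (cV P Δ a A X.hi)) (cV P Δ j B (pV P j B Y.hi)) := by
      rw [cV_sgV hΔ hA2 ha]; simp
    have e3 : cmp P a b A B C (cV P Δ a A (pV P a A (cV P Δ a A X.hi))) Y.hi = 0 := by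
      rw [pV_cV, cV_cV_self hΔ hA2 ha]; simp
    have e4 : cmp P a b A B C (sgV P A (cV P Δ a A X.hi)) (cV P Δ b B (pV P b B Y.hi)) = 0 := by
      rw [← cmp_cV_glue hΔ h, cV_cV_self hΔ hA2 ha]; simp
    rw [e1, e2, e3, e4, cmp_dV h, dV_cV hΔ hA2 ha, cV_sgV hΔ hA2 ha]
    simp only [map_neg, LinearMap.neg_apply]
    abel

/-! ### The relation with three vertices -/

/-- The sets of legs that arise from three sets `A`, `B`, `D` of legs, if `a ∈ A` is glued to
`b ∈ B` and `b' ∈ B` is glued to `d ∈ D`. -/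
structure Chain (a b b' d : ℕ) (A B D AB BD C : Finset ℕ) : Prop where
  ab : Glue a b A B AB
  ab_d : Glue b' d AB D C
  bd : Glue b' d B D BD
  a_bd : Glue a b A BD C
  ne : b' ≠ b

namespace Chain

variable {b' : ℕ} {AB BD : Finset ℕ}

lemma swap (h : Chain a b b' d A B D AB BD C) : Chain d b' b a D B A BD AB C :=
  ⟨h.bd.swap, h.a_bd.swap, h.ab.swap, h.ab_d.swap, h.ne.symm⟩

lemma other_eq (h : Chain a b b' d A B D AB BD C) (hB : B.card = 2) : other B b = b' :=
  (eq_other hB h.ab.mem_right h.bd.mem_left h.ne).symm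

lemma glue (h : Chain a b b' d A B D AB BD C) (hB : B.card = 2) : Glue a d A D C := by
  have hr := h.ab.renames hB
  rw [h.other_eq hB] at hr
  refine Glue.of_mem_iff h.ab.two_le_left h.bd.two_le_right h.ab.mem_left h.bd.mem_right ?_ ?_
  · intro z hz hza hzD
    have h1 : z ∈ AB := h.ab.mem_iff.2 (.inl ⟨hz, hza⟩)
    refine h.ab_d.disj h1 ?_ hzD
    rintro rfl
    exact hr.notMem (Finset.mem_erase.2 ⟨hza, hz⟩)
  · intro z
    rw [h.ab_d.mem_iff, hr.eq]
    have := hr.notMem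
    simp only [Finset.mem_insert, Finset.mem_erase] at *
    grind

/-- If `B` has two elements, then `A` is renamed. -/
lemma glueMap_left (h : Chain a b b' d A B D AB BD C) (hB : B.card = 2) :
    GlueMap a d b' d (h.ab.ren hB) (Equiv.refl D) (Equiv.refl C) where
  left := h.glue hB
  right := h.ab_d
  fst z hz := by rw [h.ab.ren_self hB z hz, h.other_eq hB]
  snd z hz := hz
  map_fst z w hz hw := by rw [h.ab.ren_of_ne hB z hz]; exact hw.symm
  map_snd z w hz hw := hw.symm

/-- If `A` has two elements, then `B` is renamed. -/
lemma glueMap_middle (h : Chain a b b' d A B D AB BD C) (hA : A.card = 2) :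
    GlueMap b' d b' d (h.ab.swap.ren hA) (Equiv.refl D) (h.a_bd.swap.ren hA) where
  left := h.bd
  right := h.ab_d
  fst z hz := by rw [h.ab.swap.ren_of_ne hA z (by rw [hz]; exact h.ne), hz]
  snd z hz := hz
  map_fst z w hz hw := by
    by_cases hzb : (z : ℕ) = b
    · rw [h.ab.swap.ren_self hA z hzb, h.a_bd.swap.ren_self hA w (hw ▸ hzb)]
    · rw [h.ab.swap.ren_of_ne hA z hzb, h.a_bd.swap.ren_of_ne hA w (hw ▸ hzb), hw]
  map_snd z w hz hw := by
    have : (w : ℕ) ≠ b := by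
      intro hwb
      have hzb : (z : ℕ) = b := hw.trans hwb
      exact hz (h.bd.disj (hzb ▸ h.ab.mem_right) (hzb ▸ h.ne.symm) z.2)
    rw [h.a_bd.swap.ren_of_ne hA w this, ← hw]
    rfl

end Chain

section

variable {b' : ℕ} {AB BD : Finset ℕ}

/-- The left factor of arity at least three is acted upon by a factor of arity two. -/
lemma mu2_mu2_hl (hΔ : IsCircle P Δ) (h : Chain a b b' d A B D AB BD C) (hA : 3 ≤ A.card)
    (hB : B.card = 2) (X : QObj P A) (Y : QObj P B) (Z : QObj P D) :
    mu2 P Δ b' d AB D C (mu2 P Δ a b A B AB X Y) Z =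
      mu2 P Δ a d A D C (legQ P a A (readAt B b Y.lo) (sgQ P A X)) Z := by
  rw [mu2_hl h.ab hA hB]
  have := mu2_qmap hΔ (h.glueMap_left hB) (legQ P a A (readAt B b Y.lo) (sgQ P A X)) Z
  rw [qmap_refl, qmap_refl] at this
  exact this.symm

/-- The right factor of arity at least three is acted upon by a factor of arity two. -/
lemma mu2_mu2_lh (hΔ : IsCircle P Δ) (h : Chain a b b' d A B D AB BD C) (hB : B.card = 2)
    (hD : 3 ≤ D.card) (X : QObj P A) (Y : QObj P B) (Z : QObj P D) :
    mu2 P Δ a b A BD C X (mu2 P Δ b' d B D BD Y Z) =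
      mu2 P Δ a d A D C X (legQ P d D (readAt B b' Y.lo) Z) := by
  rw [mu2_lh h.bd hB hD]
  have := mu2_qmap hΔ (h.swap.glueMap_left hB).swap X (legQ P d D (readAt B b' Y.lo) Z)
  rw [qmap_refl, qmap_refl] at this
  exact this.symm

lemma relation_lh (hΔ : IsCircle P Δ) (h : Chain a b b' d A B D AB BD C) (hA : A.card = 2)
    (hB : 3 ≤ B.card) (X : QObj P A) (Y : QObj P B) (Z : QObj P D) :
    mu2 P Δ b' d AB D C (mu2 P Δ a b A B AB X Y) Z +
      mu2 P Δ a b A BD C (sgQ P A X) (mu2 P Δ b' d B D BD Y Z) = 0 := by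
  have h1 := h.bd.card
  have h2 := h.bd.two_le_right
  have := mu2_qmap hΔ (h.glueMap_middle hA) (legQ P b B (readAt A a X.lo) Y) Z
  rw [qmap_refl] at this
  rw [mu2_lh h.ab hA hB, mu2_lh h.a_bd hA (by omega), ← this,
    mu2_legQ_left h.bd hB h.ab.mem_right h.ne.symm, sgQ_lo, map_neg, legQ_neg, map_neg,
    add_neg_cancel]

lemma relation_hl (hΔ : IsCircle P Δ) (h : Chain a b b' d A B D AB BD C) (hD : D.card = 2)
    (hB : 3 ≤ B.card) (X : QObj P A) (Y : QObj P B) (Z : QObj P D) :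
    mu2 P Δ b' d AB D C (mu2 P Δ a b A B AB X Y) Z +
      mu2 P Δ a b A BD C (sgQ P A X) (mu2 P Δ b' d B D BD Y Z) = 0 := by
  have h1 := h.ab.card
  have h2 := h.ab.two_le_left
  have := mu2_qmap hΔ (h.swap.glueMap_middle hD).swap (sgQ P A X)
    (legQ P b' B (readAt D d Z.lo) (sgQ P B Y))
  rw [qmap_refl] at this
  have hn : legQ P b' AB (readAt D d Z.lo) (-mu2 P Δ a b A B AB (sgQ P A X) (sgQ P B Y)) =
      - legQ P b' AB (readAt D d Z.lo) (mu2 P Δ a b A B AB (sgQ P A X) (sgQ P B Y)) :=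
    QObj.ext (by simp) (by simp)
  rw [mu2_hl h.bd hB hD, mu2_hl h.ab_d (by omega) hD, ← this,
    mu2_legQ_right h.ab hB h.bd.mem_left h.ne, sgQ_mu2 hΔ h.ab, hn, map_neg]
  exact neg_add_cancel _

lemma relation_hhh (hΔ : IsCircle P Δ) (h : Chain a b b' d A B D AB BD C) (hA : 3 ≤ A.card)
    (hB : 3 ≤ B.card) (hD : 3 ≤ D.card) (X : QObj P A) (Y : QObj P B) (Z : QObj P D) :
    mu2 P Δ b' d AB D C (mu2 P Δ a b A B AB X Y) Z +
      mu2 P Δ a b A BD C (sgQ P A X) (mu2 P Δ b' d B D BD Y Z) = 0 := by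
  have h1 := h.ab.card
  have h2 := h.ab_d.card
  have h3 := h.bd.card
  refine QObj.ext_hi (by omega) ?_
  rw [QObj.hi_add, mu2_hi_hh h.ab_d (by omega) hD, mu2_hi_hh h.ab hA hB,
    mu2_hi_hh h.a_bd hA (by omega), mu2_hi_hh h.bd hB hD, sgQ_hi,
    cmp_cV_right h.ab h.bd.mem_left h.ne, cmp_assoc h.ab h.ab_d h.bd h.a_bd h.ne,
    cV_sgV hΔ (by omega) h.ab.mem_left]
  simp

lemma readAt_mu2_left (h : Chain a b b' d A B D AB BD C) (hA : A.card = 2) (hB : B.card = 2)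
    (X : QObj P A) (Y : QObj P B) :
    readAt AB b' (mu2 P Δ a b A B AB X Y).lo = readAt A a X.lo * readAt B b' Y.lo := by
  have h1 := h.ab.card
  have ha := other_mem hA h.ab.mem_left
  have ha' := other_ne hA h.ab.mem_left
  have hbb := h.bd.mem_left
  rw [readAt_of_ne (a := other A a) (by omega) (h.ab.mem_iff.2 (.inl ⟨ha, ha'⟩))
    (h.ab.mem_iff.2 (.inr ⟨hbb, h.ne⟩)) (fun h' => h.ne (h.ab.disj (h' ▸ ha) (h' ▸ ha') hbb)),
    mu2_lo_ll h.ab hA hB, mul_neg_one, map_neg, tau_mul, tau_tau, neg_neg,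
    readAt_of_ne hB h.ab.mem_right hbb h.ne]

lemma readAt_mu2_right (h : Chain a b b' d A B D AB BD C) (hB : B.card = 2) (hD : D.card = 2)
    (Y : QObj P B) (Z : QObj P D) :
    readAt BD b (mu2 P Δ b' d B D BD Y Z).lo = - (readAt B b Y.lo * readAt D d Z.lo) := by
  have := mu2_lo_ll (Δ := Δ) h.bd hB hD Y Z
  rw [← readAt_other hB h.bd.mem_left, ← h.other_eq hB, other_other hB h.ab.mem_right] at this
  rw [← h.other_eq hB, this, mul_neg_one]

lemma relation_hll (hΔ : IsCircle P Δ) (h : Chain a b b' d A B D AB BD C) (hA : 3 ≤ A.card)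
    (hB : B.card = 2) (hD : D.card = 2) (X : QObj P A) (Y : QObj P B) (Z : QObj P D) :
    mu2 P Δ b' d AB D C (mu2 P Δ a b A B AB X Y) Z +
      mu2 P Δ a b A BD C (sgQ P A X) (mu2 P Δ b' d B D BD Y Z) = 0 := by
  have h3 := h.bd.card
  have hBD : BD.card = 2 := by omega
  rw [mu2_mu2_hl hΔ h hA hB, mu2_hl (h.glue hB) hA hD, mu2_hl h.a_bd hA hBD,
    readAt_mu2_right h hB hD, sgQ_legQ, sgQ_sgQ, legQ_neg, map_neg, mul_comm, legQ_mul]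
  rw [qmap_congr (e := h.a_bd.ren hBD) (f := (h.glue hB).ren hD), add_neg_cancel]
  intro z
  by_cases hz : (z : ℕ) = a
  · rw [Glue.ren_self _ _ _ hz, Glue.ren_self _ _ _ hz]
    have h4 := other_mem hD h.bd.mem_right
    have h5 := other_ne hD h.bd.mem_right
    refine (eq_other hBD h.a_bd.mem_right (h.bd.mem_iff.2 (.inr ⟨h4, h5⟩)) fun h' => ?_).symm
    exact h.ne.symm (h.bd.swap.disj h4 h5 (h' ▸ h.ab.mem_right) ▸ h'.symm)
  · rw [Glue.ren_of_ne _ _ _ hz, Glue.ren_of_ne _ _ _ hz]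

lemma relation_llh (hΔ : IsCircle P Δ) (h : Chain a b b' d A B D AB BD C) (hA : A.card = 2)
    (hB : B.card = 2) (hD : 3 ≤ D.card) (X : QObj P A) (Y : QObj P B) (Z : QObj P D) :
    mu2 P Δ b' d AB D C (mu2 P Δ a b A B AB X Y) Z +
      mu2 P Δ a b A BD C (sgQ P A X) (mu2 P Δ b' d B D BD Y Z) = 0 := by
  have h1 := h.ab.card
  have hAB : AB.card = 2 := by omega
  rw [mu2_mu2_lh hΔ h hB hD, mu2_lh (h.glue hB) hA hD, mu2_lh h.ab_d hAB hD,
    readAt_mu2_left h hA hB, legQ_mul, sgQ_lo, map_neg, legQ_neg, map_neg]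
  rw [qmap_congr (e := h.ab_d.swap.ren hAB) (f := (h.glue hB).swap.ren hA), add_neg_cancel]
  intro z
  by_cases hz : (z : ℕ) = d
  · rw [Glue.ren_self _ _ _ hz, Glue.ren_self _ _ _ hz]
    have h4 := other_mem hA h.ab.mem_left
    have h5 := other_ne hA h.ab.mem_left
    refine (eq_other hAB h.ab_d.mem_left (h.ab.mem_iff.2 (.inl ⟨h4, h5⟩)) fun h' => ?_).symm
    exact h.ne (h.ab.disj h4 h5 (h' ▸ h.bd.mem_left) ▸ h'.symm)
  · rw [Glue.ren_of_ne _ _ _ hz, Glue.ren_of_ne _ _ _ hz]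

lemma relation_lll (h : Chain a b b' d A B D AB BD C) (hA : A.card = 2)
    (hB : B.card = 2) (hD : D.card = 2) (X : QObj P A) (Y : QObj P B) (Z : QObj P D) :
    mu2 P Δ b' d AB D C (mu2 P Δ a b A B AB X Y) Z +
      mu2 P Δ a b A BD C (sgQ P A X) (mu2 P Δ b' d B D BD Y Z) = 0 := by
  have h1 := h.ab.card
  have h2 := h.ab_d.card
  have h3 := h.bd.card
  have hAB : AB.card = 2 := by omega
  have h4 := other_mem hA h.ab.mem_left
  have h5 := other_ne hA h.ab.mem_left
  have h6 : other AB b' = other A a :=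
    (eq_other hAB h.ab_d.mem_left (h.ab.mem_iff.2 (.inl ⟨h4, h5⟩)) fun h' =>
      h.ne (h.ab.disj h4 h5 (h' ▸ h.bd.mem_left) ▸ h'.symm)).symm
  have e1 := mu2_lo_ll (Δ := Δ) h.ab_d hAB hD (mu2 P Δ a b A B AB X Y) Z
  rw [h6, readAt_mu2_left h hA hB, tau_mul] at e1
  refine QObj.ext_readAt (by omega) (other A a) ?_
  rw [QObj.lo_add, map_add, e1, mu2_lo_ll h.a_bd hA (by omega), readAt_mu2_right h hB hD, sgQ_lo,
    ← h.other_eq hB, readAt_other hB h.ab.mem_right, tau_tau]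
  simp
  ring

lemma relation_hlh (hΔ : IsCircle P Δ) (h : Chain a b b' d A B D AB BD C) (hA : 3 ≤ A.card)
    (hB : B.card = 2) (hD : 3 ≤ D.card) (X : QObj P A) (Y : QObj P B) (Z : QObj P D) :
    mu2 P Δ b' d AB D C (mu2 P Δ a b A B AB X Y) Z +
      mu2 P Δ a b A BD C (sgQ P A X) (mu2 P Δ b' d B D BD Y Z) +
      (dQ P Δ C (mu3 P a b d A B D C X Y Z) + mu3 P a b d A B D C (dQ P Δ A X) Y Z +
        mu3 P a b d A B D C (sgQ P A X) (sgQ P B Y) (dQ P Δ D Z)) = 0 := by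
  have h0 := h.glue hB
  have h1 := h0.card
  have hA2 := h.ab.two_le_left
  rw [mu2_mu2_hl hΔ h hA hB, mu2_mu2_lh hΔ h hB hD]
  refine QObj.ext_hi (by omega) ?_
  simp only [QObj.hi_add, mu2_hi_hh h0 hA hD, legQ_hi, sgQ_hi, dQ_hi, mu3_hi h0, sgV_sgV,
    QObj.hi_zero, sgQ_lo]
  rw [readAt_of_ne hB h.ab.mem_right h.bd.mem_left h.ne, map_neg, tern_neg, tern_dV h0, sgV_sgV]
  generalize readAt B b Y.lo = f
  have e1 := h0.sum_eq (k := fun j => cV P Δ j C (pV P j C (tern P a d A D C f (sgV P A X.hi) Z.hi)))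
    (f := fun j => tern P a d A D C f (cV P Δ j A (pV P j A (sgV P A X.hi))) Z.hi)
    (g := fun j => tern P a d A D C f X.hi (cV P Δ j D (pV P j D Z.hi)))
    (fun j hj hja => by rw [← tern_pV_left h0 hj hja, tern_cV_left hΔ h0 hj hja])
    (fun j hj hjd => by rw [← tern_pV_right h0 hj hjd, tern_cV_right h0 hj hjd, sgV_sgV])
  have e2 : ∀ j ∈ A, cV P Δ j A (pV P j A (sgV P A X.hi)) =
      - sgV P A (cV P Δ j A (pV P j A X.hi)) :=
    fun j hj => by rw [pV_sgV, cV_sgV hΔ hA2 hj]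
  have e4 := tern_homotopy (a := a) (c := d) (D := C) f (cV P Δ a A (sgV P A X.hi)) Z.hi
  have e5 := tern_cV_glue hΔ h0 f (sgV P A X.hi) (pV P d D Z.hi)
  rw [sgV_sgV] at e5
  rw [e1, ← e5]
  rw [pV_cV, opV_cV] at e4
  simp only [map_add, map_sum, LinearMap.add_apply, LinearMap.sum_apply]
  rw [Finset.sum_congr rfl fun j hj => by rw [e2 j hj], dV_sgV]
  simp only [map_neg, LinearMap.neg_apply, Finset.sum_neg_distrib]
  linear_combination (norm := module) -e4

lemma relation_three (hΔ : IsCircle P Δ) (h : Chain a b b' d A B D AB BD C) (X : QObj P A)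
    (Y : QObj P B) (Z : QObj P D) :
    mu2 P Δ b' d AB D C (mu2 P Δ a b A B AB X Y) Z +
      mu2 P Δ a b A BD C (sgQ P A X) (mu2 P Δ b' d B D BD Y Z) +
      (dQ P Δ C (mu3 P a b d A B D C X Y Z) + mu3 P a b d A B D C (dQ P Δ A X) Y Z +
        mu3 P a b d A B D C (sgQ P A X) (sgQ P B Y) (dQ P Δ D Z)) = 0 := by
  by_cases hl : 3 ≤ A.card ∧ B.card = 2 ∧ 3 ≤ D.card
  · exact relation_hlh hΔ h hl.1 hl.2.1 hl.2.2 X Y Z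
  have h0 : dQ P Δ C (mu3 P a b d A B D C X Y Z) + mu3 P a b d A B D C (dQ P Δ A X) Y Z +
      mu3 P a b d A B D C (sgQ P A X) (sgQ P B Y) (dQ P Δ D Z) = 0 := by
    by_cases hA : 3 ≤ A.card
    · by_cases hB : B.card = 2
      · have hD : ¬ 3 ≤ D.card := fun hD => hl ⟨hA, hB, hD⟩
        rw [mu3_of_hi_right _ _ (QObj.hi_eq_zero hD _), mu3_of_hi_right _ _ (QObj.hi_eq_zero hD _),
          mu3_of_hi_right _ _ (QObj.hi_eq_zero hD _)]
        simp
      · rw [mu3_of_lo _ (QObj.lo_eq_zero hB _), mu3_of_lo _ (QObj.lo_eq_zero hB _),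
          mu3_of_lo _ (QObj.lo_eq_zero hB _)]
        simp
    · rw [mu3_of_hi_left (QObj.hi_eq_zero hA _), mu3_of_hi_left (QObj.hi_eq_zero hA _),
        mu3_of_hi_left (QObj.hi_eq_zero hA _)]
      simp
  rw [h0, add_zero]
  rcases eq_or_lt_of_le h.ab.two_le_left with hA | hA <;>
    rcases eq_or_lt_of_le h.ab.two_le_right with hB | hB <;>
    rcases eq_or_lt_of_le h.bd.two_le_right with hD | hD
  · exact relation_lll h hA.symm hB.symm hD.symm X Y Z
  · exact relation_llh hΔ h hA.symm hB.symm hD X Y Z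
  · exact relation_lh hΔ h hA.symm hB X Y Z
  · exact relation_lh hΔ h hA.symm hB X Y Z
  · exact relation_hll hΔ h hA hB.symm hD.symm X Y Z
  · exact absurd ⟨hA, hB.symm, hD⟩ hl
  · exact relation_hl hΔ h hD.symm hB X Y Z
  · exact relation_hhh hΔ h hA hB hD X Y Z

end

end

section

variable {P : CyclicOperad.{u}} {Δ : ∀ B, P.obj B} {A B C D E L M AB BD DE ABD BDE : Finset ℕ}
  {a b b' d d' e x y : ℕ}

/-! ### The relations with four and five vertices -/

lemma mu3_of_card_left (hA : ¬ 3 ≤ A.card) (X : QObj P A) (Y : QObj P B) (Z : QObj P C) :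
    mu3 P a b d A B C D X Y Z = 0 :=
  mu3_of_hi_left (X.hi_eq_zero hA) Y Z

lemma mu3_of_card_middle (hB : B.card ≠ 2) (X : QObj P A) (Y : QObj P B) (Z : QObj P C) :
    mu3 P a b d A B C D X Y Z = 0 :=
  mu3_of_lo X (Y.lo_eq_zero hB) Z

lemma mu3_of_card_right (hC : ¬ 3 ≤ C.card) (X : QObj P A) (Y : QObj P B) (Z : QObj P C) :
    mu3 P a b d A B C D X Y Z = 0 :=
  mu3_of_hi_right X Y (Z.hi_eq_zero hC)

lemma mu2_mu3 (h : Chain a b b' d A B D AB BD C) (hB : 3 ≤ B.card) (X : QObj P A)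
    (Y : QObj P L) (Z : QObj P B) (W : QObj P D) :
    mu3 P a x b A L BD C (sgQ P A X) (sgQ P L Y) (mu2 P Δ b' d B D BD Z W) +
      mu2 P Δ b' d AB D C (mu3 P a x b A L B AB X Y Z) W = 0 := by
  by_cases hA : 3 ≤ A.card
  swap
  · rw [mu3_of_card_left hA, mu3_of_card_left hA, mu2_zero_left, add_zero]
  have h1 := h.ab.card
  have h2 := h.ab_d.card
  have h3 := h.bd.two_le_right
  refine QObj.ext_hi (by omega) ?_
  rw [QObj.hi_add, mu3_hi h.a_bd, sgQ_hi, sgV_sgV, sgQ_lo, map_neg, tern_neg, QObj.hi_zero]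
  rcases eq_or_lt_of_le h3 with hD | hD
  · rw [mu2_hi_hl h.ab_d (by omega) hD.symm, mu2_hi_hl h.bd hB hD.symm, mu3_hi h.ab,
      tern_sgV h.ab, sgV_sgV, ← tern_opV_right h.ab h.bd.mem_left h.ne,
      tern_mV (h.swap.glueMap_middle hD.symm).swap, mV_refl]
    exact neg_add_cancel _
  · rw [mu2_hi_hh h.ab_d (by omega) hD, mu2_hi_hh h.bd hB hD, mu3_hi h.ab,
      tern_cV_right h.ab h.bd.mem_left h.ne, sgV_sgV, cmp_tern h.ab h.ab_d h.bd h.a_bd h.ne]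
    exact neg_add_cancel _

lemma opV_neg (q : Polynomial ℚ) (X : PV P A) : opV P a A (-q) X = - opV P a A q X := by
  rw [opV, map_neg]; rfl

lemma mu3_mu2 (hΔ : IsCircle P Δ) (h : Chain a b b' d A B D AB BD C) (hB : 3 ≤ B.card)
    (X : QObj P A) (Y : QObj P B) (Z : QObj P L) (W : QObj P D) :
    mu3 P b' x d AB L D C (mu2 P Δ a b A B AB X Y) Z W +
      mu2 P Δ a b A BD C (sgQ P A X) (mu3 P b' x d B L D BD Y Z W) = 0 := by
  by_cases hD : 3 ≤ D.card
  swap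
  · rw [mu3_of_card_right hD, mu3_of_card_right hD, mu2_zero_right, add_zero]
  have h1 := h.bd.card
  have h2 := h.ab_d.card
  have h3 := h.ab.card
  have h4 := h.ab.two_le_left
  refine QObj.ext_hi (by omega) ?_
  rw [QObj.hi_add, mu3_hi h.ab_d, QObj.hi_zero]
  rcases eq_or_lt_of_le h4 with hA | hA
  · rw [mu2_hi_lh h.ab hA.symm hB, mu2_hi_lh h.a_bd hA.symm (by omega), mu3_hi h.bd, sgQ_lo,
      map_neg, opV_neg, map_neg,
      ← tern_opV_left h.bd h.ab.mem_right h.ne.symm, tern_mV (h.glueMap_middle hA.symm), mV_refl,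
      ← mV_sgV, ← opV_sgV]
    exact add_neg_cancel _
  · rw [mu2_hi_hh h.ab hA hB, mu2_hi_hh h.a_bd hA (by omega), mu3_hi h.bd, sgQ_hi, cmp_sgV h.ab,
      tern_cmp h.ab h.ab_d h.bd h.a_bd h.ne, cV_sgV hΔ h4 h.ab.mem_left, map_neg,
      LinearMap.neg_apply]
    exact add_neg_cancel _

/-- The sets of legs that arise from a path with four vertices. -/
structure Chain₄ (a b b' d d' e : ℕ) (A B D E AB BD DE ABD BDE C : Finset ℕ) : Prop where
  abd : Chain a b b' d A B D AB BD ABD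
  bde : Chain b' d d' e B D E BD DE BDE
  a_b_de : Chain a b b' d A B DE AB BDE C
  ab_d_e : Chain b' d d' e AB D E ABD DE C
  a_bd_e : Chain a b d' e A BD E ABD BDE C

lemma relation_four (hΔ : IsCircle P Δ) (h : Chain₄ a b b' d d' e A B D E AB BD DE ABD BDE C)
    (X : QObj P A) (Y : QObj P B) (Z : QObj P D) (W : QObj P E) :
    mu3 P b' d e AB D E C (mu2 P Δ a b A B AB X Y) Z W +
      mu3 P a b e A BD E C (sgQ P A X) (mu2 P Δ b' d B D BD Y Z) W +
      mu3 P a b d A B DE C (sgQ P A X) (sgQ P B Y) (mu2 P Δ d' e D E DE Z W) +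
      mu2 P Δ d' e ABD E C (mu3 P a b d A B D ABD X Y Z) W +
      mu2 P Δ a b A BDE C (sgQ P A X) (mu3 P b' d e B D E BDE Y Z W) = 0 := by
  have h1 := h.abd.ab.card
  have h2 := h.abd.bd.card
  have h3 := h.bde.bd.card
  rcases eq_or_lt_of_le h.abd.ab.two_le_right with hB | hB <;>
    rcases eq_or_lt_of_le h.abd.bd.two_le_right with hD | hD
  · rw [mu3_of_card_right (C := D) (by omega), mu3_of_card_left (A := B) (by omega), mu2_zero_left,
      mu2_zero_right, add_zero, add_zero]
    by_cases hA : 3 ≤ A.card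
    swap
    · rw [mu3_of_card_left (A := A) hA, mu3_of_card_left (A := A) hA,
        mu3_of_card_left (A := AB) (by omega)]
      simp
    by_cases hE : 3 ≤ E.card
    swap
    · rw [mu3_of_card_right (C := E) hE, mu3_of_card_right (C := E) hE,
        mu3_of_card_right (C := DE) (by omega)]
      simp
    have g1 := h.a_bd_e.glue (by omega)
    have g2 := g1.card
    refine QObj.ext_hi (by omega) ?_
    have e1 := tern_mV (P := P) (h.ab_d_e.glue hD.symm |> fun g => GlueMap.mk (a := a) (b := e)
      (e := h.abd.ab.ren hB.symm) (f := Equiv.refl E) (g := Equiv.refl C) g1 g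
      (fun z hz => by rw [Glue.ren_self _ _ _ hz, h.abd.other_eq hB.symm]) (fun z hz => hz)
      (fun z w hz hw => by rw [Glue.ren_of_ne _ _ _ hz]; exact hw.symm)
      (fun z w hz hw => hw.symm))
      (readAt D d Z.lo) (opV P a A (readAt B b Y.lo) X.hi) W.hi
    have e2 := tern_mV (P := P) (h.a_b_de.glue hB.symm |> fun g => GlueMap.mk (a := a) (b := e)
      (e := Equiv.refl A) (f := h.bde.bd.swap.ren hD.symm) (g := Equiv.refl C) g1 g
      (fun z hz => hz) (fun z hz => by rw [Glue.ren_self _ _ _ hz, h.bde.swap.other_eq hD.symm])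
      (fun z w hz hw => hw.symm)
      (fun z w hz hw => by rw [Glue.ren_of_ne _ _ _ hz]; exact hw.symm))
      (readAt B b Y.lo) X.hi (opV P e E (readAt D d' Z.lo) W.hi)
    rw [mV_refl, mV_refl] at e1 e2
    rw [QObj.hi_add, QObj.hi_add, QObj.hi_zero, mu3_hi (h.ab_d_e.glue hD.symm), mu3_hi g1,
      mu3_hi (h.a_b_de.glue hB.symm), mu2_hi_hl h.abd.ab hA hB.symm,
      mu2_hi_lh h.bde.bd hD.symm hE, ← mV_sgV, ← opV_sgV, sgV_sgV, ← e1,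
      readAt_mu2_right h.abd hB.symm hD.symm, sgQ_lo, map_neg, tern_neg, tern_neg, sgQ_hi, sgV_sgV,
      ← e2, tern_mul, readAt_of_ne hD.symm h.abd.bd.mem_right h.bde.bd.mem_left h.bde.ne]
    abel
  · rw [mu3_of_card_middle (B := D) (by omega), mu3_of_card_middle (B := BD) (by omega),
      mu3_of_card_left (A := B) (by omega), mu2_zero_right, zero_add, zero_add, add_zero]
    exact mu2_mu3 ⟨h.abd.glue hB.symm, h.a_bd_e.ab_d, h.bde.bd, h.a_b_de.glue hB.symm, h.bde.ne⟩
      hD X Y Z W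
  · rw [mu3_of_card_right (C := D) (by omega), mu3_of_card_middle (B := BD) (by omega),
      mu3_of_card_middle (B := B) (by omega), mu2_zero_left, add_zero, add_zero, add_zero]
    exact mu3_mu2 hΔ ⟨h.abd.ab, h.ab_d_e.glue hD.symm, h.bde.glue hD.symm, h.a_b_de.a_bd, h.abd.ne⟩
      hB X Y Z W
  · rw [mu3_of_card_middle (B := D) (by omega), mu3_of_card_middle (B := BD) (by omega),
      mu3_of_card_middle (B := B) (by omega), mu3_of_card_middle (B := B) (by omega),
      mu3_of_card_middle (B := D) (by omega), mu2_zero_left, mu2_zero_right]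
    simp

lemma relation_five (h : Chain a b b' d A B D AB BD C) (X : QObj P A) (Y : QObj P L) (Z : QObj P B)
    (W : QObj P M) (V : QObj P D) :
    mu3 P b' y d AB M D C (mu3 P a x b A L B AB X Y Z) W V +
      mu3 P a x b A L BD C (sgQ P A X) (sgQ P L Y) (mu3 P b' y d B M D BD Z W V) = 0 := by
  refine QObj.ext ?_ (by simp)
  rw [QObj.hi_add, mu3_hi h.ab_d, mu3_hi h.ab, mu3_hi h.a_bd, mu3_hi h.bd, tern_sgV h.ab,
    tern_tern h.ab h.ab_d h.bd h.a_bd h.ne, sgQ_hi, sgQ_lo, map_neg, tern_neg, sgV_sgV]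
  exact add_neg_cancel _

end

/-! ### Edges of trees -/

namespace Tree

variable {ι : Type} {T : Tree ι} {i j : ι} {a b : ℕ}

/-- The flags `a` at `i` and `b` at `j` form the only edge between `i` and `j`. -/
structure Edge (T : Tree ι) (i j : ι) (a b : ℕ) : Prop where
  fst : a ∈ T.flags i
  snd : b ∈ T.flags j
  glued : T.glued a b
  glued_swap : T.glued b a
  unique : ∀ a' ∈ T.flags i, ∀ b' ∈ T.flags j, T.glued a' b' ∨ T.glued b' a' → a' = a ∧ b' = b

/-- There is no edge between `i` and `j`. -/
def NoEdge (T : Tree ι) (i j : ι) : Prop :=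
  ∀ a ∈ T.flags i, ∀ b ∈ T.flags j, ¬ T.glued a b ∧ ¬ T.glued b a

lemma Edge.swap (h : T.Edge i j a b) : T.Edge j i b a :=
  ⟨h.snd, h.fst, h.glued_swap, h.glued, fun a' ha b' hb hab =>
    (h.unique b' hb a' ha hab.symm).symm⟩

lemma NoEdge.swap (h : T.NoEdge i j) : T.NoEdge j i := fun a ha b hb => (h b hb a ha).symm

end Tree

section

variable {P : CyclicOperad.{u}} {Δ : ∀ B, P.obj B} {ι : Type} {T : Tree ι} {i j k : ι}
  {a b b' d : ℕ}

lemma edgeOp_eq (h : T.Edge i j a b) (X : QObj P (T.flags i)) (Y : QObj P (T.flags j)) :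
    edgeOp P Δ T i j X Y = mu2 P Δ a b _ _ _ X Y := by
  classical
  rw [edgeOp, Finset.sum_eq_single_of_mem a h.fst, Finset.sum_eq_single_of_mem b h.snd,
    if_pos h.glued]
  · exact fun b' hb' hne => if_neg fun hg => hne (h.unique a h.fst b' hb' (.inl hg)).2
  · exact fun a' ha' hne => Finset.sum_eq_zero fun b' hb' =>
      if_neg fun hg => hne (h.unique a' ha' b' hb' (.inl hg)).1

lemma pathOp_eq (h : T.Edge i j a b) (h' : T.Edge j k b' d) (X : QObj P (T.flags i))
    (Y : QObj P (T.flags j)) (Z : QObj P (T.flags k)) :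
    pathOp P T i j k X Y Z = mu3 P a b d _ _ _ _ X Y Z := by
  classical
  rw [pathOp, Finset.sum_eq_single_of_mem a h.fst, Finset.sum_eq_single_of_mem b h.snd,
    Finset.sum_eq_single_of_mem b' h'.fst, Finset.sum_eq_single_of_mem d h'.snd,
    if_pos ⟨h.glued, h'.glued⟩]
  · exact fun d' hd' hne => if_neg fun hg => hne (h'.unique b' h'.fst d' hd' (.inl hg.2)).2
  · exact fun c hc hne => Finset.sum_eq_zero fun d' hd' =>
      if_neg fun hg => hne (h'.unique c hc d' hd' (.inl hg.2)).1
  · exact fun b₁ hb₁ hne => Finset.sum_eq_zero fun c hc => Finset.sum_eq_zero fun d' hd' =>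
      if_neg fun hg => hne (h.unique a h.fst b₁ hb₁ (.inl hg.1)).2
  · exact fun a' ha' hne => Finset.sum_eq_zero fun b₁ hb₁ => Finset.sum_eq_zero fun c hc =>
      Finset.sum_eq_zero fun d' hd' => if_neg fun hg => hne (h.unique a' ha' b₁ hb₁ (.inl hg.1)).1

lemma exists_of_edgeOp_ne_zero {X : QObj P (T.flags i)} {Y : QObj P (T.flags j)}
    (h : edgeOp P Δ T i j X Y ≠ 0) : ∃ a ∈ T.flags i, ∃ b ∈ T.flags j, T.glued a b := by
  classical
  obtain ⟨a, ha, h⟩ := Finset.exists_ne_zero_of_sum_ne_zero h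
  obtain ⟨b, hb, h⟩ := Finset.exists_ne_zero_of_sum_ne_zero h
  exact ⟨a, ha, b, hb, by_contra fun hg => h (if_neg hg)⟩

lemma exists_of_pathOp_ne_zero {X : QObj P (T.flags i)} {Y : QObj P (T.flags j)}
    {Z : QObj P (T.flags k)} (h : pathOp P T i j k X Y Z ≠ 0) :
    (∃ a ∈ T.flags i, ∃ b ∈ T.flags j, T.glued a b) ∧
    (∃ a ∈ T.flags j, ∃ b ∈ T.flags k, T.glued a b) ∧
    3 ≤ (T.flags i).card ∧ (T.flags j).card = 2 ∧ 3 ≤ (T.flags k).card := by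
  classical
  obtain ⟨a, ha, h⟩ := Finset.exists_ne_zero_of_sum_ne_zero h
  obtain ⟨b, hb, h⟩ := Finset.exists_ne_zero_of_sum_ne_zero h
  obtain ⟨b', hb', h⟩ := Finset.exists_ne_zero_of_sum_ne_zero h
  obtain ⟨d, hd, h⟩ := Finset.exists_ne_zero_of_sum_ne_zero h
  have hg : T.glued a b ∧ T.glued b' d := by_contra fun hg => h (if_neg hg)
  rw [if_pos hg] at h
  exact ⟨⟨a, ha, b, hb, hg.1⟩, ⟨b', hb', d, hd, hg.2⟩,
    by_contra fun h' => h (mu3_of_card_left h' _ _ _),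
    by_contra fun h' => h (mu3_of_card_middle h' _ _ _),
    by_contra fun h' => h (mu3_of_card_right h' _ _ _)⟩

lemma pathOp_eq_zero (h : T.NoEdge i j ∨ T.NoEdge j k) (X : QObj P (T.flags i))
    (Y : QObj P (T.flags j)) (Z : QObj P (T.flags k)) : pathOp P T i j k X Y Z = 0 := by
  by_contra h0
  obtain ⟨⟨a, ha, b, hb, h1⟩, ⟨b', hb', d, hd, h2⟩, -⟩ := exists_of_pathOp_ne_zero h0
  rcases h with h | h
  · exact (h a ha b hb).1 h1
  · exact (h b' hb' d hd).1 h2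

end

/-! ### Koszul signs -/

section

variable {ι : Type} [LinearOrder ι] {i j : ι} {deg : ι → ℤ}

/-- The Koszul sign of moving a factor at `i` in front of one at `j`. -/
def koszul (deg : ι → ℤ) (i j : ι) : ℚ := if j < i then (-1) ^ (deg j * deg i) else 1

lemma koszul_of_lt (h : i < j) : koszul deg i j = 1 := if_neg h.not_gt

lemma koszul_of_gt (h : j < i) : koszul deg i j = (-1) ^ (deg j * deg i) := if_pos h

lemma koszul_swap (h : i ≠ j) : koszul deg j i = (-1) ^ (deg i * deg j) * koszul deg i j := by
  rcases lt_or_gt_of_ne h with h | h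
  · rw [koszul_of_lt h, koszul_of_gt h, mul_one]
  · rw [koszul_of_lt h, koszul_of_gt h, mul_comm (deg j), neg_one_zpow_mul_self]

end

/-! ### The operations of trees in terms of edges -/

section

variable {P : CyclicOperad.{u}} {Δ : ∀ B, P.obj B} {ι : Type} [Fintype ι] [LinearOrder ι]
  {T : Tree ι} {i j k : ι} {a b b' d : ℕ} {x : ∀ i, QObj P (T.flags i)} {deg : ι → ℤ}

lemma Qop_one (h : Fintype.card ι = 1) (i : ι) :
    Qop P Δ T x = (Q P).castMap (T.flags i) T.legs (dQ P Δ (T.flags i) (x i)) := by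
  have : i = Fintype.orderIsoFinOfCardEq ι h 0 := by
    have := Fintype.card_le_one_iff_subsingleton.1 h.le
    exact Subsingleton.elim _ _
  subst this
  simp only [Qop, h, dite_true]

lemma Qop_two_of_lt (h : Fintype.card ι = 2) (hij : i < j) :
    Qop P Δ T x = edgeOp P Δ T i j (x i) (x j) := by
  obtain ⟨h0, h1⟩ : Fintype.orderIsoFinOfCardEq ι h 0 = i ∧ Fintype.orderIsoFinOfCardEq ι h 1 = j := by
    generalize Fintype.orderIsoFinOfCardEq ι h = e
    have h1 := e.symm.lt_iff_lt.2 hij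
    constructor
    · rw [← e.apply_symm_apply i]; congr 1; omega
    · rw [← e.apply_symm_apply j]; congr 1; omega
  subst h0 h1
  have h' : ¬ Fintype.card ι = 1 := by omega
  exact (dif_neg h').trans (dif_pos h)

lemma Qop_three_of_lt (h : Fintype.card ι = 3) (hij : i < j) (hjk : j < k) :
    Qop P Δ T x = pathOp P T i j k (x i) (x j) (x k) +
      pathOp P T j i k (sgQ P _ (x j)) (x i) (x k) +
      pathOp P T i k j (x i) (x k) (sgQ P _ (x j)) := by
  obtain ⟨h0, h1, h2⟩ : Fintype.orderIsoFinOfCardEq ι h 0 = i ∧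
      Fintype.orderIsoFinOfCardEq ι h 1 = j ∧ Fintype.orderIsoFinOfCardEq ι h 2 = k := by
    generalize Fintype.orderIsoFinOfCardEq ι h = e
    have h1 := e.symm.lt_iff_lt.2 hij
    have h2 := e.symm.lt_iff_lt.2 hjk
    refine ⟨?_, ?_, ?_⟩
    · rw [← e.apply_symm_apply i]; congr 1; omega
    · rw [← e.apply_symm_apply j]; congr 1; omega
    · rw [← e.apply_symm_apply k]; congr 1; omega
  subst h0 h1 h2
  have h' : ¬ Fintype.card ι = 1 := by omega
  have h'' : ¬ Fintype.card ι = 2 := by omega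
  exact (dif_neg h').trans ((dif_neg h'').trans (dif_pos h))

lemma Qop_eq_zero (h1 : Fintype.card ι ≠ 1) (h2 : Fintype.card ι ≠ 2) (h3 : Fintype.card ι ≠ 3) :
    Qop P Δ T x = 0 :=
  (dif_neg h1).trans ((dif_neg h2).trans (dif_neg h3))

lemma exists_lt_of_card_two (h : Fintype.card ι = 2) : ∃ i j : ι, i < j ∧ ∀ k, k = i ∨ k = j := by
  let e := Fintype.orderIsoFinOfCardEq ι h
  refine ⟨e 0, e 1, e.lt_iff_lt.2 (by decide), fun k => ?_⟩
  obtain ⟨k, rfl⟩ := e.surjective k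
  fin_cases k <;> simp

lemma exists_lt_of_card_three (h : Fintype.card ι = 3) :
    ∃ i j k : ι, i < j ∧ j < k ∧ ∀ l, l = i ∨ l = j ∨ l = k := by
  let e := Fintype.orderIsoFinOfCardEq ι h
  refine ⟨e 0, e 1, e 2, e.lt_iff_lt.2 (by decide), e.lt_iff_lt.2 (by decide), fun k => ?_⟩
  obtain ⟨k, rfl⟩ := e.surjective k
  fin_cases k <;> simp

lemma exists_of_Qop_two_ne_zero (h : Fintype.card ι = 2) (h0 : Qop P Δ T x ≠ 0) :
    ∃ i j, i ≠ j ∧ (∀ k, k = i ∨ k = j) ∧ ¬ T.NoEdge i j := by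
  obtain ⟨i, j, hij, hk⟩ := exists_lt_of_card_two h
  rw [Qop_two_of_lt h hij] at h0
  obtain ⟨a, ha, b, hb, hg⟩ := exists_of_edgeOp_ne_zero h0
  exact ⟨i, j, hij.ne, hk, fun hN => (hN a ha b hb).1 hg⟩

lemma exists_of_Qop_three_ne_zero (h : Fintype.card ι = 3) (h0 : Qop P Δ T x ≠ 0) :
    ∃ i j k, i ≠ j ∧ j ≠ k ∧ i ≠ k ∧ (∀ l, l = i ∨ l = j ∨ l = k) ∧ ¬ T.NoEdge i j ∧
      ¬ T.NoEdge j k ∧ 3 ≤ (T.flags i).card ∧ (T.flags j).card = 2 ∧ 3 ≤ (T.flags k).card := by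
  obtain ⟨i, j, k, hij, hjk, hl⟩ := exists_lt_of_card_three h
  rw [Qop_three_of_lt h hij hjk] at h0
  have key : ∀ {i j k : ι} {X Y Z}, pathOp P T i j k X Y Z ≠ 0 → ¬ T.NoEdge i j ∧
      ¬ T.NoEdge j k ∧ 3 ≤ (T.flags i).card ∧ (T.flags j).card = 2 ∧ 3 ≤ (T.flags k).card := by
    intro i j k X Y Z h
    obtain ⟨⟨a, ha, b, hb, h1⟩, ⟨b', hb', d, hd, h2⟩, h3⟩ := exists_of_pathOp_ne_zero h
    exact ⟨fun hN => (hN a ha b hb).1 h1, fun hN => (hN b' hb' d hd).1 h2, h3⟩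
  by_cases h1 : pathOp P T i j k (x i) (x j) (x k) = 0
  · by_cases h2 : pathOp P T j i k (sgQ P _ (x j)) (x i) (x k) = 0
    · rw [h1, h2, zero_add, zero_add] at h0
      exact ⟨i, k, j, (hij.trans hjk).ne, hjk.ne', hij.ne, fun l => (hl l).imp_right Or.symm, key h0⟩
    · exact ⟨j, i, k, hij.ne', (hij.trans hjk).ne, hjk.ne,
        fun l => by rcases hl l with h | h | h <;> simp [h], key h2⟩
  · exact ⟨i, j, k, hij.ne, hjk.ne, (hij.trans hjk).ne, hl, key h1⟩

lemma Qop_two (hΔ : IsCircle P Δ) (h : Fintype.card ι = 2) (hij : i ≠ j) (hE : T.Edge i j a b)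
    (hG : Glue a b (T.flags i) (T.flags j) T.legs)
    (hx : ∀ i, x i ∈ (Q P).gr (T.flags i) (deg i)) :
    Qop P Δ T x = koszul deg i j • mu2 P Δ a b _ _ _ (x i) (x j) := by
  rcases lt_or_gt_of_ne hij with hij | hij
  · rw [koszul_of_lt hij, one_smul, Qop_two_of_lt h hij, edgeOp_eq hE]
  · rw [koszul_of_gt hij, Qop_two_of_lt h hij, edgeOp_eq hE.swap]
    exact mu2_symm hΔ hG.swap (hx j) (hx i)

lemma mu3_smul_left {A B C D : Finset ℕ} (c : ℚ) (X : QObj P A) (Y : QObj P B) (Z : QObj P C) :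
    mu3 P a b d A B C D (c • X) Y Z = c • mu3 P a b d A B C D X Y Z := by
  rw [mu3, mu3, ← mkQ_smul, smul_zero, QObj.hi_smul, map_smul, LinearMap.smul_apply]

lemma mu3_smul_right {A B C D : Finset ℕ} (c : ℚ) (X : QObj P A) (Y : QObj P B) (Z : QObj P C) :
    mu3 P a b d A B C D X Y (c • Z) = c • mu3 P a b d A B C D X Y Z := by
  rw [mu3, mu3, ← mkQ_smul, smul_zero, QObj.hi_smul, map_smul]

lemma Qop_three (h : Fintype.card ι = 3) (hij : i ≠ j) (hjk : j ≠ k)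
    (hik : i ≠ k) (hE : T.Edge i j a b) (hE' : T.Edge j k b' d) (hN : T.NoEdge i k) (hb : b' ≠ b)
    (hG : (T.flags j).card = 2 → Glue a d (T.flags i) (T.flags k) T.legs)
    (hx : ∀ i, x i ∈ (Q P).gr (T.flags i) (deg i)) :
    Qop P Δ T x = (koszul deg i j * koszul deg i k * koszul deg j k) •
      mu3 P a b d _ _ _ _ (x i) (x j) (x k) := by
  wlog hlt : i < k generalizing i k a b b' d
  · have hki := lt_of_le_of_ne (not_lt.1 hlt) hik.symm
    rw [this hjk.symm hij.symm hik.symm hE'.swap hE.swap hN.swap hb.symm (fun h => (hG h).swap) hki]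
    by_cases hB : (T.flags j).card = 2
    swap
    · rw [mu3_of_card_middle hB, mu3_of_card_middle hB, smul_zero, smul_zero]
    rw [mu3_symm (hG hB) hE.snd hE'.fst hb (hx i) (hx j) (hx k), smul_smul, koszul_swap hij,
      koszul_swap hjk, koszul_swap hik]
    congr 1
    rw [zpow_add₀ (by norm_num), zpow_add₀ (by norm_num)]
    ring
  have key : ∀ l, (T.flags j).card ≠ 2 ∨ (x j).lo = 0 ∨
      (-1 : ℚ) ^ (deg l * deg j) = (-1) ^ deg l := by
    intro l
    rcases odd_or_lo_eq_zero (hx j) with ⟨n, hn⟩ | h0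
    · refine .inr (.inr (neg_one_zpow_congr ?_))
      rw [hn]; exact ⟨deg l * n, by ring⟩
    · exact .inr (.inl h0)
  rcases lt_or_gt_of_ne hij with h1 | h1
  · rcases lt_or_gt_of_ne hjk with h2 | h2
    · rw [Qop_three_of_lt h h1 h2, koszul_of_lt h1, koszul_of_lt h2, koszul_of_lt hlt,
        pathOp_eq_zero (.inr hN), pathOp_eq_zero (.inl hN), pathOp_eq hE hE', add_zero,
        add_zero, mul_one, mul_one, one_smul]
    · rw [Qop_three_of_lt h hlt h2, koszul_of_lt h1, koszul_of_gt h2, koszul_of_lt hlt,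
        pathOp_eq_zero (.inl hN), pathOp_eq_zero (.inl hN.swap), pathOp_eq hE hE',
        sgQ_of_mem (hx k), mu3_smul_right]
      rcases key k with h0 | h0 | h0
      · rw [mu3_of_card_middle h0]; simp; rfl
      · rw [mu3_of_lo _ h0]; simp; rfl
      · simp [h0]; rfl
  · rw [Qop_three_of_lt h h1 hlt, koszul_of_gt h1, koszul_of_lt (h1.trans hlt), koszul_of_lt hlt,
      pathOp_eq_zero (.inr hN), pathOp_eq_zero (.inr hN.swap), pathOp_eq hE hE',
      sgQ_of_mem (hx i), mu3_smul_left]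
    rcases key i with h0 | h0 | h0
    · rw [mu3_of_card_middle h0]; simp; rfl
    · rw [mu3_of_lo _ h0]; simp; rfl
    · simp [mul_comm (deg j), h0]; rfl

end

/-! ### Acyclic and connected graphs -/

lemma not_adj_of_isPath {V : Type*} {G : SimpleGraph V} (hG : G.IsAcyclic) {i j : V}
    (p : G.Walk i j) (hp : p.IsPath) (h : 2 ≤ p.length) : ¬ G.Adj i j := by
  intro hij
  have := hG.subsingleton_path i j
  have h1 : (⟨p, hp⟩ : G.Path i j) = ⟨hij.toWalk, by simp [hij.ne]⟩ := Subsingleton.elim _ _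
  have h2 := congrArg (fun q : G.Path i j => (q : G.Walk i j).length) h1
  simp at h2
  omega

lemma exists_adj_of_mem {V : Type*} {G : SimpleGraph V} (hG : G.Connected) {S : Set V} {i j : V}
    (hi : i ∈ S) (hj : j ∉ S) : ∃ k ∈ S, ∃ l, l ∉ S ∧ G.Adj k l := by
  obtain ⟨p⟩ := hG.preconnected i j
  obtain ⟨d, -, h1, h2⟩ := p.exists_boundary_dart S hi hj
  exact ⟨_, h1, _, h2, d.adj⟩

section

variable {V : Type*} {G : SimpleGraph V} (hG : G.IsAcyclic) {i j k l m : V} (hij : G.Adj i j)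
  (hjk : G.Adj j k)
include hG hij hjk

lemma not_adj_of_path_two (hik : i ≠ k) : ¬ G.Adj i k :=
  not_adj_of_isPath hG (.cons hij (.cons hjk .nil))
    (by simp [hij.ne, hjk.ne, hik]) (by simp)

lemma not_adj_of_path_three (hkl : G.Adj k l) (hik : i ≠ k) (hil : i ≠ l) (hjl : j ≠ l) :
    ¬ G.Adj i l :=
  not_adj_of_isPath hG (.cons hij (.cons hjk (.cons hkl .nil)))
    (by simp [hij.ne, hjk.ne, hik, hkl.ne, hil, hjl]) (by simp)

lemma not_adj_of_path_four (hkl : G.Adj k l) (hlm : G.Adj l m) (hik : i ≠ k) (hil : i ≠ l)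
    (hjl : j ≠ l) (him : i ≠ m) (hjm : j ≠ m) (hkm : k ≠ m) : ¬ G.Adj i m :=
  not_adj_of_isPath hG (.cons hij (.cons hjk (.cons hkl (.cons hlm .nil))))
    (by simp [hij.ne, hjk.ne, hik, hkl.ne, hil, hjl, hlm.ne, him, hjm, hkm]) (by simp)

end

/-! ### Restriction and contraction of trees -/

namespace Tree

variable {ι : Type} {T : Tree ι} {i j k l : ι} {a b b' c d : ℕ} {V W U VW WU R : Finset ι}

lemma mem_restrict_legs :
    c ∈ (T.restrict V).legs ↔ (∃ i ∈ V, c ∈ T.flags i) ∧ ∀ b, T.glued c b → ¬ T.FlagOf V b := by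
  simp [restrict]

lemma Edge.restrict (h : T.Edge i j a b) (hi : i ∈ V) (hj : j ∈ V) :
    (T.restrict V).Edge ⟨i, hi⟩ ⟨j, hj⟩ a b :=
  ⟨h.fst, h.snd, ⟨h.glued, ⟨i, hi, h.fst⟩, ⟨j, hj, h.snd⟩⟩, ⟨h.glued_swap, ⟨j, hj, h.snd⟩,
    ⟨i, hi, h.fst⟩⟩, fun a' ha b' hb hab => h.unique a' ha b' hb (hab.imp And.left And.left)⟩

lemma NoEdge.restrict (h : T.NoEdge i j) (hi : i ∈ V) (hj : j ∈ V) :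
    (T.restrict V).NoEdge ⟨i, hi⟩ ⟨j, hj⟩ :=
  fun a ha b hb => ⟨fun hg => (h a ha b hb).1 hg.1, fun hg => (h a ha b hb).2 hg.1⟩

lemma NoEdge.contract_coe {k l : {i // i ∉ V}} (h : T.NoEdge k l) :
    (T.contract V).NoEdge (k : WithBot {i // i ∉ V}) l :=
  fun a ha b hb => ⟨fun hg => (h a ha b hb).1 hg.1, fun hg => (h a ha b hb).2 hg.1⟩

lemma NoEdge.contract_bot {k : {i // i ∉ V}} (h : ∀ j ∈ V, T.NoEdge j k) :
    (T.contract V).NoEdge ⊥ (k : WithBot {i // i ∉ V}) := by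
  intro a ha b hb
  obtain ⟨⟨j, hj, haj⟩, -⟩ := mem_restrict_legs.1 ha
  exact ⟨fun hg => (h j hj a haj b hb).1 hg.1, fun hg => (h j hj a haj b hb).2 hg.1⟩

namespace IsTree

variable (hT : T.IsTree)
include hT

lemma eq_of_mem (hi : a ∈ T.flags i) (hj : a ∈ T.flags j) : i = j := by
  by_contra h
  exact Finset.disjoint_left.1 (hT.disjoint i j h) hi hj

lemma flagOf_iff (hi : a ∈ T.flags i) : T.FlagOf V a ↔ i ∈ V :=
  ⟨fun ⟨_, hj, hj'⟩ => hT.eq_of_mem hi hj' ▸ hj, fun h => ⟨i, h, hi⟩⟩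

lemma not_glued (hi : a ∈ T.flags i) (hj : b ∈ T.flags i) : ¬ T.glued a b := by
  intro h
  obtain ⟨k, l, hkl, hk, hl⟩ := hT.ends a b h
  exact hkl ((hT.eq_of_mem hk hi).trans (hT.eq_of_mem hj hl))

lemma restrict_legs_singleton (i : ι) : (T.restrict {i}).legs = T.flags i := by
  ext c
  rw [mem_restrict_legs]
  constructor
  · rintro ⟨⟨j, hj, hc⟩, -⟩
    rwa [Finset.mem_singleton.1 hj] at hc
  · refine fun hc => ⟨⟨i, Finset.mem_singleton_self i, hc⟩, fun b hb ⟨j, hj, hbj⟩ => ?_⟩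
    rw [Finset.mem_singleton.1 hj] at hbj
    exact hT.not_glued hc hbj hb

lemma restrict_legs_of_forall_mem (hV : ∀ i, i ∈ V) : (T.restrict V).legs = T.legs := by
  ext c
  rw [mem_restrict_legs, hT.mem_legs]
  constructor
  · rintro ⟨⟨i, -, hi⟩, h⟩
    refine ⟨⟨i, hi⟩, fun b hb => h b hb ?_⟩
    obtain ⟨-, l, -, -, hl⟩ := hT.ends c b hb
    exact ⟨l, hV l, hl⟩
  · rintro ⟨⟨i, hi⟩, h⟩
    exact ⟨⟨i, hV i, hi⟩, fun b hb => absurd hb (h b)⟩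

lemma adj_iff : T.graph.Adj i j ↔ i ≠ j ∧ ∃ a ∈ T.flags i, ∃ b ∈ T.flags j, T.glued a b := by
  rw [graph, SimpleGraph.fromRel_adj]
  refine and_congr_right fun _ => or_iff_left_of_imp ?_
  rintro ⟨a, ha, b, hb, h⟩
  exact ⟨b, hb, a, ha, hT.symm _ _ h⟩

lemma exists_edge (h : T.graph.Adj i j) : ∃ a b, T.Edge i j a b := by
  obtain ⟨-, a, ha, b, hb, hab⟩ := hT.adj_iff.1 h
  refine ⟨a, b, ha, hb, hab, hT.symm _ _ hab, fun a' ha' b' hb' h' => ?_⟩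
  have h' : T.glued a' b' := h'.elim id (hT.symm _ _)
  obtain rfl := hT.simple i j a' ha' a ha b' hb' b hb h' hab
  exact ⟨rfl, hT.unique _ _ _ h' hab⟩

lemma noEdge_self : T.NoEdge i i := fun _ ha _ hb => ⟨hT.not_glued ha hb, hT.not_glued hb ha⟩

lemma noEdge (h : ¬ T.graph.Adj i j) : T.NoEdge i j := by
  by_cases hij : i = j
  · exact hij ▸ hT.noEdge_self
  · exact fun a ha b hb => ⟨fun hg => h (hT.adj_iff.2 ⟨hij, a, ha, b, hb, hg⟩),
      fun hg => h (hT.adj_iff.2 ⟨hij, a, ha, b, hb, hT.symm _ _ hg⟩)⟩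

/-- The vertices in `V` span a subtree if they are all adjacent to one of them. -/
lemma restrict (hc : i ∈ V) (h : ∀ j ∈ V, j = i ∨ T.graph.Adj j i) : (T.restrict V).IsTree := by
  have hadj : ∀ j k : {i // i ∈ V}, (T.restrict V).graph.Adj j k ↔ T.graph.Adj j k := by
    intro j k
    rw [hT.adj_iff, graph, SimpleGraph.fromRel_adj, Ne, Subtype.ext_iff]
    refine and_congr_right fun _ => ⟨?_, ?_⟩
    · rintro (⟨a, ha, b, hb, hg⟩ | ⟨a, ha, b, hb, hg⟩)
      · exact ⟨a, ha, b, hb, hg.1⟩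
      · exact ⟨b, hb, a, ha, hT.symm _ _ hg.1⟩
    · rintro ⟨a, ha, b, hb, hg⟩
      exact .inl ⟨a, ha, b, hb, hg, ⟨j, j.2, ha⟩, ⟨k, k.2, hb⟩⟩
  refine ⟨fun j => hT.two_le j, fun j k hjk => hT.disjoint j k fun h => hjk (Subtype.ext h),
    fun a b hab => ⟨hT.symm _ _ hab.1, hab.2.2, hab.2.1⟩, ?_,
    fun a b c hb hc => hT.unique a b c hb.1 hc.1, fun j k a ha a' ha' b hb b' hb' h1 h2 =>
      hT.simple j k a ha a' ha' b hb b' hb' h1.1 h2.1, ⟨?_, ?_⟩, ?_⟩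
  · rintro a b ⟨hab, ⟨j, hj, ha⟩, ⟨k, hk, hb⟩⟩
    refine ⟨⟨j, hj⟩, ⟨k, hk⟩, fun hjk => ?_, ha, hb⟩
    rw [Subtype.mk.injEq] at hjk
    exact hT.not_glued ha (hjk ▸ hb) hab
  · have hr : ∀ j, (T.restrict V).graph.Reachable j ⟨i, hc⟩ := by
      intro j
      rcases h j j.2 with hj | hj
      · rw [show j = ⟨i, hc⟩ from Subtype.ext hj]
      · exact SimpleGraph.Adj.reachable ((hadj j ⟨i, hc⟩).2 hj)
    have : Nonempty {i // i ∈ V} := ⟨⟨i, hc⟩⟩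
    exact ⟨fun j k => (hr j).trans (hr k).symm⟩
  · exact SimpleGraph.IsAcyclic.comap ⟨Subtype.val, fun h => (hadj _ _).1 h⟩
      Subtype.val_injective hT.isTree.isAcyclic
  · intro a
    rw [mem_restrict_legs]
    constructor
    · rintro ⟨⟨j, hj, ha⟩, hg⟩
      exact ⟨⟨⟨j, hj⟩, ha⟩, fun b hb => hg b hb.1 hb.2.2⟩
    · rintro ⟨⟨j, ha⟩, hg⟩
      exact ⟨⟨j, j.2, ha⟩, fun b hb hV => hg b ⟨hb, ⟨j, j.2, ha⟩, hV⟩⟩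

lemma edge_contract_coe {k l : {i // i ∉ V}} (h : T.Edge k l a b) :
    (T.contract V).Edge (k : WithBot {i // i ∉ V}) l a b := by
  have ha : ¬ T.FlagOf V a := fun h' => k.2 ((hT.flagOf_iff h.fst).1 h')
  exact ⟨h.fst, h.snd, ⟨h.glued, fun h' => ha h'.1⟩, ⟨h.glued_swap, fun h' => ha h'.2⟩,
    fun a' ha' b' hb' hg => h.unique a' ha' b' hb' (hg.imp And.left And.left)⟩

lemma edge_contract_bot {k : {i // i ∉ V}} (h : T.Edge j k a b) (hj : j ∈ V)
    (hN : ∀ i ∈ V, i = j ∨ T.NoEdge i k) :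
    (T.contract V).Edge ⊥ (k : WithBot {i // i ∉ V}) a b := by
  have hb : ¬ T.FlagOf V b := fun h' => k.2 ((hT.flagOf_iff h.snd).1 h')
  refine ⟨mem_restrict_legs.2 ⟨⟨j, hj, h.fst⟩, fun b' hb' => ?_⟩, h.snd,
    ⟨h.glued, fun h' => hb h'.2⟩, ⟨h.glued_swap, fun h' => hb h'.1⟩, fun a' ha' b' hb' hg => ?_⟩
  · rwa [← hT.unique a b b' h.glued hb']
  · obtain ⟨⟨i, hi, hai⟩, -⟩ := mem_restrict_legs.1 ha'
    rcases hN i hi with rfl | hN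
    · exact h.unique a' hai b' hb' (hg.imp And.left And.left)
    · rcases hg with hg | hg
      · exact absurd hg.1 (hN a' hai b' hb').1
      · exact absurd hg.1 (hN a' hai b' hb').2

/-- The gluing of two subtrees along the only edge between them. -/
lemma glue [DecidableEq ι] (hVW : Disjoint V W) (hU : U = V ∪ W) (hi : i ∈ V) (hj : j ∈ W)
    (hE : T.Edge i j a b) (hN : ∀ v ∈ V, ∀ w ∈ W, (v = i ∧ w = j) ∨ T.NoEdge v w)
    (hV : 2 ≤ (T.restrict V).legs.card) (hW : 2 ≤ (T.restrict W).legs.card) :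
    Glue a b (T.restrict V).legs (T.restrict W).legs (T.restrict U).legs := by
  subst hU
  have hVW' : ∀ {i}, i ∈ V → i ∉ W := fun h => Finset.disjoint_left.1 hVW h
  have key : ∀ {v w a' b'}, v ∈ V → w ∈ W → a' ∈ T.flags v → b' ∈ T.flags w →
      T.glued a' b' ∨ T.glued b' a' → a' = a ∧ b' = b := by
    intro v w a' b' hv hw ha hb hg
    rcases hN v hv w hw with ⟨rfl, rfl⟩ | h
    · exact hE.unique a' ha b' hb hg
    · exact absurd hg (not_or.2 (h a' ha b' hb))
  refine Glue.of_mem_iff hV hW ?_ ?_ ?_ ?_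
  · refine mem_restrict_legs.2 ⟨⟨i, hi, hE.fst⟩, fun b' hb' h => ?_⟩
    rw [← hT.unique a b b' hE.glued hb', hT.flagOf_iff hE.snd] at h
    exact hVW' h hj
  · refine mem_restrict_legs.2 ⟨⟨j, hj, hE.snd⟩, fun b' hb' h => ?_⟩
    rw [← hT.unique b a b' hE.glued_swap hb', hT.flagOf_iff hE.fst] at h
    exact hVW' hi h
  · intro z hz _ hz'
    obtain ⟨⟨v, hv, hzv⟩, -⟩ := mem_restrict_legs.1 hz
    obtain ⟨⟨w, hw, hzw⟩, -⟩ := mem_restrict_legs.1 hz'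
    exact absurd (hT.eq_of_mem hzv hzw ▸ hw) (hVW' hv)
  · intro z
    simp only [mem_restrict_legs]
    constructor
    · rintro ⟨⟨v, hv, hz⟩, h⟩
      have h1 : ∀ b, T.glued z b → ¬ T.FlagOf V b ∧ ¬ T.FlagOf W b := fun b hb =>
        ⟨fun ⟨k, hk, hk'⟩ => h b hb ⟨k, Finset.mem_union_left _ hk, hk'⟩,
          fun ⟨k, hk, hk'⟩ => h b hb ⟨k, Finset.mem_union_right _ hk, hk'⟩⟩
      rcases Finset.mem_union.1 hv with hv | hv
      · refine .inl ⟨⟨⟨v, hv, hz⟩, fun b hb => (h1 b hb).1⟩, ?_⟩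
        rintro rfl
        exact (h1 b hE.glued).2 ⟨j, hj, hE.snd⟩
      · refine .inr ⟨⟨⟨v, hv, hz⟩, fun b hb => (h1 b hb).2⟩, ?_⟩
        rintro rfl
        exact (h1 a hE.glued_swap).1 ⟨i, hi, hE.fst⟩
    · rintro (⟨⟨⟨v, hv, hz⟩, h⟩, hne⟩ | ⟨⟨⟨v, hv, hz⟩, h⟩, hne⟩)
      · refine ⟨⟨v, Finset.mem_union_left _ hv, hz⟩, ?_⟩
        rintro b' hb' ⟨w, hw, hbw⟩
        rcases Finset.mem_union.1 hw with hw | hw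
        · exact h b' hb' ⟨w, hw, hbw⟩
        · exact hne (key hv hw hz hbw (.inl hb')).1
      · refine ⟨⟨v, Finset.mem_union_right _ hv, hz⟩, ?_⟩
        rintro b' hb' ⟨w, hw, hbw⟩
        rcases Finset.mem_union.1 hw with hw | hw
        · exact hne (key hw hv hbw hz (.inr hb')).2
        · exact h b' hb' ⟨w, hw, hbw⟩

/-- Three subtrees that form a path. -/
lemma chain [DecidableEq ι] (h1 : Disjoint V W) (h2 : Disjoint W U) (h3 : Disjoint V U)
    (hVW : VW = V ∪ W) (hWU : WU = W ∪ U) (hR : R = V ∪ W ∪ U) {j' : ι} (hi : i ∈ V) (hj : j ∈ W)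
    (hj' : j' ∈ W) (hk : k ∈ U) (hE : T.Edge i j a b) (hE' : T.Edge j' k b' d)
    (hN : ∀ v ∈ V, ∀ w ∈ W, (v = i ∧ w = j) ∨ T.NoEdge v w)
    (hN' : ∀ v ∈ W, ∀ w ∈ U, (v = j' ∧ w = k) ∨ T.NoEdge v w)
    (hN'' : ∀ v ∈ V, ∀ w ∈ U, T.NoEdge v w)
    (hV : 2 ≤ (T.restrict V).legs.card) (hW : 2 ≤ (T.restrict W).legs.card)
    (hU : 2 ≤ (T.restrict U).legs.card) :
    Chain a b b' d (T.restrict V).legs (T.restrict W).legs (T.restrict U).legs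
      (T.restrict VW).legs (T.restrict WU).legs (T.restrict R).legs := by
  have g1 := hT.glue h1 hVW hi hj hE hN hV hW
  have g2 := hT.glue h2 hWU hj' hk hE' hN' hW hU
  refine ⟨g1, hT.glue (j := k) (i := j') ?_ (hVW ▸ hR) ?_ hk hE' ?_ g1.two_le hU, g2,
    hT.glue (i := i) (j := j) ?_ (by rw [hWU, hR, Finset.union_assoc]) hi ?_ hE ?_ hV g2.two_le, ?_⟩
  · rw [hVW, Finset.disjoint_union_left]; exact ⟨h3, h2⟩
  · rw [hVW]; exact Finset.mem_union_right _ hj'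
  · intro v hv w hw
    rw [hVW] at hv
    rcases Finset.mem_union.1 hv with hv | hv
    · exact .inr (hN'' v hv w hw)
    · exact hN' v hv w hw
  · rw [hWU, Finset.disjoint_union_right]; exact ⟨h1, h3⟩
  · rw [hWU]; exact Finset.mem_union_left _ hj
  · intro v hv w hw
    rw [hWU] at hw
    rcases Finset.mem_union.1 hw with hw | hw
    · exact hN v hv w hw
    · exact .inr (hN'' v hv w hw)
  · rintro rfl
    have := hT.unique _ _ _ hE.glued_swap hE'.glued
    subst this
    exact Finset.disjoint_left.1 h3 hi (hT.eq_of_mem hE.fst hE'.snd ▸ hk)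

end IsTree

end Tree

/-! ### Multilinearity of the operations -/

section

variable {P : CyclicOperad.{u}} {Δ : ∀ B, P.obj B} {A B C D : Finset ℕ} {a b c d : ℕ}

lemma dQ_add (X Y : QObj P A) : dQ P Δ A (X + Y) = dQ P Δ A X + dQ P Δ A Y := by
  refine QObj.ext ?_ (by simp)
  simp only [dQ_hi, QObj.hi_add, map_add, Finset.sum_add_distrib]
  abel

lemma dQ_smul (t : ℚ) (X : QObj P A) : dQ P Δ A (t • X) = t • dQ P Δ A X := by
  refine QObj.ext ?_ (by simp)
  simp only [dQ_hi, QObj.hi_smul, map_smul, Finset.smul_sum, smul_add]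

lemma sgQ_add (X Y : QObj P A) : sgQ P A (X + Y) = sgQ P A X + sgQ P A Y :=
  QObj.ext (by simp [sgQ_hi]) (by simp [sgQ_lo, add_comm])

lemma sgQ_smul (t : ℚ) (X : QObj P A) : sgQ P A (t • X) = t • sgQ P A X :=
  QObj.ext (by simp [sgQ_hi]) (by simp [sgQ_lo])

lemma mu2_add_left (X X' : QObj P A) (Y : QObj P B) :
    mu2 P Δ a b A B C (X + X') Y = mu2 P Δ a b A B C X Y + mu2 P Δ a b A B C X' Y := by
  rw [mu2, mu2, mu2, ← mkQ_add]
  congr 1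
  · simp only [QObj.hi_add, QObj.lo_add, map_add, LinearMap.add_apply, opd, LinearMap.comp_add,
      TensorProduct.map_add_right]
    abel
  · simp only [QObj.lo_add, map_add, add_mul, neg_add]

lemma mu2_add_right (X : QObj P A) (Y Y' : QObj P B) :
    mu2 P Δ a b A B C X (Y + Y') = mu2 P Δ a b A B C X Y + mu2 P Δ a b A B C X Y' := by
  rw [mu2, mu2, mu2, ← mkQ_add]
  congr 1
  · simp only [QObj.hi_add, QObj.lo_add, map_add, LinearMap.add_apply, opd, LinearMap.comp_add,
      TensorProduct.map_add_right]
    abel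
  · simp only [QObj.lo_add, map_add, mul_add, neg_add]

lemma mu2_smul_left (t : ℚ) (X : QObj P A) (Y : QObj P B) :
    mu2 P Δ a b A B C (t • X) Y = t • mu2 P Δ a b A B C X Y := by
  rw [mu2, mu2, ← mkQ_smul]
  congr 1
  · simp only [QObj.hi_smul, QObj.lo_smul, map_smul, LinearMap.smul_apply, opd,
      LinearMap.comp_smul, TensorProduct.map_smul_right, smul_add]
  · rw [QObj.lo_smul, map_smul, smul_mul_assoc, ← smul_neg, map_smul]

lemma mu2_smul_right (t : ℚ) (X : QObj P A) (Y : QObj P B) :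
    mu2 P Δ a b A B C X (t • Y) = t • mu2 P Δ a b A B C X Y := by
  rw [mu2, mu2, ← mkQ_smul]
  congr 1
  · simp only [QObj.hi_smul, QObj.lo_smul, map_smul, LinearMap.smul_apply, opd,
      LinearMap.comp_smul, TensorProduct.map_smul_right, smul_add]
  · rw [QObj.lo_smul, map_smul, mul_smul_comm, ← smul_neg, map_smul]

lemma mu3_add_left (X X' : QObj P A) (Y : QObj P B) (Z : QObj P C) :
    mu3 P a b d A B C D (X + X') Y Z = mu3 P a b d A B C D X Y Z + mu3 P a b d A B C D X' Y Z := by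
  rw [mu3, mu3, mu3, ← mkQ_add, add_zero, QObj.hi_add, map_add, LinearMap.add_apply]

lemma mu3_add_right (X : QObj P A) (Y : QObj P B) (Z Z' : QObj P C) :
    mu3 P a b d A B C D X Y (Z + Z') = mu3 P a b d A B C D X Y Z + mu3 P a b d A B C D X Y Z' := by
  rw [mu3, mu3, mu3, ← mkQ_add, add_zero, QObj.hi_add, map_add]

lemma mu3_add_middle (X : QObj P A) (Y Y' : QObj P B) (Z : QObj P C) :
    mu3 P a b d A B C D X (Y + Y') Z = mu3 P a b d A B C D X Y Z + mu3 P a b d A B C D X Y' Z := by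
  rw [mu3, mu3, mu3, ← mkQ_add, add_zero, map₂_kernel3, map₂_kernel3, map₂_kernel3, QObj.lo_add,
    map_add, tern, altSum_add]
  rfl

lemma mu3_smul_middle (t : ℚ) (X : QObj P A) (Y : QObj P B) (Z : QObj P C) :
    mu3 P a b d A B C D X (t • Y) Z = t • mu3 P a b d A B C D X Y Z := by
  rw [mu3, mu3, ← mkQ_smul, smul_zero, map₂_kernel3, map₂_kernel3, QObj.lo_smul, map_smul, tern,
    altSum_smul]
  rfl

section

variable {ι : Type} {T : Tree ι} {i j k : ι}

lemma edgeOp_add_left (X X' : QObj P (T.flags i)) (Y : QObj P (T.flags j)) :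
    edgeOp P Δ T i j (X + X') Y = edgeOp P Δ T i j X Y + edgeOp P Δ T i j X' Y := by
  simp only [edgeOp, mu2_add_left, ite_add_zero, Finset.sum_add_distrib]

lemma edgeOp_add_right (X : QObj P (T.flags i)) (Y Y' : QObj P (T.flags j)) :
    edgeOp P Δ T i j X (Y + Y') = edgeOp P Δ T i j X Y + edgeOp P Δ T i j X Y' := by
  simp only [edgeOp, mu2_add_right, ite_add_zero, Finset.sum_add_distrib]

lemma edgeOp_smul_left (t : ℚ) (X : QObj P (T.flags i)) (Y : QObj P (T.flags j)) :
    edgeOp P Δ T i j (t • X) Y = t • edgeOp P Δ T i j X Y := by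
  simp only [edgeOp, Finset.smul_sum, mu2_smul_left, smul_ite, smul_zero]

lemma edgeOp_smul_right (t : ℚ) (X : QObj P (T.flags i)) (Y : QObj P (T.flags j)) :
    edgeOp P Δ T i j X (t • Y) = t • edgeOp P Δ T i j X Y := by
  simp only [edgeOp, Finset.smul_sum, mu2_smul_right, smul_ite, smul_zero]

lemma pathOp_add_left (X X' : QObj P (T.flags i)) (Y : QObj P (T.flags j))
    (Z : QObj P (T.flags k)) :
    pathOp P T i j k (X + X') Y Z = pathOp P T i j k X Y Z + pathOp P T i j k X' Y Z := by
  simp only [pathOp, mu3_add_left, ite_add_zero, Finset.sum_add_distrib]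

lemma pathOp_add_middle (X : QObj P (T.flags i)) (Y Y' : QObj P (T.flags j))
    (Z : QObj P (T.flags k)) :
    pathOp P T i j k X (Y + Y') Z = pathOp P T i j k X Y Z + pathOp P T i j k X Y' Z := by
  simp only [pathOp, mu3_add_middle, ite_add_zero, Finset.sum_add_distrib]

lemma pathOp_add_right (X : QObj P (T.flags i)) (Y : QObj P (T.flags j))
    (Z Z' : QObj P (T.flags k)) :
    pathOp P T i j k X Y (Z + Z') = pathOp P T i j k X Y Z + pathOp P T i j k X Y Z' := by
  simp only [pathOp, mu3_add_right, ite_add_zero, Finset.sum_add_distrib]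

lemma pathOp_smul_left (t : ℚ) (X : QObj P (T.flags i)) (Y : QObj P (T.flags j))
    (Z : QObj P (T.flags k)) :
    pathOp P T i j k (t • X) Y Z = t • pathOp P T i j k X Y Z := by
  simp only [pathOp, Finset.smul_sum, mu3_smul_left, smul_ite, smul_zero]

lemma pathOp_smul_middle (t : ℚ) (X : QObj P (T.flags i)) (Y : QObj P (T.flags j))
    (Z : QObj P (T.flags k)) :
    pathOp P T i j k X (t • Y) Z = t • pathOp P T i j k X Y Z := by
  simp only [pathOp, Finset.smul_sum, mu3_smul_middle, smul_ite, smul_zero]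

lemma pathOp_smul_right (t : ℚ) (X : QObj P (T.flags i)) (Y : QObj P (T.flags j))
    (Z : QObj P (T.flags k)) :
    pathOp P T i j k X Y (t • Z) = t • pathOp P T i j k X Y Z := by
  simp only [pathOp, Finset.smul_sum, mu3_smul_right, smul_ite, smul_zero]

end

lemma castMap_self (S : SymSeq.{u}) (x : S.obj A) : S.castMap A A x = x := by
  simp [SymSeq.castMap]

lemma exists_multilinearMap {ι : Type} [DecidableEq ι] {M : ι → Type*} {N : Type*}
    [∀ i, AddCommGroup (M i)] [∀ i, Module ℚ (M i)] [AddCommGroup N] [Module ℚ N]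
    (F : (∀ i, M i) → N)
    (h1 : ∀ m i x y, F (Function.update m i (x + y)) =
      F (Function.update m i x) + F (Function.update m i y))
    (h2 : ∀ m i (t : ℚ) x, F (Function.update m i (t • x)) = t • F (Function.update m i x)) :
    ∃ f : MultilinearMap ℚ M N, ∀ x, F x = f x :=
  ⟨{ toFun := F
     map_update_add' := fun m i x y => by convert h1 m i x y
     map_update_smul' := fun m i t x => by convert h2 m i t x }, fun _ => rfl⟩

lemma Qop_multilinear {ι : Type} [Fintype ι] [LinearOrder ι] (T : Tree ι) :
    ∃ f : MultilinearMap ℚ (fun i => QObj P (T.flags i)) (QObj P T.legs),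
      ∀ x, Qop P Δ T x = f x := by
  by_cases h1 : Fintype.card ι = 1
  · have : Subsingleton ι := Fintype.card_le_one_iff_subsingleton.1 h1.le
    obtain ⟨i⟩ : Nonempty ι := Fintype.card_pos_iff.1 (by omega)
    obtain ⟨f, hf⟩ := exists_multilinearMap (fun x : ∀ i, QObj P (T.flags i) =>
      ((Q P).castMap (T.flags i) T.legs (dQ P Δ (T.flags i) (x i)) : QObj P T.legs)) (by
        intro m k X Y
        obtain rfl := Subsingleton.elim i k
        simp only [Function.update_self, dQ_add]
        exact map_add _ _ _) (by
        intro m k t X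
        obtain rfl := Subsingleton.elim i k
        simp only [Function.update_self, dQ_smul]
        exact map_smul _ _ _)
    exact ⟨f, fun x => (Qop_one h1 i).trans (hf x)⟩
  by_cases h2 : Fintype.card ι = 2
  · obtain ⟨i, j, hij, hk⟩ := exists_lt_of_card_two h2
    obtain ⟨f, hf⟩ := exists_multilinearMap (fun x : ∀ i, QObj P (T.flags i) =>
      edgeOp P Δ T i j (x i) (x j)) (by
        intro m k X Y
        rcases hk k with rfl | rfl
        · simp only [Function.update_self, Function.update_of_ne hij.ne', edgeOp_add_left]
        · simp only [Function.update_self, Function.update_of_ne hij.ne, edgeOp_add_right]) (by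
        intro m k t X
        rcases hk k with rfl | rfl
        · simp only [Function.update_self, Function.update_of_ne hij.ne', edgeOp_smul_left]
        · simp only [Function.update_self, Function.update_of_ne hij.ne, edgeOp_smul_right])
    exact ⟨f, fun x => (Qop_two_of_lt h2 hij).trans (hf x)⟩
  by_cases h3 : Fintype.card ι = 3
  · obtain ⟨i, j, k, hij, hjk, hl⟩ := exists_lt_of_card_three h3
    have hik := hij.trans hjk
    obtain ⟨f, hf⟩ := exists_multilinearMap (fun x : ∀ i, QObj P (T.flags i) =>
      pathOp P T i j k (x i) (x j) (x k) + pathOp P T j i k (sgQ P _ (x j)) (x i) (x k) +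
        pathOp P T i k j (x i) (x k) (sgQ P _ (x j))) (by
        intro m l X Y
        rcases hl l with rfl | rfl | rfl <;>
        · simp only [Function.update_self, Function.update_of_ne hij.ne,
            Function.update_of_ne hij.ne', Function.update_of_ne hik.ne,
            Function.update_of_ne hik.ne', Function.update_of_ne hjk.ne,
            Function.update_of_ne hjk.ne', pathOp_add_left, pathOp_add_middle, pathOp_add_right,
            sgQ_add]
          abel) (by
        intro m l t X
        rcases hl l with rfl | rfl | rfl <;>
        simp only [Function.update_self, Function.update_of_ne hij.ne,
          Function.update_of_ne hij.ne', Function.update_of_ne hik.ne, Function.update_of_ne hik.ne',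
          Function.update_of_ne hjk.ne, Function.update_of_ne hjk.ne', pathOp_smul_left,
          pathOp_smul_middle, pathOp_smul_right, sgQ_smul, smul_add])
    exact ⟨f, fun x => (Qop_three_of_lt h3 hij hjk).trans (hf x)⟩
  · exact ⟨0, fun x => Qop_eq_zero h1 h2 h3⟩

end

/-! ### Nested operations -/

section

variable {P : CyclicOperad.{u}} {ι : Type} {T : Tree ι} {x : ∀ i, QObj P (T.flags i)} {deg : ι → ℤ}
  {V : Finset ι} {m : ℤ} {y : QObj P (T.restrict V).legs}

lemma card_restrict [Fintype {i // i ∈ V}] : Fintype.card {i // i ∈ V} = V.card :=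
  Fintype.card_of_subtype V fun _ => Iff.rfl

/-- The degrees of a decoration of `T / V`. -/
def contractDeg (V : Finset ι) (m : ℤ) (deg : ι → ℤ) : WithBot {i // i ∉ V} → ℤ :=
  WithBot.recBotCoe m fun i => deg i

lemma contractDec_mem (hy : y ∈ (Q P).gr _ m) (hx : ∀ i, x i ∈ (Q P).gr (T.flags i) (deg i))
    (w : WithBot {i // i ∉ V}) :
    T.contractDec (S := Q P) V y x w ∈ (Q P).gr ((T.contract V).flags w) (contractDeg V m deg w) := by
  induction w using WithBot.recBotCoe with
  | bot => exact hy
  | coe w => exact hx w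

variable [LinearOrder ι]

lemma koszul_bot (k : {i // i ∉ V}) : koszul (contractDeg V m deg) ⊥ k = 1 :=
  koszul_of_lt (WithBot.bot_lt_coe k)

lemma koszul_coe_bot (k : {i // i ∉ V}) :
    koszul (contractDeg V m deg) k ⊥ = (-1) ^ (m * deg k) :=
  koszul_of_gt (WithBot.bot_lt_coe k)

lemma koszul_coe (k l : {i // i ∉ V}) :
    koszul (contractDeg V m deg) (k : WithBot {i // i ∉ V}) l = koszul deg k l := by
  simp only [koszul, WithBot.coe_lt_coe]
  rfl

end

section

variable {P : CyclicOperad.{u}} {Δ : ∀ B, P.obj B} {ι : Type} [Fintype ι] [LinearOrder ι]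
  {T : Tree ι} {i j k l : ι} {a b b' d : ℕ} {x : ∀ i, QObj P (T.flags i)} {deg : ι → ℤ}
  {V : Finset ι} {m : ℤ} {y : QObj P (T.restrict V).legs}

lemma Qop_eq_zero_of_eq_zero (h : x i = 0) : Qop P Δ T x = 0 := by
  obtain ⟨f, hf⟩ := Qop_multilinear (P := P) (Δ := Δ) T
  exact (hf x).trans (f.map_coord_zero i h)

lemma Qop_contract_zero :
    Qop P Δ (T.contract V) (T.contractDec (S := Q P) V (0 : QObj P _) x) = 0 :=
  Qop_eq_zero_of_eq_zero (i := (⊥ : WithBot {i // i ∉ V})) rfl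

lemma card_contract [Fintype {i // i ∉ V}] :
    Fintype.card (WithBot {i // i ∉ V}) + V.card = Fintype.card ι + 1 := by
  have h : Fintype.card (WithBot {i // i ∉ V}) = Fintype.card {i // i ∉ V} + 1 :=
    Fintype.card_option
  have h1 : Fintype.card {i // i ∉ V} = Vᶜ.card := Fintype.card_of_subtype _ (by simp)
  have h2 := V.card_add_card_compl
  omega

variable (hΔ : IsCircle P Δ) (hT : T.IsTree) (hy : y ∈ (Q P).gr _ m)
  (hx : ∀ i, x i ∈ (Q P).gr (T.flags i) (deg i))
include hT hy hx

include hΔ in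
lemma Qop_contract_two (hk : k ∉ V) (hV : ∀ i, i ∈ V ∨ i = k) (hj : j ∈ V) (hE : T.Edge j k a b)
    (hN : ∀ i ∈ V, i = j ∨ T.NoEdge i k) (hG : Glue a b (T.restrict V).legs (T.flags k) T.legs) :
    Qop P Δ (T.contract V) (T.contractDec (S := Q P) V y x) =
      mu2 P Δ a b (T.restrict V).legs (T.flags k) T.legs y (x k) := by
  have hc : Vᶜ = {k} := by
    ext i
    rw [Finset.mem_compl, Finset.mem_singleton]
    exact ⟨fun h => (hV i).resolve_left h, fun h => h ▸ hk⟩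
  have h1 := V.card_add_card_compl
  have h2 := card_contract (V := V)
  rw [hc, Finset.card_singleton] at h1
  have := Qop_two hΔ (by omega) WithBot.bot_ne_coe
    (hT.edge_contract_bot (k := ⟨k, hk⟩) hE hj hN) hG (contractDec_mem hy hx)
  rw [koszul_bot, one_smul] at this
  exact this

lemma Qop_contract_three (hk : k ∉ V) (hl : l ∉ V) (hkl : k ≠ l) (hV : ∀ i, i ∈ V ∨ i = k ∨ i = l)
    (hj : j ∈ V) (hE : T.Edge j k a b) (hE' : T.Edge k l b' d) (hN : ∀ i ∈ V, i = j ∨ T.NoEdge i k)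
    (hN' : ∀ i ∈ V, T.NoEdge i l) (hb : b' ≠ b)
    (hG : (T.flags k).card = 2 → Glue a d (T.restrict V).legs (T.flags l) T.legs) :
    Qop P Δ (T.contract V) (T.contractDec (S := Q P) V y x) = koszul deg k l •
      mu3 P a b d (T.restrict V).legs (T.flags k) (T.flags l) T.legs y (x k) (x l) := by
  have hc : Vᶜ = {k, l} := by
    ext i
    rw [Finset.mem_compl, Finset.mem_insert, Finset.mem_singleton]
    exact ⟨fun h => (hV i).resolve_left h, by rintro (rfl | rfl) <;> assumption⟩
  have h1 := V.card_add_card_compl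
  have h2 := card_contract (V := V)
  rw [hc, Finset.card_pair hkl] at h1
  have := Qop_three (Δ := Δ) (by omega) WithBot.bot_ne_coe
    (fun h => hkl (congrArg Subtype.val (WithBot.coe_injective h))) WithBot.bot_ne_coe
    (hT.edge_contract_bot (k := ⟨k, hk⟩) hE hj hN)
    (hT.edge_contract_coe (k := ⟨k, hk⟩) (l := ⟨l, hl⟩) hE') (Tree.NoEdge.contract_bot hN') hb hG
    (contractDec_mem hy hx)
  rw [koszul_bot, koszul_bot, one_mul, one_mul, koszul_coe] at this
  exact this

lemma Qop_contract_three_middle (hk : k ∉ V) (hl : l ∉ V) (hkl : k ≠ l)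
    (hV : ∀ i, i ∈ V ∨ i = k ∨ i = l) {j' : ι} (hj : j ∈ V) (hj' : j' ∈ V) (hE : T.Edge k j a b)
    (hE' : T.Edge j' l b' d) (hN : ∀ i ∈ V, i = j ∨ T.NoEdge i k)
    (hN' : ∀ i ∈ V, i = j' ∨ T.NoEdge i l) (hkl' : T.NoEdge k l) (hb : b' ≠ b)
    (hG : (T.restrict V).legs.card = 2 → Glue a d (T.flags k) (T.flags l) T.legs) :
    Qop P Δ (T.contract V) (T.contractDec (S := Q P) V y x) =
      ((-1) ^ (m * deg k) * koszul deg k l) •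
      mu3 P a b d (T.flags k) (T.restrict V).legs (T.flags l) T.legs (x k) y (x l) := by
  have hc : Vᶜ = {k, l} := by
    ext i
    rw [Finset.mem_compl, Finset.mem_insert, Finset.mem_singleton]
    exact ⟨fun h => (hV i).resolve_left h, by rintro (rfl | rfl) <;> assumption⟩
  have h1 := V.card_add_card_compl
  have h2 := card_contract (V := V)
  rw [hc, Finset.card_pair hkl] at h1
  have := Qop_three (Δ := Δ) (by omega) WithBot.coe_ne_bot WithBot.bot_ne_coe
    (fun h => hkl (congrArg Subtype.val (WithBot.coe_injective h)))
    (hT.edge_contract_bot (k := ⟨k, hk⟩) hE.swap hj hN).swap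
    (hT.edge_contract_bot (k := ⟨l, hl⟩) hE' hj' hN') hkl'.contract_coe hb hG
    (contractDec_mem hy hx)
  rw [koszul_bot, mul_one, koszul_coe, koszul_coe_bot] at this
  exact this

lemma Qop_contract_three_right (hk : k ∉ V) (hl : l ∉ V) (hkl : k ≠ l)
    (hV : ∀ i, i ∈ V ∨ i = k ∨ i = l)
    (hj : j ∈ V) (hE : T.Edge k l a b) (hE' : T.Edge l j b' d) (hN : ∀ i ∈ V, i = j ∨ T.NoEdge i l)
    (hN' : ∀ i ∈ V, T.NoEdge i k) (hb : b' ≠ b)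
    (hG : (T.flags l).card = 2 → Glue a d (T.flags k) (T.restrict V).legs T.legs) :
    Qop P Δ (T.contract V) (T.contractDec (S := Q P) V y x) =
      (koszul deg k l * (-1) ^ (m * deg k) * (-1) ^ (m * deg l)) •
      mu3 P a b d (T.flags k) (T.flags l) (T.restrict V).legs T.legs (x k) (x l) y := by
  have hc : Vᶜ = {k, l} := by
    ext i
    rw [Finset.mem_compl, Finset.mem_insert, Finset.mem_singleton]
    exact ⟨fun h => (hV i).resolve_left h, by rintro (rfl | rfl) <;> assumption⟩
  have h1 := V.card_add_card_compl
  have h2 := card_contract (V := V)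
  rw [hc, Finset.card_pair hkl] at h1
  have := Qop_three (Δ := Δ) (by omega)
    (fun h => hkl (congrArg Subtype.val (WithBot.coe_injective h))) WithBot.coe_ne_bot
    WithBot.coe_ne_bot (hT.edge_contract_coe (k := ⟨k, hk⟩) (l := ⟨l, hl⟩) hE)
    (hT.edge_contract_bot (k := ⟨l, hl⟩) hE'.swap hj hN).swap
    (Tree.NoEdge.contract_bot (k := ⟨k, hk⟩) hN').swap hb hG
    (contractDec_mem hy hx)
  rw [koszul_coe, koszul_coe_bot, koszul_coe_bot] at this
  exact this

end

section

variable {P : CyclicOperad.{u}} {Δ : ∀ B, P.obj B} {A B C D R : Finset ℕ} {a b b' d : ℕ}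

variable (P) in
/-- The identification of `Q P(A)` with `Q P(C)` for equal sets `A = C` of legs. -/
def castQ (A C : Finset ℕ) : QObj P A →ₗ[ℚ] QObj P C := (Q P).castMap A C

lemma castQ_self (X : QObj P A) : castQ P A A X = X := castMap_self (Q P) X

lemma castQ_eq (h : A = C) (F : ∀ A, QObj P A) : castQ P A C (F A) = F C := by
  subst h; exact castQ_self _

lemma castQ_mem {m : ℤ} {X : QObj P A} (h : A = C) (hX : X ∈ (Q P).gr A m) :
    castQ P A C X ∈ (Q P).gr C m := by
  subst h; rwa [castQ_self]

lemma mu2_castQ_left (h : A = C) (X : QObj P A) (Y : QObj P B) :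
    mu2 P Δ a b C B R (castQ P A C X) Y = mu2 P Δ a b A B R X Y := by
  subst h; rw [castQ_self]

lemma mu3_castQ_left (h : A = C) (X : QObj P A) (Y : QObj P B) (Z : QObj P D) :
    mu3 P a b d C B D R (castQ P A C X) Y Z = mu3 P a b d A B D R X Y Z := by
  subst h; rw [castQ_self]

lemma mu3_castQ_middle (h : A = C) (X : QObj P B) (Y : QObj P A) (Z : QObj P D) :
    mu3 P a b d B C D R X (castQ P A C Y) Z = mu3 P a b d B A D R X Y Z := by
  subst h; rw [castQ_self]

lemma mu3_castQ_right (h : A = C) (X : QObj P B) (Y : QObj P D) (Z : QObj P A) :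
    mu3 P a b d B D C R X Y (castQ P A C Z) = mu3 P a b d B D A R X Y Z := by
  subst h; rw [castQ_self]

end

section

variable {P : CyclicOperad.{u}} {Δ : ∀ B, P.obj B} {ι : Type} [LinearOrder ι] {T : Tree ι}
  {i j k : ι} {a b b' d : ℕ} {x : ∀ i, QObj P (T.flags i)} {deg : ι → ℤ}

lemma Qop_restrict_one [Fintype {l // l ∈ ({i} : Finset ι)}] :
    Qop P Δ (T.restrict {i}) (fun l => x l) =
      castQ P (T.flags i) (T.restrict {i}).legs (dQ P Δ (T.flags i) (x i)) :=
  Qop_one (T := T.restrict {i}) (x := fun l => x l)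
    (by rw [card_restrict, Finset.card_singleton]) ⟨i, Finset.mem_singleton_self i⟩

variable (hx : ∀ i, x i ∈ (Q P).gr (T.flags i) (deg i))
include hx

lemma Qop_restrict_two [Fintype {l // l ∈ ({i, j} : Finset ι)}] (hΔ : IsCircle P Δ)
    (hij : i ≠ j) (hE : T.Edge i j a b)
    (hG : Glue a b (T.flags i) (T.flags j) (T.restrict {i, j}).legs) :
    Qop P Δ (T.restrict {i, j}) (fun l => x l) =
      koszul deg i j • mu2 P Δ a b _ _ (T.restrict {i, j}).legs (x i) (x j) :=
  Qop_two (T := T.restrict {i, j}) (x := fun l => x l) (deg := fun l => deg l) hΔ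
    (by rw [card_restrict, Finset.card_pair hij])
    (i := ⟨i, by simp⟩) (j := ⟨j, by simp⟩) (fun h => hij (congrArg Subtype.val h))
    (hE.restrict _ _) hG (fun l => hx l)

lemma Qop_restrict_three [Fintype {l // l ∈ ({i, j, k} : Finset ι)}]
    (hij : i ≠ j) (hjk : j ≠ k) (hik : i ≠ k) (hE : T.Edge i j a b) (hE' : T.Edge j k b' d)
    (hN : T.NoEdge i k) (hb : b' ≠ b) (hG : (T.flags j).card = 2 →
      Glue a d (T.flags i) (T.flags k) (T.restrict {i, j, k}).legs) :
    Qop P Δ (T.restrict {i, j, k}) (fun l => x l) =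
      (koszul deg i j * koszul deg i k * koszul deg j k) •
        mu3 P a b d _ _ _ (T.restrict {i, j, k}).legs (x i) (x j) (x k) :=
  Qop_three (T := T.restrict {i, j, k}) (x := fun l => x l) (deg := fun l => deg l)
    (by rw [card_restrict, Finset.card_eq_three.2 ⟨i, j, k, hij, hik, hjk, rfl⟩])
    (i := ⟨i, by simp⟩) (j := ⟨j, by simp⟩) (k := ⟨k, by simp⟩)
    (fun h => hij (congrArg Subtype.val h)) (fun h => hjk (congrArg Subtype.val h))
    (fun h => hik (congrArg Subtype.val h)) (hE.restrict _ _) (hE'.restrict _ _) (hN.restrict _ _)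
    hb hG (fun l => hx l)

end

section

variable {ι : Type} [Fintype ι] [LinearOrder ι] {V W : Finset ι} {deg : ι → ℤ}

lemma frontSign_eq (h1 : ∀ i ∈ W, i ∉ V) (h2 : ∀ i, i ∈ V ∨ i ∈ W) :
    frontSign V deg = ∏ i ∈ W, ∏ j ∈ V, koszul deg j i := by
  have : Vᶜ = W := by
    ext i
    rw [Finset.mem_compl]
    exact ⟨fun h => (h2 i).resolve_left h, h1 i⟩
  rw [frontSign, this]
  rfl

lemma frontSign_of_forall_mem (h : ∀ i, i ∈ V) : frontSign V deg = 1 := by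
  rw [frontSign_eq (W := ∅) (by simp) (fun i => .inl (h i)), Finset.prod_empty]

end

section

variable {P : CyclicOperad.{u}} {Δ : ∀ B, P.obj B} {ι : Type} [Fintype ι] [LinearOrder ι]
  {T : Tree ι} {i j k l : ι} {a b b' d : ℕ} {x : ∀ i, QObj P (T.flags i)} {deg : ι → ℤ}
  {V : Finset ι}

variable (P Δ T) in
/-- The nested operation of the subtree spanned by `V`. -/
def nestedQ (V : Finset ι) (x : ∀ i, QObj P (T.flags i)) : QObj P T.legs :=
  TreeOps.nested (Qop P Δ) T V x

lemma nestedQ_eq {y : QObj P (T.restrict V).legs} {z : QObj P T.legs}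
    (h1 : Qop P Δ (T.restrict V) (fun i => x i) = y)
    (h2 : Qop P Δ (T.contract V) (T.contractDec (S := Q P) V y x) = z) : nestedQ P Δ T V x = z :=
  (congrArg (fun y => Qop P Δ (T.contract V) (T.contractDec (S := Q P) V y x)) h1).trans h2

lemma nestedQ_eq_zero (h : Qop P Δ (T.restrict V) (fun i => x i) = 0) : nestedQ P Δ T V x = 0 :=
  nestedQ_eq h Qop_contract_zero

lemma Qop_contract_one (hV : ∀ i, i ∈ V) (y : QObj P (T.restrict V).legs) :
    Qop P Δ (T.contract V) (T.contractDec (S := Q P) V y x) =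
      castQ P (T.restrict V).legs T.legs (dQ P Δ _ y) := by
  have h2 := card_contract (V := V)
  rw [Finset.eq_univ_iff_forall.2 hV, Finset.card_univ] at h2
  have h : Fintype.card (WithBot {i // i ∉ V}) = 1 := by
    rw [Finset.eq_univ_iff_forall.2 hV]; omega
  exact Qop_one (T := T.contract V) (x := T.contractDec (S := Q P) V y x) h ⊥

end

section

variable {ι M : Type*} [DecidableEq ι] [AddCommMonoid M] {i j k : ι}

lemma sum_powerset_pair (hij : i ≠ j) (f : Finset ι → M) :
    ∑ V ∈ ({i, j} : Finset ι).powerset, f V = f ∅ + f {j} + (f {i} + f {i, j}) := by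
  rw [Finset.sum_powerset_insert (by simpa using hij), ← insert_empty_eq j,
    Finset.sum_powerset_insert (by simp), Finset.sum_powerset_insert (by simp)]
  simp only [Finset.powerset_empty, Finset.sum_singleton, insert_empty_eq]

lemma sum_powerset_triple (hij : i ≠ j) (hik : i ≠ k) (hjk : j ≠ k) (f : Finset ι → M) :
    ∑ V ∈ ({i, j, k} : Finset ι).powerset, f V = f ∅ + f {k} + (f {j} + f {j, k}) +
      (f {i} + f {i, k} + (f {i, j} + f {i, j, k})) := by
  rw [Finset.sum_powerset_insert (by simp [hij, hik]), sum_powerset_pair hjk,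
    sum_powerset_pair hjk]
  simp only [insert_empty_eq]

end

lemma Tree.not_isTree_restrict_empty {ι : Type} (T : Tree ι) : ¬ (T.restrict ∅).IsTree := fun h => by
  obtain ⟨i, hi⟩ := h.isTree.nonempty
  exact Finset.notMem_empty i hi

section

variable {ι : Type} {T : Tree ι} (hT : T.IsTree)
include hT

lemma Tree.IsTree.exists_pair [Fintype ι] (h : Fintype.card ι = 2) :
    ∃ i j, i ≠ j ∧ (∀ k, k = i ∨ k = j) ∧ T.graph.Adj i j := by
  classical
  obtain ⟨i, j, hij⟩ := Fintype.exists_pair_of_one_lt_card (α := ι) (by omega)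
  have hc : ∀ k, k = i ∨ k = j := by
    intro k
    have := Finset.eq_univ_of_card {i, j} (by rw [Finset.card_pair hij, h])
    have hk : k ∈ ({i, j} : Finset ι) := this ▸ Finset.mem_univ k
    simpa using hk
  obtain ⟨k, rfl, l, hl, hkl⟩ := exists_adj_of_mem hT.isTree.connected
    (Set.mem_singleton i) (fun h => hij (Set.mem_singleton_iff.1 h).symm : j ∉ ({i} : Set ι))
  obtain rfl := (hc l).resolve_left hl
  exact ⟨k, l, hij, hc, hkl⟩

lemma Tree.IsTree.exists_path_three [Fintype ι] (h : 3 ≤ Fintype.card ι) :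
    ∃ i j k, i ≠ k ∧ T.graph.Adj i j ∧ T.graph.Adj j k := by
  classical
  obtain ⟨i, j, hij⟩ := Fintype.exists_pair_of_one_lt_card (α := ι) (by omega)
  obtain ⟨k, rfl, l, hl, hkl⟩ := exists_adj_of_mem hT.isTree.connected
    (Set.mem_singleton i) (fun h => hij (Set.mem_singleton_iff.1 h).symm : j ∉ ({i} : Set ι))
  obtain ⟨m, hm⟩ : ∃ m, m ∉ ({k, l} : Finset ι) := by
    by_contra! hc
    have := Finset.card_le_two (a := k) (b := l)
    rw [Finset.eq_univ_iff_forall.2 hc, Finset.card_univ] at this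
    omega
  obtain ⟨n, hn, o, ho, hno⟩ := exists_adj_of_mem hT.isTree.connected
    (by simp : k ∈ (({k, l} : Finset ι) : Set ι)) (by exact_mod_cast hm)
  simp only [Finset.coe_insert, Finset.coe_singleton, Set.mem_insert_iff, Set.mem_singleton_iff,
    not_or] at hn ho
  rcases hn with rfl | rfl
  · exact ⟨l, n, o, Ne.symm ho.2, hkl.symm, hno⟩
  · exact ⟨k, n, o, Ne.symm ho.1, hkl, hno⟩

lemma Tree.IsTree.exists_adj_of_notMem {V : Finset ι} {i j : ι} (hi : i ∈ V) (hj : j ∉ V) :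
    ∃ k ∈ V, ∃ l, l ∉ V ∧ T.graph.Adj k l :=
  exists_adj_of_mem hT.isTree.connected (S := V) hi hj

end

/-! ### The relations of trees with at most three vertices -/

section

variable {P : CyclicOperad.{u}} {Δ : ∀ B, P.obj B} {A B C : Finset ℕ} {a b : ℕ}

lemma dQ_castQ (h : A = C) (X : QObj P A) : dQ P Δ C (castQ P A C X) = castQ P A C (dQ P Δ A X) := by
  subst h; rw [castQ_self, castQ_self]

variable {ι : Type} [Fintype ι] [LinearOrder ι] {T : Tree ι} (hΔ : IsCircle P Δ) (hT : T.IsTree)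
  {x : ∀ i, QObj P (T.flags i)} {deg : ι → ℤ} (hx : ∀ i, x i ∈ (Q P).gr (T.flags i) (deg i))
include hΔ hT

lemma relation_card_one (h : Fintype.card ι = 1) {V : Finset ι} (hV : (T.restrict V).IsTree) :
    nestedQ P Δ T V x = 0 := by
  obtain ⟨i, hi⟩ := hV.isTree.nonempty
  have : Subsingleton ι := Fintype.card_le_one_iff_subsingleton.1 h.le
  have hV' : ∀ j, j ∈ V := fun j => Subsingleton.elim i j ▸ hi
  obtain rfl : V = {i} := by
    ext j; simp [hi, Subsingleton.elim j i]
  rw [nestedQ_eq Qop_restrict_one (Qop_contract_one hV' _),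
    dQ_castQ (hT.restrict_legs_singleton i).symm, dQ_dQ hΔ, map_zero, map_zero]

include hx

open Classical in
lemma relation_card_two (h : Fintype.card ι = 2) :
    ∑ V ∈ (Finset.univ : Finset (Finset ι)).filter (fun V => (T.restrict V).IsTree),
      frontSign V deg • nestedQ P Δ T V x = 0 := by
  obtain ⟨i, j, hij, hc, hadj⟩ := hT.exists_pair h
  obtain ⟨a, b, hE⟩ := hT.exists_edge hadj
  have li := hT.restrict_legs_singleton i
  have lj := hT.restrict_legs_singleton j
  have cij : ∀ k, k ∈ ({i, j} : Finset ι) := fun k => by simpa using hc k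
  have lij := hT.restrict_legs_of_forall_mem cij
  have hG := hT.glue (V := {i}) (W := {j}) (U := {i, j}) (by simpa using hij) rfl
    (Finset.mem_singleton_self i) (Finset.mem_singleton_self j) hE (by simp)
    (li ▸ hT.two_le i) (lj ▸ hT.two_le j)
  rw [li, lj] at hG
  have huniv : (Finset.univ : Finset (Finset ι)) = ({i, j} : Finset ι).powerset := by
    rw [← Finset.powerset_univ, Finset.eq_univ_iff_forall.2 cij]
  have ti := hT.restrict (V := {i}) (i := i) (by simp) (by simp)
  have tj := hT.restrict (V := {j}) (i := j) (by simp) (by simp)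
  have tij := hT.restrict (V := {i, j}) (i := i) (by simp) (by simp [hadj.symm])
  have hG' := lij ▸ hG
  have ri : nestedQ P Δ T {i} x = mu2 P Δ a b _ _ T.legs (dQ P Δ _ (x i)) (x j) := by
    rw [nestedQ_eq Qop_restrict_one (Qop_contract_two hΔ hT
      (castQ_mem li.symm (dQ_mem hΔ (hx i))) hx (by simpa using hij.symm)
      (by simpa using hc) (Finset.mem_singleton_self i) hE (by simp) (li.symm ▸ hG')),
      mu2_castQ_left li.symm]
  have rj : nestedQ P Δ T {j} x = (-1 : ℚ) ^ ((deg j + 1) * deg i) •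
      mu2 P Δ a b _ _ T.legs (x i) (dQ P Δ _ (x j)) := by
    rw [nestedQ_eq Qop_restrict_one (Qop_contract_two hΔ hT
      (castQ_mem lj.symm (dQ_mem hΔ (hx j))) hx (by simpa using hij)
      (by simpa [or_comm] using hc) (Finset.mem_singleton_self j) hE.swap (by simp)
      (lj.symm ▸ hG'.swap)), mu2_castQ_left lj.symm, mu2_symm hΔ hG'.swap (dQ_mem hΔ (hx j)) (hx i)]
  have rij : nestedQ P Δ T {i, j} x = koszul deg i j • dQ P Δ _ (mu2 P Δ a b _ _ T.legs (x i) (x j)) := by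
    rw [nestedQ_eq (Qop_restrict_two hx hΔ hij hE hG) (Qop_contract_one cij _), dQ_smul, map_smul,
      castQ_eq lij (fun A => dQ P Δ A (mu2 P Δ a b _ _ A (x i) (x j)))]
  have key := relation_two hΔ hG' (x i) (x j)
  rw [sgQ_of_mem (hx i), mu2_smul_left] at key
  rw [Finset.sum_filter, huniv, sum_powerset_pair hij, if_neg T.not_isTree_restrict_empty, if_pos ti, if_pos tj, if_pos tij, ri, rj, rij,
    frontSign_of_forall_mem cij,
    frontSign_eq (V := {i}) (W := {j}) (by simpa using hij.symm) (by simpa using hc),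
    frontSign_eq (V := {j}) (W := {i}) (by simpa using hij) (by simpa [or_comm] using hc)]
  simp only [Finset.prod_singleton]
  rw [koszul_swap hij, add_mul, one_mul, zpow_add₀ (by norm_num), mul_comm (deg j)]
  have e := neg_one_zpow_mul_self (deg i * deg j)
  generalize (-1 : ℚ) ^ (deg i * deg j) = p at *
  generalize (-1 : ℚ) ^ deg i = q at *
  generalize koszul deg i j = s at *
  refine Eq.trans ?_ ((congrArg (s • ·) key).trans (smul_zero s))
  simp only [smul_smul, smul_add, one_mul]
  rw [show p * s * (p * q) = s * q by linear_combination s * q * e]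
  abel

end

section

variable {P : CyclicOperad.{u}} {Δ : ∀ B, P.obj B}
  {ι : Type} [Fintype ι] [LinearOrder ι] {T : Tree ι} (hΔ : IsCircle P Δ) (hT : T.IsTree)
  {x : ∀ i, QObj P (T.flags i)} {deg : ι → ℤ} (hx : ∀ i, x i ∈ (Q P).gr (T.flags i) (deg i))
include hΔ hT hx

open Classical in
lemma relation_card_three (h : Fintype.card ι = 3) :
    ∑ V ∈ (Finset.univ : Finset (Finset ι)).filter (fun V => (T.restrict V).IsTree),
      frontSign V deg • nestedQ P Δ T V x = 0 := by
  obtain ⟨i, j, k, hik, aij, ajk⟩ := hT.exists_path_three h.ge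
  have hij := aij.ne
  have hjk := ajk.ne
  have cijk : ∀ l, l ∈ ({i, j, k} : Finset ι) := Finset.eq_univ_iff_forall.1
    (Finset.eq_univ_of_card _ (by rw [Finset.card_eq_three.2 ⟨i, j, k, hij, hik, hjk, rfl⟩, h]))
  have hc : ∀ l, l = i ∨ l = j ∨ l = k := by simpa using cijk
  obtain ⟨a, b, hE⟩ := hT.exists_edge aij
  obtain ⟨b', d, hE'⟩ := hT.exists_edge ajk
  have hN := hT.noEdge (not_adj_of_path_two hT.isTree.isAcyclic aij ajk hik)
  have li := hT.restrict_legs_singleton i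
  have lj := hT.restrict_legs_singleton j
  have lk := hT.restrict_legs_singleton k
  have lijk := hT.restrict_legs_of_forall_mem cijk
  have ch := hT.chain (V := {i}) (W := {j}) (U := {k}) (VW := {i, j}) (WU := {j, k})
    (R := {i, j, k}) (by simpa using hij) (by simpa using hjk) (by simpa using hik) rfl rfl (by ext; simp)
    (Finset.mem_singleton_self i) (Finset.mem_singleton_self j) (Finset.mem_singleton_self j)
    (Finset.mem_singleton_self k) hE hE' (by simp) (by simp) (by simpa using hN)
    (li ▸ hT.two_le i) (lj ▸ hT.two_le j) (lk ▸ hT.two_le k)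
  rw [li, lj, lk] at ch
  have ch' := lijk ▸ ch
  have huniv : (Finset.univ : Finset (Finset ι)) = ({i, j, k} : Finset ι).powerset := by
    rw [← Finset.powerset_univ, Finset.eq_univ_iff_forall.2 cijk]
  have ti := hT.restrict (V := {i}) (i := i) (by simp) (by simp)
  have tj := hT.restrict (V := {j}) (i := j) (by simp) (by simp)
  have tk := hT.restrict (V := {k}) (i := k) (by simp) (by simp)
  have tij := hT.restrict (V := {i, j}) (i := i) (by simp) (by simp [aij.symm])
  have tjk := hT.restrict (V := {j, k}) (i := j) (by simp) (by simp [ajk.symm])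
  have tijk := hT.restrict (V := {i, j, k}) (i := j) (by simp) (by simp [ajk.symm, aij])
  have ri : nestedQ P Δ T {i} x = koszul deg j k •
      mu3 P a b d _ _ _ T.legs (dQ P Δ _ (x i)) (x j) (x k) := by
    rw [nestedQ_eq Qop_restrict_one (Qop_contract_three hT
      (castQ_mem li.symm (dQ_mem hΔ (hx i))) hx (k := j) (l := k) (by simpa using hij.symm)
      (by simpa using hik.symm) hjk (by simpa using hc) (Finset.mem_singleton_self i) hE hE'
      (by simp) (by simpa using hN) ch.ne (fun hB => li.symm ▸ ch'.glue hB)),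
      mu3_castQ_left li.symm]
  have rj : nestedQ P Δ T {j} x = 0 := by
    rw [nestedQ_eq Qop_restrict_one (Qop_contract_three_middle hT
      (castQ_mem lj.symm (dQ_mem hΔ (hx j))) hx (k := i) (l := k) (by simpa using hij)
      (by simpa using hjk.symm) hik (by simpa [or_left_comm] using hc) (Finset.mem_singleton_self j)
      (Finset.mem_singleton_self j) hE hE'
      (by simp) (by simp) hN ch.ne (fun hB => ch'.glue (lj ▸ hB))),
      mu3_castQ_middle lj.symm, mu3_of_lo _ (dQ_lo _), smul_zero]
  have rk : nestedQ P Δ T {k} x = (koszul deg i j * (-1) ^ ((deg k + 1) * deg i) *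
      (-1) ^ ((deg k + 1) * deg j)) •
      mu3 P a b d _ _ _ T.legs (x i) (x j) (dQ P Δ _ (x k)) := by
    rw [nestedQ_eq Qop_restrict_one (Qop_contract_three_right hT
      (castQ_mem lk.symm (dQ_mem hΔ (hx k))) hx (k := i) (l := j) (by simpa using hik)
      (by simpa using hjk) hij (by simpa [or_comm, or_left_comm] using hc)
      (Finset.mem_singleton_self k) hE hE'
      (by simp) (by simpa using hN.swap) ch.ne (fun hB => lk.symm ▸ ch'.glue hB)),
      mu3_castQ_right lk.symm]
  have rij : nestedQ P Δ T {i, j} x = koszul deg i j •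
      mu2 P Δ b' d _ _ T.legs (mu2 P Δ a b _ _ (T.restrict {i, j}).legs (x i) (x j)) (x k) := by
    rw [nestedQ_eq (Qop_restrict_two hx hΔ hij hE ch.ab) (Qop_contract_two hΔ hT
      (Submodule.smul_mem _ _ (mu2_mem hΔ ch.ab (hx i) (hx j))) hx (k := k)
      (by simp [hik.symm, hjk.symm]) (by simpa [or_assoc] using hc) (j := j) (by simp) hE'
      (by simp [hN]) ch'.ab_d), mu2_smul_left]
  have rjk : nestedQ P Δ T {j, k} x =
      (koszul deg j k * (-1) ^ ((deg j + deg k + 1) * deg i)) •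
      mu2 P Δ a b _ _ T.legs (x i) (mu2 P Δ b' d _ _ (T.restrict {j, k}).legs (x j) (x k)) := by
    rw [nestedQ_eq (Qop_restrict_two hx hΔ hjk hE' ch.bd) (Qop_contract_two hΔ hT
      (Submodule.smul_mem _ _ (mu2_mem hΔ ch.bd (hx j) (hx k))) hx (k := i)
      (by simp [hik, hij]) (by simpa [or_comm, or_left_comm] using hc) (j := j) (by simp) hE.swap
      (by simp [hN.swap]) ch'.a_bd.swap), mu2_smul_left,
      mu2_symm hΔ ch'.a_bd.swap (mu2_mem hΔ ch.bd (hx j) (hx k)) (hx i), smul_smul]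
  have rijk : nestedQ P Δ T {i, j, k} x = (koszul deg i j * koszul deg i k * koszul deg j k) •
      dQ P Δ _ (mu3 P a b d _ _ _ T.legs (x i) (x j) (x k)) := by
    rw [nestedQ_eq (Qop_restrict_three hx hij hjk hik hE hE' hN ch.ne ch.glue)
      (Qop_contract_one cijk _), dQ_smul, map_smul,
      castQ_eq lijk (fun A => dQ P Δ A (mu3 P a b d _ _ _ A (x i) (x j) (x k)))]
  have rik : nestedQ P Δ T {i, k} x = 0 := by
    refine nestedQ_eq_zero (by_contra fun h0 => ?_)
    obtain ⟨p, q, hpq, -, hne⟩ := exists_of_Qop_two_ne_zero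
      (by rw [card_restrict, Finset.card_pair hik]) h0
    refine hne ?_
    obtain ⟨p, hp⟩ := p
    obtain ⟨q, hq⟩ := q
    refine Tree.NoEdge.restrict ?_ hp hq
    simp only [Finset.mem_insert, Finset.mem_singleton] at hp hq
    rcases hp with rfl | rfl <;> rcases hq with rfl | rfl
    · exact hT.noEdge_self
    · exact hN
    · exact hN.swap
    · exact hT.noEdge_self
  have key := relation_three hΔ ch' (x i) (x j) (x k)
  rw [sgQ_of_mem (hx i), sgQ_of_mem (hx j), mu2_smul_left, mu3_smul_left, mu3_smul_middle] at key
  rw [Finset.sum_filter, huniv, sum_powerset_triple hij hik hjk, if_neg T.not_isTree_restrict_empty,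
    if_pos ti, if_pos tj, if_pos tk, if_pos tij, if_pos tjk, if_pos tijk, ri, rj, rk, rij, rjk, rijk,
    rik, frontSign_of_forall_mem cijk,
    frontSign_eq (V := {i}) (W := {j, k}) (by simp [hij.symm, hik.symm]) (by simpa using hc),
    frontSign_eq (V := {k}) (W := {i, j}) (by simp [hik, hjk])
      (by simpa [or_comm, or_left_comm] using hc),
    frontSign_eq (V := {i, j}) (W := {k}) (by simp [hik.symm, hjk.symm])
      (by simpa [or_assoc] using hc),
    frontSign_eq (V := {j, k}) (W := {i}) (by simp [hik, hij])
      (by simpa [or_comm, or_left_comm] using hc)]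
  rw [Finset.prod_pair hjk, Finset.prod_pair hij, Finset.prod_singleton, Finset.prod_singleton,
    Finset.prod_singleton, Finset.prod_singleton, Finset.prod_singleton, Finset.prod_singleton,
    Finset.prod_pair hij, Finset.prod_pair hjk]
  rw [koszul_swap hij, koszul_swap hik, koszul_swap hjk]
  simp only [add_mul, one_mul, zpow_add₀ (show (-1 : ℚ) ≠ 0 by norm_num)]
  rw [mul_comm (deg j) (deg i), mul_comm (deg k) (deg i), mul_comm (deg k) (deg j)]
  have e1 := neg_one_zpow_mul_self (deg i * deg j)
  have e2 := neg_one_zpow_mul_self (deg i * deg k)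
  have e3 := neg_one_zpow_mul_self (deg j * deg k)
  generalize (-1 : ℚ) ^ (deg i * deg j) = p1 at *
  generalize (-1 : ℚ) ^ (deg i * deg k) = p2 at *
  generalize (-1 : ℚ) ^ (deg j * deg k) = p3 at *
  generalize (-1 : ℚ) ^ deg i = q1 at *
  generalize (-1 : ℚ) ^ deg j = q2 at *
  generalize koszul deg i j = s1 at *
  generalize koszul deg i k = s2 at *
  generalize koszul deg j k = s3 at *
  refine Eq.trans ?_ ((congrArg ((s1 * s2 * s3) • ·) key).trans (smul_zero _))
  simp only [smul_smul, smul_add, one_mul, smul_zero, ite_self]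
  rw [show p2 * s2 * (p3 * s3) * (s1 * (p2 * q1) * (p3 * q2)) = s1 * s2 * s3 * q1 * q2 by
      linear_combination s1 * s2 * s3 * q1 * q2 * (p3 * p3 * e2 + e3),
    show p1 * s1 * (p2 * s2) * (s3 * (p1 * p2 * q1)) = s1 * s2 * s3 * q1 by
      linear_combination s1 * s2 * s3 * q1 * (p2 * p2 * e1 + e2)]
  module

end

/-! ### Nonvanishing nested operations -/

section

variable {P : CyclicOperad.{u}} {Δ : ∀ B, P.obj B}
  {ι : Type} [Fintype ι] [LinearOrder ι] {T : Tree ι} {x : ∀ i, QObj P (T.flags i)}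
  {V : Finset ι}

lemma Qop_restrict_ne_zero (h : nestedQ P Δ T V x ≠ 0) :
    Qop P Δ (T.restrict V) (fun i => x i) ≠ 0 :=
  fun h0 => h (nestedQ_eq_zero h0)

lemma Qop_contract_ne_zero (h : nestedQ P Δ T V x ≠ 0) :
    Qop P Δ (T.contract V)
      (T.contractDec (S := Q P) V (Qop P Δ (T.restrict V) fun i => x i) x) ≠ 0 :=
  h

lemma card_of_nestedQ_ne_zero (h : nestedQ P Δ T V x ≠ 0) :
    1 ≤ V.card ∧ V.card ≤ 3 ∧ Fintype.card ι ≤ V.card + 2 := by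
  have h1 := Qop_restrict_ne_zero h
  have h2 := Qop_contract_ne_zero h
  have h3 := card_contract (V := V)
  have h4 : Fintype.card {i // i ∈ V} = V.card := card_restrict
  constructor
  · by_contra h5
    exact h1 (Qop_eq_zero (by omega) (by omega) (by omega))
  constructor
  · by_contra h5
    exact h1 (Qop_eq_zero (by omega) (by omega) (by omega))
  · by_contra h5
    exact h2 (Qop_eq_zero (by omega) (by omega) (by omega))

lemma exists_of_nestedQ_ne_zero_two (h : nestedQ P Δ T V x ≠ 0) (hV : V.card = 2) :
    ∃ i j, i ≠ j ∧ V = {i, j} ∧ ¬ T.NoEdge i j := by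
  obtain ⟨i, j, hij, hc, hN⟩ := exists_of_Qop_two_ne_zero (card_restrict.trans hV)
    (Qop_restrict_ne_zero h)
  refine ⟨i, j, fun h => hij (Subtype.ext h), ?_, fun h => hN (h.restrict i.2 j.2)⟩
  ext k
  rw [Finset.mem_insert, Finset.mem_singleton]
  constructor
  · exact fun hk => (hc ⟨k, hk⟩).imp (congrArg Subtype.val) (congrArg Subtype.val)
  · rintro (rfl | rfl)
    · exact i.2
    · exact j.2

lemma exists_of_nestedQ_ne_zero_three (h : nestedQ P Δ T V x ≠ 0) (hV : V.card = 3) :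
    ∃ i j k, i ≠ j ∧ j ≠ k ∧ i ≠ k ∧ V = {i, j, k} ∧ ¬ T.NoEdge i j ∧ ¬ T.NoEdge j k ∧
      3 ≤ (T.flags i).card ∧ (T.flags j).card = 2 ∧ 3 ≤ (T.flags k).card := by
  obtain ⟨i, j, k, hij, hjk, hik, hc, hN, hN', hA⟩ := exists_of_Qop_three_ne_zero
    (card_restrict.trans hV) (Qop_restrict_ne_zero h)
  refine ⟨i, j, k, fun h => hij (Subtype.ext h), fun h => hjk (Subtype.ext h),
    fun h => hik (Subtype.ext h), ?_, fun h => hN (h.restrict i.2 j.2),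
    fun h => hN' (h.restrict j.2 k.2), hA⟩
  ext l
  rw [Finset.mem_insert, Finset.mem_insert, Finset.mem_singleton]
  constructor
  · exact fun hl => (hc ⟨l, hl⟩).imp (congrArg Subtype.val)
      (Or.imp (congrArg Subtype.val) (congrArg Subtype.val))
  · rintro (rfl | rfl | rfl)
    · exact i.2
    · exact j.2
    · exact k.2

/-- If the contracted tree has three vertices and the new vertex is an end of it. -/
structure EndContract (T : Tree ι) (V : Finset ι) (k l : ι) : Prop where
  fst : k ∉ V
  snd : l ∉ V
  ne : k ≠ l
  edge : ∃ j ∈ V, ¬ T.NoEdge j k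
  edge' : ¬ T.NoEdge k l
  card : (T.flags k).card = 2
  card' : 3 ≤ (T.flags l).card

lemma exists_of_nestedQ_ne_zero_contract (h : nestedQ P Δ T V x ≠ 0)
    (hV : V.card + 2 = Fintype.card ι) :
    (T.restrict V).legs.card = 2 ∨ ∃ k l, EndContract T V k l := by
  have h3 := card_contract (V := V)
  obtain ⟨i, j, k, hij, hjk, hik, -, hN, hN', hA, hB, hD⟩ := exists_of_Qop_three_ne_zero
    (by omega) (Qop_contract_ne_zero h)
  have hbot : ∀ {v : {i // i ∉ V}}, ¬ (T.contract V).NoEdge ⊥ (v : WithBot {i // i ∉ V}) →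
      ∃ j ∈ V, ¬ T.NoEdge j v := by
    intro v hv
    by_contra! h
    exact hv (Tree.NoEdge.contract_bot h)
  have hcoe : ∀ {v w : {i // i ∉ V}}, ¬ (T.contract V).NoEdge (v : WithBot {i // i ∉ V}) w →
      ¬ T.NoEdge v w := fun hv h => hv h.contract_coe
  induction j using WithBot.recBotCoe with
  | bot => exact .inl hB
  | coe j =>
    right
    induction i using WithBot.recBotCoe with
    | bot =>
      induction k using WithBot.recBotCoe with
      | bot => exact absurd rfl hik
      | coe k =>
        exact ⟨j, k, j.2, k.2, fun h => hjk (congrArg _ (Subtype.ext h)), hbot hN, hcoe hN', hB, hD⟩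
    | coe i =>
      induction k using WithBot.recBotCoe with
      | bot =>
        exact ⟨j, i, j.2, i.2, fun h => hij (congrArg _ (Subtype.ext h.symm)),
          hbot fun h => hN' h.swap, fun h => hcoe hN h.swap, hB, hA⟩
      | coe k =>
        exfalso
        have : Fintype.card {i // i ∉ V} = 2 := by
          have : Fintype.card (WithBot {i // i ∉ V}) = Fintype.card {i // i ∉ V} + 1 :=
            Fintype.card_option
          omega
        have h1 : ({i, j, k} : Finset {i // i ∉ V}).card = 3 :=
          Finset.card_eq_three.2 ⟨i, j, k, fun h => hij (congrArg _ h),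
            fun h => hik (congrArg _ h), fun h => hjk (congrArg _ h), rfl⟩
        have h2 := Finset.card_le_univ ({i, j, k} : Finset {i // i ∉ V})
        omega

end

/-! ### Trees with four vertices -/

section

variable {ι : Type} {T : Tree ι} (hT : T.IsTree)
include hT

lemma Tree.IsTree.three_le_card {c i j k : ι} (h1 : T.graph.Adj c i) (h2 : T.graph.Adj c j)
    (h3 : T.graph.Adj c k) (hij : i ≠ j) (hik : i ≠ k) (hjk : j ≠ k) : 3 ≤ (T.flags c).card := by
  obtain ⟨a, b, e1⟩ := hT.exists_edge h1
  obtain ⟨a', b', e2⟩ := hT.exists_edge h2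
  obtain ⟨a'', b'', e3⟩ := hT.exists_edge h3
  have key : ∀ {i j a b a' b'}, T.Edge c i a b → T.Edge c j a' b' → i ≠ j → a ≠ a' := by
    rintro i j a b a' b' e e' hij rfl
    exact hij (hT.eq_of_mem e.snd (hT.unique _ _ _ e.glued e'.glued ▸ e'.snd))
  exact Finset.two_lt_card.2 ⟨a, e1.fst, a', e2.fst, a'', e3.fst, key e1 e2 hij, key e1 e3 hik,
    key e2 e3 hjk⟩

/-- A tree with four vertices is a path or a star. -/
lemma Tree.IsTree.path_or_star [Fintype ι] (h : Fintype.card ι = 4) :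
    (∃ i j k l, i ≠ k ∧ i ≠ l ∧ j ≠ l ∧ T.graph.Adj i j ∧ T.graph.Adj j k ∧ T.graph.Adj k l) ∨
    ∃ c, 3 ≤ (T.flags c).card ∧ ∀ i, i ≠ c → T.graph.Adj c i := by
  classical
  obtain ⟨i, j, k, hik, hij, hjk⟩ := hT.exists_path_three (by omega)
  have h3 : ({i, j, k} : Finset ι).card = 3 :=
    Finset.card_eq_three.2 ⟨i, j, k, hij.ne, hik, hjk.ne, rfl⟩
  obtain ⟨m, hm⟩ : ∃ m, m ∉ ({i, j, k} : Finset ι) := by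
    by_contra! hc
    rw [Finset.eq_univ_iff_forall.2 hc, Finset.card_univ] at h3
    omega
  obtain ⟨n, hn, l, hl, hnl⟩ := hT.exists_adj_of_notMem (by simp : i ∈ ({i, j, k} : Finset ι)) hm
  simp only [Finset.mem_insert, Finset.mem_singleton, not_or] at hn hl
  obtain ⟨hli, hlj, hlk⟩ := hl
  rcases hn with rfl | rfl | rfl
  · exact .inl ⟨l, n, j, k, hlj, hlk, hik, hnl.symm, hij, hjk⟩
  · refine .inr ⟨n, hT.three_le_card hij.symm hjk hnl hik (Ne.symm hli) (Ne.symm hlk),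
      fun v hv => ?_⟩
    have h4 : ({i, n, k, l} : Finset ι).card = 4 := by
      rw [Finset.card_insert_of_notMem (by simp [hij.ne, hik, Ne.symm hli]),
        Finset.card_eq_three.2 ⟨n, k, l, hjk.ne, Ne.symm hlj, Ne.symm hlk, rfl⟩]
    have hv' : v ∈ ({i, n, k, l} : Finset ι) :=
      Finset.eq_univ_iff_forall.1 (Finset.eq_univ_of_card _ (h4.trans h.symm)) v
    simp only [Finset.mem_insert, Finset.mem_singleton] at hv'
    rcases hv' with rfl | rfl | rfl | rfl
    · exact hij.symm
    · exact absurd rfl hv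
    · exact hjk
    · exact hnl
  · exact .inl ⟨i, j, n, l, hik, Ne.symm hli, Ne.symm hlj, hij, hjk, hnl⟩

variable {P : CyclicOperad.{u}} {Δ : ∀ B, P.obj B} [Fintype ι] [LinearOrder ι]
  {x : ∀ i, QObj P (T.flags i)} {deg : ι → ℤ}

lemma nestedQ_star (h : Fintype.card ι = 4) {c : ι} (hc : 3 ≤ (T.flags c).card)
    (hadj : ∀ i, i ≠ c → T.graph.Adj c i) (V : Finset ι) : nestedQ P Δ T V x = 0 := by
  by_contra h0
  have hleaf : ∀ i j, i ≠ c → j ≠ c → T.NoEdge i j := by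
    intro i j hi hj
    by_cases hij : i = j
    · exact hij ▸ hT.noEdge_self
    · exact hT.noEdge (not_adj_of_path_two hT.isTree.isAcyclic (hadj i hi).symm (hadj j hj) hij)
  obtain ⟨h1, h2, h3⟩ := card_of_nestedQ_ne_zero h0
  have h4 : V.card = 2 ∨ V.card = 3 := by omega
  rcases h4 with hV | hV
  · obtain ⟨i, j, hij, rfl, hN⟩ := exists_of_nestedQ_ne_zero_two h0 hV
    have key : ∃ m, m ≠ c ∧ ({i, j} : Finset ι) = {c, m} := by
      by_cases hi : i = c
      · exact ⟨j, fun hj => hij (hi.trans hj.symm), by rw [hi]⟩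
      · by_cases hj : j = c
        · exact ⟨i, hi, by rw [hj, Finset.pair_comm]⟩
        · exact absurd (hleaf i j hi hj) hN
    obtain ⟨m, hm, hcm⟩ := key
    rw [hcm] at h0 hV
    rcases exists_of_nestedQ_ne_zero_contract h0 (by omega) with h5 | ⟨k, l, hk⟩
    · obtain ⟨a, b, hE⟩ := hT.exists_edge (hadj m hm)
      have lc := hT.restrict_legs_singleton c
      have lm := hT.restrict_legs_singleton m
      have := (hT.glue (V := {c}) (W := {m}) (U := {c, m}) (by simpa using hm.symm) rfl
        (Finset.mem_singleton_self c) (Finset.mem_singleton_self m) hE (by simp)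
        (lc ▸ hT.two_le c) (lm ▸ hT.two_le m)).card
      rw [lc, lm] at this
      have := hT.two_le m
      omega
    · refine hk.edge' (hleaf k l ?_ ?_)
      · rintro rfl; exact hk.fst (by simp)
      · rintro rfl; exact hk.snd (by simp)
  · obtain ⟨i, j, k, hij, hjk, hik, -, hN, hN', hA⟩ := exists_of_nestedQ_ne_zero_three h0 hV
    have hj : j ≠ c := by rintro rfl; omega
    have hi : i = c := by_contra fun hi => hN (hleaf i j hi hj)
    have hk : k = c := by_contra fun hk => hN' (hleaf j k hj hk)
    exact hik (hi.trans hk.symm)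

end

section

variable {ι : Type} [DecidableEq ι] {T : Tree ι} (hT : T.IsTree)
include hT

/-- The five pairs of nested subtrees in a path with four vertices. -/
lemma Tree.IsTree.chain₄ {i j k l : ι} {a b b' d d' e : ℕ} (hij : i ≠ j) (hik : i ≠ k) (hil : i ≠ l)
    (hjk : j ≠ k) (hjl : j ≠ l) (hkl : k ≠ l) (hE : T.Edge i j a b) (hE' : T.Edge j k b' d)
    (hE'' : T.Edge k l d' e) (Nik : T.NoEdge i k) (Nil : T.NoEdge i l) (Njl : T.NoEdge j l)
    (hc : ∀ m, m ∈ ({i, j, k, l} : Finset ι)) :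
    Chain₄ a b b' d d' e (T.flags i) (T.flags j) (T.flags k) (T.flags l)
      (T.restrict {i, j}).legs (T.restrict {j, k}).legs (T.restrict {k, l}).legs
      (T.restrict {i, j, k}).legs (T.restrict {j, k, l}).legs T.legs := by
  have two : ∀ m, 2 ≤ (T.restrict {m}).legs.card := fun m =>
    (hT.restrict_legs_singleton m).symm ▸ hT.two_le m
  have c1 := hT.chain (V := {i}) (W := {j}) (U := {k}) (VW := {i, j}) (WU := {j, k})
    (R := {i, j, k}) (by simpa using hij) (by simpa using hjk) (by simpa using hik) rfl rfl
    (by ext; simp) (Finset.mem_singleton_self i) (Finset.mem_singleton_self j)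
    (Finset.mem_singleton_self j) (Finset.mem_singleton_self k) hE hE' (by simp) (by simp)
    (by simpa using Nik) (two i) (two j) (two k)
  have c2 := hT.chain (V := {j}) (W := {k}) (U := {l}) (VW := {j, k}) (WU := {k, l})
    (R := {j, k, l}) (by simpa using hjk) (by simpa using hkl) (by simpa using hjl) rfl rfl
    (by ext; simp) (Finset.mem_singleton_self j) (Finset.mem_singleton_self k)
    (Finset.mem_singleton_self k) (Finset.mem_singleton_self l) hE' hE'' (by simp) (by simp)
    (by simpa using Njl) (two j) (two k) (two l)
  have c3 := hT.chain (V := {i}) (W := {j}) (U := {k, l}) (VW := {i, j}) (WU := {j, k, l})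
    (R := {i, j, k, l}) (by simpa using hij) (by simp [hjk, hjl]) (by simp [hik, hil])
    rfl rfl (by
      ext; simp only [Finset.mem_union, Finset.mem_insert, Finset.mem_singleton]; tauto) (Finset.mem_singleton_self i)
    (Finset.mem_singleton_self j) (Finset.mem_singleton_self j) (by simp) hE hE' (by simp)
    (by simp [Njl]) (by simp [Nik, Nil]) (two i) (two j) c2.bd.two_le
  have c4 := hT.chain (V := {i, j}) (W := {k}) (U := {l}) (VW := {i, j, k}) (WU := {k, l})
    (R := {i, j, k, l}) (by simp [hik.symm, hjk.symm]) (by simpa using hkl)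
    (by simp [hil.symm, hjl.symm])
    (by ext; simp) rfl (by
      ext; simp only [Finset.mem_union, Finset.mem_insert, Finset.mem_singleton]; tauto) (i := j) (by simp)
    (Finset.mem_singleton_self k) (Finset.mem_singleton_self k) (Finset.mem_singleton_self l)
    hE' hE'' (by simp [Nik]) (by simp) (by simp [Nil, Njl]) c1.ab.two_le (two k) (two l)
  have c5 := hT.chain (V := {i}) (W := {j, k}) (U := {l}) (VW := {i, j, k}) (WU := {j, k, l})
    (R := {i, j, k, l}) (by simp [hij, hik]) (by simp [hjl.symm, hkl.symm])
    (by simpa using hil) rfl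
    (by
      ext; simp only [Finset.mem_union, Finset.mem_insert, Finset.mem_singleton]; tauto)
    (by
      ext; simp only [Finset.mem_union, Finset.mem_insert, Finset.mem_singleton]; tauto)
    (Finset.mem_singleton_self i) (j := j) (j' := k) (by simp) (by simp)
    (Finset.mem_singleton_self l) hE hE'' (by simp [Nik]) (by simp [Njl]) (by simp [Nil])
    (two i) c1.bd.two_le (two l)
  simp only [hT.restrict_legs_singleton, hT.restrict_legs_of_forall_mem hc] at c1 c2 c3 c4 c5
  exact ⟨c1, c2, c3, c4, c5⟩

end

section

variable {P : CyclicOperad.{u}} {Δ : ∀ B, P.obj B}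
  {ι : Type} [Fintype ι] [LinearOrder ι] {T : Tree ι} (hT : T.IsTree) (hΔ : IsCircle P Δ)
  {x : ∀ i, QObj P (T.flags i)} {deg : ι → ℤ} (hx : ∀ i, x i ∈ (Q P).gr (T.flags i) (deg i))
include hT hΔ hx

open Classical in
lemma relation_path_four (h : Fintype.card ι = 4) {i j k l : ι} (hik : i ≠ k) (hil : i ≠ l)
    (hjl : j ≠ l) (aij : T.graph.Adj i j) (ajk : T.graph.Adj j k) (akl : T.graph.Adj k l) :
    ∑ V ∈ (Finset.univ : Finset (Finset ι)).filter (fun V => (T.restrict V).IsTree),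
      frontSign V deg • nestedQ P Δ T V x = 0 := by
  have hij := aij.ne
  have hjk := ajk.ne
  have hkl := akl.ne
  have cijkl : ∀ m, m ∈ ({i, j, k, l} : Finset ι) := Finset.eq_univ_iff_forall.1
    (Finset.eq_univ_of_card _ (by
      rw [Finset.card_insert_of_notMem (by simp [hij, hik, hil]),
        Finset.card_eq_three.2 ⟨j, k, l, hjk, hjl, hkl, rfl⟩, h]))
  have hc : ∀ m, m = i ∨ m = j ∨ m = k ∨ m = l := by simpa using cijkl
  obtain ⟨a, b, hE⟩ := hT.exists_edge aij
  obtain ⟨b', d, hE'⟩ := hT.exists_edge ajk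
  obtain ⟨d', e, hE''⟩ := hT.exists_edge akl
  have hG := hT.isTree.isAcyclic
  have Nik := hT.noEdge (not_adj_of_path_two hG aij ajk hik)
  have Njl := hT.noEdge (not_adj_of_path_two hG ajk akl hjl)
  have Nil := hT.noEdge (not_adj_of_path_three hG aij ajk akl hik hil hjl)
  have ch := hT.chain₄ hij hik hil hjk hjl hkl hE hE' hE'' Nik Nil Njl cijkl
  have tij := hT.restrict (V := {i, j}) (i := i) (by simp) (by simp [aij.symm])
  have tjk := hT.restrict (V := {j, k}) (i := j) (by simp) (by simp [ajk.symm])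
  have tkl := hT.restrict (V := {k, l}) (i := k) (by simp) (by simp [akl.symm])
  have tijk := hT.restrict (V := {i, j, k}) (i := j) (by simp) (by simp [ajk.symm, aij])
  have tjkl := hT.restrict (V := {j, k, l}) (i := k) (by simp) (by simp [akl.symm, ajk])
  have hadj : ∀ p q, ¬ T.NoEdge p q → (p = i ∧ q = j) ∨ (p = j ∧ q = i) ∨ (p = j ∧ q = k) ∨
      (p = k ∧ q = j) ∨ (p = k ∧ q = l) ∨ (p = l ∧ q = k) := by
    intro p q hN
    by_contra! hpq
    refine hN ?_
    rcases hc p with rfl | rfl | rfl | rfl <;> rcases hc q with rfl | rfl | rfl | rfl <;>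
      first
      | exact hT.noEdge_self
      | exact Nik
      | exact Nik.swap
      | exact Njl
      | exact Njl.swap
      | exact Nil
      | exact Nil.swap
      | simp at hpq
  have hzero : ∀ V, nestedQ P Δ T V x ≠ 0 →
      V ∈ ({{i, j}, {j, k}, {k, l}, {i, j, k}, {j, k, l}} : Finset (Finset ι)) := by
    intro V hV
    obtain ⟨-, h2, h3⟩ := card_of_nestedQ_ne_zero hV
    simp only [Finset.mem_insert, Finset.mem_singleton]
    have h4 : V.card = 2 ∨ V.card = 3 := by omega
    rcases h4 with h4 | h4
    · obtain ⟨p, q, -, rfl, hN⟩ := exists_of_nestedQ_ne_zero_two hV h4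
      rcases hadj p q hN with ⟨rfl, rfl⟩ | ⟨rfl, rfl⟩ | ⟨rfl, rfl⟩ | ⟨rfl, rfl⟩ | ⟨rfl, rfl⟩ |
        ⟨rfl, rfl⟩ <;> simp [Finset.pair_comm]
    · obtain ⟨p, q, r, -, -, hpr, rfl, hN, hN', -⟩ := exists_of_nestedQ_ne_zero_three hV h4
      have hrev : ({r, q, p} : Finset ι) = {p, q, r} := by
        ext; simp only [Finset.mem_insert, Finset.mem_singleton]; tauto
      rcases hadj p q hN with ⟨rfl, rfl⟩ | ⟨rfl, rfl⟩ | ⟨rfl, rfl⟩ | ⟨rfl, rfl⟩ | ⟨rfl, rfl⟩ |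
        ⟨rfl, rfl⟩ <;> rcases hadj _ r hN' with ⟨h, rfl⟩ | ⟨h, rfl⟩ | ⟨h, rfl⟩ | ⟨h, rfl⟩ |
        ⟨h, rfl⟩ | ⟨h, rfl⟩ <;> first
        | exact absurd rfl hpr
        | exact absurd h ‹_›
        | exact absurd h.symm ‹_›
        | simp
        | simp [hrev]
  have rij : nestedQ P Δ T {i, j} x = (koszul deg k l * koszul deg i j) •
      mu3 P b' d e _ _ _ T.legs (mu2 P Δ a b _ _ (T.restrict {i, j}).legs (x i) (x j)) (x k)
        (x l) := by
    rw [nestedQ_eq (Qop_restrict_two hx hΔ hij hE ch.abd.ab) (Qop_contract_three hT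
      (Submodule.smul_mem _ _ (mu2_mem hΔ ch.abd.ab (hx i) (hx j))) hx (k := k) (l := l)
      (by simp [hik.symm, hjk.symm]) (by simp [hil.symm, hjl.symm]) hkl (by simpa [or_assoc] using hc)
      (j := j) (by simp) hE' hE'' (by simp [Nik]) (by simp [Nil, Njl]) ch.ab_d_e.ne
      ch.ab_d_e.glue), mu3_smul_left, smul_smul]
  have rjk : nestedQ P Δ T {j, k} x =
      ((-1) ^ ((deg j + deg k + 1) * deg i) * koszul deg i l * koszul deg j k) •
      mu3 P a b e _ _ _ T.legs (x i) (mu2 P Δ b' d _ _ (T.restrict {j, k}).legs (x j) (x k))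
        (x l) := by
    rw [nestedQ_eq (Qop_restrict_two hx hΔ hjk hE' ch.abd.bd) (Qop_contract_three_middle hT
      (Submodule.smul_mem _ _ (mu2_mem hΔ ch.abd.bd (hx j) (hx k))) hx (k := i) (l := l)
      (by simp [hij, hik]) (by simp [hjl.symm, hkl.symm]) hil
      (by simpa [or_comm, or_left_comm, or_assoc] using hc)
      (j := j) (j' := k) (by simp) (by simp) hE hE'' (by simp [Nik.swap]) (by simp [Njl]) Nil
      ch.a_bd_e.ne ch.a_bd_e.glue), mu3_smul_middle, smul_smul]
  have rkl : nestedQ P Δ T {k, l} x =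
      (koszul deg i j * (-1) ^ ((deg k + deg l + 1) * deg i) *
        (-1) ^ ((deg k + deg l + 1) * deg j) * koszul deg k l) •
      mu3 P a b d _ _ _ T.legs (x i) (x j)
        (mu2 P Δ d' e _ _ (T.restrict {k, l}).legs (x k) (x l)) := by
    rw [nestedQ_eq (Qop_restrict_two hx hΔ hkl hE'' ch.bde.bd) (Qop_contract_three_right hT
      (Submodule.smul_mem _ _ (mu2_mem hΔ ch.bde.bd (hx k) (hx l))) hx (k := i) (l := j)
      (by simp [hik, hil]) (by simp [hjk, hjl]) hij
      (by simpa [or_comm, or_left_comm, or_assoc] using hc)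
      (j := k) (by simp) hE hE' (by simp [Njl.swap]) (by simp [Nik.swap, Nil.swap])
      ch.a_b_de.ne ch.a_b_de.glue), mu3_smul_right, smul_smul]
  have rijk : nestedQ P Δ T {i, j, k} x =
      (koszul deg i j * koszul deg i k * koszul deg j k) •
      mu2 P Δ d' e _ _ T.legs (mu3 P a b d _ _ _ (T.restrict {i, j, k}).legs (x i) (x j) (x k))
        (x l) := by
    by_cases hB : (T.flags j).card = 2
    swap
    · rw [mu3_of_card_middle hB, mu2_zero_left, smul_zero]
      exact nestedQ_eq_zero ((Qop_restrict_three hx hij hjk hik hE hE' Nik ch.abd.ne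
        ch.abd.glue).trans (by rw [mu3_of_card_middle hB, smul_zero]; rfl))
    rw [nestedQ_eq (Qop_restrict_three hx hij hjk hik hE hE' Nik ch.abd.ne ch.abd.glue)
      (Qop_contract_two hΔ hT (Submodule.smul_mem _ _ (mu3_mem (ch.abd.glue hB) (hx i) (hx j) (hx k))) hx
      (k := l) (by simp [hil.symm, hjl.symm, hkl.symm]) (by simpa [or_assoc] using hc)
      (j := k) (by simp) hE'' (by simp [Nil, Njl]) ch.a_bd_e.ab_d), mu2_smul_left]
  have rjkl : nestedQ P Δ T {j, k, l} x =
      (koszul deg j k * koszul deg j l * koszul deg k l *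
        (-1) ^ ((deg j + deg k + deg l + 1) * deg i)) •
      mu2 P Δ a b _ _ T.legs (x i)
        (mu3 P b' d e _ _ _ (T.restrict {j, k, l}).legs (x j) (x k) (x l)) := by
    by_cases hB : (T.flags k).card = 2
    swap
    · rw [mu3_of_card_middle hB, mu2_zero_right, smul_zero]
      exact nestedQ_eq_zero ((Qop_restrict_three hx hjk hkl hjl hE' hE'' Njl ch.bde.ne
        ch.bde.glue).trans (by rw [mu3_of_card_middle hB, smul_zero]; rfl))
    have hm := mu3_mem (b := d) (ch.bde.glue hB) (hx j) (hx k) (hx l)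
    rw [nestedQ_eq (Qop_restrict_three hx hjk hkl hjl hE' hE'' Njl ch.bde.ne ch.bde.glue)
      (Qop_contract_two hΔ hT (Submodule.smul_mem _ _ hm) hx
      (k := i) (by simp [hij, hik, hil]) (by simpa [or_comm, or_left_comm, or_assoc] using hc)
      (j := j) (by simp) hE.swap (by simp [Nil.swap, Nik.swap]) ch.a_b_de.a_bd.swap), mu2_smul_left,
      mu2_symm hΔ ch.a_b_de.a_bd.swap hm (hx i), smul_smul]
  have key := relation_four hΔ ch (x i) (x j) (x k) (x l)
  rw [sgQ_of_mem (hx i), sgQ_of_mem (hx j), mu3_smul_left, mu3_smul_left, mu3_smul_middle,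
    mu2_smul_left] at key
  have n1 : ({i, j} : Finset ι) ∉ ({{j, k}, {k, l}, {i, j, k}, {j, k, l}} : Finset (Finset ι)) := by
    simp only [Finset.mem_insert, Finset.mem_singleton, not_or]
    exact ⟨ne_of_mem_of_not_mem' (a := i) (by simp) (by simp [hij, hik]),
      ne_of_mem_of_not_mem' (a := i) (by simp) (by simp [hik, hil]),
      (ne_of_mem_of_not_mem' (a := k) (by simp) (by simp [hik.symm, hjk.symm])).symm,
      ne_of_mem_of_not_mem' (a := i) (by simp) (by simp [hij, hik, hil])⟩
  have n2 : ({j, k} : Finset ι) ∉ ({{k, l}, {i, j, k}, {j, k, l}} : Finset (Finset ι)) := by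
    simp only [Finset.mem_insert, Finset.mem_singleton, not_or]
    exact ⟨ne_of_mem_of_not_mem' (a := j) (by simp) (by simp [hjk, hjl]),
      (ne_of_mem_of_not_mem' (a := i) (by simp) (by simp [hij, hik])).symm,
      (ne_of_mem_of_not_mem' (a := l) (by simp) (by simp [hjl.symm, hkl.symm])).symm⟩
  have n3 : ({k, l} : Finset ι) ∉ ({{i, j, k}, {j, k, l}} : Finset (Finset ι)) := by
    simp only [Finset.mem_insert, Finset.mem_singleton, not_or]
    exact ⟨ne_of_mem_of_not_mem' (a := l) (by simp) (by simp [hil.symm, hjl.symm, hkl.symm]),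
      (ne_of_mem_of_not_mem' (a := j) (by simp) (by simp [hjk, hjl])).symm⟩
  have n4 : ({i, j, k} : Finset ι) ∉ ({{j, k, l}} : Finset (Finset ι)) := by
    rw [Finset.mem_singleton]
    exact ne_of_mem_of_not_mem' (a := i) (by simp) (by simp [hij, hik, hil])
  rw [← Finset.sum_subset (s₁ := {{i, j}, {j, k}, {k, l}, {i, j, k}, {j, k, l}}) (by
      intro V hV
      simp only [Finset.mem_insert, Finset.mem_singleton] at hV
      rw [Finset.mem_filter]
      rcases hV with rfl | rfl | rfl | rfl | rfl <;>
        exact ⟨Finset.mem_univ _, by assumption⟩)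
    (fun V _ hV => by rw [not_imp_comm.1 (hzero V) hV, smul_zero]),
    Finset.sum_insert n1, Finset.sum_insert n2, Finset.sum_insert n3, Finset.sum_insert n4,
    Finset.sum_singleton, rij, rjk, rkl, rijk, rjkl,
    frontSign_eq (V := {i, j}) (W := {k, l}) (by simp [hik.symm, hjk.symm, hil.symm, hjl.symm])
      (by simpa [or_assoc] using hc),
    frontSign_eq (V := {j, k}) (W := {i, l}) (by simp [hij, hik, hjl.symm, hkl.symm])
      (by simpa [or_comm, or_left_comm, or_assoc] using hc),
    frontSign_eq (V := {k, l}) (W := {i, j}) (by simp [hik, hil, hjk, hjl])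
      (by simpa [or_comm, or_left_comm, or_assoc] using hc),
    frontSign_eq (V := {i, j, k}) (W := {l}) (by simp [hil.symm, hjl.symm, hkl.symm])
      (by simpa [or_assoc] using hc),
    frontSign_eq (V := {j, k, l}) (W := {i}) (by simp [hij, hik, hil])
      (by simpa [or_comm, or_left_comm, or_assoc] using hc)]
  simp only [Finset.prod_insert, Finset.prod_singleton, Finset.mem_insert, Finset.mem_singleton,
    hij, hik, hil, hjk, hjl, hkl, or_self, not_false_eq_true]
  rw [koszul_swap hij, koszul_swap hik, koszul_swap hil, koszul_swap hjk, koszul_swap hjl]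
  simp only [add_mul, one_mul, zpow_add₀ (show (-1 : ℚ) ≠ 0 by norm_num)]
  rw [mul_comm (deg j) (deg i), mul_comm (deg k) (deg i), mul_comm (deg k) (deg j),
    mul_comm (deg l) (deg i), mul_comm (deg l) (deg j)]
  have e1 := neg_one_zpow_mul_self (deg i * deg j)
  have e2 := neg_one_zpow_mul_self (deg i * deg k)
  have e3 := neg_one_zpow_mul_self (deg i * deg l)
  have e4 := neg_one_zpow_mul_self (deg j * deg k)
  have e5 := neg_one_zpow_mul_self (deg j * deg l)
  generalize (-1 : ℚ) ^ (deg i * deg j) = p1 at *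
  generalize (-1 : ℚ) ^ (deg i * deg k) = p2 at *
  generalize (-1 : ℚ) ^ (deg i * deg l) = p3 at *
  generalize (-1 : ℚ) ^ (deg j * deg k) = p4 at *
  generalize (-1 : ℚ) ^ (deg j * deg l) = p5 at *
  generalize (-1 : ℚ) ^ deg i = q1 at *
  generalize (-1 : ℚ) ^ deg j = q2 at *
  generalize koszul deg i j = s1 at *
  generalize koszul deg i k = s2 at *
  generalize koszul deg i l = s3 at *
  generalize koszul deg j k = s4 at *
  generalize koszul deg j l = s5 at *
  generalize koszul deg k l = s6 at *
  refine Eq.trans ?_ ((congrArg ((s1 * s2 * s3 * s4 * s5 * s6) • ·) key).trans (smul_zero _))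
  simp only [smul_smul, smul_add, ← add_assoc]
  rw [show p1 * s1 * (p2 * s2) * (s5 * s6) * (p1 * p2 * q1 * s3 * s4) =
      s1 * s2 * s3 * s4 * s5 * s6 * q1 by
      linear_combination s1 * s2 * s3 * s4 * s5 * s6 * q1 * (p2 * p2 * e1 + e2),
    show p2 * s2 * (p3 * s3) * (p4 * s4 * (p5 * s5)) *
        (s1 * (p2 * p3 * q1) * (p4 * p5 * q2) * s6) = s1 * s2 * s3 * s4 * s5 * s6 * (q1 * q2) by
      linear_combination s1 * s2 * s3 * s4 * s5 * s6 * q1 * q2 *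
        (p3 * p3 * p4 * p4 * p5 * p5 * e2 + p4 * p4 * p5 * p5 * e3 + p5 * p5 * e4 + e5),
    show p1 * s1 * (p2 * s2 * (p3 * s3)) * (s4 * s5 * s6 * (p1 * p2 * p3 * q1)) =
        s1 * s2 * s3 * s4 * s5 * s6 * q1 by
      linear_combination s1 * s2 * s3 * s4 * s5 * s6 * q1 *
        (p2 * p2 * p3 * p3 * e1 + p3 * p3 * e2 + e3)]
  module

open Classical in
lemma relation_card_four (h : Fintype.card ι = 4) :
    ∑ V ∈ (Finset.univ : Finset (Finset ι)).filter (fun V => (T.restrict V).IsTree),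
      frontSign V deg • nestedQ P Δ T V x = 0 := by
  rcases hT.path_or_star h with ⟨i, j, k, l, hik, hil, hjl, aij, ajk, akl⟩ | ⟨c, hc, hadj⟩
  · exact relation_path_four hT hΔ hx h hik hil hjl aij ajk akl
  · exact Finset.sum_eq_zero fun V _ => by rw [nestedQ_star hT h hc hadj V, smul_zero]

end

section

variable {P : CyclicOperad.{u}} {Δ : ∀ B, P.obj B} {ι : Type} [Fintype ι] [LinearOrder ι]
  {T : Tree ι} {x : ∀ i, QObj P (T.flags i)} {deg : ι → ℤ}

open Classical in
lemma relation_of_six_le_card (h : 6 ≤ Fintype.card ι) :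
    ∑ V ∈ (Finset.univ : Finset (Finset ι)).filter (fun V => (T.restrict V).IsTree),
      frontSign V deg • nestedQ P Δ T V x = 0 :=
  Finset.sum_eq_zero fun V _ => by
    have hV : nestedQ P Δ T V x = 0 := by
      by_contra hV
      have := card_of_nestedQ_ne_zero hV
      omega
    rw [hV, smul_zero]

end

/-! ### Trees with five vertices -/

section

variable {ι : Type} {T : Tree ι}

/-- A path with five vertices of which the first, the third and the last have arity at least
three, and the others have arity two. -/
structure PathFive (T : Tree ι) (i j k l m : ι) : Prop where
  ne : i ≠ j ∧ i ≠ k ∧ i ≠ l ∧ i ≠ m ∧ j ≠ k ∧ j ≠ l ∧ j ≠ m ∧ k ≠ l ∧ k ≠ m ∧ l ≠ m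
  adj : T.graph.Adj i j ∧ T.graph.Adj j k ∧ T.graph.Adj k l ∧ T.graph.Adj l m
  card : 3 ≤ (T.flags i).card ∧ (T.flags j).card = 2 ∧ 3 ≤ (T.flags k).card ∧
    (T.flags l).card = 2 ∧ 3 ≤ (T.flags m).card

variable [Fintype ι] [LinearOrder ι] (hT : T.IsTree)
  {P : CyclicOperad.{u}} {Δ : ∀ B, P.obj B} {x : ∀ i, QObj P (T.flags i)} {deg : ι → ℤ}
include hT

lemma exists_pathFive (h : Fintype.card ι = 5) {V : Finset ι} (hV : nestedQ P Δ T V x ≠ 0) :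
    ∃ i j k l m, PathFive T i j k l m := by
  have hadj : ∀ {i j}, ¬ T.NoEdge i j → T.graph.Adj i j := fun hN =>
    by_contra fun h => hN (hT.noEdge h)
  obtain ⟨-, h2, h3⟩ := card_of_nestedQ_ne_zero hV
  obtain ⟨i, j, k, hij, hjk, hik, rfl, hN, hN', hi, hj, hk⟩ :=
    exists_of_nestedQ_ne_zero_three hV (by omega)
  have aij := hadj hN
  have ajk := hadj hN'
  obtain ⟨a, b, hE⟩ := hT.exists_edge aij
  obtain ⟨b', d, hE'⟩ := hT.exists_edge ajk
  have Nik := hT.noEdge (not_adj_of_path_two hT.isTree.isAcyclic aij ajk hik)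
  have two : ∀ m, 2 ≤ (T.restrict {m}).legs.card := fun m =>
    (hT.restrict_legs_singleton m).symm ▸ hT.two_le m
  have ch := hT.chain (V := {i}) (W := {j}) (U := {k}) (VW := {i, j}) (WU := {j, k})
    (R := {i, j, k}) (by simpa using hij) (by simpa using hjk) (by simpa using hik) rfl rfl
    (by ext; simp) (Finset.mem_singleton_self i) (Finset.mem_singleton_self j)
    (Finset.mem_singleton_self j) (Finset.mem_singleton_self k) hE hE' (by simp) (by simp)
    (by simpa using Nik) (two i) (two j) (two k)
  simp only [hT.restrict_legs_singleton] at ch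
  have h4 := ch.ab.card
  have h5 := ch.ab_d.card
  rcases exists_of_nestedQ_ne_zero_contract hV (by omega) with h6 | ⟨l, m, hlm⟩
  · omega
  have hl := hlm.fst
  have hm := hlm.snd
  simp only [Finset.mem_insert, Finset.mem_singleton, not_or] at hl hm
  have alm := hadj hlm.edge'
  obtain ⟨n, hn, hnl⟩ := hlm.edge
  simp only [Finset.mem_insert, Finset.mem_singleton] at hn
  rcases hn with rfl | rfl | rfl
  · exact ⟨k, j, n, l, m, ⟨hjk.symm, hik.symm, Ne.symm hl.2.2, Ne.symm hm.2.2, hij.symm,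
      Ne.symm hl.2.1, Ne.symm hm.2.1, Ne.symm hl.1, Ne.symm hm.1, hlm.ne⟩,
      ⟨ajk.symm, aij.symm, hadj hnl, alm⟩, ⟨hk, hj, hi, hlm.card, hlm.card'⟩⟩
  · have := hT.three_le_card aij.symm ajk (hadj hnl) hik (Ne.symm hl.1) (Ne.symm hl.2.2)
    omega
  · exact ⟨i, j, n, l, m, ⟨hij, hik, Ne.symm hl.1, Ne.symm hm.1, hjk,
      Ne.symm hl.2.1, Ne.symm hm.2.1, Ne.symm hl.2.2, Ne.symm hm.2.2, hlm.ne⟩,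
      ⟨aij, ajk, hadj hnl, alm⟩, ⟨hi, hj, hk, hlm.card, hlm.card'⟩⟩

variable (hx : ∀ i, x i ∈ (Q P).gr (T.flags i) (deg i))
include hx

open Classical in
lemma relation_pathFive (h : Fintype.card ι = 5) {i j k l m : ι} (hP : PathFive T i j k l m) :
    ∑ V ∈ (Finset.univ : Finset (Finset ι)).filter (fun V => (T.restrict V).IsTree),
      frontSign V deg • nestedQ P Δ T V x = 0 := by
  obtain ⟨⟨hij, hik, hil, him, hjk, hjl, hjm, hkl, hkm, hlm⟩, ⟨aij, ajk, akl, alm⟩,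
    ⟨fi, fj, fk, fl, fm⟩⟩ := hP
  have cV : ∀ n, n ∈ ({i, j, k, l, m} : Finset ι) := Finset.eq_univ_iff_forall.1
    (Finset.eq_univ_of_card _ (by
      rw [Finset.card_insert_of_notMem (by simp [hij, hik, hil, him]),
        Finset.card_insert_of_notMem (by simp [hjk, hjl, hjm]),
        Finset.card_eq_three.2 ⟨k, l, m, hkl, hkm, hlm, rfl⟩, h]))
  have hc : ∀ n, n = i ∨ n = j ∨ n = k ∨ n = l ∨ n = m := by simpa using cV
  obtain ⟨a, x₁, hE⟩ := hT.exists_edge aij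
  obtain ⟨x₂, b, hE'⟩ := hT.exists_edge ajk
  obtain ⟨b', y₁, hF⟩ := hT.exists_edge akl
  obtain ⟨y₂, d, hF'⟩ := hT.exists_edge alm
  have hG := hT.isTree.isAcyclic
  have Nik := hT.noEdge (not_adj_of_path_two hG aij ajk hik)
  have Njl := hT.noEdge (not_adj_of_path_two hG ajk akl hjl)
  have Nkm := hT.noEdge (not_adj_of_path_two hG akl alm hkm)
  have Nil := hT.noEdge (not_adj_of_path_three hG aij ajk akl hik hil hjl)
  have Njm := hT.noEdge (not_adj_of_path_three hG ajk akl alm hjl hjm hkm)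
  have Nim := hT.noEdge (not_adj_of_path_four hG aij ajk akl alm hik hil hjl him hjm hkm)
  have tijk := hT.restrict (V := {i, j, k}) (i := j) (by simp) (by simp [ajk.symm, aij])
  have tklm := hT.restrict (V := {k, l, m}) (i := l) (by simp) (by simp [alm.symm, akl])
  have two : ∀ m, 2 ≤ (T.restrict {m}).legs.card := fun m =>
    (hT.restrict_legs_singleton m).symm ▸ hT.two_le m
  have c1 := hT.chain (V := {i}) (W := {j}) (U := {k}) (VW := {i, j}) (WU := {j, k})
    (R := {i, j, k}) (by simpa using hij) (by simpa using hjk) (by simpa using hik) rfl rfl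
    (by ext; simp) (Finset.mem_singleton_self i) (Finset.mem_singleton_self j)
    (Finset.mem_singleton_self j) (Finset.mem_singleton_self k) hE hE' (by simp) (by simp)
    (by simpa using Nik) (two i) (two j) (two k)
  have c2 := hT.chain (V := {k}) (W := {l}) (U := {m}) (VW := {k, l}) (WU := {l, m})
    (R := {k, l, m}) (by simpa using hkl) (by simpa using hlm) (by simpa using hkm) rfl rfl
    (by ext; simp) (Finset.mem_singleton_self k) (Finset.mem_singleton_self l)
    (Finset.mem_singleton_self l) (Finset.mem_singleton_self m) hF hF' (by simp) (by simp)
    (by simpa using Nkm) (two k) (two l) (two m)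
  have c3 := hT.chain (V := {j}) (W := {k}) (U := {l}) (VW := {j, k}) (WU := {k, l})
    (R := {j, k, l}) (by simpa using hjk) (by simpa using hkl) (by simpa using hjl) rfl rfl
    (by ext; simp) (Finset.mem_singleton_self j) (Finset.mem_singleton_self k)
    (Finset.mem_singleton_self k) (Finset.mem_singleton_self l) hE' hF (by simp) (by simp)
    (by simpa using Njl) (two j) (two k) (two l)
  have c4 := hT.chain (V := {i, j, k}) (W := {l}) (U := {m}) (VW := {i, j, k, l}) (WU := {l, m})
    (R := {i, j, k, l, m}) (by simp [hil.symm, hjl.symm, hkl.symm]) (by simpa using hlm)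
    (by simp [him.symm, hjm.symm, hkm.symm])
    (by ext; simp only [Finset.mem_union, Finset.mem_insert, Finset.mem_singleton]; tauto) rfl
    (by ext; simp only [Finset.mem_union, Finset.mem_insert, Finset.mem_singleton]; tauto)
    (i := k) (by simp) (Finset.mem_singleton_self l) (Finset.mem_singleton_self l)
    (Finset.mem_singleton_self m) hF hF' (by simp [Nil, Njl]) (by simp) (by simp [Nim, Njm, Nkm])
    c1.ab_d.two_le (two l) (two m)
  have c5 := hT.chain (V := {i}) (W := {j}) (U := {k, l, m}) (VW := {i, j}) (WU := {j, k, l, m})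
    (R := {i, j, k, l, m}) (by simpa using hij) (by simp [hjk, hjl, hjm])
    (by simp [hik, hil, him]) rfl rfl
    (by ext; simp only [Finset.mem_union, Finset.mem_insert, Finset.mem_singleton]; tauto)
    (Finset.mem_singleton_self i) (Finset.mem_singleton_self j) (Finset.mem_singleton_self j)
    (k := k) (by simp) hE hE' (by simp) (by simp [Njl, Njm]) (by simp [Nik, Nil, Nim])
    (two i) (two j) c2.ab_d.two_le
  simp only [hT.restrict_legs_singleton, hT.restrict_legs_of_forall_mem cV] at c1 c2 c3 c4 c5
  have ch : Chain a b b' d (T.flags i) (T.flags k) (T.flags m) (T.restrict {i, j, k}).legs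
      (T.restrict {k, l, m}).legs T.legs :=
    ⟨c1.glue fj, c4.glue fl, c2.glue fl, c5.glue fj, c3.ne⟩
  have hzero : ∀ V, nestedQ P Δ T V x ≠ 0 → V ∈ ({{i, j, k}, {k, l, m}} : Finset (Finset ι)) := by
    intro V hV
    obtain ⟨-, h2, h3⟩ := card_of_nestedQ_ne_zero hV
    obtain ⟨p, q, r, -, -, hpr, rfl, hN, hN', -, hq, -⟩ :=
      exists_of_nestedQ_ne_zero_three hV (by omega)
    rw [Finset.mem_insert, Finset.mem_singleton]
    have hjn : ∀ n, ¬ T.NoEdge j n → n = i ∨ n = k := by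
      intro n hn
      rcases hc n with rfl | rfl | rfl | rfl | rfl
      · exact .inl rfl
      · exact absurd hT.noEdge_self hn
      · exact .inr rfl
      · exact absurd Njl hn
      · exact absurd Njm hn
    have hln : ∀ n, ¬ T.NoEdge l n → n = k ∨ n = m := by
      intro n hn
      rcases hc n with rfl | rfl | rfl | rfl | rfl
      · exact absurd Nil.swap hn
      · exact absurd Njl.swap hn
      · exact .inl rfl
      · exact absurd hT.noEdge_self hn
      · exact .inr rfl
    have hN'' : ¬ T.NoEdge q p := fun h => hN h.swap
    rcases hc q with rfl | rfl | rfl | rfl | rfl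
    · omega
    · left
      rcases hjn p hN'' with rfl | rfl <;> rcases hjn r hN' with rfl | rfl
      · exact absurd rfl hpr
      · rfl
      · ext; simp only [Finset.mem_insert, Finset.mem_singleton]; tauto
      · exact absurd rfl hpr
    · omega
    · right
      rcases hln p hN'' with rfl | rfl <;> rcases hln r hN' with rfl | rfl
      · exact absurd rfl hpr
      · rfl
      · ext; simp only [Finset.mem_insert, Finset.mem_singleton]; tauto
      · exact absurd rfl hpr
    · omega
  have rijk : nestedQ P Δ T {i, j, k} x =
      (koszul deg l m * (koszul deg i j * koszul deg i k * koszul deg j k)) •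
      mu3 P b' y₁ d _ _ _ T.legs
        (mu3 P a x₁ b _ _ _ (T.restrict {i, j, k}).legs (x i) (x j) (x k)) (x l) (x m) := by
    rw [nestedQ_eq (Qop_restrict_three hx hij hjk hik hE hE' Nik c1.ne c1.glue)
      (Qop_contract_three hT (Submodule.smul_mem _ _ (mu3_mem ch.ab (hx i) (hx j) (hx k))) hx
      (k := l) (l := m) (by simp [hil.symm, hjl.symm, hkl.symm])
      (by simp [him.symm, hjm.symm, hkm.symm]) hlm (by simpa [or_assoc] using hc)
      (j := k) (by simp) hF hF' (by simp [Nil, Njl]) (by simp [Nim, Njm, Nkm]) c4.ne c4.glue),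
      mu3_smul_left, smul_smul]
  have rklm : nestedQ P Δ T {k, l, m} x =
      (koszul deg i j * (-1) ^ ((deg k + deg l + deg m + 1) * deg i) *
        (-1) ^ ((deg k + deg l + deg m + 1) * deg j) *
        (koszul deg k l * koszul deg k m * koszul deg l m)) •
      mu3 P a x₁ b _ _ _ T.legs (x i) (x j)
        (mu3 P b' y₁ d _ _ _ (T.restrict {k, l, m}).legs (x k) (x l) (x m)) := by
    rw [nestedQ_eq (Qop_restrict_three hx hkl hlm hkm hF hF' Nkm c2.ne c2.glue)
      (Qop_contract_three_right hT
      (Submodule.smul_mem _ _ (mu3_mem ch.bd (hx k) (hx l) (hx m))) hx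
      (k := i) (l := j) (by simp [hik, hil, him]) (by simp [hjk, hjl, hjm]) hij
      (by simpa [or_comm, or_left_comm, or_assoc] using hc)
      (j := k) (by simp) hE hE' (by simp [Njl.swap, Njm.swap])
      (by simp [Nik.swap, Nil.swap, Nim.swap]) c5.ne c5.glue),
      mu3_smul_right, smul_smul]
  have key := relation_five ch (x := x₁) (y := y₁) (x i) (x j) (x k) (x l) (x m)
  rw [sgQ_of_mem (hx i), sgQ_of_mem (hx j), mu3_smul_left, mu3_smul_middle] at key
  have n1 : ({i, j, k} : Finset ι) ≠ {k, l, m} :=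
    ne_of_mem_of_not_mem' (a := i) (by simp) (by simp [hik, hil, him])
  rw [← Finset.sum_subset (s₁ := {{i, j, k}, {k, l, m}}) (by
      intro V hV
      rw [Finset.mem_insert, Finset.mem_singleton] at hV
      rw [Finset.mem_filter]
      rcases hV with rfl | rfl <;> exact ⟨Finset.mem_univ _, by assumption⟩)
    (fun V _ hV => by rw [not_imp_comm.1 (hzero V) hV, smul_zero]),
    Finset.sum_pair n1, rijk, rklm,
    frontSign_eq (V := {i, j, k}) (W := {l, m})
      (by simp [hil.symm, hjl.symm, hkl.symm, him.symm, hjm.symm, hkm.symm])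
      (by simpa [or_assoc] using hc),
    frontSign_eq (V := {k, l, m}) (W := {i, j}) (by simp [hik, hil, him, hjk, hjl, hjm])
      (by simpa [or_comm, or_left_comm, or_assoc] using hc)]
  simp only [Finset.prod_insert, Finset.prod_singleton, Finset.mem_insert, Finset.mem_singleton,
    hij, hik, hjk, hkl, hkm, hlm, or_self, not_false_eq_true]
  rw [koszul_swap hik, koszul_swap hil, koszul_swap him, koszul_swap hjk, koszul_swap hjl,
    koszul_swap hjm]
  simp only [add_mul, one_mul, zpow_add₀ (show (-1 : ℚ) ≠ 0 by norm_num)]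
  rw [mul_comm (deg k) (deg i), mul_comm (deg k) (deg j), mul_comm (deg l) (deg i),
    mul_comm (deg l) (deg j), mul_comm (deg m) (deg i), mul_comm (deg m) (deg j)]
  have e1 := neg_one_zpow_mul_self (deg i * deg k)
  have e2 := neg_one_zpow_mul_self (deg i * deg l)
  have e3 := neg_one_zpow_mul_self (deg i * deg m)
  have e4 := neg_one_zpow_mul_self (deg j * deg k)
  have e5 := neg_one_zpow_mul_self (deg j * deg l)
  have e6 := neg_one_zpow_mul_self (deg j * deg m)
  clear rijk rklm
  generalize (-1 : ℚ) ^ (deg i * deg k) = p1 at *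
  generalize (-1 : ℚ) ^ (deg i * deg l) = p2 at *
  generalize (-1 : ℚ) ^ (deg i * deg m) = p3 at *
  generalize (-1 : ℚ) ^ (deg j * deg k) = p4 at *
  generalize (-1 : ℚ) ^ (deg j * deg l) = p5 at *
  generalize (-1 : ℚ) ^ (deg j * deg m) = p6 at *
  generalize (-1 : ℚ) ^ deg i = q1 at *
  generalize (-1 : ℚ) ^ deg j = q2 at *
  generalize koszul deg i j = s1
  generalize koszul deg i k = s2
  generalize koszul deg i l = s3
  generalize koszul deg i m = s4
  generalize koszul deg j k = s5
  generalize koszul deg j l = s6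
  generalize koszul deg j m = s7
  generalize koszul deg k l = s8
  generalize koszul deg k m = s9
  generalize koszul deg l m = s0
  refine Eq.trans ?_ ((congrArg ((s1 * s2 * s3 * s4 * s5 * s6 * s7 * s8 * s9 * s0) • ·) key).trans
    (smul_zero _))
  simp only [smul_smul, smul_add]
  refine congrArg₂ _ (congrArg (· • _) (by ring)) (congrArg (· • _) ?_)
  linear_combination s1 * s2 * s3 * s4 * s5 * s6 * s7 * s8 * s9 * s0 * q1 * q2 *
    (p2 * p2 * p3 * p3 * p4 * p4 * p5 * p5 * p6 * p6 * e1 +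
      p3 * p3 * p4 * p4 * p5 * p5 * p6 * p6 * e2 + p4 * p4 * p5 * p5 * p6 * p6 * e3 +
      p5 * p5 * p6 * p6 * e4 + p6 * p6 * e5 + e6)

open Classical in
lemma relation_card_five (h : Fintype.card ι = 5) :
    ∑ V ∈ (Finset.univ : Finset (Finset ι)).filter (fun V => (T.restrict V).IsTree),
      frontSign V deg • nestedQ P Δ T V x = 0 := by
  by_cases hV : ∃ V, nestedQ P Δ T V x ≠ 0
  · obtain ⟨V, hV⟩ := hV
    obtain ⟨i, j, k, l, m, hP⟩ := exists_pathFive hT h hV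
    exact relation_pathFive hT hx h hP
  · push Not at hV
    exact Finset.sum_eq_zero fun V _ => by rw [hV V, smul_zero]

end

/-! ### Trees with at most three vertices -/

section

variable {ι : Type} {T : Tree ι} (hT : T.IsTree)
include hT

lemma Tree.IsTree.flags_eq_legs (i : ι) (hc : ∀ k, k = i) : T.flags i = T.legs := by
  classical
  rw [← hT.restrict_legs_singleton i, hT.restrict_legs_of_forall_mem (by simpa using hc)]

lemma Tree.IsTree.glue_legs {i j : ι} {a b : ℕ} (hij : i ≠ j) (hc : ∀ k, k = i ∨ k = j)
    (hE : T.Edge i j a b) : Glue a b (T.flags i) (T.flags j) T.legs := by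
  classical
  have := hT.glue (V := {i}) (W := {j}) (U := {i, j}) (by simpa using hij) rfl
    (Finset.mem_singleton_self i) (Finset.mem_singleton_self j) hE (by simp)
    ((hT.restrict_legs_singleton i).symm ▸ hT.two_le i)
    ((hT.restrict_legs_singleton j).symm ▸ hT.two_le j)
  rwa [hT.restrict_legs_singleton, hT.restrict_legs_singleton,
    hT.restrict_legs_of_forall_mem (by simpa using hc)] at this

lemma Tree.IsTree.exists_chain_legs {i j k : ι} {a b b' d : ℕ} (hik : i ≠ k)
    (aij : T.graph.Adj i j) (ajk : T.graph.Adj j k) (hc : ∀ l, l = i ∨ l = j ∨ l = k)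
    (hE : T.Edge i j a b) (hE' : T.Edge j k b' d) :
    ∃ AB BD, Chain a b b' d (T.flags i) (T.flags j) (T.flags k) AB BD T.legs := by
  classical
  have hN := hT.noEdge (not_adj_of_path_two hT.isTree.isAcyclic aij ajk hik)
  have two : ∀ m, 2 ≤ (T.restrict {m}).legs.card := fun m =>
    (hT.restrict_legs_singleton m).symm ▸ hT.two_le m
  have := hT.chain (V := {i}) (W := {j}) (U := {k}) (VW := {i, j}) (WU := {j, k})
    (R := {i, j, k}) (by simpa using aij.ne) (by simpa using ajk.ne) (by simpa using hik) rfl rfl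
    (by ext; simp) (Finset.mem_singleton_self i) (Finset.mem_singleton_self j)
    (Finset.mem_singleton_self j) (Finset.mem_singleton_self k) hE hE' (by simp) (by simp)
    (by simpa using hN) (two i) (two j) (two k)
  rw [hT.restrict_legs_singleton, hT.restrict_legs_singleton, hT.restrict_legs_singleton,
    hT.restrict_legs_of_forall_mem (V := {i, j, k}) (by simpa using hc)] at this
  exact ⟨_, _, this⟩

lemma Tree.IsTree.exists_path_three_of_card [Fintype ι] (h : Fintype.card ι = 3) :
    ∃ i j k, i ≠ k ∧ T.graph.Adj i j ∧ T.graph.Adj j k ∧ ∀ l, l = i ∨ l = j ∨ l = k := by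
  classical
  obtain ⟨i, j, k, hik, aij, ajk⟩ := hT.exists_path_three h.ge
  have := Finset.eq_univ_iff_forall.1 (Finset.eq_univ_of_card ({i, j, k} : Finset ι)
    (by rw [Finset.card_eq_three.2 ⟨i, j, k, aij.ne, hik, ajk.ne, rfl⟩, h]))
  exact ⟨i, j, k, hik, aij, ajk, by simpa using this⟩

end

section

variable {α M : Type*} [Fintype α] [CommMonoid M] {i j k : α}

@[to_additive]
lemma prod_univ_of_pair (hij : i ≠ j) (hc : ∀ l, l = i ∨ l = j) (f : α → M) :
    ∏ l, f l = f i * f j := by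
  classical
  rw [← Finset.prod_pair hij]
  congr 1
  ext l; simpa using hc l

@[to_additive]
lemma prod_univ_of_triple (hij : i ≠ j) (hik : i ≠ k) (hjk : j ≠ k)
    (hc : ∀ l, l = i ∨ l = j ∨ l = k) (f : α → M) : ∏ l, f l = f i * f j * f k := by
  classical
  have : (Finset.univ : Finset α) = {i, j, k} := by ext l; simpa using hc l
  rw [this, Finset.prod_insert (by simp [hij, hik]), Finset.prod_pair hjk, mul_assoc]

end

/-! ### Degrees of the operations of trees -/

section

variable {P : CyclicOperad.{u}} {Δ : ∀ B, P.obj B}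
  {ι : Type} [Fintype ι] [LinearOrder ι] {T : Tree ι} (hΔ : IsCircle P Δ) (hT : T.IsTree)
  {x : ∀ i, QObj P (T.flags i)} {deg : ι → ℤ} (hx : ∀ i, x i ∈ (Q P).gr (T.flags i) (deg i))
include hΔ hT hx

lemma Qop_mem : Qop P Δ T x ∈ (Q P).gr T.legs (∑ i, deg i + 1) := by
  by_cases h1 : Fintype.card ι = 1
  · obtain ⟨i, hi⟩ := Fintype.card_eq_one_iff.1 h1
    have hs : ∑ i, deg i = deg i :=
      Fintype.sum_eq_single i fun j hj => absurd (hi j) hj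
    rw [Qop_one h1 i, hs]
    exact castQ_mem (hT.flags_eq_legs i hi) (dQ_mem hΔ (hx i))
  by_cases h2 : Fintype.card ι = 2
  · obtain ⟨i, j, hij, hc, hadj⟩ := hT.exists_pair h2
    obtain ⟨a, b, hE⟩ := hT.exists_edge hadj
    have hG := hT.glue_legs hij hc hE
    rw [Qop_two hΔ h2 hij hE hG hx, sum_univ_of_pair hij hc]
    exact Submodule.smul_mem _ _ (mu2_mem hΔ hG (hx i) (hx j))
  by_cases h3 : Fintype.card ι = 3
  · obtain ⟨i, j, k, hik, aij, ajk, hc⟩ := hT.exists_path_three_of_card h3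
    obtain ⟨a, b, hE⟩ := hT.exists_edge aij
    obtain ⟨b', d, hE'⟩ := hT.exists_edge ajk
    have hN := hT.noEdge (not_adj_of_path_two hT.isTree.isAcyclic aij ajk hik)
    obtain ⟨_, _, ch⟩ := hT.exists_chain_legs hik aij ajk hc hE hE'
    rw [Qop_three h3 aij.ne ajk.ne hik hE hE' hN ch.ne ch.glue hx,
      sum_univ_of_triple aij.ne hik ajk.ne hc]
    refine Submodule.smul_mem _ _ ?_
    by_cases hB : (T.flags j).card = 2
    · exact mu3_mem (ch.glue hB) (hx i) (hx j) (hx k)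
    · rw [mu3_of_card_middle hB]
      exact zero_mem _
  rw [Qop_eq_zero h1 h2 h3]
  exact zero_mem _

end

/-! ### Permutations of the vertices -/

section

variable {ι κ : Type} [LinearOrder ι] [LinearOrder κ] (e : ι ≃ κ) (deg : κ → ℤ)

/-- The contribution of a pair of vertices to the sign of a renaming. -/
def pairSign (i j : ι) : ℚ :=
  if i < j ∧ e j < e i then (-1 : ℚ) ^ (deg (e i) * deg (e j)) else 1

lemma pairSign_self (i : ι) : pairSign e deg i i = 1 := if_neg fun h => lt_irrefl _ h.1

lemma pairSign_mul_koszul {i j : ι} (hij : i ≠ j) :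
    pairSign e deg i j * pairSign e deg j i * koszul deg (e i) (e j) =
      koszul (fun i => deg (e i)) i j := by
  have he : e i ≠ e j := fun h => hij (e.injective h)
  simp only [pairSign, koszul]
  rcases lt_or_gt_of_ne hij with h1 | h1 <;> rcases lt_or_gt_of_ne he with h2 | h2 <;>
    simp [h1, h2, h1.not_gt, h2.not_gt, mul_comm (deg (e i)), neg_one_zpow_mul_self]

end

section

variable {P : CyclicOperad.{u}} {Δ : ∀ B, P.obj B} {ι κ : Type} [Fintype ι] [LinearOrder ι]
  [Fintype κ] [LinearOrder κ] {T : Tree κ} (hΔ : IsCircle P Δ) (hT : T.IsTree)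
  {x : ∀ i, QObj P (T.flags i)} {deg : κ → ℤ} (hx : ∀ i, x i ∈ (Q P).gr (T.flags i) (deg i))
include hΔ hT hx

lemma Qop_reindex (e : ι ≃ κ) :
    Qop P Δ (T.reindex e) (fun i => x (e i)) = permSign e deg • Qop P Δ T x := by
  have hcard := Fintype.card_congr e
  have hs : permSign e deg = ∏ i, ∏ j, pairSign e deg i j := rfl
  by_cases h1 : Fintype.card κ = 1
  · obtain ⟨i, hi⟩ := Fintype.card_eq_one_iff.1 (hcard.trans h1)
    have : permSign e deg = 1 := by
      rw [hs]
      refine Finset.prod_eq_one fun j _ => Finset.prod_eq_one fun k _ => ?_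
      rw [hi j, hi k, pairSign_self]
    rw [this, one_smul, Qop_one h1 (e i)]
    exact Qop_one (T := T.reindex e) (x := fun i => x (e i)) (hcard.trans h1) i
  by_cases h2 : Fintype.card κ = 2
  · obtain ⟨i, j, hij, hc, hadj⟩ := hT.exists_pair h2
    obtain ⟨i, rfl⟩ := e.surjective i
    obtain ⟨j, rfl⟩ := e.surjective j
    obtain ⟨a, b, hE⟩ := hT.exists_edge hadj
    have hG := hT.glue_legs hij hc hE
    have hij' : i ≠ j := fun h => hij (congrArg e h)
    have hc' : ∀ k, k = i ∨ k = j := fun k => (hc (e k)).imp (e.injective ·) (e.injective ·)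
    have hE' : (T.reindex e).Edge i j a b :=
      ⟨hE.fst, hE.snd, hE.glued, hE.glued_swap, hE.unique⟩
    have hsign : koszul (fun i => deg (e i)) i j =
        permSign e deg * koszul deg (e i) (e j) := by
      rw [hs, prod_univ_of_pair hij' hc', prod_univ_of_pair hij' hc', prod_univ_of_pair hij' hc',
        pairSign_self, pairSign_self, one_mul, mul_one, pairSign_mul_koszul e deg hij']
    exact (Qop_two (T := T.reindex e) (x := fun i => x (e i)) hΔ (hcard.trans h2) hij' hE' hG
      fun i => hx (e i)).trans ((congrArg (· • mu2 P Δ a b _ _ T.legs (x (e i)) (x (e j)))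
      hsign).trans ((mul_smul _ _ _).trans (congrArg (permSign e deg • ·)
      (Qop_two hΔ h2 hij hE hG hx).symm)))
  by_cases h3 : Fintype.card κ = 3
  · obtain ⟨i, j, k, hik, aij, ajk, hc⟩ := hT.exists_path_three_of_card h3
    obtain ⟨i, rfl⟩ := e.surjective i
    obtain ⟨j, rfl⟩ := e.surjective j
    obtain ⟨k, rfl⟩ := e.surjective k
    obtain ⟨a, b, hE⟩ := hT.exists_edge aij
    obtain ⟨b', d, hF⟩ := hT.exists_edge ajk
    have hN := hT.noEdge (not_adj_of_path_two hT.isTree.isAcyclic aij ajk hik)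
    obtain ⟨_, _, ch⟩ := hT.exists_chain_legs hik aij ajk hc hE hF
    have hij' : i ≠ j := fun h => aij.ne (congrArg e h)
    have hjk' : j ≠ k := fun h => ajk.ne (congrArg e h)
    have hik' : i ≠ k := fun h => hik (congrArg e h)
    have hc' : ∀ l, l = i ∨ l = j ∨ l = k := fun l =>
      (hc (e l)).imp (e.injective ·) (Or.imp (e.injective ·) (e.injective ·))
    have hE' : (T.reindex e).Edge i j a b :=
      ⟨hE.fst, hE.snd, hE.glued, hE.glued_swap, hE.unique⟩
    have hF' : (T.reindex e).Edge j k b' d :=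
      ⟨hF.fst, hF.snd, hF.glued, hF.glued_swap, hF.unique⟩
    have hN' : (T.reindex e).NoEdge i k := hN
    have hsign : koszul (fun i => deg (e i)) i j * koszul (fun i => deg (e i)) i k *
        koszul (fun i => deg (e i)) j k = permSign e deg *
        (koszul deg (e i) (e j) * koszul deg (e i) (e k) * koszul deg (e j) (e k)) := by
      rw [hs, prod_univ_of_triple hij' hik' hjk' hc', prod_univ_of_triple hij' hik' hjk' hc',
        prod_univ_of_triple hij' hik' hjk' hc', prod_univ_of_triple hij' hik' hjk' hc',
        pairSign_self, pairSign_self, pairSign_self, ← pairSign_mul_koszul e deg hij',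
        ← pairSign_mul_koszul e deg hik', ← pairSign_mul_koszul e deg hjk']
      ring
    exact (Qop_three (T := T.reindex e) (x := fun i => x (e i)) (hcard.trans h3) hij' hjk' hik'
      hE' hF' hN' ch.ne ch.glue fun i => hx (e i)).trans
      ((congrArg (· • mu3 P a b d _ _ _ T.legs (x (e i)) (x (e j)) (x (e k))) hsign).trans
      ((mul_smul _ _ _).trans (congrArg (permSign e deg • ·)
      (Qop_three h3 aij.ne ajk.ne hik hE hF hN ch.ne ch.glue hx).symm)))
  exact (Qop_eq_zero (T := T.reindex e) (hcard.trans_ne h1) (hcard.trans_ne h2)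
    (hcard.trans_ne h3)).trans ((smul_zero _).symm.trans (congrArg (permSign e deg • ·)
    (Qop_eq_zero h1 h2 h3).symm))

end

/-! ### Bijections of the flags -/

section

variable {P : CyclicOperad.{u}} {Δ : ∀ B, P.obj B} {A A' C C' : Finset ℕ}

lemma qmap_castQ (h : A = C) (h' : A' = C') (f : A ≃ A') (g : C ≃ C')
    (hfg : ∀ (z : A) (w : C), (z : ℕ) = w → (g w : ℕ) = f z) (X : QObj P A) :
    qmap P g (castQ P A C X) = castQ P A' C' (qmap P f X) := by
  subst h h'
  rw [castQ_self, castQ_self]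
  exact qmap_congr (fun z => hfg z z rfl) X

variable {ι : Type} {T T' : Tree ι} (hT : T.IsTree) (hT' : T'.IsTree)
  (f : ∀ i, T.flags i ≃ T'.flags i) (g : T.legs ≃ T'.legs)
  (hf : ∀ i j (a : T.flags i) (b : T.flags j), T.glued a b ↔ T'.glued (f i a) (f j b))
  (hg : ∀ i (a : T.flags i) (c : T.legs), (a : ℕ) = c → (g c : ℕ) = f i a)

include hf in
lemma Tree.Edge.map {i j : ι} {a b : ℕ} (h : T.Edge i j a b) :
    T'.Edge i j (f i ⟨a, h.fst⟩) (f j ⟨b, h.snd⟩) := by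
  refine ⟨(f i _).2, (f j _).2, (hf _ _ _ _).1 h.glued, (hf _ _ _ _).1 h.glued_swap,
    fun a' ha' b' hb' hab => ?_⟩
  obtain ⟨a₁, ha₁⟩ := (f i).surjective ⟨a', ha'⟩
  obtain ⟨b₁, hb₁⟩ := (f j).surjective ⟨b', hb'⟩
  obtain rfl : (f i a₁ : ℕ) = a' := congrArg Subtype.val ha₁
  obtain rfl : (f j b₁ : ℕ) = b' := congrArg Subtype.val hb₁
  rw [← hf, ← hf] at hab
  obtain ⟨h1, h2⟩ := h.unique a₁ a₁.2 b₁ b₁.2 hab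
  exact ⟨congrArg (fun z => (f i z : ℕ)) (Subtype.ext h1),
    congrArg (fun z => (f j z : ℕ)) (Subtype.ext h2)⟩

include hf in
lemma Tree.NoEdge.map {i j : ι} (h : T.NoEdge i j) : T'.NoEdge i j := by
  intro a' ha' b' hb'
  obtain ⟨a₁, ha₁⟩ := (f i).surjective ⟨a', ha'⟩
  obtain ⟨b₁, hb₁⟩ := (f j).surjective ⟨b', hb'⟩
  obtain rfl : (f i a₁ : ℕ) = a' := congrArg Subtype.val ha₁
  obtain rfl : (f j b₁ : ℕ) = b' := congrArg Subtype.val hb₁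
  rw [← hf, ← hf]
  exact h a₁ a₁.2 b₁ b₁.2

include hT hT' hf hg

lemma edgeOp_qmap (hΔ : IsCircle P Δ) {i j : ι} (hij : i ≠ j) (hc : ∀ k, k = i ∨ k = j)
    (hadj : T.graph.Adj i j) (X : QObj P (T.flags i)) (Y : QObj P (T.flags j)) :
    qmap P g (edgeOp P Δ T i j X Y) = edgeOp P Δ T' i j (qmap P (f i) X) (qmap P (f j) Y) := by
  obtain ⟨a, b, hE⟩ := hT.exists_edge hadj
  have hE' := hE.map f hf
  rw [edgeOp_eq hE, edgeOp_eq hE']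
  refine mu2_qmap hΔ ⟨hT.glue_legs hij hc hE, hT'.glue_legs hij hc hE', ?_, ?_, ?_, ?_⟩ X Y
  · rintro z rfl; rfl
  · rintro z rfl; rfl
  · exact fun z w _ h => hg i z w h
  · exact fun z w _ h => hg j z w h

lemma pathOp_qmap {i j k : ι} (hik : i ≠ k) (hc : ∀ l, l = i ∨ l = j ∨ l = k)
    (X : QObj P (T.flags i)) (Y : QObj P (T.flags j)) (Z : QObj P (T.flags k)) :
    qmap P g (pathOp P T i j k X Y Z) =
      pathOp P T' i j k (qmap P (f i) X) (qmap P (f j) Y) (qmap P (f k) Z) := by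
  by_cases hN : T.NoEdge i j ∨ T.NoEdge j k
  · rw [pathOp_eq_zero hN, pathOp_eq_zero (hN.imp (.map f hf) (.map f hf)), map_zero]
  rw [not_or] at hN
  have aij : T.graph.Adj i j := by_contra fun h => hN.1 (hT.noEdge h)
  have ajk : T.graph.Adj j k := by_contra fun h => hN.2 (hT.noEdge h)
  obtain ⟨a, b, hE⟩ := hT.exists_edge aij
  obtain ⟨b', d, hF⟩ := hT.exists_edge ajk
  have hE' := hE.map f hf
  have hF' := hF.map f hf
  have aij' : T'.graph.Adj i j := by_contra fun h =>
    (hT'.noEdge h _ hE'.fst _ hE'.snd).1 hE'.glued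
  have ajk' : T'.graph.Adj j k := by_contra fun h =>
    (hT'.noEdge h _ hF'.fst _ hF'.snd).1 hF'.glued
  have hcard := card_eq_of_equiv (f j)
  rw [pathOp_eq hE hF, pathOp_eq hE' hF']
  by_cases hB : (T.flags j).card = 2
  · obtain ⟨_, _, ch⟩ := hT.exists_chain_legs hik aij ajk hc hE hF
    obtain ⟨_, _, ch'⟩ := hT'.exists_chain_legs hik aij' ajk' hc hE' hF'
    refine mu3_qmap ⟨ch.glue hB, ch'.glue (by omega), ?_, ?_, ?_, ?_⟩ hB hE.snd ?_ X Y Z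
    · rintro z rfl; rfl
    · rintro z rfl; rfl
    · exact fun z w _ h => hg i z w h
    · exact fun z w _ h => hg k z w h
    · rintro z rfl; rfl
  · rw [mu3_of_card_middle hB, mu3_of_card_middle (by omega), map_zero]

lemma Qop_qmap [Fintype ι] [LinearOrder ι] (hΔ : IsCircle P Δ) (x : ∀ i, QObj P (T.flags i)) :
    qmap P g (Qop P Δ T x) = Qop P Δ T' fun i => qmap P (f i) (x i) := by
  by_cases h1 : Fintype.card ι = 1
  · obtain ⟨i, hi⟩ := Fintype.card_eq_one_iff.1 h1
    rw [Qop_one h1 i, Qop_one h1 i, ← dQ_qmap hΔ]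
    exact qmap_castQ (hT.flags_eq_legs i hi) (hT'.flags_eq_legs i hi) (f i) g (hg i) _
  by_cases h2 : Fintype.card ι = 2
  · obtain ⟨i, j, hij, hc⟩ := exists_lt_of_card_two h2
    obtain ⟨p, q, hpq, -, hadj⟩ := hT.exists_pair h2
    have hadj : T.graph.Adj i j := by
      rcases hc p with rfl | rfl <;> rcases hc q with rfl | rfl
      · exact absurd rfl hpq
      · exact hadj
      · exact hadj.symm
      · exact absurd rfl hpq
    rw [Qop_two_of_lt h2 hij, Qop_two_of_lt h2 hij]
    exact edgeOp_qmap hT hT' f g hf hg hΔ hij.ne hc hadj _ _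
  by_cases h3 : Fintype.card ι = 3
  · obtain ⟨i, j, k, hij, hjk, hc⟩ := exists_lt_of_card_three h3
    rw [Qop_three_of_lt h3 hij hjk, Qop_three_of_lt h3 hij hjk, map_add, map_add,
      pathOp_qmap hT hT' f g hf hg (hij.trans hjk).ne hc,
      pathOp_qmap hT hT' f g hf hg hjk.ne fun l => or_left_comm.1 (hc l),
      pathOp_qmap hT hT' f g hf hg hij.ne fun l => (hc l).imp_right Or.symm,
      sgQ_qmap]
  rw [Qop_eq_zero h1 h2 h3, Qop_eq_zero h1 h2 h3]
  exact map_zero (qmap P g)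

end

/-! ### The unit -/

section

variable {P : CyclicOperad.{u}} {Δ : ∀ B, P.obj B} {A B C D : Finset ℕ} {a b d : ℕ}

variable (P) in
/-- The unit with legs `B`, read with `b` as its first leg. -/
def unitQ (B : Finset ℕ) (b : ℕ) : QObj P B := mkQ P B 0 (readAt B b 1)

lemma readAt_unitQ (hB : B.card = 2) : readAt B b (unitQ P B b).lo = 1 := by
  rw [unitQ, mkQ_lo hB, readAt_readAt]

lemma unitQ_mem (hB : B.card = 2) : unitQ P B b ∈ (Q P).gr B (-1) := by
  rw [mem_gr_iff, unitQ, mkQ_zero_hi, mkQ_lo hB]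
  refine ⟨zero_mem _, readAt_mem (Submodule.subset_span ⟨0, by norm_num, (pow_zero _).symm⟩)⟩

lemma qmap_unitQ (f : A ≃ B) (hA : A.card = 2) (z : A) :
    qmap P f (unitQ P A z) = unitQ P B (f z) := by
  have hB := (card_eq_of_equiv f).trans hA
  refine QObj.ext_readAt hB (f z) ?_
  rw [readAt_qmap_lo hA, readAt_unitQ hA, readAt_unitQ hB]

lemma exists_readAt_eq_C (c : ℚ) : ∃ c', readAt A a (Polynomial.C c) = Polynomial.C c' := by
  rw [readAt]
  split_ifs
  · exact ⟨c, rfl⟩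
  · exact ⟨-c, by simp [tau]⟩

lemma mu3_unitQ_middle (X : QObj P A) (Z : QObj P C) :
    mu3 P a b d A B C D X (unitQ P B e) Z = 0 := by
  by_cases hB : B.card = 2
  swap
  · exact mu3_of_card_middle hB _ _ _
  rw [mu3, map₂_kernel3]
  obtain ⟨c, hc⟩ := exists_readAt_eq_C (A := B) (a := e) 1
  obtain ⟨c', hc'⟩ := exists_readAt_eq_C (A := B) (a := b) c
  rw [unitQ, mkQ_lo hB, ← Polynomial.C_1, hc, hc', tern, altSum_C, LinearMap.zero_apply,
    LinearMap.zero_apply, mkQ_zero_zero]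

/-- The unit is a strict unit up to sign for the binary composition. -/
lemma mu2_unitQ (h : Glue a b A B C) (hB : B.card = 2) (X : QObj P A) (f : A ≃ C)
    (hf : ∀ z : A, (z : ℕ) ≠ a → (f z : ℕ) = z) :
    mu2 P Δ a b A B C X (unitQ P B b) = qmap P f (sgQ P A X) := by
  have hcard := card_eq_of_equiv f
  rcases eq_or_lt_of_le h.two_le_left with hA | hA
  · have ha := other_mem hA.symm h.mem_left
    have ha' := other_ne hA.symm h.mem_left
    refine QObj.ext_readAt (by omega) (other A a) ?_
    rw [mu2_lo_ll h hA.symm hB, readAt_unitQ hB,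
      readAt_qmap_lo' hA.symm f ha (fun y hy => (hf y (hy ▸ ha')).trans hy), sgQ_lo, map_neg,
      readAt_other hA.symm h.mem_left]
    ring
  · rw [mu2_hl h hA hB, readAt_unitQ hB]
    have : legQ P a A 1 (sgQ P A X) = sgQ P A X := by
      refine QObj.ext_hi hA ?_
      rw [legQ_hi, opV, map_one]; rfl
    rw [this]
    refine qmap_congr (fun z => ?_) _
    by_cases hz : (z : ℕ) = a
    · obtain ⟨w, hw⟩ := (h.ren hB).surjective (f z)
      by_cases hwa : (w : ℕ) = a
      · rw [← hw, Subtype.ext (hz.trans hwa.symm)]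
      · have : (f w : ℕ) = f z := by rw [hf w hwa, ← hw, h.ren_of_ne hB w hwa]
        exact absurd (congrArg Subtype.val (f.injective (Subtype.ext this))) (hz ▸ hwa)
    · rw [hf z hz, h.ren_of_ne hB z hz]

end

section

variable {P : CyclicOperad.{u}} {Δ : ∀ B, P.obj B} {ι : Type} {T : Tree ι}

lemma pathOp_unitQ {i j k l : ι} {X : QObj P (T.flags i)} {Y : QObj P (T.flags j)}
    {Z : QObj P (T.flags k)} (hl : l = i ∨ l = j ∨ l = k) (hB : (T.flags l).card = 2) {e : ℕ}
    (hY : l = j → Y = unitQ P (T.flags j) e) : pathOp P T i j k X Y Z = 0 := by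
  rw [pathOp]
  refine Finset.sum_eq_zero fun a _ => Finset.sum_eq_zero fun b _ => Finset.sum_eq_zero fun b' _ =>
    Finset.sum_eq_zero fun d _ => ?_
  have : mu3 P a b d _ _ _ T.legs X Y Z = 0 := by
    rcases hl with rfl | rfl | rfl
    · exact mu3_of_card_left (by omega) _ _ _
    · rw [hY rfl, mu3_unitQ_middle]
    · exact mu3_of_card_right (by omega) _ _ _
  rw [this, ite_self]

variable [Fintype ι] [LinearOrder ι] {x : ∀ i, QObj P (T.flags i)}

lemma Qop_unitQ_right (hT : T.IsTree) {i j : ι} (hij : i < j)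
    (hc : ∀ k, k = i ∨ k = j) {a b : ℕ} (ha : a ∈ T.flags i) (hb : b ∈ T.flags j)
    (hg : T.glued a b) (hB : (T.flags j).card = 2) {n : ℤ} (hx : x i ∈ (Q P).gr (T.flags i) n)
    (hxj : x j = unitQ P (T.flags j) b) (f : T.flags i ≃ T.legs)
    (hf : ∀ z : T.flags i, (z : ℕ) ≠ a → (f z : ℕ) = z) :
    Qop P Δ T x = (-1 : ℚ) ^ n • qmap P f (x i) := by
  have hcard : Fintype.card ι = 2 := by
    rw [← Finset.card_univ, ← Finset.card_pair hij.ne]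
    congr 1
    ext k; simpa using hc k
  obtain ⟨a', b', hE⟩ := hT.exists_edge (hT.adj_iff.2 ⟨hij.ne, a, ha, b, hb, hg⟩)
  obtain ⟨rfl, rfl⟩ := hE.unique a ha b hb (.inl hg)
  rw [Qop_two_of_lt hcard hij, edgeOp_eq hE, hxj, mu2_unitQ (hT.glue_legs hij.ne hc hE) hB _ f hf,
    sgQ_of_mem hx, map_smul]

lemma Qop_unitQ (h2 : Fintype.card ι ≠ 2) {i : ι} (hB : (T.flags i).card = 2)
    {b : ℕ} (hx : x i = unitQ P (T.flags i) b) : Qop P Δ T x = 0 := by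
  by_cases h1 : Fintype.card ι = 1
  · exact (Qop_one h1 i).trans ((congrArg (castQ P _ _) (dQ_of_card hB _)).trans (map_zero _))
  by_cases h3 : Fintype.card ι = 3
  · obtain ⟨p, q, r, hpq, hqr, hc⟩ := exists_lt_of_card_three h3
    rw [Qop_three_of_lt h3 hpq hqr, pathOp_unitQ (hc i) hB (e := b) (by rintro rfl; exact hx),
      pathOp_unitQ (or_left_comm.1 (hc i)) hB (e := b) (by rintro rfl; exact hx),
      pathOp_unitQ ((hc i).imp_right Or.symm) hB (e := b) (by rintro rfl; exact hx)]
    exact (add_zero _).trans (add_zero _)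
  exact Qop_eq_zero h1 h2 h3

lemma isStrictUnit_Q : IsStrictUnit (Q P) (Qop P Δ) (Qunit P) where
  degree _ hB _ _ := unitQ_mem hB
  map f hB b := qmap_unitQ f hB b
  binary _ hT _ _ hij hc _ ha _ hb hg hB _ _ hx hxj f hf :=
    Qop_unitQ_right hT hij hc ha hb hg hB hx hxj f hf
  other _ _ h2 _ hB _ _ _ hx := Qop_unitQ h2 hB hx

end

/-! ### The augmentation ideal -/

section

variable {P : CyclicOperad.{u}} {Δ : ∀ B, P.obj B} {A B C D : Finset ℕ} {a b d : ℕ}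

lemma mem_Qideal_iff {X : QObj P A} : X ∈ Qideal P A ↔ X.lo.coeff 0 = 0 := Iff.rfl

lemma mem_Qideal_of_lo {X : QObj P A} (h : X.lo = 0) : X ∈ Qideal P A := by
  rw [mem_Qideal_iff, h, Polynomial.coeff_zero]

lemma coeff_zero_tau (q : Polynomial ℚ) : (tau q).coeff 0 = - q.coeff 0 := by
  induction q using Polynomial.induction_on' with
  | add p q hp hq => simp only [map_add, Polynomial.coeff_add, hp, hq, neg_add]
  | monomial n t =>
    rw [tau_monomial]
    rcases n with _ | n <;> simp [Polynomial.coeff_monomial]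

lemma coeff_zero_readAt (q : Polynomial ℚ) : (readAt A a q).coeff 0 = 0 ↔ q.coeff 0 = 0 := by
  rw [readAt]
  split_ifs
  · rfl
  · rw [coeff_zero_tau, neg_eq_zero]

lemma mu2_mem_Qideal {X : QObj P A} {Y : QObj P B} (hX : X ∈ Qideal P A) :
    mu2 P Δ a b A B C X Y ∈ Qideal P C := by
  by_cases hC : C.card = 2
  · rw [mem_Qideal_iff, mu2, mkQ_lo hC, coeff_zero_readAt, Polynomial.coeff_neg, neg_eq_zero,
      Polynomial.mul_coeff_zero, (coeff_zero_readAt _).2 (mem_Qideal_iff.1 hX), zero_mul]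
  · exact mem_Qideal_of_lo (mu2_lo_of_card hC _ _)

lemma castQ_mem_Qideal {X : QObj P A} (hX : X ∈ Qideal P A) : castQ P A C X ∈ Qideal P C := by
  by_cases h : A = C
  · subst h; rwa [castQ_self]
  · rw [castQ, SymSeq.castMap, dif_neg h]; exact zero_mem _

lemma qmap_mem_Qideal (f : A ≃ B) {X : QObj P A} (hX : X ∈ Qideal P A) :
    qmap P f X ∈ Qideal P B := by
  by_cases hA : A.card = 2
  · obtain ⟨a, ha⟩ := Finset.card_pos.1 (show 0 < A.card by omega)
    rw [mem_Qideal_iff, ← coeff_zero_readAt (A := B) (a := f ⟨a, ha⟩), readAt_qmap_lo hA,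
      coeff_zero_readAt]
    exact hX
  · exact mem_Qideal_of_lo (QObj.lo_eq_zero (card_eq_of_equiv f ▸ hA) _)

lemma isCompl_Qideal (hB : B.card = 2) :
    IsCompl (Qideal P B) (Submodule.span ℚ {unitQ P B b}) := by
  have h1 : (unitQ P B b).lo.coeff 0 ≠ 0 := by
    rw [Ne, ← coeff_zero_readAt (A := B) (a := b), readAt_unitQ hB, Polynomial.coeff_one_zero]
    exact one_ne_zero
  constructor
  · rw [Submodule.disjoint_def]
    intro X hX hX'
    obtain ⟨c, rfl⟩ := Submodule.mem_span_singleton.1 hX'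
    have hc : c * (unitQ P B b).lo.coeff 0 = 0 := hX
    rw [(mul_eq_zero.1 hc).resolve_right h1]
    exact zero_smul ℚ _
  · have key : ∀ X : QObj P B,
        X - (X.lo.coeff 0 / (unitQ P B b).lo.coeff 0) • unitQ P B b ∈ Qideal P B := by
      intro X
      refine mem_Qideal_iff.2 ?_
      rw [sub_eq_add_neg, QObj.lo_add, QObj.lo_neg, QObj.lo_smul, Polynomial.coeff_add,
        Polynomial.coeff_neg, Polynomial.coeff_smul, smul_eq_mul, div_mul_cancel₀ _ h1,
        add_neg_cancel]
    rw [codisjoint_iff, Submodule.eq_top_iff']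
    exact fun X => Submodule.mem_sup.2 ⟨_, key X, _,
      Submodule.smul_mem _ _ (Submodule.mem_span_singleton_self _), sub_add_cancel _ _⟩

variable {ι : Type} {T : Tree ι}

lemma edgeOp_mem_Qideal {i j : ι} {X : QObj P (T.flags i)} {Y : QObj P (T.flags j)}
    (hX : X ∈ Qideal P (T.flags i)) : edgeOp P Δ T i j X Y ∈ Qideal P T.legs := by
  refine Submodule.sum_mem _ fun a _ => Submodule.sum_mem _ fun b _ => ?_
  split_ifs
  · exact mu2_mem_Qideal hX
  · exact mem_Qideal_of_lo rfl

lemma pathOp_mem_Qideal {i j k : ι} {X : QObj P (T.flags i)} {Y : QObj P (T.flags j)}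
    {Z : QObj P (T.flags k)} : pathOp P T i j k X Y Z ∈ Qideal P T.legs := by
  refine Submodule.sum_mem _ fun a _ => Submodule.sum_mem _ fun b _ => Submodule.sum_mem _
    fun b' _ => Submodule.sum_mem _ fun d _ => ?_
  split_ifs
  · exact mem_Qideal_of_lo (mu3_lo _ _ _)
  · exact mem_Qideal_of_lo rfl

lemma Qop_mem_Qideal [Fintype ι] [LinearOrder ι] {x : ∀ i, QObj P (T.flags i)}
    (hx : ∀ i, x i ∈ Qideal P (T.flags i)) : Qop P Δ T x ∈ Qideal P T.legs := by
  by_cases h1 : Fintype.card ι = 1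
  · obtain ⟨i, -⟩ := Fintype.card_eq_one_iff.1 h1
    rw [Qop_one h1 i]
    exact castQ_mem_Qideal (mem_Qideal_of_lo (dQ_lo _))
  by_cases h2 : Fintype.card ι = 2
  · obtain ⟨i, j, hij, -⟩ := exists_lt_of_card_two h2
    rw [Qop_two_of_lt h2 hij]
    exact edgeOp_mem_Qideal (hx i)
  by_cases h3 : Fintype.card ι = 3
  · obtain ⟨i, j, k, hij, hjk, -⟩ := exists_lt_of_card_three h3
    rw [Qop_three_of_lt h3 hij hjk]
    exact add_mem (add_mem pathOp_mem_Qideal pathOp_mem_Qideal) pathOp_mem_Qideal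
  rw [Qop_eq_zero h1 h2 h3]
  exact zero_mem _

lemma isAugmentationIdeal_Qideal :
    IsAugmentationIdeal (Q P) (Qop P Δ) (Qunit P) (Qideal P) where
  eq_top A hA := Submodule.eq_top_iff'.2 fun X =>
    mem_Qideal_of_lo (QObj.lo_eq_zero (by omega) X)
  isCompl _ hB _ _ := isCompl_Qideal hB
  map f _ hX := qmap_mem_Qideal f hX
  closed _ _ _ hx := Qop_mem_Qideal hx

end

/-! ### The homotopy operad -/

section

variable {P : CyclicOperad.{u}} {Δ : ∀ B, P.obj B}

open Classical in
lemma sum_nestedQ (hΔ : IsCircle P Δ) {ι : Type} [Fintype ι] [LinearOrder ι] {T : Tree ι}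
    (hT : T.IsTree) {x : ∀ i, QObj P (T.flags i)} {deg : ι → ℤ}
    (hx : ∀ i, x i ∈ (Q P).gr (T.flags i) (deg i)) :
    ∑ V ∈ (Finset.univ : Finset (Finset ι)).filter (fun V => (T.restrict V).IsTree),
      frontSign V deg • nestedQ P Δ T V x = 0 := by
  have h0 : 0 < Fintype.card ι := Fintype.card_pos_iff.2 hT.isTree.nonempty
  by_cases h1 : Fintype.card ι = 1
  · refine Finset.sum_eq_zero fun V hV => ?_
    rw [relation_card_one hΔ hT h1 (Finset.mem_filter.1 hV).2, smul_zero]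
  by_cases h2 : Fintype.card ι = 2
  · exact relation_card_two hΔ hT hx h2
  by_cases h3 : Fintype.card ι = 3
  · exact relation_card_three hΔ hT hx h3
  by_cases h4 : Fintype.card ι = 4
  · exact relation_card_four hT hΔ hx h4
  by_cases h5 : Fintype.card ι = 5
  · exact relation_card_five hT hx h5
  exact relation_of_six_le_card (by omega)

lemma isHomotopyOperad_Q (hΔ : IsCircle P Δ) : IsHomotopyOperad (Q P) (Qop P Δ) where
  lawful := Q_isLawful
  multilinear T _ := Qop_multilinear T
  degree _ hT _ _ hx := Qop_mem hΔ hT hx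
  vertex_equivariant _ e hT _ _ hx := Qop_reindex hΔ hT hx e
  flag_equivariant _ _ hT hT' f g hf hg x := Qop_qmap hT hT' f g hf hg hΔ x
  relation _ hT _ _ hx := sum_nestedQ hΔ hT hx

end

end CycOp

end

theorem mainTheorem4 (P : CycOp.CyclicOperad.{u}) (Δ : ∀ B, P.obj B) (hΔ : CycOp.IsCircle P Δ) :
    CycOp.IsHomotopyOperad (CycOp.Q P) (CycOp.Qop P Δ) ∧
    CycOp.IsStrictUnit (CycOp.Q P) (CycOp.Qop P Δ) (CycOp.Qunit P) ∧
    CycOp.IsAugmentationIdeal (CycOp.Q P) (CycOp.Qop P Δ) (CycOp.Qunit P) (CycOp.Qideal P) := by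
  exact ⟨CycOp.isHomotopyOperad_Q hΔ, CycOp.isStrictUnit_Q, CycOp.isAugmentationIdeal_Qideal⟩
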